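/- **Setting.** Work with radial functions on $\mathbb R^4$, written as functions of $r>0$ (or of $y>0$), with $(f,g)=\int_0^\infty f g\,r^3dr$, $|f|_{L^2}^2=(f,f)$, $\int f=\int_0^\infty f\,r^3dr$, $\Delta f=f''+\frac3r f'$, $\Lambda f=f+yf'$, $Df=2f+yf'$ and $f_\lambda(r)=\frac1\lambda f(\frac r\lambda)$. Let $Q(r)=(1+\frac{r^2}8)^{-1}$, $\Phi=D\Lambda Q$, $V=3Q^2$, $H=-\Delta-V$, $H_\lambda=-\Delta-3Q_\lambda^2$. Fix a smooth $\chi\ge 0$ with $\chi(r)=1$ for $r\le1$ and $\chi(r)=0$ for $r\ge 2$, put $\chi_B(r)=\chi(r/B)$, and fix a radial bound state $0\ne\psi\in L^2$, $H\psi=-\zeta\psi$, $\zeta>0$. For $b>0$ let $B_0=\frac2b$, $B_1=\frac{|\log b|}b$. *Profiles.* Let $\Gamma$ be the solution of $H\Gamma=0$ on $(0,\infty)$ with $\Gamma(1)=0$ and $\Gamma'\Lambda Q-\Gamma(\Lambda Q)'=-y^{-3}$. Put $c_b=\frac{(D\Lambda Q,\Lambda Q)}{(\chi_{B_0/4}\Lambda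 Q,\Lambda Q)}$, $F=-D\Lambda Q+c_b\chi_{B_0/4}\Lambda Q$, $$\tilde T_1(y)=\Gamma(y)\int_0^yF\,\Lambda Q\,s^3ds-\Lambda Q(y)\int_0^yF\,\Gamma\,s^3ds,\qquad T_1=\tilde T_1-\frac{(\tilde T_1,\chi_M\Phi)}{(\chi_M\Phi,\Lambda Q)}\Lambda Q,$$ so that $HT_1=F$ and $(T_1,\chi_M\Phi)=0$, and let $P_{B_1}=Q+\chi_{B_1}b^2T_1$ and $\tilde P_{B_0}=\chi_{B_0/4}Q$. *Trapped regime.* Let $M,K,b_0,T>0$. Consider a radial strong solution $u$ of $\partial_{tt}u-\Delta u-u^3=0$ on $[0,T]$, that is, $(u,\partial_tu)\in C([0,T];(\dot H^1\cap\dot H^2)\times H^1)$, and $\partial_tu$ is differentiable in time with values in $L^2$, with derivative $\Delta u+u^3$. Suppose that $$u(t)=(P_{B_1(b(t))}+\varepsilon(t))_{\lambda(t)}=(P_{B_1(b(t))})_{\lambda(t)}+w(t),$$ where $\lambda\in C^2([0,T])$, $\lambda>0$, $b=-\lambda_t$ and $(\varepsilon(t),\chi_M\Phi)=0$. Let $s$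 be the rescaled time, $\frac{ds}{dt}=\frac1\lambda$, and set $$\mathcal E=\lambda^2\Big[\int(\partial_r\partial_tw)^2-\int3Q_\lambda^2(\partial_tw)^2+\int(H_\lambda w)^2\Big],$$ $$\kappa_\pm=\tfrac12\Big[(\varepsilon,\psi)\pm\tfrac1{\sqrt\zeta}(\partial_s\varepsilon,\psi)\Big]\pm\tfrac{b_s}{2\sqrt\zeta}(\partial_bP_{B_1},\psi).$$ The solution is *trapped* on $[0,T]$ if for all $t\in[0,T]$: - $0<b<5b_0$; - $|b_s|^2\le K\frac{b^4}{|\log b|^2}$; - $\big\|\big(\partial_rw,\ \partial_tw+\frac b\lambda((1-\chi_{B_1})\Lambda Q)_\lambda\big)\big\|_{L^2\times L^2}\le\sqrt{b_0}$; - $|\mathcal E|\le K\frac{b^4}{|\log b|^2}$; - $|\kappa_+|\le\frac{2b^2}{|\log b|}$ and $|\kappa_-|\le K^{1/8}\frac{b^2}{|\log b|}$. **Lemma.** Let $$G(b)=b|\Lambda\tilde P_{B_0}|_{L^2}^2+\int_0^b\tilde b\,(\partial_b\tilde P_{B_0},\Lambda\tilde P_{B_0})\,d\tilde b,$$ $$\mathcal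 I(s)=(\partial_s\varepsilon,\Lambda\tilde P_{B_0})+b(\varepsilon+2\Lambda\varepsilon,\Lambda\tilde P_{B_0})+b_s(\partial_b\tilde P_{B_0},\Lambda\tilde P_{B_0})+b_s(\partial_b(P_{B_1}-\tilde P_{B_0}),\Lambda\tilde P_{B_0}).$$ There is a constant $C>0$, depending only on the fixed $\chi,\psi,\zeta$ (in particular not on $M$, $K$, $b_0$, $T$ or $u$), such that the following holds. 1. $\big|G(b)-64\,b|\log b|\big|\le Cb$ for all sufficiently small $b>0$. 2. For every $M\ge M_0$, every $K=K(M)\ge K_0(M)$ and every $0<b_0<b^*(M,K)$, every solution that is trapped on $[0,T]$ satisfies on $[0,T]$ $$|\mathcal I|\le C\,K\,b,$$ and $G(b)+\mathcal I$ is differentiable with $$\Big|\frac{d}{ds}\{G(b)+\mathcal I\}+32b^2\Big|\le C\,K\,\frac{b^2}{\sqrt{|\log b|}}.$$ -/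

import Mathlib

open Real Set Filter Topology MeasureTheory
open scoped ContDiff

namespace CriticalWave

noncomputable section

/-! Radial calculus in dimension `N = 4`. A radial function on `ℝ⁴` is given by its profile
`f : ℝ → ℝ`, of which only the values at `r > 0` matter. -/

/-- The measure `r³ dr` on `(0, ∞)`. -/
def radialMeasure : Measure ℝ :=
  (volume.restrict (Ioi (0 : ℝ))).withDensity fun r => ENNReal.ofReal (r ^ 3)

/-- The radial inner product `(f, g) = ∫₀^∞ f g r³ dr`. -/
def ip (f g : ℝ → ℝ) : ℝ := ∫ r, f r * g r ∂radialMeasure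

/-- The radial Laplacian of `ℝ⁴`. -/
def lap (f : ℝ → ℝ) (r : ℝ) : ℝ := deriv (deriv f) r + 3 / r * deriv f r

/-- `Λ f = f + y ∂_y f`. -/
def Lam (f : ℝ → ℝ) (y : ℝ) : ℝ := f y + y * deriv f y

/-- `D f = 2 f + y ∂_y f`. -/
def Dop (f : ℝ → ℝ) (y : ℝ) : ℝ := 2 * f y + y * deriv f y

/-- The ground state. -/
def Q (y : ℝ) : ℝ := 1 / (1 + y ^ 2 / 8)

/-- `Φ = D Λ Q`. -/
def Phi : ℝ → ℝ := Dop (Lam Q)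

/-- The potential `V = f'(Q) = 3 Q²`. -/
def V (y : ℝ) : ℝ := 3 * Q y ^ 2

/-- A smooth nonnegative radial cut-off, equal to `1` for `r ≤ 1` and to `0` for `r ≥ 2`. -/
structure IsCutoff (χ : ℝ → ℝ) : Prop where
  smooth : ContDiff ℝ ∞ χ
  nonneg : ∀ r, 0 ≤ χ r
  eq_one : ∀ r, r ≤ 1 → χ r = 1
  eq_zero : ∀ r, 2 ≤ r → χ r = 0

/-- `χ_B(r) = χ(r / B)`. -/
def cut (χ : ℝ → ℝ) (B r : ℝ) : ℝ := χ (r / B)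

/-- `B₀ = 2 / b`. -/
def B0 (b : ℝ) : ℝ := 2 / b

/-- `B₁ = |log b| / b`. -/
def B1 (b : ℝ) : ℝ := |log b| / b

/-- `ψ` is a radial bound state of `H = -Δ - V` with eigenvalue `-ζ < 0`. -/
structure IsBoundState (ψ : ℝ → ℝ) (ζ : ℝ) : Prop where
  pos : 0 < ζ
  regular : ContDiff ℝ 2 fun x : EuclideanSpace ℝ (Fin 4) => ψ ‖x‖
  memL2 : MemLp ψ 2 radialMeasure
  nontrivial : ∃ r, 0 < r ∧ ψ r ≠ 0
  eigen : ∀ r, 0 < r → - lap ψ r - V r * ψ r = - ζ * ψ r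

/-! The approximate self-similar profile `P_{B₁} = Q + χ_{B₁} b² T₁`. -/

/-- The numerator of `Γ` in terms of `x = y² / 8`; the constant is chosen so that `Γ(1) = 0`. -/
def gamNum (x : ℝ) : ℝ :=
  (1 - x) * (x + 6 * log x - 1 / x - (1 / 8 - 6 * log 8 - 8 + 128 / 7)) + 16

/-- The second element of the kernel of `H`, singular at the origin. For `0 < y < √8` it is
`-ΛQ(y) ∫₁^y ds / (s³ (ΛQ)²(s))`; the formula is the integrated one and continues it smoothly
through the zero `√8` of `ΛQ`. Its Wronskian is `Γ' ΛQ - Γ (ΛQ)' = -1 / y³`. -/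
def Gam (y : ℝ) : ℝ := -(gamNum (y ^ 2 / 8) / (16 * (1 + y ^ 2 / 8) ^ 2))

/-- `c_b = (DΛQ, ΛQ) / (χ_{B₀/4} ΛQ, ΛQ)`. -/
def cb (χ : ℝ → ℝ) (b : ℝ) : ℝ :=
  ip Phi (Lam Q) / ip (fun y => cut χ (B0 b / 4) y * Lam Q y) (Lam Q)

/-- `F = -DΛQ + c_b χ_{B₀/4} ΛQ`. -/
def source (χ : ℝ → ℝ) (b y : ℝ) : ℝ :=
  - Phi y + cb χ b * (cut χ (B0 b / 4) y * Lam Q y)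

/-- The solution `T̃₁` of `H T̃₁ = F`. -/
def Ttilde (χ : ℝ → ℝ) (b y : ℝ) : ℝ :=
  Gam y * (∫ s in (0 : ℝ)..y, source χ b s * Lam Q s * s ^ 3)
    - Lam Q y * ∫ s in (0 : ℝ)..y, source χ b s * Gam s * s ^ 3

/-- The solution `T₁` of `H T₁ = F`, `(T₁, χ_M Φ) = 0`. -/
def T1 (χ : ℝ → ℝ) (M b y : ℝ) : ℝ :=
  Ttilde χ b y
    - ip (Ttilde χ b) (fun z => cut χ M z * Phi z)
        / ip (fun z => cut χ M z * Phi z) (Lam Q) * Lam Q y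

/-- `P_{B₁} = Q + χ_{B₁} b² T₁`, as a function of `b` and `y`. -/
def PB1 (χ : ℝ → ℝ) (M b y : ℝ) : ℝ := Q y + cut χ (B1 b) y * (b ^ 2 * T1 χ M b y)

/-- `∂_b P_{B₁}`. -/
def dbPB1 (χ : ℝ → ℝ) (M b y : ℝ) : ℝ := deriv (fun β => PB1 χ M β y) b

/-- `P̃_{B₀} = χ_{B₀/4} Q`, as a function of `b` and `y`. -/
def Ptilde (χ : ℝ → ℝ) (b y : ℝ) : ℝ := cut χ (B0 b / 4) y * Q y

/-- `∂_b P̃_{B₀}`. -/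
def dbPtilde (χ : ℝ → ℝ) (b y : ℝ) : ℝ := deriv (fun β => Ptilde χ β y) b

/-- `G(b) = b |Λ P̃_{B₀}|²_{L²} + ∫₀^b b̃ (∂_b P̃_{B₀}, Λ P̃_{B₀}) db̃`. -/
def G (χ : ℝ → ℝ) (b : ℝ) : ℝ :=
  b * ip (Lam (Ptilde χ b)) (Lam (Ptilde χ b))
    + ∫ β in (0 : ℝ)..b, β * ip (dbPtilde χ β) (Lam (Ptilde χ β))

/-! Solutions of the wave equation `∂_tt u - Δ u - u³ = 0`. -/

/-- A function on `(0, ∞)` that is absolutely continuous on compact subintervals. -/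
def LocallyAC (f : ℝ → ℝ) : Prop :=
  ∀ a b, 0 < a → a < b → AbsolutelyContinuousOnInterval f a b

/-- The radial class `Ḣ¹ ∩ Ḣ²(ℝ⁴)`. -/
structure RadialH2 (g : ℝ → ℝ) : Prop where
  diff : ∀ r, 0 < r → DifferentiableAt ℝ g r
  ac_deriv : LocallyAC (deriv g)
  decay : Tendsto g atTop (𝓝 0)
  grad_memL2 : MemLp (deriv g) 2 radialMeasure
  lap_memL2 : MemLp (lap g) 2 radialMeasure

/-- The radial class `H¹(ℝ⁴)`. -/
structure RadialH1 (g : ℝ → ℝ) : Prop where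
  ac : LocallyAC g
  memL2 : MemLp g 2 radialMeasure
  grad_memL2 : MemLp (deriv g) 2 radialMeasure

/-- The time derivative at time `t`, position `r`, of a function on `[0, T] × (0, ∞)`
(one-sided at the end points). -/
def dt (T : ℝ) (v : ℝ → ℝ → ℝ) (t r : ℝ) : ℝ := derivWithin (fun τ => v τ r) (Icc 0 T) t

/-- `t ↦ v(t)` is continuous on `[0, T]` for the `L²` distance. -/
def ContinuousL2 (T : ℝ) (v : ℝ → ℝ → ℝ) : Prop :=
  ∀ t₀ ∈ Icc 0 T, Tendsto (fun t => eLpNorm (fun r => v t r - v t₀ r) 2 radialMeasure)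
    (𝓝[Icc 0 T] t₀) (𝓝 0)

/-- `u` is a radial strong solution on `[0, T]` of the energy critical focusing wave equation in
dimension `4`: `(u, ∂_t u)` is continuous in time with values in `(Ḣ¹ ∩ Ḣ²) × H¹`, and `∂_t u` is
differentiable in time in `L²` with derivative `Δ u + u³`. In terms of radial profiles such a
function is `C¹` on `[0, T] × (0, ∞)`, because radial functions in `Ḣ¹ ∩ Ḣ²(ℝ⁴)` are `C¹` away
from the origin and those in `Ḣ¹(ℝ⁴)` are continuous there. -/
structure IsStrongSolution (T : ℝ) (u : ℝ → ℝ → ℝ) : Prop where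
  c1 : ContDiffOn ℝ 1 (Function.uncurry u) (Icc 0 T ×ˢ Ioi 0)
  memH2 : ∀ t ∈ Icc 0 T, RadialH2 (u t)
  memH1 : ∀ t ∈ Icc 0 T, RadialH1 (dt T u t)
  cont_grad : ContinuousL2 T fun t => deriv (u t)
  cont_lap : ContinuousL2 T fun t => lap (u t)
  cont_dt : ContinuousL2 T (dt T u)
  cont_grad_dt : ContinuousL2 T fun t => deriv (dt T u t)
  equation : ∀ t₀ ∈ Icc 0 T,
    Tendsto (fun t => eLpNorm
        (fun r => (dt T u t r - dt T u t₀ r) / (t - t₀) - (lap (u t₀) r + u t₀ r ^ 3))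
        2 radialMeasure)
      (𝓝[Icc 0 T \ {t₀}] t₀) (𝓝 0)

/-! The decomposition `u = (P_{B₁(b)} + ε)_λ = (P_{B₁(b)})_λ + w` with `b = -λ_t`, where
`f_λ(r) = λ⁻¹ f(r / λ)`. The rescaled time `s` is defined by `ds/dt = 1/λ`, that is
`∂_s = λ ∂_t` (at fixed `y`). All quantities are written as functions of `t`. -/

/-- `b = -λ_t`. -/
def bpar (T : ℝ) (lam : ℝ → ℝ) (t : ℝ) : ℝ := - derivWithin lam (Icc 0 T) t

/-- The derivative `d/ds = λ d/dt` with respect to the rescaled time. -/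
def dds (T : ℝ) (lam f : ℝ → ℝ) (t : ℝ) : ℝ := lam t * derivWithin f (Icc 0 T) t

/-- `b_s`. -/
def bs (T : ℝ) (lam : ℝ → ℝ) (t : ℝ) : ℝ := dds T lam (bpar T lam) t

/-- `f_λ(r) = λ⁻¹ f(r / λ)`. -/
def rescale (l : ℝ) (f : ℝ → ℝ) (r : ℝ) : ℝ := l⁻¹ * f (r / l)

/-- `ε(t, y) = λ u(t, λ y) - P_{B₁(b(t))}(y)`. -/
def eps (χ : ℝ → ℝ) (M T : ℝ) (u : ℝ → ℝ → ℝ) (lam : ℝ → ℝ) (t y : ℝ) : ℝ :=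
  lam t * u t (lam t * y) - PB1 χ M (bpar T lam t) y

/-- `∂_s ε`. -/
def dsEps (χ : ℝ → ℝ) (M T : ℝ) (u : ℝ → ℝ → ℝ) (lam : ℝ → ℝ) (t y : ℝ) : ℝ :=
  dds T lam (fun τ => eps χ M T u lam τ y) t

/-- `w = u - (P_{B₁(b)})_λ`. -/
def wrad (χ : ℝ → ℝ) (M T : ℝ) (u : ℝ → ℝ → ℝ) (lam : ℝ → ℝ) (t r : ℝ) : ℝ :=
  u t r - rescale (lam t) (PB1 χ M (bpar T lam t)) r

/-- The potential `f'(Q_λ) = 3 Q_λ²`. -/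
def Vlam (l r : ℝ) : ℝ := 3 * rescale l Q r ^ 2

/-- `H_λ w = -Δ w - f'(Q_λ) w`. -/
def Hlam (l : ℝ) (w : ℝ → ℝ) (r : ℝ) : ℝ := - lap w r - Vlam l r * w r

/-- The energy `𝓔 = λ² ∫ [(H_λ ∂_t w, ∂_t w) + (H_λ w)²]`, where the first term is the quadratic
form `∫ (∂_r ∂_t w)² - ∫ f'(Q_λ) (∂_t w)²` of `H_λ`. -/
def energy (χ : ℝ → ℝ) (M T : ℝ) (u : ℝ → ℝ → ℝ) (lam : ℝ → ℝ) (t : ℝ) : ℝ :=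
  lam t ^ 2 *
    ((∫ r, deriv (dt T (wrad χ M T u lam) t) r ^ 2 ∂radialMeasure)
      - (∫ r, Vlam (lam t) r * dt T (wrad χ M T u lam) t r ^ 2 ∂radialMeasure)
      + ∫ r, Hlam (lam t) (wrad χ M T u lam t) r ^ 2 ∂radialMeasure)

/-- `κ₊` (for `σ = 1`) and `κ₋` (for `σ = -1`): `κ± = ã± ± b_s / (2 √ζ) (∂_b P_{B₁}, ψ)`, where
`(ε, ψ) = ã₊ + ã₋` and `(∂_s ε, ψ) = √ζ (ã₊ - ã₋)`. -/
def kappa (σ : ℝ) (χ ψ : ℝ → ℝ) (ζ M T : ℝ) (u : ℝ → ℝ → ℝ) (lam : ℝ → ℝ) (t : ℝ) : ℝ :=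
  (ip (eps χ M T u lam t) ψ + σ * (ip (dsEps χ M T u lam t) ψ / √ζ)) / 2
    + σ * (bs T lam t / (2 * √ζ) * ip (dbPB1 χ M (bpar T lam t)) ψ)

/-- The trapped regime on `[0, T]` with parameters `M`, `K = K(M)` and `b₀`: `u` is a solution with
the decomposition `u = (P_{B₁(b)} + ε)_λ`, `b = -λ_t`, `(ε, χ_M Φ) = 0`, and the bootstrap
estimates hold on `[0, T]`. -/
structure Trapped (χ ψ : ℝ → ℝ) (ζ M K b₀ T : ℝ) (u : ℝ → ℝ → ℝ) (lam : ℝ → ℝ) : Prop where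
  solution : IsStrongSolution T u
  lam_c2 : ContDiffOn ℝ 2 lam (Icc 0 T)
  lam_pos : ∀ t ∈ Icc 0 T, 0 < lam t
  orthogonality : ∀ t ∈ Icc 0 T, ip (eps χ M T u lam t) (fun y => cut χ M y * Phi y) = 0
  b_pos : ∀ t ∈ Icc 0 T, 0 < bpar T lam t
  b_small : ∀ t ∈ Icc 0 T, bpar T lam t < 5 * b₀
  bs_bound : ∀ t ∈ Icc 0 T,
    |bs T lam t| ^ 2 ≤ K * (bpar T lam t ^ 4 / |log (bpar T lam t)| ^ 2)
  energy_norm : ∀ t ∈ Icc 0 T,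
    √((∫ r, deriv (wrad χ M T u lam t) r ^ 2 ∂radialMeasure)
      + ∫ r, (dt T (wrad χ M T u lam) t r
          + bpar T lam t / lam t * rescale (lam t)
              (fun y => (1 - cut χ (B1 (bpar T lam t)) y) * Lam Q y) r) ^ 2 ∂radialMeasure)
      ≤ √b₀
  H2_bound : ∀ t ∈ Icc 0 T,
    |energy χ M T u lam t| ≤ K * (bpar T lam t ^ 4 / |log (bpar T lam t)| ^ 2)
  unstable : ∀ t ∈ Icc 0 T,
    |kappa 1 χ ψ ζ M T u lam t| ≤ 2 * (bpar T lam t ^ 2 / |log (bpar T lam t)|)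
  stable : ∀ t ∈ Icc 0 T,
    |kappa (-1) χ ψ ζ M T u lam t|
      ≤ K ^ (1 / 8 : ℝ) * (bpar T lam t ^ 2 / |log (bpar T lam t)|)

/-- The functional
`𝓘 = (∂_s ε, Λ P̃) + b (ε + 2 Λ ε, Λ P̃) + b_s (∂_b P̃, Λ P̃) + b_s (∂_b (P_{B₁} - P̃), Λ P̃)`,
`P̃ = P̃_{B₀}`, at time `t`. -/
def Ifun (χ : ℝ → ℝ) (M T : ℝ) (u : ℝ → ℝ → ℝ) (lam : ℝ → ℝ) (t : ℝ) : ℝ :=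
  ip (dsEps χ M T u lam t) (Lam (Ptilde χ (bpar T lam t)))
    + bpar T lam t * ip (fun y => eps χ M T u lam t y + 2 * Lam (eps χ M T u lam t) y)
        (Lam (Ptilde χ (bpar T lam t)))
    + bs T lam t * ip (dbPtilde χ (bpar T lam t)) (Lam (Ptilde χ (bpar T lam t)))
    + bs T lam t * ip (fun y => dbPB1 χ M (bpar T lam t) y - dbPtilde χ (bpar T lam t) y)
        (Lam (Ptilde χ (bpar T lam t)))

end

end CriticalWave

/-!
In the self-similar variable `y = r / λ` the solution is `v = P_{B₁} + ε`, its momentum is `p`, and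
`η = p - b Λ P_{B₁} - b_s ∂_b P_{B₁}` is `∂_s ε + b Λ ε`. Let `Z = Λ P̃_{B₀}`, a test function living
on `b y ≤ 1`.

*The identity.* Integrating by parts the scaling operators, `𝓘 = (p, Z) - b (v, D Z)` plus a function
of `b`; only pairings of `u` and `∂_t u` with fixed families of smooth weights occur, and these are
differentiable in time for a strong solution. Hence (`hasDerivWithinAt_G_add_Ifun`)
`d/ds (G + 𝓘) = (Δv + v³, Z) - b² (v, (1 + D) D Z) + b_s S`, where every term of `S` is bounded thanks
to the choice of `G` (`abs_bsCoeff_le`). On the support of `Z` the profile is `Q + b² T₁`, so that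
`Δv + v³ = -H ε + b² Φ - b² c_b χ_{B₀/4} Λ Q` up to quadratic terms. As `Λ` is adjoint to `-(1 + D)`,
`(Φ, Z)` cancels `(Q, (1 + D) D Z)`, and since `c_b` is `32 / (χ_{B₀/4} Λ Q, Λ Q)`,
what is left of the profile terms is `-b² c_b (χ_{B₀/4} Λ Q, Z) = -32 b² + O(b² / |log b|)`.

*The remainder.* Everything else is linear in `ε` and `η`, or small through the decay of `T₁`
(`exists_T1_bound`). The operator `H` is inverted explicitly with the two solutions `Λ Q` and `Γ` of
`H f = 0`; the orthogonality to `χ_M Φ` fixes the component along `Λ Q`, and this gives pointwise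
bounds of `ε` and `Λ ε` by `|H ε|_{L²}` (`exists_inversion_bound`). The energy is
`|H ε|² + ⟨H η, η⟩`. The form of `H` is nonnegative on functions vanishing at `√8`, the zero of `Λ Q`,
hence has a single negative direction, and becomes nonnegative once `ζ / |ψ|²` times the square of
`(η, ψ)` is added (`IsBoundState.formPlus_self_nonneg`). The number
`(η, ψ)` is `√ζ (κ₊ - κ₋)` up to small terms, so that the bootstrap bounds give
`|H ε| + √⟨H η, η⟩₊ = O(√K b² / |log b|)` (`exists_remainder_bound`). To pair `η` with a test
function `Y`, subtract the multiple of `χ_M Φ` that makes `Y` orthogonal to `Λ Q`; the difference is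
`H f` with `f` decaying, and Cauchy-Schwarz for the corrected form applies (`exists_duality_bound`),
while `(η, χ_M Φ) = b (Λ ε, χ_M Φ)` follows by differentiating the orthogonality condition.

*The constants.* All errors are `O(√K b² / √|log b|)` with a constant `C` depending on `M`
(`exists_flux_bound`). For `K ≥ C²` one has `C √K ≤ K`, and this makes the final constant
independent of `M`. The asymptotics of `G` (`exists_G_bound`) is the logarithmic divergence of
`|Λ Q|²_{L²}`, the integrand being `64 / y` at infinity.
-/

open Real Set Filter Topology MeasureTheory
open scoped ContDiff

namespace CriticalWave

noncomputable section

local notation "ϱ" => radialMeasure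
variable {f g F S ψ lam : ℝ → ℝ} {u Y : ℝ → ℝ → ℝ} {y r b a c A C R M ζ K b₀ T t : ℝ}

/-! ### The radial measure -/

theorem integrable_radial_iff : Integrable f ϱ ↔ IntegrableOn (fun r => r ^ 3 * f r) (Ioi 0) := by
  unfold radialMeasure; rw [integrable_withDensity_iff_integrable_smul' (by fun_prop) (by simp)]
  refine integrable_congr ?_
  filter_upwards [ae_restrict_mem measurableSet_Ioi] with r hr
  have : (0 : ℝ) ≤ r ^ 3 := pow_nonneg (le_of_lt hr) 3; simp [ENNReal.toReal_ofReal this]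

theorem integral_radial (f : ℝ → ℝ) : ∫ r, f r ∂ϱ = ∫ r in Ioi 0, r ^ 3 * f r := by
  unfold radialMeasure; rw [integral_withDensity_eq_integral_toReal_smul (by fun_prop) (by simp)]
  refine integral_congr_ae ?_
  filter_upwards [ae_restrict_mem measurableSet_Ioi] with r hr
  have : (0 : ℝ) ≤ r ^ 3 := pow_nonneg (le_of_lt hr) 3; simp [ENNReal.toReal_ofReal this]

theorem radialMeasure_ac : ϱ ≪ volume.restrict (Ioi (0 : ℝ)) := withDensity_absolutelyContinuous _ _

theorem ac_radialMeasure : volume.restrict (Ioi (0 : ℝ)) ≪ ϱ := by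
  refine withDensity_absolutelyContinuous' (by fun_prop) ?_
  filter_upwards [ae_restrict_mem measurableSet_Ioi] with r hr
  have : (0 : ℝ) < r ^ 3 := pow_pos hr 3; simpa using this

theorem ae_radial_of_ae {p : ℝ → Prop} (h : ∀ᵐ r, 0 < r → p r) : ∀ᵐ r ∂ϱ, p r :=
  radialMeasure_ac.ae_le ((ae_restrict_iff' measurableSet_Ioi).2 h)

theorem ae_radial_of_forall {p : ℝ → Prop} (h : ∀ r, 0 < r → p r) : ∀ᵐ r ∂ϱ, p r :=
  ae_radial_of_ae (Eventually.of_forall h)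

theorem integral_radial_congr (h : ∀ r, 0 < r → f r = g r) : ∫ r, f r ∂ϱ = ∫ r, g r ∂ϱ :=
  integral_congr_ae (ae_radial_of_forall h)

theorem ip_congr {f' g' : ℝ → ℝ} (hf : ∀ r, 0 < r → f r = f' r)
    (hg : ∀ r, 0 < r → g r = g' r) : ip f g = ip f' g' :=
  integral_radial_congr fun r hr => by rw [hf r hr, hg r hr]

theorem ip_comm (f g : ℝ → ℝ) : ip f g = ip g f := by unfold ip; simp_rw [mul_comm]

theorem aesm_radial (h : ContinuousOn f (Ioi 0)) : AEStronglyMeasurable f ϱ :=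
  (h.aestronglyMeasurable measurableSet_Ioi).mono_ac radialMeasure_ac

theorem radial_integral_comp_mul (hc : 0 < c) (f : ℝ → ℝ) :
    ∫ r, f (c * r) ∂ϱ = (c ^ 4)⁻¹ * ∫ r, f r ∂ϱ := by
  rw [integral_radial, integral_radial]
  have h := integral_comp_mul_left_Ioi (fun r => r ^ 3 * f r) 0 hc
  simp only [mul_zero, smul_eq_mul] at h
  have h2 : ∀ r : ℝ, r ^ 3 * f (c * r) = (c ^ 3)⁻¹ * ((c * r) ^ 3 * f (c * r)) := by
    intro r; field_simp
  simp_rw [h2]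
  rw [integral_const_mul, h]; field_simp

theorem integrable_radial_comp_mul (hc : 0 < c)
    (hf : Integrable f ϱ) : Integrable (fun r => f (c * r)) ϱ := by
  rw [integrable_radial_iff] at hf ⊢
  have h := (integrableOn_Ioi_comp_mul_left_iff (fun r => r ^ 3 * f r) 0 hc).2 (by simpa using hf)
  refine (Integrable.const_mul h (c ^ 3)⁻¹).congr (Eventually.of_forall fun r => ?_)
  simp only; field_simp

theorem aesm_radial_comp_mul (hc : 0 < c) (hf : AEStronglyMeasurable f ϱ) :
    AEStronglyMeasurable (fun r => f (c * r)) ϱ := by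
  have h1 : AEStronglyMeasurable f (volume.restrict (Ioi (0 : ℝ))) := hf.mono_ac ac_radialMeasure
  refine AEStronglyMeasurable.mono_ac radialMeasure_ac ?_
  have hq : Measure.QuasiMeasurePreserving (fun r : ℝ => c * r) (volume.restrict (Ioi 0))
      (volume.restrict (Ioi 0)) := by
    have h0 : Measure.QuasiMeasurePreserving (fun r : ℝ => c * r) volume volume := by
      refine ⟨by fun_prop, ?_⟩
      rw [Real.map_volume_mul_left hc.ne']; exact Measure.smul_absolutelyContinuous
    exact h0.restrict fun r hr => mul_pos hc hr
  exact h1.comp_quasiMeasurePreserving hq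

theorem memLp_radial_comp_mul (hc : 0 < c) (hf : MemLp f 2 ϱ) : MemLp (fun r => f (c * r)) 2 ϱ := by
  rw [memLp_two_iff_integrable_sq (aesm_radial_comp_mul hc hf.1)]
  exact integrable_radial_comp_mul hc (f := fun r => f r ^ 2) hf.integrable_sq

theorem integrable_radial_of_le (hf : AEStronglyMeasurable f ϱ)
    (hb : ∀ y, 0 < y → y ≤ R → |y ^ 3 * f y| ≤ A) (h0 : ∀ y, R < y → f y = 0) :
    Integrable f ϱ := by
  rw [integrable_radial_iff]
  have hm : AEStronglyMeasurable (fun r => r ^ 3 * f r) (volume.restrict (Ioi (0 : ℝ))) :=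
    (by fun_prop : Continuous fun r : ℝ => r ^ 3).aestronglyMeasurable.mul
      (hf.mono_ac ac_radialMeasure)
  have : IntegrableOn (fun r => r ^ 3 * f r) (Ioc 0 R) :=
    Integrable.mono' (integrable_const A) (hm.mono_set Ioc_subset_Ioi_self)
      ((ae_restrict_iff' measurableSet_Ioc).2 (Eventually.of_forall fun y hy => hb y hy.1 hy.2))
  refine (this.of_forall_sdiff_eq_zero measurableSet_Ioi fun y hy => ?_)
  rw [h0 y (by by_contra h; exact hy.2 ⟨hy.1, not_lt.1 h⟩), mul_zero]

theorem integral_radial_eq_interval (hR : 0 ≤ R) (h0 : ∀ y, R < y → f y = 0) :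
    ∫ r, f r ∂ϱ = ∫ r in (0 : ℝ)..R, r ^ 3 * f r := by
  rw [integral_radial, intervalIntegral.integral_of_le hR]
  refine (setIntegral_eq_of_subset_of_forall_sdiff_eq_zero measurableSet_Ioi
    Ioc_subset_Ioi_self fun y hy => ?_)
  rw [h0 y (by by_contra h; exact hy.2 ⟨hy.1, not_lt.1 h⟩), mul_zero]

/-- A primitive from `0` is at most the supremum of the integrand times the length. -/
theorem abs_primitive_le (hy : 0 ≤ y)
    (h : ∀ s, 0 < s → s ≤ y → |f s| ≤ A) : |∫ s in (0 : ℝ)..y, f s| ≤ A * y := by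
  have := intervalIntegral.norm_integral_le_of_norm_le_const (a := 0) (b := y) (C := A)
    (f := f) (fun s hs => by
      rw [uIoc_of_le hy] at hs; exact h s hs.1 hs.2)
  simpa [abs_of_nonneg hy] using this

theorem abs_integral_radial_le (hR : 0 ≤ R)
    (hb : ∀ y, 0 < y → y ≤ R → |y ^ 3 * f y| ≤ A) (h0 : ∀ y, R < y → f y = 0) :
    |∫ r, f r ∂ϱ| ≤ A * R := by
  rw [integral_radial_eq_interval hR h0]; exact abs_primitive_le hR hb

theorem integrable_radial_of_decay (hf : AEStronglyMeasurable f ϱ)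
    (hb : ∀ y, 0 < y → |y ^ 3 * f y| ≤ A / (1 + y ^ 2)) :
    Integrable f ϱ := by
  rw [integrable_radial_iff]
  have hm : AEStronglyMeasurable (fun r => r ^ 3 * f r) (volume.restrict (Ioi (0 : ℝ))) :=
    (by fun_prop : Continuous fun r : ℝ => r ^ 3).aestronglyMeasurable.mul
      (hf.mono_ac ac_radialMeasure)
  have hi : Integrable (fun y : ℝ => A * (1 + y ^ 2)⁻¹) := integrable_inv_one_add_sq.const_mul A
  refine Integrable.mono' hi.integrableOn hm ?_
  filter_upwards [ae_restrict_mem measurableSet_Ioi] with y hy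
  simpa [div_eq_mul_inv] using hb y hy

theorem memLp_radial_of_le (hf : AEStronglyMeasurable f ϱ)
    (hb : ∀ y, 0 < y → y ≤ R → |y ^ 3 * f y ^ 2| ≤ A) (h0 : ∀ y, R < y → f y = 0) :
    MemLp f 2 ϱ :=
  (memLp_two_iff_integrable_sq hf).2
    (integrable_radial_of_le (hf.pow 2) hb fun y hy => by simp [h0 y hy])

theorem memLp_radial_of_decay (hf : AEStronglyMeasurable f ϱ)
    (hb : ∀ y, 0 < y → |y ^ 3 * f y ^ 2| ≤ A / (1 + y ^ 2)) :
    MemLp f 2 ϱ :=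
  (memLp_two_iff_integrable_sq hf).2 (integrable_radial_of_decay (hf.pow 2) hb)

/-- Cauchy–Schwarz for real functions on any measure space. -/
theorem sq_integral_mul_le {α : Type*} [MeasurableSpace α] {μ : Measure α} {f g : α → ℝ}
    (hf : Integrable (fun x => f x ^ 2) μ) (hg : Integrable (fun x => g x ^ 2) μ)
    (hfg : Integrable (fun x => f x * g x) μ) :
    (∫ x, f x * g x ∂μ) ^ 2 ≤ (∫ x, f x ^ 2 ∂μ) * ∫ x, g x ^ 2 ∂μ := by
  have key : ∀ t : ℝ, 0 ≤ (∫ x, g x ^ 2 ∂μ) * (t * t) + (2 * ∫ x, f x * g x ∂μ) * t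
      + ∫ x, f x ^ 2 ∂μ := by
    intro t
    have h : 0 ≤ ∫ x, (f x + t * g x) ^ 2 ∂μ := integral_nonneg fun x => sq_nonneg _
    have e : ∀ x, (f x + t * g x) ^ 2 = f x ^ 2 + ((2 * t) * (f x * g x) + t ^ 2 * g x ^ 2) :=
      fun x => by ring
    simp_rw [e] at h
    have h1 : Integrable (fun x => 2 * t * (f x * g x) + t ^ 2 * g x ^ 2) μ :=
      (hfg.const_mul _).add (hg.const_mul _)
    rw [integral_add hf h1,
      integral_add (hfg.const_mul _) (hg.const_mul _), integral_const_mul, integral_const_mul] at h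
    linarith
  have := discrim_le_zero key
  unfold discrim at this; nlinarith

theorem abs_ip_le (hf : MemLp f 2 ϱ) (hg : MemLp g 2 ϱ) :
    |ip f g| ≤ √(∫ r, f r ^ 2 ∂ϱ) * √(∫ r, g r ^ 2 ∂ϱ) := by
  rw [← Real.sqrt_mul (integral_nonneg fun x => sq_nonneg _)]
  exact Real.abs_le_sqrt (sq_integral_mul_le hf.integrable_sq hg.integrable_sq
    (hf.integrable_mul hg))

theorem ip_eq_comb {F w : ℝ → ℝ} (hf : Integrable (fun y => f y * w y) ϱ)
    (hg : Integrable (fun y => g y * w y) ϱ) (c d : ℝ)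
    (e : ∀ y, 0 < y → F y * w y = c * (f y * w y) + d * (g y * w y)) :
    ip F w = c * ip f w + d * ip g w := by
  unfold ip
  rw [← integral_const_mul, ← integral_const_mul, ← integral_add (hf.const_mul c) (hg.const_mul d)]
  exact integral_radial_congr e

theorem abs_pow_mul (hy : 0 < y) {n : ℕ} {x : ℝ} : |y ^ n * x| = y ^ n * |x| := by
  rw [abs_mul, abs_of_pos (pow_pos hy n)]

theorem exists_abs_le (hf : ContinuousOn f (Icc a b)) :
    ∃ C, 0 < C ∧ ∀ y, a ≤ y → y ≤ b → |f y| ≤ C := by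
  obtain ⟨C, hC⟩ := isCompact_Icc.exists_bound_of_continuousOn hf
  exact ⟨max C 1, by positivity, fun y h1 h2 => (hC y ⟨h1, h2⟩).trans (le_max_left _ _)⟩

theorem integrable_mul_of_bounded (hf : ContinuousOn f (Ioi 0)) (hg : ContinuousOn g (Ici 0))
    (hA : ∀ y, 0 < y → y ≤ R → |y * f y| ≤ A) (h0 : ∀ y, R < y → g y = 0) :
    Integrable (fun y => f y * g y) ϱ := by
  obtain ⟨B, hB, hb⟩ := exists_abs_le (f := fun y => y ^ 2 * g y) (a := 0) (b := R)
    ((by fun_prop : ContinuousOn (fun y => y ^ 2 * g y) (Ici 0)).mono Icc_subset_Ici_self)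
  refine integrable_radial_of_le (R := R) (A := A * B)
    (aesm_radial (hf.mul (hg.mono Ioi_subset_Ici_self))) (fun y hy hyR => ?_)
    fun y hy => by rw [h0 y hy, mul_zero]
  rw [show y ^ 3 * (f y * g y) = (y * f y) * (y ^ 2 * g y) by ring, abs_mul]
  exact mul_le_mul (hA y hy hyR) (hb y hy.le hyR) (abs_nonneg _)
    ((abs_nonneg _).trans (hA y hy hyR))

theorem integrable_mul_of_continuous (hf : Continuous f) (hg : Continuous g)
    (h0 : ∀ y, R < y → g y = 0) : Integrable (fun y => f y * g y) ϱ := by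
  obtain ⟨A, -, hA⟩ := exists_abs_le (f := fun y => y * f y) (a := 0) (b := R) (by fun_prop)
  exact integrable_mul_of_bounded hf.continuousOn hg.continuousOn (fun y hy => hA y hy.le) h0

/-! ### Locally absolutely continuous functions -/

theorem LocallyAC.continuousOn (hf : LocallyAC f) : ContinuousOn f (Ioi 0) := by
  intro x hx
  have hx : 0 < x := hx
  have h := (hf (x / 2) (2 * x) (by linarith) (by linarith)).continuousOn
  rw [uIcc_of_le (by linarith)] at h
  exact (h.continuousAt (Icc_mem_nhds (by linarith) (by linarith))).continuousWithinAt

theorem LocallyAC.ac (hf : LocallyAC f) (ha : 0 < a) (hb : 0 < b) :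
    AbsolutelyContinuousOnInterval f a b := by
  rcases lt_trichotomy a b with h | h | h
  · exact hf a b ha h
  · subst h
    exact (hf a (a + 1) ha (by linarith)).mono (by simp [uIcc_of_le])
  · exact (hf b a hb h).symm

theorem LocallyAC.integral_deriv (hf : LocallyAC f) (ha : 0 < a)
    (hb : 0 < b) : ∫ x in a..b, deriv f x = f b - f a :=
  (hf.ac ha hb).integral_deriv_eq_sub

theorem LocallyAC.ae_differentiableAt (hf : LocallyAC f) :
    ∀ᵐ x, 0 < x → DifferentiableAt ℝ f x := by
  have h : ∀ n : ℕ, ∀ᵐ x, x ∈ uIcc (1 / ((n : ℝ) + 1)) ((n : ℝ) + 2) → DifferentiableAt ℝ f x :=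
    fun n => (hf.ac (by positivity) (by positivity)).boundedVariationOn.ae_differentiableAt_of_mem_uIcc
  filter_upwards [ae_all_iff.2 h] with x hx hx0
  obtain ⟨n, hn⟩ := exists_nat_gt (max x (1 / x))
  refine hx n ?_
  have h1 : x < n := lt_of_le_of_lt (le_max_left _ _) hn
  have h2 : 1 / x < n := lt_of_le_of_lt (le_max_right _ _) hn
  have h3 : 1 / ((n : ℝ) + 1) ≤ x := by
    rw [div_lt_iff₀ hx0] at h2; rw [div_le_iff₀ (by positivity)]
    nlinarith
  exact mem_uIcc_of_le h3 (by linarith)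

theorem LocallyAC.add (hf : LocallyAC f) (hg : LocallyAC g) :
    LocallyAC (fun x => f x + g x) := fun a b ha hab => (hf a b ha hab).add (hg a b ha hab)

theorem LocallyAC.sub (hf : LocallyAC f) (hg : LocallyAC g) :
    LocallyAC (fun x => f x - g x) := fun a b ha hab => (hf a b ha hab).sub (hg a b ha hab)

theorem LocallyAC.mul (hf : LocallyAC f) (hg : LocallyAC g) :
    LocallyAC (fun x => f x * g x) := fun a b ha hab => (hf a b ha hab).mul (hg a b ha hab)

theorem LocallyAC.const_mul (hf : LocallyAC f) (c : ℝ) :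
    LocallyAC (fun x => c * f x) := fun a b ha hab => (hf a b ha hab).const_mul c

theorem LocallyAC.congr (hf : LocallyAC f) (h : ∀ x, 0 < x → f x = g x) : LocallyAC g := by
  intro a b ha hab
  have hab' := hf a b ha hab; rw [absolutelyContinuousOnInterval_iff] at hab' ⊢
  intro ε hε
  obtain ⟨δ, hδ, H⟩ := hab' ε hε
  refine ⟨δ, hδ, fun E hE hE2 => ?_⟩
  convert H E hE hE2 using 1
  refine Finset.sum_congr rfl fun i hi => ?_
  have h1 := hE.1 i hi; rw [uIcc_of_le hab.le] at h1
  rw [h _ (ha.trans_le h1.1.1), h _ (ha.trans_le h1.2.1)]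

/-- A function with a continuous derivative on `(0, ∞)` is locally absolutely continuous. -/
theorem locallyAC_of_hasDerivAt {f' : ℝ → ℝ} (h : ∀ x, 0 < x → HasDerivAt f (f' x) x)
    (hc : ContinuousOn f' (Ioi 0)) : LocallyAC f := by
  intro a b ha hab
  have hsub : uIcc a b ⊆ Ioi 0 := by rw [uIcc_of_le hab.le]; exact fun x hx => ha.trans_le hx.1
  have h1 : ContDiffOn ℝ 1 f (Ioi 0) := by
    rw [contDiffOn_one_iff_derivWithin (uniqueDiffOn_Ioi 0)]
    refine ⟨fun x hx => (h x hx).differentiableAt.differentiableWithinAt, ?_⟩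
    refine hc.congr fun x hx => ?_
    rw [(h x hx).hasDerivWithinAt.derivWithin (uniqueDiffOn_Ioi 0 x hx)]
  exact (h1.mono hsub).absolutelyContinuousOnInterval

theorem LocallyAC.comp_mul (hf : LocallyAC f) (hc : 0 < c) : LocallyAC (fun x => f (c * x)) := by
  intro a b ha hab
  have hi := (hf (c * a) (c * b) (by positivity) (by gcongr)).intervalIntegrable_deriv
  have hi2 : IntervalIntegrable (fun x => c * deriv f (c * x)) volume a b := by
    have := (hi.comp_mul_left (c := c)); simp only [mul_div_cancel_left₀ _ hc.ne'] at this
    exact this.const_mul c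
  have h1 := hi2.absolutelyContinuousOnInterval_intervalIntegral (c := a) left_mem_uIcc
  rw [absolutelyContinuousOnInterval_iff] at h1 ⊢
  intro ε hε
  obtain ⟨δ, hδ, H⟩ := h1 ε hε
  refine ⟨δ, hδ, fun E hE hE2 => ?_⟩
  convert H E hE hE2 using 1
  have key : ∀ x ∈ uIcc a b, ∫ v in a..x, c * deriv f (c * v) = f (c * x) - f (c * a) := by
    intro x hx; rw [uIcc_of_le hab.le] at hx
    have hx0 : 0 < x := ha.trans_le hx.1
    rw [intervalIntegral.integral_const_mul, intervalIntegral.integral_comp_mul_left _ hc.ne',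
      hf.integral_deriv (by positivity) (by positivity)]
    simp [hc.ne']
  refine Finset.sum_congr rfl fun i hi => ?_
  have h1 := hE.1 i hi; rw [key _ h1.1, key _ h1.2, dist_sub_right]

/-! ### The ground state and the kernel of the linearized operator -/

theorem Q_pos (y : ℝ) : 0 < Q y := by unfold Q; positivity

theorem Q_le_one (y : ℝ) : Q y ≤ 1 := by
  unfold Q; rw [div_le_one (by positivity)]; nlinarith [sq_nonneg y]

theorem sq_mul_Q (y : ℝ) : y ^ 2 * Q y = 8 * (1 - Q y) := by unfold Q; field_simp; ring

theorem Q_le (y : ℝ) : Q y ≤ 8 / (1 + y ^ 2) := by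
  rw [le_div_iff₀ (by positivity)]
  have := sq_mul_Q y
  have := Q_le_one y
  have := Q_pos y; nlinarith

theorem hasDerivAt_Q (y : ℝ) : HasDerivAt Q (-(y / 4) * Q y ^ 2) y := by
  have h : HasDerivAt (fun y : ℝ => 1 + y ^ 2 / 8) (y / 4) y := by
    have := ((hasDerivAt_pow 2 y).div_const 8).const_add 1
    exact this.congr_deriv (by norm_num; ring)
  have h2 := (hasDerivAt_const y (1 : ℝ)).div h (by positivity)
  unfold Q
  refine h2.congr_deriv ?_
  field_simp; ring

theorem contDiff_Q {n : WithTop ℕ∞} : ContDiff ℝ n Q := by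
  unfold Q; exact contDiff_const.div (by fun_prop) fun y => by positivity

theorem continuous_Q : Continuous Q := (contDiff_Q (n := 0)).continuous

theorem mul_deriv_Q (y : ℝ) : y * deriv Q y = 2 * Q y ^ 2 - 2 * Q y := by
  rw [(hasDerivAt_Q y).deriv]
  have := sq_mul_Q y
  linear_combination (-(Q y) / 4) * this

theorem Lam_Q (y : ℝ) : Lam Q y = 2 * Q y ^ 2 - Q y := by unfold Lam; rw [mul_deriv_Q]; ring

theorem Lam_Q_fun : Lam Q = fun y => 2 * Q y ^ 2 - Q y := funext Lam_Q

/-- The derivative of `ΛQ`. -/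
def dLamQ (y : ℝ) : ℝ := -(y / 4) * Q y ^ 2 * (4 * Q y - 1)

theorem hasDerivAt_LamQ (y : ℝ) : HasDerivAt (Lam Q) (dLamQ y) y := by
  rw [Lam_Q_fun]
  have h := (((hasDerivAt_Q y).pow 2).const_mul 2).sub (hasDerivAt_Q y)
  refine h.congr_deriv ?_
  unfold dLamQ; push_cast; ring

theorem contDiff_LamQ {n : WithTop ℕ∞} : ContDiff ℝ n (Lam Q) := by
  rw [Lam_Q_fun]; exact (contDiff_const.mul (contDiff_Q.pow 2)).sub contDiff_Q

theorem continuous_LamQ : Continuous (Lam Q) := (contDiff_LamQ (n := 0)).continuous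

theorem mul_dLamQ (y : ℝ) : y * dLamQ y = (2 * Q y ^ 2 - 2 * Q y) * (4 * Q y - 1) := by
  unfold dLamQ
  have := sq_mul_Q y
  linear_combination (-(Q y) / 4 * (4 * Q y - 1)) * this

theorem Phi_eq (y : ℝ) : Phi y = 8 * Q y ^ 3 - 6 * Q y ^ 2 := by
  unfold Phi Dop; rw [(hasDerivAt_LamQ y).deriv, mul_dLamQ, Lam_Q]; ring

theorem contDiff_Phi {n : WithTop ℕ∞} : ContDiff ℝ n Phi := by
  rw [show Phi = fun y => 8 * Q y ^ 3 - 6 * Q y ^ 2 from funext Phi_eq]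
  exact (contDiff_const.mul (contDiff_Q.pow 3)).sub (contDiff_const.mul (contDiff_Q.pow 2))

theorem continuous_Phi : Continuous Phi := (contDiff_Phi (n := 0)).continuous

theorem continuous_dLamQ : Continuous dLamQ := by
  unfold dLamQ
  have := continuous_Q; fun_prop

theorem abs_LamQ_le (y : ℝ) : |Lam Q y| ≤ Q y := by
  rw [Lam_Q, abs_le]
  have := Q_le_one y
  have := Q_pos y
  constructor <;> nlinarith

theorem abs_Phi_le (y : ℝ) : |Phi y| ≤ 6 * Q y ^ 2 := by
  rw [Phi_eq, abs_le]
  have h1 := Q_le_one y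
  have h2 := Q_pos y
  have h3 : 0 ≤ Q y ^ 2 * (1 - Q y) := by apply mul_nonneg <;> nlinarith
  have h4 : 0 ≤ Q y ^ 3 := by positivity
  constructor <;> nlinarith

theorem abs_mul_dLamQ_le (y : ℝ) : |y * dLamQ y| ≤ 6 * Q y := by
  rw [mul_dLamQ]
  have h1 := Q_le_one y
  have h2 := Q_pos y
  rw [show (2 * Q y ^ 2 - 2 * Q y) * (4 * Q y - 1)
    = Q y * (2 * (Q y - 1) * (4 * Q y - 1)) by ring, abs_mul, abs_of_pos h2, mul_comm]
  gcongr; rw [abs_le]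
  constructor <;> nlinarith [mul_nonneg h2.le (sub_nonneg.2 h1)]

theorem hasDerivAt_cube_dLamQ (y : ℝ) :
    HasDerivAt (fun y => y ^ 3 * dLamQ y) (-(y ^ 3 * (V y * Lam Q y))) y := by
  have hq := hasDerivAt_Q y
  have h := ((hasDerivAt_pow 3 y).mul
    ((((hasDerivAt_id y).div_const 4).neg.mul (hq.pow 2)).mul ((hq.const_mul 4).sub_const 1)))
  unfold dLamQ
  refine h.congr_deriv ?_
  simp only [Lam_Q, V, id, Pi.mul_apply, Pi.pow_apply, Pi.neg_apply]; push_cast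
  have e2 : y ^ 2 * Q y = 8 - 8 * Q y := by linarith [sq_mul_Q y]
  norm_num
  linear_combination (y ^ 3 * Q y ^ 2 * (-1 / 8) + 3 / 4 * y ^ 3 * Q y ^ 3) * e2

/-- The non-constant factor of `gamNum`. -/
def gamFac (x : ℝ) : ℝ := x + 6 * log x - 1 / x - (1 / 8 - 6 * log 8 - 8 + 128 / 7)

/-- The derivative of `gamNum`. -/
def dgamNum (x : ℝ) : ℝ := -gamFac x + (1 - x) * (1 + 6 / x + 1 / x ^ 2)

theorem hasDerivAt_gamFac {x : ℝ} (hx : x ≠ 0) : HasDerivAt gamFac (1 + 6 / x + 1 / x ^ 2) x := by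
  refine ((((hasDerivAt_id x).add ((Real.hasDerivAt_log hx).const_mul 6)).sub
    ((hasDerivAt_const x (1 : ℝ)).div (hasDerivAt_id x) hx)).sub_const _).congr_deriv ?_
  simp only [id]; field_simp; ring

theorem hasDerivAt_gamNum {x : ℝ} (hx : x ≠ 0) : HasDerivAt gamNum (dgamNum x) x := by
  refine ((((hasDerivAt_id x).const_sub 1).mul (hasDerivAt_gamFac hx)).add_const 16).congr_deriv ?_
  simp only [dgamNum, id]; ring

theorem hasDerivAt_dgamNum {x : ℝ} (hx : x ≠ 0) :
    HasDerivAt dgamNum (-2 * (1 + 6 / x + 1 / x ^ 2) + (1 - x) * (-6 / x ^ 2 - 2 / x ^ 3)) x := by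
  have h3 : HasDerivAt (fun x : ℝ => 1 + 6 / x + 1 / x ^ 2) (-6 / x ^ 2 - 2 / x ^ 3) x := by
    refine (((hasDerivAt_const x (6 : ℝ)).div (hasDerivAt_id x) hx).const_add 1).add
      ((hasDerivAt_const x (1 : ℝ)).div (hasDerivAt_pow 2 x) (by positivity)) |>.congr_deriv ?_
    simp only [id]; push_cast; field_simp; ring
  refine ((hasDerivAt_gamFac hx).neg.add (((hasDerivAt_id x).const_sub 1).mul h3)).congr_deriv ?_
  simp only [id]; ring

/-- The derivative of `Γ`. -/
def dGam (y : ℝ) : ℝ := y / 4 * (-(dgamNum (y ^ 2 / 8) * (1 + y ^ 2 / 8) - 2 * gamNum (y ^ 2 / 8))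
    / (16 * (1 + y ^ 2 / 8) ^ 3))

theorem hasDerivAt_sq_div_eight (y : ℝ) : HasDerivAt (fun y : ℝ => y ^ 2 / 8) (y / 4) y := by
  have := (hasDerivAt_pow 2 y).div_const 8; exact this.congr_deriv (by norm_num; ring)

theorem hasDerivAt_Gam (hy : 0 < y) : HasDerivAt Gam (dGam y) y := by
  have hx : y ^ 2 / 8 ≠ 0 := by positivity
  have h1 := (hasDerivAt_gamNum hx).comp y (hasDerivAt_sq_div_eight y)
  have h2 := (((hasDerivAt_sq_div_eight y).const_add 1).pow 2).const_mul 16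
  have h := (h1.div h2 (by simp only [Pi.pow_apply]; positivity)).neg
  unfold Gam
  refine h.congr_deriv ?_
  unfold dGam; simp only [Function.comp_apply, Pi.pow_apply]; push_cast; field_simp

theorem hasDerivAt_cube_dGam (hy : 0 < y) :
    HasDerivAt (fun y => y ^ 3 * dGam y) (-(y ^ 3 * (V y * Gam y))) y := by
  have hx : y ^ 2 / 8 ≠ 0 := by positivity
  have h1 := (hasDerivAt_gamNum hx).comp y (hasDerivAt_sq_div_eight y)
  have h1' := (hasDerivAt_dgamNum hx).comp y (hasDerivAt_sq_div_eight y)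
  have h2 := ((hasDerivAt_sq_div_eight y).const_add 1)
  have h3 := (((h1'.mul h2).sub (h1.const_mul 2)).neg).div ((h2.pow 3).const_mul 16)
    (by simp only [Pi.pow_apply]; positivity)
  have h := (hasDerivAt_pow 3 y).mul (((hasDerivAt_id y).div_const 4).mul h3)
  unfold dGam
  refine h.congr_deriv ?_
  simp only [Function.comp_apply, Pi.pow_apply, Pi.mul_apply, Pi.sub_apply, Pi.neg_apply,
    Pi.div_apply, id, V, Q, Gam, dgamNum, gamNum, gamFac]
  push_cast
  generalize log (y ^ 2 / 8) = l
  generalize log 8 = l8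
  field_simp; ring

theorem wronskian (hy : 0 < y) : dGam y * Lam Q y - Gam y * dLamQ y = -1 / y ^ 3 := by
  simp only [dGam, dLamQ, Lam_Q, Q, Gam, dgamNum, gamNum, gamFac]
  generalize log (y ^ 2 / 8) = l
  generalize log 8 = l8
  field_simp; ring

theorem abs_log_le {x : ℝ} (hx : 0 < x) : |log x| ≤ x + 1 / x := by
  have h1 := Real.log_le_sub_one_of_pos hx
  have h2 := Real.log_le_sub_one_of_pos (one_div_pos.2 hx)
  rw [Real.log_div one_ne_zero hx.ne', Real.log_one] at h2
  have : 0 < 1 / x := by positivity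
  rw [abs_le]; constructor <;> linarith

theorem abs_gamNum_le : ∃ k : ℝ, 0 < k ∧ ∀ x : ℝ, 0 < x →
    |gamNum x| ≤ k * ((1 + x) ^ 2 * (1 + 1 / x)) ∧
      |x * dgamNum x| ≤ k * ((1 + x) ^ 2 * (1 + 1 / x)) := by
  set c : ℝ := |1 / 8 - 6 * log 8 - 8 + 128 / 7| with hc
  have hcn : 0 ≤ c := abs_nonneg _
  refine ⟨32 + c, by positivity, fun x hx => ?_⟩
  have hi : 0 < 1 / x := by positivity
  have hxi : x * (1 / x) = 1 := by field_simp
  have hin : |gamFac x| ≤ 7 * x + 7 * (1 / x) + c := by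
    have := abs_le.1 (abs_log_le hx)
    have := abs_le.1 hc.ge
    unfold gamFac; rw [abs_le]; constructor <;> linarith
  have h1x : |1 - x| ≤ 1 + x := by rw [abs_le]; constructor <;> linarith
  set i := 1 / x with hi_def
  have hp := mul_nonneg (mul_nonneg hcn hx.le) hx.le
  rw [show (1 + x) ^ 2 * (1 + i) = (1 + x) * (2 + x + i) by linear_combination (1 + x) * hxi]
  constructor
  · have : |gamNum x| ≤ (1 + x) * (7 * x + 7 * i + c) + 16 := by
      refine (abs_add_le ((1 - x) * gamFac x) 16).trans ?_
      rw [abs_mul, abs_of_pos (by norm_num : (0 : ℝ) < 16)]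
      gcongr
    nlinarith [mul_nonneg hcn hx.le, mul_nonneg hcn hi.le, mul_pos hx hx, mul_pos hx hi]
  · have e2 : x * dgamNum x = -(x * gamFac x) + (1 - x) * (x + 6 + i) := by
      unfold dgamNum; rw [hi_def]; field_simp
    have : |x * dgamNum x| ≤ x * (7 * x + 7 * i + c) + (1 + x) * (x + 6 + i) := by
      rw [e2]
      refine (abs_add_le _ _).trans ?_
      rw [abs_neg, abs_mul, abs_mul, abs_of_pos hx, abs_of_pos (by positivity : 0 < x + 6 + i)]
      gcongr
    nlinarith [mul_nonneg hcn hx.le, mul_nonneg hcn hi.le, mul_pos hx hx, mul_pos hx hi]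

theorem abs_Gam_le : ∃ k : ℝ, 1 ≤ k ∧ ∀ y : ℝ, 0 < y →
    |Gam y| ≤ k * (1 + 1 / y ^ 2) ∧ |y * dGam y| ≤ k * (1 + 1 / y ^ 2) := by
  obtain ⟨k, hk, h⟩ := abs_gamNum_le
  refine ⟨8 * k + 1, by linarith, fun y hy => ?_⟩
  set x := y ^ 2 / 8 with hx_def
  have hx : 0 < x := by positivity
  obtain ⟨h1, h2⟩ := h x hx
  have hp : 0 < 1 + 1 / y ^ 2 := by positivity
  have hk8 : k * (1 + 1 / x) ≤ 8 * k * (1 + 1 / y ^ 2) := by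
    rw [hx_def, show 1 / (y ^ 2 / 8) = 8 * (1 / y ^ 2) by field_simp]
    linarith
  constructor
  · have : |Gam y| ≤ k * (1 + 1 / x) := by
      unfold Gam
      rw [abs_neg, abs_div, abs_of_pos (by positivity : 0 < 16 * (1 + y ^ 2 / 8) ^ 2), ← hx_def,
        div_le_iff₀ (by positivity)]
      refine h1.trans ?_
      have : 0 ≤ k * ((1 + x) ^ 2 * (1 + 1 / x)) := by positivity
      nlinarith
    nlinarith
  · have : |y * dGam y| ≤ k * (1 + 1 / x) := by
      have e : y * dGam y = -(2 * ((x * dgamNum x) * (1 + x) - 2 * x * gamNum x))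
          / (16 * (1 + x) ^ 3) := by
        unfold dGam
        rw [← hx_def, show y * (y / 4 * (-(dgamNum x * (1 + x) - 2 * gamNum x) / (16 * (1 + x) ^ 3)))
          = (y ^ 2 / 8) * 2 * (-(dgamNum x * (1 + x) - 2 * gamNum x) / (16 * (1 + x) ^ 3)) by ring,
          ← hx_def]
        ring
      rw [e, abs_div, abs_of_pos (by positivity : 0 < 16 * (1 + x) ^ 3),
        div_le_iff₀ (by positivity), abs_neg, abs_mul, abs_two]
      have h3 : |x * dgamNum x * (1 + x) - 2 * x * gamNum x|
          ≤ k * ((1 + x) ^ 2 * (1 + 1 / x)) * (1 + x)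
            + 2 * x * (k * ((1 + x) ^ 2 * (1 + 1 / x))) := by
        refine (abs_sub _ _).trans ?_
        rw [abs_mul, abs_mul (2 * x), abs_of_pos (by linarith : 0 < 1 + x),
          abs_of_pos (by linarith : 0 < 2 * x)]
        gcongr
      have h4 : 0 ≤ k * ((1 + x) ^ 2 * (1 + 1 / x)) := by positivity
      nlinarith
    nlinarith

theorem continuous_cube_mul_Gam : Continuous fun y => Gam y * y ^ 3 := by
  have e : (fun y => Gam y * y ^ 3) = fun y : ℝ =>
      -((1 - y ^ 2 / 8) * (y ^ 2 / 8 * y ^ 3 + 6 * (2 * (y * log y) * y ^ 2 - log 8 * y ^ 3) - 8 * y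
        - (1 / 8 - 6 * log 8 - 8 + 128 / 7) * y ^ 3) + 16 * y ^ 3)
        / (16 * (1 + y ^ 2 / 8) ^ 2) := by
    funext y
    rcases eq_or_ne y 0 with rfl | hy
    · simp
    · unfold Gam gamNum
      have h8 : log (y ^ 2 / 8) = 2 * log y - log 8 := by
        rw [Real.log_div (by positivity) (by norm_num), Real.log_pow]; norm_num
      rw [h8]; field_simp
  rw [e]
  refine Continuous.div ?_ (by fun_prop) fun y => by positivity
  have := Real.continuous_mul_log; fun_prop

theorem continuousOn_Gam : ContinuousOn Gam (Ioi 0) := fun _ hy =>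
  (hasDerivAt_Gam hy).continuousAt.continuousWithinAt

theorem continuousOn_dGam : ContinuousOn dGam (Ioi 0) := by
  have h : ContinuousOn (fun y => (y ^ 3 * dGam y) * (y ^ 3)⁻¹) (Ioi 0) := by
    refine ContinuousOn.mul
      (fun y hy => (hasDerivAt_cube_dGam hy).continuousAt.continuousWithinAt) ?_
    exact ContinuousOn.inv₀ (by fun_prop) fun y hy => (pow_pos hy 3).ne'
  refine h.congr fun y hy => ?_
  have : (0 : ℝ) < y := hy; field_simp

/-! ### The inverse of the linearized operator -/

/-- The solution `f` of `H f = S` that is regular at the origin and obtained by variation of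
constants from `ΛQ` and `Γ`. -/
def Tinv (S : ℝ → ℝ) (y : ℝ) : ℝ := Gam y * (∫ s in (0 : ℝ)..y, S s * Lam Q s * s ^ 3)
    - Lam Q y * ∫ s in (0 : ℝ)..y, S s * Gam s * s ^ 3

/-- The derivative of `Tinv S`. -/
def dTinv (S : ℝ → ℝ) (y : ℝ) : ℝ := dGam y * (∫ s in (0 : ℝ)..y, S s * Lam Q s * s ^ 3)
    - dLamQ y * ∫ s in (0 : ℝ)..y, S s * Gam s * s ^ 3

theorem continuous_mul_LamQ (hS : Continuous S) : Continuous fun s => S s * Lam Q s * s ^ 3 :=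
  (hS.mul continuous_LamQ).mul (by fun_prop)

theorem continuous_mul_Gam (hS : Continuous S) : Continuous fun s => S s * Gam s * s ^ 3 := by
  have := hS.mul continuous_cube_mul_Gam
  exact this.congr fun s => by simp only [Pi.mul_apply, mul_assoc]

theorem hasDerivAt_Tinv (hS : Continuous S) (hy : 0 < y) : HasDerivAt (Tinv S) (dTinv S y) y := by
  have h1 := (continuous_mul_LamQ hS).integral_hasStrictDerivAt 0 y
  have h2 := (continuous_mul_Gam hS).integral_hasStrictDerivAt 0 y
  have h := ((hasDerivAt_Gam hy).mul h1.hasDerivAt).sub ((hasDerivAt_LamQ y).mul h2.hasDerivAt)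
  unfold Tinv
  refine h.congr_deriv ?_
  unfold dTinv; ring

theorem hasDerivAt_cube_dTinv (hS : Continuous S) (hy : 0 < y) :
    HasDerivAt (fun y => y ^ 3 * dTinv S y) (-(y ^ 3 * (V y * Tinv S y + S y))) y := by
  have h1 := (continuous_mul_LamQ hS).integral_hasStrictDerivAt 0 y
  have h2 := (continuous_mul_Gam hS).integral_hasStrictDerivAt 0 y
  have h := ((hasDerivAt_cube_dGam hy).mul h1.hasDerivAt).sub
    ((hasDerivAt_cube_dLamQ y).mul h2.hasDerivAt)
  have e : (fun y => y ^ 3 * dTinv S y) = fun y =>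
      y ^ 3 * dGam y * (∫ s in (0 : ℝ)..y, S s * Lam Q s * s ^ 3)
      - y ^ 3 * dLamQ y * ∫ s in (0 : ℝ)..y, S s * Gam s * s ^ 3 := by
    funext y; unfold dTinv; ring
  rw [e]
  refine h.congr_deriv ?_
  have w := wronskian hy; rw [eq_div_iff (by positivity)] at w
  unfold Tinv
  linear_combination (S y * y ^ 3) * w

theorem continuousOn_dTinv (hS : Continuous S) : ContinuousOn (dTinv S) (Ioi 0) := by
  have h1 := (continuous_mul_LamQ hS)
  have h2 := (continuous_mul_Gam hS)
  refine (continuousOn_dGam.mul ?_).sub (continuous_dLamQ.continuousOn.mul ?_)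
  · exact (intervalIntegral.continuous_primitive (fun a b => h1.intervalIntegrable a b) 0).continuousOn
  · exact (intervalIntegral.continuous_primitive (fun a b => h2.intervalIntegrable a b) 0).continuousOn

theorem continuousOn_Tinv (hS : Continuous S) : ContinuousOn (Tinv S) (Ioi 0) := fun _ hy =>
  (hasDerivAt_Tinv hS hy).continuousAt.continuousWithinAt

/-- A function on the half-line whose derivative `f'` satisfies `(y³ f')' = y³ g` has Laplacian
`g`. -/
theorem lap_eq_of_hasDerivAt {f' : ℝ → ℝ} {g : ℝ} (hy : 0 < y)
    (h1 : ∀ z, 0 < z → HasDerivAt f (f' z) z)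
    (h2 : HasDerivAt (fun y => y ^ 3 * f' y) (y ^ 3 * g) y) : lap f y = g := by
  have hd : HasDerivAt f' (g - 3 / y * f' y) y := by
    have h3 := h2.mul ((hasDerivAt_pow 3 y).inv (by positivity))
    have h4 : (fun y => y ^ 3 * f' y) * (fun y : ℝ => y ^ 3)⁻¹ =ᶠ[𝓝 y] f' := by
      filter_upwards [lt_mem_nhds hy] with z hz
      simp only [Pi.mul_apply, Pi.inv_apply]; field_simp
    refine (h4.hasDerivAt_iff.1 h3).congr_deriv ?_
    simp only [Pi.inv_apply]; push_cast; field_simp; ring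
  have h4 : deriv f =ᶠ[𝓝 y] f' := by filter_upwards [lt_mem_nhds hy] with z hz using (h1 z hz).deriv
  unfold lap; rw [h4.deriv_eq, hd.deriv, h4.eq_of_nhds]; ring

theorem lap_Q (hy : 0 < y) : lap Q y = -Q y ^ 3 := by
  refine lap_eq_of_hasDerivAt hy (fun z _ => hasDerivAt_Q z) ?_
  have h := (hasDerivAt_pow 3 y).mul
    (((hasDerivAt_id y).div_const 4).neg.mul ((hasDerivAt_Q y).pow 2))
  refine h.congr_deriv ?_
  simp only [id, Pi.mul_apply, Pi.pow_apply, Pi.neg_apply]; push_cast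
  have e2 : y ^ 2 * Q y = 8 - 8 * Q y := by linarith [sq_mul_Q y]
  norm_num
  linear_combination (1 / 8 * y ^ 3 * Q y ^ 2) * e2

theorem Tinv_add {S' : ℝ → ℝ} (hS : Continuous S) (hS' : Continuous S') (a b y : ℝ) :
    Tinv (fun s => a * S s + b * S' s) y = a * Tinv S y + b * Tinv S' y := by
  unfold Tinv
  have h1 := (continuous_mul_LamQ hS).intervalIntegrable (μ := volume) 0 y
  have h2 := (continuous_mul_Gam hS).intervalIntegrable (μ := volume) 0 y
  have h1' := (continuous_mul_LamQ hS').intervalIntegrable (μ := volume) 0 y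
  have h2' := (continuous_mul_Gam hS').intervalIntegrable (μ := volume) 0 y
  have e1 : ∀ s, (a * S s + b * S' s) * Lam Q s * s ^ 3
      = a * (S s * Lam Q s * s ^ 3) + b * (S' s * Lam Q s * s ^ 3) := fun s => by ring
  have e2 : ∀ s, (a * S s + b * S' s) * Gam s * s ^ 3
      = a * (S s * Gam s * s ^ 3) + b * (S' s * Gam s * s ^ 3) := fun s => by ring
  simp_rw [e1, e2]
  rw [intervalIntegral.integral_add (h1.const_mul a) (h1'.const_mul b),
    intervalIntegral.integral_add (h2.const_mul a) (h2'.const_mul b)]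
  simp only [intervalIntegral.integral_const_mul]; ring

theorem abs_LamQ_le_one (y : ℝ) : |Lam Q y| ≤ 1 := (abs_LamQ_le y).trans (Q_le_one y)

/-- The operator `Tinv` gains two powers of `y` at the origin. -/
theorem abs_Tinv_le : ∃ k : ℝ, 0 < k ∧ ∀ (S : ℝ → ℝ) (A y : ℝ), 0 < y → 0 ≤ A →
    (∀ s, 0 < s → s ≤ y → |S s| ≤ A) →
    |Tinv S y| ≤ k * A * (y ^ 2 + y ^ 4) ∧ |y * dTinv S y| ≤ k * A * (y ^ 2 + y ^ 4) := by
  obtain ⟨k, hk, h⟩ := abs_Gam_le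
  refine ⟨7 * k, by linarith, fun S A y hy hA hS => ?_⟩
  have i1 : |∫ s in (0 : ℝ)..y, S s * Lam Q s * s ^ 3| ≤ (A * y ^ 3) * y := by
    refine abs_primitive_le hy.le fun s hs hsy => ?_
    rw [abs_mul, abs_mul, abs_of_pos (pow_pos hs 3)]
    have h1 := hS s hs hsy
    have h2 := abs_LamQ_le_one s
    calc |S s| * |Lam Q s| * s ^ 3 ≤ A * 1 * y ^ 3 := by gcongr
      _ = A * y ^ 3 := by ring
  have i2 : |∫ s in (0 : ℝ)..y, S s * Gam s * s ^ 3| ≤ (A * (k * (y ^ 3 + y))) * y := by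
    refine abs_primitive_le hy.le fun s hs hsy => ?_
    have h1 := hS s hs hsy
    have h2 : |Gam s * s ^ 3| ≤ k * (y ^ 3 + y) := by
      rw [abs_mul, abs_of_pos (pow_pos hs 3)]
      calc |Gam s| * s ^ 3 ≤ (k * (1 + 1 / s ^ 2)) * s ^ 3 := by gcongr; exact (h s hs).1
        _ = k * (s ^ 3 + s) := by field_simp
        _ ≤ k * (y ^ 3 + y) := by gcongr
    rw [mul_assoc, abs_mul]
    gcongr
  have hG := (h y hy).1
  have hG' := (h y hy).2
  have hL := abs_LamQ_le_one y
  have hL' : |y * dLamQ y| ≤ 6 := (abs_mul_dLamQ_le y).trans (by linarith [Q_le_one y])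
  have e : k * (1 + 1 / y ^ 2) * (A * y ^ 3 * y) = k * A * (y ^ 2 + y ^ 4) := by field_simp; ring
  have hp : 0 ≤ k * A * (y ^ 2 + y ^ 4) := by positivity
  constructor
  · unfold Tinv
    refine (abs_sub _ _).trans ?_
    rw [abs_mul, abs_mul]
    calc _ ≤ k * (1 + 1 / y ^ 2) * (A * y ^ 3 * y) + 1 * ((A * (k * (y ^ 3 + y))) * y) := by gcongr
      _ ≤ _ := by rw [e]; linarith
  · unfold dTinv; rw [mul_sub, ← mul_assoc, ← mul_assoc]
    refine (abs_sub _ _).trans ?_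
    rw [abs_mul, abs_mul (y * dLamQ y)]
    calc _ ≤ k * (1 + 1 / y ^ 2) * (A * y ^ 3 * y) + 6 * ((A * (k * (y ^ 3 + y))) * y) := by gcongr
      _ ≤ _ := by rw [e]; linarith

/-! ### The quadratic form of the linearized operator -/

/-- The space of radial functions with square integrable gradient on which the quadratic form of
`H` is considered. -/
structure FormDomain (f : ℝ → ℝ) : Prop where
  ac : LocallyAC f
  grad : MemLp (deriv f) 2 ϱ
  wt : MemLp (fun y => f y / (1 + y)) 2 ϱ

/-- The bilinear form `∫ f' g' - ∫ V f g` of `H`. -/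
def form (f g : ℝ → ℝ) : ℝ := ∫ y, (deriv f y * deriv g y - V y * (f y * g y)) ∂ϱ

theorem continuous_V : Continuous V := by
  have := continuous_Q
  unfold V; fun_prop

theorem V_nonneg (y : ℝ) : 0 ≤ V y := by unfold V; positivity

theorem V_mul_le (hy : 0 < y) : V y * (1 + y) ^ 2 ≤ 384 := by
  have h := Q_le y
  have h1 := Q_le_one y
  have h0 := Q_pos y; rw [le_div_iff₀ (by positivity)] at h
  unfold V
  have : Q y * (1 + y) ^ 2 ≤ 16 := by nlinarith [mul_nonneg h0.le (sq_nonneg (y - 1))]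
  nlinarith [mul_nonneg h0.le (sq_nonneg (1 + y))]

namespace FormDomain

theorem integrable_V (hf : FormDomain f) (hg : FormDomain g) :
    Integrable (fun y => V y * (f y * g y)) ϱ := by
  have h := hf.wt.integrable_mul hg.wt
  have h2 : Integrable (fun y => (V y * (1 + y) ^ 2) * (f y / (1 + y) * (g y / (1 + y)))) ϱ := by
    refine h.bdd_mul (c := 384) ?_ ?_
    · exact (by have := continuous_V; fun_prop :
        Continuous fun y => V y * (1 + y) ^ 2).aestronglyMeasurable
    · refine ae_radial_of_forall fun y hy => ?_
      rw [Real.norm_eq_abs, abs_of_nonneg (mul_nonneg (V_nonneg y) (sq_nonneg _))]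
      exact V_mul_le hy
  refine h2.congr (ae_radial_of_forall fun y hy => ?_)
  have : 1 + y ≠ 0 := by positivity
  field_simp

theorem integrable_form (hf : FormDomain f) (hg : FormDomain g) :
    Integrable (fun y => deriv f y * deriv g y - V y * (f y * g y)) ϱ :=
  (hf.grad.integrable_mul hg.grad).sub (hf.integrable_V hg)

theorem ae_deriv_comb (hf : FormDomain f) (hg : FormDomain g) (a b : ℝ) :
    ∀ᵐ y ∂ϱ, deriv (fun y => a * f y + b * g y) y = a * deriv f y + b * deriv g y := by
  refine ae_radial_of_ae ?_
  filter_upwards [hf.ac.ae_differentiableAt, hg.ac.ae_differentiableAt] with y h1 h2 hy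
  exact (((h1 hy).hasDerivAt.const_mul a).add ((h2 hy).hasDerivAt.const_mul b)).deriv

theorem comb (hf : FormDomain f) (hg : FormDomain g) (a b : ℝ) :
    FormDomain fun y => a * f y + b * g y where
  ac := (hf.ac.const_mul a).add (hg.ac.const_mul b)
  grad := by
    have h : MemLp (fun y => a * deriv f y + b * deriv g y) 2 ϱ :=
      (hf.grad.const_mul a).add (hg.grad.const_mul b)
    exact h.ae_eq ((hf.ae_deriv_comb hg a b).mono fun y hy => hy.symm)
  wt := by
    have h : MemLp (fun y => a * (f y / (1 + y)) + b * (g y / (1 + y))) 2 ϱ :=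
      (hf.wt.const_mul a).add (hg.wt.const_mul b)
    exact h.ae_eq (Eventually.of_forall fun y => by ring)

theorem form_comb (hf : FormDomain f) (hg : FormDomain g) (a b : ℝ) :
    form (fun y => a * f y + b * g y) (fun y => a * f y + b * g y)
      = a ^ 2 * form f f + 2 * a * b * form f g + b ^ 2 * form g g := by
  unfold form
  have h1 := (hf.integrable_form hf).const_mul (a ^ 2)
  have h2 := (hf.integrable_form hg).const_mul (2 * a * b)
  have h3 := (hg.integrable_form hg).const_mul (b ^ 2)
  have h12 : Integrable (fun y => a ^ 2 * (deriv f y * deriv f y - V y * (f y * f y))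
      + 2 * a * b * (deriv f y * deriv g y - V y * (f y * g y))) ϱ := h1.add h2
  rw [← integral_const_mul, ← integral_const_mul, ← integral_const_mul, ← integral_add h1 h2,
    ← integral_add h12 h3]
  refine integral_congr_ae ((hf.ae_deriv_comb hg a b).mono fun y hy => ?_)
  simp only [hy]; ring

end FormDomain

/-! ### Boundary terms -/

theorem not_integrableOn_inv_zero {δ : ℝ} (hδ : 0 < δ) (hc : 0 < c) :
    ¬ IntegrableOn (fun y : ℝ => c * y⁻¹) (Ioc 0 δ) := by
  intro h
  have h1 : IntegrableOn (fun y : ℝ => y⁻¹) (Ioc 0 δ) := by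
    refine (Integrable.const_mul h c⁻¹).congr (Eventually.of_forall fun y => ?_)
    simp only; field_simp
  have h2 := (intervalIntegrable_iff_integrableOn_Ioc_of_le hδ.le).2 h1
  rw [intervalIntegrable_inv_iff] at h2
  rcases h2 with h2 | h2
  · exact hδ.ne h2
  · exact h2 (by simp)

/-- An integrable radial function is small, relative to `y⁻⁴`, at points arbitrarily close to the
origin. -/
theorem exists_small_near_zero {h : ℝ → ℝ} (hi : Integrable h ϱ) {ε δ : ℝ}
    (hε : 0 < ε) (hδ : 0 < δ) : ∃ y, 0 < y ∧ y < δ ∧ y ^ 4 * h y < ε := by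
  by_contra! H
  rw [integrable_radial_iff] at hi
  have h1 : IntegrableOn (fun r => r ^ 3 * h r) (Ioc 0 (δ / 2)) := hi.mono_set Ioc_subset_Ioi_self
  refine not_integrableOn_inv_zero (half_pos hδ) hε (Integrable.mono' h1 ?_ ?_)
  · exact (by fun_prop : Measurable fun y : ℝ => ε * y⁻¹).aestronglyMeasurable
  · filter_upwards [ae_restrict_mem measurableSet_Ioc] with y hy
    have hy0 : 0 < y := hy.1
    have := H y hy.1 (by linarith [hy.2])
    rw [Real.norm_eq_abs, abs_of_pos (by positivity), ← div_eq_mul_inv, div_le_iff₀ hy0]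
    linarith

/-- An integrable radial function is small, relative to `y⁻⁴`, at arbitrarily large points. -/
theorem exists_small_near_top {h : ℝ → ℝ} (hi : Integrable h ϱ) {ε : ℝ}
    (hε : 0 < ε) (R : ℝ) : ∃ y, R < y ∧ y ^ 4 * h y < ε := by
  by_contra! H
  rw [integrable_radial_iff] at hi
  set R' := max R 1 with hR'
  have hR1 : 1 ≤ R' := le_max_right _ _
  have h1 : IntegrableOn (fun r => r ^ 3 * h r) (Ioi R') :=
    hi.mono_set (Ioi_subset_Ioi (by linarith))
  have h3 : IntegrableOn (fun y : ℝ => ε * y⁻¹) (Ioi R') := by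
    refine Integrable.mono' h1
      (by fun_prop : Measurable fun y : ℝ => ε * y⁻¹).aestronglyMeasurable ?_
    filter_upwards [ae_restrict_mem measurableSet_Ioi] with y hy
    have hy1 : R' < y := hy
    have hy0 : 0 < y := by linarith
    have := H y (lt_of_le_of_lt (le_max_left _ _) hy1)
    rw [Real.norm_eq_abs, abs_of_pos (by positivity), ← div_eq_mul_inv, div_le_iff₀ hy0]
    linarith
  have h4 : IntegrableOn (fun y : ℝ => y⁻¹) (Ioi R') := by
    refine (Integrable.const_mul h3 ε⁻¹).congr (Eventually.of_forall fun y => ?_)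
    simp only; field_simp
  exact not_integrableOn_Ioi_inv h4

theorem exists_tail (hF : IntegrableOn F (Ioi 0)) {ε : ℝ} (hε : 0 < ε) :
    ∃ a₀, 0 < a₀ ∧ ∃ d₀, ∀ a d, 0 < a → a < a₀ → d₀ < d →
      |(∫ y in a..d, F y) - ∫ y in Ioi 0, F y| < ε := by
  set G := (Ioi (0 : ℝ)).indicator F with hG
  have hGi : Integrable G := hF.integrable_indicator measurableSet_Ioi
  have hii : ∀ a b, IntervalIntegrable G volume a b := fun a b => hGi.intervalIntegrable
  have hc := intervalIntegral.continuous_primitive hii 0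
  have h0 := hc.tendsto 0; simp only [intervalIntegral.integral_same] at h0
  have h1 := intervalIntegral_tendsto_integral_Ioi 0 hGi.integrableOn tendsto_id
  obtain ⟨a₀, ha₀, h0⟩ := Metric.tendsto_nhds_nhds.1 h0 (ε / 2) (by positivity)
  obtain ⟨d₀, h1⟩ := eventually_atTop.1 (Metric.tendsto_nhds.1 h1 (ε / 2) (by positivity))
  refine ⟨a₀, ha₀, max d₀ a₀, fun a d ha haa hd => ?_⟩
  have e1 : ∫ y in a..d, F y = ∫ y in a..d, G y := by
    refine intervalIntegral.integral_congr fun y hy => ?_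
    rw [uIcc_of_le (by linarith [le_max_right d₀ a₀])] at hy
    rw [hG, indicator_of_mem (show y ∈ Ioi (0 : ℝ) from ha.trans_le hy.1)]
  have e2 : ∫ y in Ioi 0, F y = ∫ y in Ioi 0, G y :=
    setIntegral_congr_fun measurableSet_Ioi fun y hy => by rw [hG, indicator_of_mem hy]
  have h2 := h0 (x := a) (by rw [Real.dist_eq, sub_zero, abs_of_pos ha]; exact haa)
  have h3 := h1 d (by linarith [le_max_left d₀ a₀])
  rw [Real.dist_eq] at h2 h3; simp only [id, sub_zero] at h2 h3
  rw [e1, e2, ← intervalIntegral.integral_interval_sub_left (hii 0 d) (hii 0 a)]; rw [abs_lt] at *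
  constructor <;> linarith

/-- A lower bound for an improper integral follows from one along suitable end points. -/
theorem integral_nonneg_of_exists (hF : IntegrableOn F (Ioi 0))
    (h : ∀ ε > 0, ∀ a₀ > 0, ∀ d₀, ∃ a d, 0 < a ∧ a < a₀ ∧ d₀ < d ∧ -ε ≤ ∫ y in a..d, F y) :
    0 ≤ ∫ y in Ioi 0, F y := by
  by_contra! H
  set ε := -(∫ y in Ioi 0, F y) / 2 with hε
  have hε0 : 0 < ε := by rw [hε]; linarith
  obtain ⟨a₀, ha₀, d₀, h1⟩ := exists_tail hF hε0
  obtain ⟨a, d, ha, haa, hd, h2⟩ := h ε hε0 a₀ ha₀ d₀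
  have := (abs_lt.1 (h1 a d ha haa hd)).2; linarith

theorem integral_eq_zero_of_exists (hF : IntegrableOn F (Ioi 0))
    (h : ∀ ε > 0, ∀ a₀ > 0, ∀ d₀, ∃ a d, 0 < a ∧ a < a₀ ∧ d₀ < d ∧ |∫ y in a..d, F y| ≤ ε) :
    ∫ y in Ioi 0, F y = 0 := by
  refine le_antisymm ?_ (integral_nonneg_of_exists hF fun ε hε a₀ ha₀ d₀ => ?_)
  · have := integral_nonneg_of_exists hF.neg fun ε hε a₀ ha₀ d₀ => by
      obtain ⟨a, d, h1, h2, h3, h4⟩ := h ε hε a₀ ha₀ d₀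
      refine ⟨a, d, h1, h2, h3, ?_⟩
      simp only [Pi.neg_apply]; rw [intervalIntegral.integral_neg]; linarith [(abs_le.1 h4).2]
    simp only [Pi.neg_apply] at this; rw [integral_neg] at this; linarith
  · obtain ⟨a, d, h1, h2, h3, h4⟩ := h ε hε a₀ ha₀ d₀; exact ⟨a, d, h1, h2, h3, (abs_le.1 h4).1⟩

theorem FormDomain.exists_zero (hf : FormDomain f) {ε δ : ℝ} (hε : 0 < ε)
    (hδ : 0 < δ) : ∃ y, 0 < y ∧ y < δ ∧ y ^ 4 * f y ^ 2 < ε := by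
  obtain ⟨y, h0, h1, h2⟩ := exists_small_near_zero hf.wt.integrable_sq
    (ε := ε / 4) (δ := min δ 1) (by positivity) (by positivity)
  refine ⟨y, h0, h1.trans_le (min_le_left _ _), ?_⟩
  have h3 : y < 1 := h1.trans_le (min_le_right _ _)
  rw [div_pow, ← mul_div_assoc, div_lt_iff₀ (by positivity)] at h2
  have h4 : (1 + y) ^ 2 ≤ 4 := by nlinarith
  nlinarith

theorem FormDomain.exists_top (hf : FormDomain f) {ε : ℝ} (hε : 0 < ε)
    (R : ℝ) : ∃ y, R < y ∧ 1 < y ∧ y ^ 2 * f y ^ 2 < ε := by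
  obtain ⟨y, h1, h2⟩ := exists_small_near_top hf.wt.integrable_sq
    (ε := ε / 4) (by positivity) (max R 1)
  have h3 : 1 < y := (le_max_right R 1).trans_lt h1
  refine ⟨y, (le_max_left R 1).trans_lt h1, h3, ?_⟩
  have h4 : 0 < y := by linarith
  rw [div_pow, ← mul_div_assoc, div_lt_iff₀ (by positivity)] at h2
  have h5 : (1 + y) ^ 2 ≤ 4 * y ^ 2 := by nlinarith
  have h6 : y ^ 4 * f y ^ 2 < ε * y ^ 2 := by nlinarith
  have h7 : y ^ 2 * (y ^ 2 * f y ^ 2) < y ^ 2 * ε := by linarith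
  exact lt_of_mul_lt_mul_left h7 (by positivity)

/-- Integration by parts: if `H g = S` then the form of `H` against `g` is the pairing with `S`. -/
theorem form_eq_ip {g' : ℝ → ℝ} (hf : FormDomain f) (hg : FormDomain g)
    (h1 : ∀ y, 0 < y → HasDerivAt g (g' y) y)
    (h2 : ∀ y, 0 < y → HasDerivAt (fun y => y ^ 3 * g' y) (-(y ^ 3 * (V y * g y + S y))) y)
    (hS : ContinuousOn S (Ioi 0)) (hC : 0 < C)
    (hb : ∀ y, 0 < y → |g' y| ≤ C / (1 + y) ^ 3)
    (hi : Integrable (fun y => f y * S y) ϱ) : form f g = ip f S := by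
  have hgc : ContinuousOn g (Ioi 0) := fun y hy => (h1 y hy).continuousAt.continuousWithinAt
  have hF := integrable_radial_iff.1 ((hf.integrable_form hg).sub hi)
  have hac : LocallyAC fun y => y ^ 3 * g' y := by
    refine locallyAC_of_hasDerivAt h2 ?_
    have := continuous_V; fun_prop
  have key : ∫ y in Ioi 0, y ^ 3 * (deriv f y * deriv g y - V y * (f y * g y) - f y * S y) = 0 := by
    refine integral_eq_zero_of_exists hF fun ε hε a₀ ha₀ d₀ => ?_
    set ε' := min 1 ((ε / (2 * C)) ^ 2) with hε'
    have hε'0 : 0 < ε' := by positivity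
    obtain ⟨a, ha, haa, ha2⟩ := hf.exists_zero hε'0 (lt_min ha₀ one_pos)
    obtain ⟨d, hd, hd1, hd2⟩ := hf.exists_top hε'0 d₀
    have ha1 : a < 1 := haa.trans_le (min_le_right _ _)
    refine ⟨a, d, ha, haa.trans_le (min_le_left _ _), hd, ?_⟩
    have hd0 : 0 < d := by linarith
    have e : ∫ y in a..d, y ^ 3 * (deriv f y * deriv g y - V y * (f y * g y) - f y * S y)
        = d ^ 3 * g' d * f d - a ^ 3 * g' a * f a := by
      have hm := (hac.mul hf.ac).integral_deriv ha hd0; rw [← hm]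
      refine intervalIntegral.integral_congr_ae ?_
      filter_upwards [hf.ac.ae_differentiableAt] with y hy hyI
      have hy0 : 0 < y := by rw [uIoc_of_le (by linarith)] at hyI; exact ha.trans hyI.1
      have hd := ((h2 y hy0).mul (hy hy0).hasDerivAt).deriv; rw [(h1 y hy0).deriv]
      change _ = deriv ((fun y => y ^ 3 * g' y) * f) y
      rw [hd]; ring
    have hs : √ε' ≤ ε / (2 * C) := by
      rw [Real.sqrt_le_left (by positivity)]
      exact min_le_right _ _
    have hfa : a ^ 2 * |f a| ≤ √ε' := by
      apply Real.le_sqrt_of_sq_le; rw [mul_pow, sq_abs]; nlinarith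
    have hfd : d * |f d| ≤ √ε' := by
      apply Real.le_sqrt_of_sq_le; rw [mul_pow, sq_abs]; exact hd2.le
    have hba : |a ^ 3 * g' a * f a| ≤ C * √ε' := by
      have h3 := hb a ha
      have h4 : C / (1 + a) ^ 3 ≤ C := div_le_self hC.le (by nlinarith [pow_pos ha 3, pow_pos ha 2])
      rw [abs_mul, abs_mul, abs_of_pos (pow_pos ha 3)]
      calc a ^ 3 * |g' a| * |f a| = |g' a| * (a * (a ^ 2 * |f a|)) := by ring
        _ ≤ C * (1 * √ε') := by gcongr; exact h3.trans h4
        _ = C * √ε' := by ring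
    have hbd : |d ^ 3 * g' d * f d| ≤ C * √ε' := by
      have h3 := hb d hd0
      have h4 : C / (1 + d) ^ 3 ≤ C / d ^ 3 := by gcongr; linarith
      rw [abs_mul, abs_mul, abs_of_pos (pow_pos hd0 3)]
      calc d ^ 3 * |g' d| * |f d| ≤ d ^ 3 * (C / d ^ 3) * (d * |f d|) := by
            gcongr
            · exact h3.trans h4
            · nlinarith [abs_nonneg (f d)]
        _ ≤ d ^ 3 * (C / d ^ 3) * √ε' := by gcongr
        _ = C * √ε' := by field_simp
    rw [e]
    refine (abs_sub _ _).trans ?_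
    have : C * √ε' ≤ ε / 2 := by
      calc C * √ε' ≤ C * (ε / (2 * C)) := by gcongr
        _ = ε / 2 := by field_simp
    linarith
  have h3 := integral_radial fun y => deriv f y * deriv g y - V y * (f y * g y) - f y * S y
  rw [key, integral_sub (hf.integrable_form hg) hi] at h3
  unfold form ip; linarith

/-! ### Nonnegativity of the form on functions vanishing at the zero of `ΛQ` -/

theorem sqrt_eight_pos : 0 < √8 := by positivity

theorem sqrt_eight_sq : √8 ^ 2 = 8 := Real.sq_sqrt (by norm_num)

/-- The function `y³ (ΛQ)' / ΛQ` of the Riccati substitution. -/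
def riccati (y : ℝ) : ℝ := y ^ 3 * dLamQ y / Lam Q y

theorem LamQ_ne_zero (hy : 0 < y) (h8 : y ≠ √8) : Lam Q y ≠ 0 := by
  rw [Lam_Q]
  intro h
  have h1 : Q y = 1 / 2 := by
    have := Q_pos y
    have h2 : Q y * (2 * Q y - 1) = 0 := by linarith
    rcases mul_eq_zero.1 h2 with h3 | h3 <;> linarith
  have h2 := sq_mul_Q y; rw [h1] at h2
  apply h8; rw [show (8 : ℝ) = y ^ 2 by linarith, Real.sqrt_sq hy.le]

theorem hasDerivAt_riccati (hy : 0 < y) (h8 : y ≠ √8) :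
    HasDerivAt riccati (-(y ^ 3 * V y) - riccati y ^ 2 / y ^ 3) y := by
  have hL := LamQ_ne_zero hy h8
  have h := (hasDerivAt_cube_dLamQ y).div (hasDerivAt_LamQ y) hL
  unfold riccati
  refine h.congr_deriv ?_
  field_simp

/-- The explicit form of `riccati`, which displays its singularity at `√8`. -/
theorem riccati_mul (hy : 0 < y) (h8 : y ≠ √8) :
    riccati y * (y - √8) = (y ^ 2 * 16 * (1 - Q y) * (4 * Q y - 1)) / (Q y * (y + √8)) := by
  have hL := LamQ_ne_zero hy h8
  have hQ := Q_pos y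
  have h8p := sqrt_eight_pos
  unfold riccati; rw [div_mul_eq_mul_div, div_eq_div_iff hL (by positivity)]
  have e1 : y ^ 3 * dLamQ y = y ^ 2 * ((2 * Q y ^ 2 - 2 * Q y) * (4 * Q y - 1)) := by
    rw [← mul_dLamQ]; ring
  have e2 : (y - √8) * (y + √8) = y ^ 2 - 8 := by ring_nf; rw [sqrt_eight_sq]; ring
  have e3 : y ^ 2 * Q y = 8 * (1 - Q y) := sq_mul_Q y; rw [Lam_Q, e1]
  have e4 : (y - √8) * (Q y * (y + √8)) = 8 - 16 * Q y := by
    calc (y - √8) * (Q y * (y + √8)) = Q y * ((y - √8) * (y + √8)) := by ring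
      _ = _ := by rw [e2]; linarith
  rw [mul_assoc, e4]; ring

theorem riccati_bound : ∃ k : ℝ, 0 < k ∧ (∀ y, 0 < y → y < 1 → |riccati y| ≤ k * y ^ 4) ∧
    (∀ y, 4 < y → |riccati y| ≤ k * y ^ 2) ∧
    ∀ y, 1 < y → y < 4 → y ≠ √8 → |riccati y| * |y - √8| ≤ k := by
  refine ⟨4000, by norm_num, fun y h0 h1 => ?_, fun y h4 => ?_, fun y h1 h4 h8 => ?_⟩
  · have hL : 1 / 2 ≤ Lam Q y := by
      rw [Lam_Q]
      have h2 : 8 / 9 ≤ Q y := by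
        unfold Q; rw [div_le_div_iff₀ (by norm_num) (by positivity)]; nlinarith
      nlinarith
    unfold riccati; rw [abs_div, abs_of_pos (by linarith : 0 < Lam Q y), div_le_iff₀ (by linarith)]
    have e : y ^ 3 * dLamQ y = y ^ 4 * (-(1 / 4) * Q y ^ 2 * (4 * Q y - 1)) := by unfold dLamQ; ring
    rw [e, abs_mul, abs_of_pos (by positivity : 0 < y ^ 4)]
    have : |(-(1 / 4) * Q y ^ 2 * (4 * Q y - 1))| ≤ 1 := by
      have h1 := Q_le_one y
      have h2 := Q_pos y
      have h3 : 0 ≤ Q y ^ 2 * (1 - Q y) := by apply mul_nonneg <;> nlinarith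
      have h4 : 0 ≤ Q y ^ 3 := by positivity
      rw [abs_le]; constructor <;> nlinarith
    have : y ^ 4 * |(-(1 / 4) * Q y ^ 2 * (4 * Q y - 1))| ≤ y ^ 4 * 1 := by gcongr
    nlinarith [pow_pos h0 4]
  · have hy : 0 < y := by linarith
    have hQ : Q y ≤ 1 / 3 := by
      unfold Q; rw [div_le_div_iff₀ (by positivity) (by norm_num)]; nlinarith
    have hQ0 := Q_pos y
    have hL : Q y / 3 ≤ |Lam Q y| := by rw [Lam_Q, abs_of_neg (by nlinarith)]; nlinarith
    have hL0 : 0 < |Lam Q y| := by linarith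
    unfold riccati
    rw [abs_div, div_le_iff₀ hL0, show y ^ 3 * dLamQ y = y ^ 2 * (y * dLamQ y) by ring, abs_mul,
      abs_of_pos (pow_pos hy 2)]
    have := abs_mul_dLamQ_le y
    have h2 : 0 < y ^ 2 := by positivity
    nlinarith
  · have hy : 0 < y := by linarith
    rw [← abs_mul, riccati_mul hy h8]
    have hQ0 := Q_pos y
    have hQ1 := Q_le_one y
    have h8p := sqrt_eight_pos
    have hQ : 1 / 3 ≤ Q y := by
      unfold Q; rw [div_le_div_iff₀ (by norm_num) (by positivity)]; nlinarith
    rw [abs_div, abs_of_pos (by positivity : 0 < Q y * (y + √8)), div_le_iff₀ (by positivity),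
      abs_mul, abs_mul, abs_of_pos (by positivity : 0 < y ^ 2 * 16),
      abs_of_nonneg (by linarith : 0 ≤ 1 - Q y)]
    have h3 : |4 * Q y - 1| ≤ 3 := by rw [abs_le]; constructor <;> linarith
    have h5 : 1 / 3 ≤ Q y * (y + √8) := by nlinarith
    calc y ^ 2 * 16 * (1 - Q y) * |4 * Q y - 1| ≤ 4 ^ 2 * 16 * 1 * 3 := by gcongr; linarith
      _ ≤ 4000 * (1 / 3) := by norm_num
      _ ≤ _ := by gcongr

theorem FormDomain.integrableOn_density (hf : FormDomain f) :
    IntegrableOn (fun y => y ^ 3 * (deriv f y * deriv f y - V y * (f y * f y))) (Ioi 0) :=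
  integrable_radial_iff.1 (hf.integrable_form hf)

theorem FormDomain.integrableOn_grad (hf : FormDomain f) :
    IntegrableOn (fun y => y ^ 3 * deriv f y ^ 2) (Ioi 0) :=
  integrable_radial_iff.1 hf.grad.integrable_sq

theorem intervalIntegrable_of_Ioi (h : IntegrableOn F (Ioi 0))
    (ha : 0 ≤ a) (hb : 0 ≤ b) : IntervalIntegrable F volume a b := by
  rw [intervalIntegrable_iff]
  refine h.mono_set fun y hy => ?_
  rw [uIoc, mem_Ioc] at hy; exact lt_of_le_of_lt (le_min ha hb) hy.1

/-- The lower bound for the form on an interval that avoids the zero of `ΛQ`. -/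
theorem FormDomain.riccati_le (hf : FormDomain f) (ha : 0 < a) (hac : a ≤ c)
    (h8 : ∀ y ∈ Icc a c, y ≠ √8) :
    riccati c * f c ^ 2 - riccati a * f a ^ 2
      ≤ ∫ y in a..c, y ^ 3 * (deriv f y * deriv f y - V y * (f y * f y)) := by
  have hc : 0 < c := ha.trans_le hac
  have hIcc : uIcc a c = Icc a c := uIcc_of_le hac
  have hpos : ∀ y ∈ Icc a c, 0 < y := fun y hy => ha.trans_le hy.1
  have hr : AbsolutelyContinuousOnInterval riccati a c := by
    refine ContDiffOn.absolutelyContinuousOnInterval ?_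
    rw [hIcc]
    unfold riccati
    refine ContDiffOn.div ?_ contDiff_LamQ.contDiffOn fun y hy => LamQ_ne_zero (hpos y hy) (h8 y hy)
    unfold dLamQ
    have : ContDiff ℝ 1 Q := contDiff_Q; fun_prop
  have hfac := hf.ac.ac ha hc
  have hm := (hr.mul (hfac.mul hfac))
  have h1 := hm.integral_deriv_eq_sub
  have e : riccati c * f c ^ 2 - riccati a * f a ^ 2
      = (riccati * (f * f)) c - (riccati * (f * f)) a := by
    simp only [Pi.mul_apply]; ring
  rw [e, ← h1]
  refine intervalIntegral.integral_mono_ae_restrict hac hm.intervalIntegrable_deriv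
    (intervalIntegrable_of_Ioi hf.integrableOn_density ha.le hc.le) ?_
  filter_upwards [ae_restrict_of_ae hf.ac.ae_differentiableAt,
    ae_restrict_mem measurableSet_Icc] with y hd hy
  have hy0 := hpos y hy
  have hd := (hd hy0).hasDerivAt; rw [((hasDerivAt_riccati hy0 (h8 y hy)).mul (hd.mul hd)).deriv]
  have hsq : 0 ≤ (y ^ 3 * deriv f y - riccati y * f y) ^ 2 / y ^ 3 := by positivity
  have e2 : (y ^ 3 * deriv f y - riccati y * f y) ^ 2 / y ^ 3
      = y ^ 3 * deriv f y ^ 2 - 2 * riccati y * deriv f y * f y + riccati y ^ 2 / y ^ 3 * f y ^ 2 := by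
    field_simp; ring
  rw [e2] at hsq; simp only [Pi.mul_apply]; nlinarith

/-- A function of the form domain that vanishes at `√8` is of size
`|y - √8|^{1/2} (∫ y³ f'²)^{1/2}` near that point. -/
theorem FormDomain.sq_le_of_vanish (hf : FormDomain f) (h0 : f √8 = 0) (hy : 1 < y) :
    f y ^ 2 ≤ |y - √8| * |∫ s in √8..y, s ^ 3 * deriv f s ^ 2| := by
  have h8p := sqrt_eight_pos
  have h81 : 1 < √8 := by rw [Real.lt_sqrt] <;> norm_num
  have e := hf.ac.integral_deriv h8p (by linarith : 0 < y)
  rw [h0, sub_zero] at e; rw [← e]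
  have hle : ∀ s ∈ uIoc √8 y, 1 < s := by
    intro s hs; rw [uIoc, mem_Ioc] at hs; exact lt_of_le_of_lt (le_min h81.le hy.le) hs.1
  have hi1 : IntervalIntegrable (fun s => s ^ 3 * deriv f s ^ 2) volume √8 y :=
    intervalIntegrable_of_Ioi hf.integrableOn_grad h8p.le (by linarith)
  have hi2 : IntervalIntegrable (deriv f) volume √8 y :=
    (hf.ac.ac h8p (by linarith : 0 < y)).intervalIntegrable_deriv
  have hi3 : IntervalIntegrable (fun s => deriv f s ^ 2) volume √8 y := by
    refine hi1.mono_fun ?_ ?_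
    · exact (intervalIntegrable_iff.1 hi2).aestronglyMeasurable.pow 2
    · filter_upwards [ae_restrict_mem measurableSet_uIoc] with s hs
      have h1 := hle s hs
      rw [Real.norm_eq_abs, Real.norm_eq_abs, abs_of_nonneg (sq_nonneg _),
        abs_of_nonneg (by positivity)]
      have : 1 ≤ s ^ 3 := one_le_pow₀ h1.le; nlinarith [sq_nonneg (deriv f s)]
  rw [intervalIntegral.abs_integral_eq_abs_integral_uIoc]
  have hsq : (∫ s in √8..y, deriv f s) ^ 2 = (∫ s in uIoc √8 y, deriv f s) ^ 2 := by
    rw [← sq_abs, intervalIntegral.abs_integral_eq_abs_integral_uIoc, sq_abs]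
  rw [hsq]
  have hcs := sq_integral_mul_le (μ := volume.restrict (uIoc √8 y)) (f := fun _ => (1 : ℝ))
    (g := deriv f) (by
      simp only [one_pow]
      exact intervalIntegrable_iff.1 (intervalIntegrable_const (μ := volume) (a := √8) (b := y)))
    (intervalIntegrable_iff.1 hi3) (by simp only [one_mul]; exact intervalIntegrable_iff.1 hi2)
  simp only [one_mul, one_pow] at hcs
  refine hcs.trans ?_
  have hv : ∫ _s in uIoc √8 y, (1 : ℝ) = |y - √8| := by
    rw [setIntegral_const, uIoc, Real.volume_real_Ioc, max_sub_min_eq_abs]; simp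
  rw [hv]
  gcongr; rw [abs_of_nonneg]
  · refine setIntegral_mono_on (intervalIntegrable_iff.1 hi3) (intervalIntegrable_iff.1 hi1)
      measurableSet_uIoc fun s hs => ?_
    have h1 := hle s hs
    have : 1 ≤ s ^ 3 := one_le_pow₀ h1.le; nlinarith [sq_nonneg (deriv f s)]
  · refine setIntegral_nonneg measurableSet_uIoc fun s hs => ?_
    have h1 := hle s hs; positivity

/-- The form of `H` is nonnegative on functions that vanish at the zero of `ΛQ`: the function `ΛQ`
is a positive multiple of a solution of `H g = 0` on each of the two nodal intervals. -/
theorem FormDomain.form_nonneg_of_vanish (hf : FormDomain f) (h0 : f √8 = 0) : 0 ≤ form f f := by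
  unfold form; rw [integral_radial]
  obtain ⟨k, hk, hr0, hr1, hr2⟩ := riccati_bound
  have h8p := sqrt_eight_pos
  have h81 : 1 < √8 := by rw [Real.lt_sqrt] <;> norm_num
  have h84 : √8 < 4 := by rw [Real.sqrt_lt'] <;> norm_num
  refine integral_nonneg_of_exists hf.integrableOn_density fun ε hε a₀ ha₀ d₀ => ?_
  set F := fun y => y ^ 3 * (deriv f y * deriv f y - V y * (f y * f y)) with hF
  have hFi : ∀ {a b : ℝ}, 0 ≤ a → 0 ≤ b → IntervalIntegrable F volume a b :=
    fun ha hb => intervalIntegrable_of_Ioi hf.integrableOn_density ha hb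
  have hGi : ∀ {a b : ℝ}, 0 ≤ a → 0 ≤ b →
      IntervalIntegrable (fun y => y ^ 3 * deriv f y ^ 2) volume a b :=
    fun ha hb => intervalIntegrable_of_Ioi hf.integrableOn_grad ha hb
  set ε' := ε / (8 * (k + 1)) with hε'
  have hε'0 : 0 < ε' := by positivity
  have hε'1 : k * ε' ≤ ε / 8 := by
    rw [hε', ← mul_div_assoc, div_le_div_iff₀ (by positivity) (by norm_num)]; nlinarith
  have hε'2 : ε' ≤ ε / 8 := by rw [hε', div_le_div_iff₀ (by positivity) (by norm_num)]; nlinarith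
  -- the primitives of the density and of the gradient are continuous at `√8`
  have hcont : ∀ {G : ℝ → ℝ}, IntegrableOn G (Ioi 0) →
      Tendsto (fun y => ∫ s in √8..y, G s) (𝓝 √8) (𝓝 0) := by
    intro G hG
    have hc := intervalIntegral.continuousOn_primitive_interval' (a := √8) (b₁ := 1) (b₂ := 4)
      (μ := volume) (intervalIntegrable_of_Ioi hG (by norm_num) (by norm_num))
      (by rw [uIcc_of_le (by norm_num)]; exact ⟨h81.le, h84.le⟩)
    rw [uIcc_of_le (by norm_num)] at hc
    have := (hc.continuousAt (Icc_mem_nhds h81 h84)).tendsto; simpa using this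
  obtain ⟨δ₁, hδ₁, h1⟩ := Metric.tendsto_nhds_nhds.1 (hcont hf.integrableOn_density) ε' hε'0
  obtain ⟨δ₂, hδ₂, h2⟩ := Metric.tendsto_nhds_nhds.1 (hcont hf.integrableOn_grad) ε' hε'0
  set δ := min (min δ₁ δ₂) (1 / 10) with hδ
  have hδ0 : 0 < δ := by positivity
  have hδ1 : δ ≤ δ₁ := (min_le_left _ _).trans (min_le_left _ _)
  have hδ2 : δ ≤ δ₂ := (min_le_left _ _).trans (min_le_right _ _)
  have hδ3 : δ ≤ 1 / 10 := min_le_right _ _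
  have h827 : 2 < √8 := by rw [Real.lt_sqrt] <;> norm_num
  have h829 : √8 < 3 := by rw [Real.sqrt_lt'] <;> norm_num
  have near : ∀ y, |y - √8| = δ / 2 → |riccati y * f y ^ 2| ≤ ε / 8 ∧ |∫ s in √8..y, F s| ≤ ε / 8 := by
    intro y hy
    have hy8 : y ≠ √8 := by rintro rfl; simp at hy; linarith
    have hy' := abs_le.1 hy.le
    have hy1 : 1 < y := by linarith
    have hy4 : y < 4 := by linarith
    constructor
    · have h3 := h2 (x := y) (by rw [Real.dist_eq]; linarith)
      rw [Real.dist_eq, sub_zero] at h3; rw [abs_mul, abs_of_nonneg (sq_nonneg (f y))]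
      calc |riccati y| * f y ^ 2
          ≤ |riccati y| * (|y - √8| * |∫ s in √8..y, s ^ 3 * deriv f s ^ 2|) := by
            gcongr; exact hf.sq_le_of_vanish h0 hy1
        _ = (|riccati y| * |y - √8|) * |∫ s in √8..y, s ^ 3 * deriv f s ^ 2| := by ring
        _ ≤ k * ε' := by gcongr; exact hr2 y hy1 hy4 hy8
        _ ≤ ε / 8 := hε'1
    · have h3 := h1 (x := y) (by rw [Real.dist_eq]; linarith)
      rw [Real.dist_eq, sub_zero] at h3; exact h3.le.trans hε'2
  obtain ⟨a, ha, haa, ha2⟩ := hf.exists_zero hε'0 (lt_min ha₀ one_pos)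
  obtain ⟨d, hd, hd1, hd2⟩ := hf.exists_top hε'0 (max d₀ 4)
  have ha1 : a < 1 := haa.trans_le (min_le_right _ _)
  have hd4 : 4 < d := (le_max_right _ _).trans_lt hd
  refine ⟨a, d, ha, haa.trans_le (min_le_left _ _), (le_max_left _ _).trans_lt hd, ?_⟩
  have hc := near (√8 - δ / 2) (by rw [sub_sub_cancel_left, abs_neg, abs_of_pos (by positivity)])
  have he := near (√8 + δ / 2) (by rw [add_sub_cancel_left, abs_of_pos (by positivity)])
  set c := √8 - δ / 2 with hcd
  set e := √8 + δ / 2 with hed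
  have hI1 := hf.riccati_le ha (by linarith : a ≤ c) fun y hy => by
    have := hy.2; exact ne_of_lt (by linarith)
  have hI2 := hf.riccati_le (by linarith : 0 < e) (by linarith : e ≤ d) fun y hy => by
    have := hy.1; exact ne_of_gt (by linarith)
  have hA : |riccati a * f a ^ 2| ≤ ε / 8 := by
    rw [abs_mul, abs_of_nonneg (sq_nonneg (f a))]
    calc _ ≤ k * a ^ 4 * f a ^ 2 := by gcongr; exact hr0 a ha ha1
      _ = k * (a ^ 4 * f a ^ 2) := by ring
      _ ≤ k * ε' := by gcongr
      _ ≤ _ := hε'1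
  have hD : |riccati d * f d ^ 2| ≤ ε / 8 := by
    rw [abs_mul, abs_of_nonneg (sq_nonneg (f d))]
    calc _ ≤ k * d ^ 2 * f d ^ 2 := by gcongr; exact hr1 d hd4
      _ = k * (d ^ 2 * f d ^ 2) := by ring
      _ ≤ k * ε' := by gcongr
      _ ≤ _ := hε'1
  have hsplit : ∫ y in a..d, F y = (∫ y in a..c, F y) + (-(∫ y in √8..c, F y)
      + ∫ y in √8..e, F y) + ∫ y in e..d, F y := by
    rw [← intervalIntegral.integral_symm,
      intervalIntegral.integral_add_adjacent_intervals (hFi (by linarith) h8p.le)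
        (hFi h8p.le (by linarith)),
      intervalIntegral.integral_add_adjacent_intervals (hFi ha.le (by linarith))
        (hFi (by linarith) (by linarith)),
      intervalIntegral.integral_add_adjacent_intervals (hFi ha.le (by linarith))
        (hFi (by linarith) (by linarith))]
  rw [hsplit]
  have t1 := abs_le.1 hA
  have t2 := abs_le.1 hD
  have t3 := abs_le.1 hc.1
  have t4 := abs_le.1 hc.2
  have t5 := abs_le.1 he.1
  have t6 := abs_le.1 he.2; linarith

/-! ### The bound state -/

namespace IsBoundState

theorem exists_even_extension (h : IsBoundState ψ ζ) :
    ∃ φ : ℝ → ℝ, ContDiff ℝ 2 φ ∧ ∀ t, 0 ≤ t → φ t = ψ t := by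
  refine ⟨fun t => ψ ‖EuclideanSpace.single (0 : Fin 4) t‖, ?_, fun t ht => ?_⟩
  · have h2 : ContDiff ℝ 2 fun t : ℝ => t • EuclideanSpace.single (0 : Fin 4) (1 : ℝ) := by fun_prop
    have h3 : ∀ t : ℝ, EuclideanSpace.single (0 : Fin 4) t
        = t • EuclideanSpace.single (0 : Fin 4) (1 : ℝ) := fun t => by
      ext i; simp
    have h4 : (fun t => ψ ‖EuclideanSpace.single (0 : Fin 4) t‖)
        = fun t : ℝ => ψ ‖t • EuclideanSpace.single (0 : Fin 4) (1 : ℝ)‖ := by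
      funext t
      conv_lhs => rw [h3 t]
    rw [h4]; exact h.regular.comp h2
  · simp [abs_of_nonneg ht]

theorem hasDerivAt (h : IsBoundState ψ ζ) (hy : 0 < y) : HasDerivAt ψ (deriv ψ y) y := by
  obtain ⟨φ, hφ, e⟩ := h.exists_even_extension
  have h1 : φ =ᶠ[𝓝 y] ψ := by filter_upwards [lt_mem_nhds hy] with t ht using e t ht.le
  exact (h1.differentiableAt_iff.1 (hφ.differentiable (by norm_num) y)).hasDerivAt

theorem hasDerivAt_deriv (h : IsBoundState ψ ζ) (hy : 0 < y) :
    HasDerivAt (deriv ψ) (deriv (deriv ψ) y) y := by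
  obtain ⟨φ, hφ, e⟩ := h.exists_even_extension
  have h1 : deriv φ =ᶠ[𝓝 y] deriv ψ := by
    filter_upwards [lt_mem_nhds hy] with t ht
    refine Filter.EventuallyEq.deriv_eq ?_
    filter_upwards [lt_mem_nhds ht] with s hs using e s hs.le
  have h2 : ContDiff ℝ 1 (deriv φ) := hφ.deriv' 
  exact (h1.differentiableAt_iff.1 (h2.differentiable (by norm_num) y)).hasDerivAt

theorem continuousOn (h : IsBoundState ψ ζ) : ContinuousOn ψ (Ioi 0) := fun _ hy =>
  (h.hasDerivAt hy).continuousAt.continuousWithinAt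

theorem continuousOn_deriv (h : IsBoundState ψ ζ) : ContinuousOn (deriv ψ) (Ioi 0) := fun _ hy =>
  (h.hasDerivAt_deriv hy).continuousAt.continuousWithinAt

/-- The bound state and its derivative are bounded on bounded sets. -/
theorem exists_bound (h : IsBoundState ψ ζ) (R : ℝ) :
    ∃ C, 0 < C ∧ ∀ y, 0 < y → y ≤ R → |ψ y| ≤ C ∧ |deriv ψ y| ≤ C := by
  obtain ⟨φ, hφ, e⟩ := h.exists_even_extension
  obtain ⟨C₁, hC, h1⟩ := exists_abs_le (a := 0) (b := R) hφ.continuous.continuousOn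
  obtain ⟨C₂, -, h2⟩ := exists_abs_le (a := 0) (b := R)
    (hφ.continuous_deriv (by norm_num)).continuousOn
  refine ⟨max C₁ C₂, by positivity, fun y hy hyR => ⟨?_, ?_⟩⟩
  · rw [← e y hy.le]; exact (h1 y hy.le hyR).trans (le_max_left _ _)
  · have : deriv ψ y = deriv φ y := by
      refine Filter.EventuallyEq.deriv_eq ?_
      filter_upwards [lt_mem_nhds hy] with s hs using (e s hs.le).symm
    rw [this]; exact (h2 y hy.le hyR).trans (le_max_right _ _)

theorem deriv_deriv (h : IsBoundState ψ ζ) (hy : 0 < y) :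
    deriv (deriv ψ) y = (ζ - V y) * ψ y - 3 / y * deriv ψ y := by
  have := h.eigen y hy
  unfold lap at this; linarith

theorem hasDerivAt_cube_deriv (h : IsBoundState ψ ζ) (hy : 0 < y) :
    HasDerivAt (fun y => y ^ 3 * deriv ψ y) (-(y ^ 3 * (V y * ψ y + (-ζ * ψ y)))) y := by
  have h1 := (hasDerivAt_pow 3 y).mul (h.hasDerivAt_deriv hy)
  refine h1.congr_deriv ?_
  rw [h.deriv_deriv hy]; push_cast; field_simp; ring

theorem integrable_cube_sq (h : IsBoundState ψ ζ) :
    IntegrableOn (fun y => y ^ 3 * ψ y ^ 2) (Ioi 0) :=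
  integrable_radial_iff.1 h.memL2.integrable_sq

theorem _root_.CriticalWave.monotoneOn_Ici {f' : ℝ → ℝ}
    (h : ∀ y, R ≤ y → HasDerivAt f (f' y) y) (h0 : ∀ y, R ≤ y → 0 ≤ f' y) : MonotoneOn f (Ici R) :=
  monotoneOn_of_hasDerivWithinAt_nonneg (convex_Ici R)
    (fun y hy => (h y hy).continuousAt.continuousWithinAt)
    (fun y hy => (h y (interior_subset hy)).hasDerivWithinAt) fun y hy => h0 y (interior_subset hy)

/-- The bound state decays exponentially: `F = y³ ψ²` satisfies `F'' ≥ ζ F` at large `y` and is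
integrable. -/
theorem exists_exp_bound (h : IsBoundState ψ ζ) :
    ∃ R C : ℝ, 1 ≤ R ∧ 0 < C ∧ ∀ y, R ≤ y → y ^ 3 * ψ y ^ 2 ≤ C * exp (-(√ζ * y)) := by
  have hζ := h.pos
  set κ := √ζ with hκ
  have hκ0 : 0 < κ := by positivity
  have hκ2 : κ ^ 2 = ζ := Real.sq_sqrt hζ.le
  set F : ℝ → ℝ := fun y => y ^ 3 * ψ y ^ 2 with hF
  set F' : ℝ → ℝ := fun y => 3 * y ^ 2 * ψ y ^ 2 + 2 * y ^ 3 * ψ y * deriv ψ y with hF'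
  set F'' : ℝ → ℝ := fun y => 6 * y * ψ y ^ 2 + 6 * y ^ 2 * ψ y * deriv ψ y
    + 2 * y ^ 3 * deriv ψ y ^ 2 + 2 * (ζ - V y) * (y ^ 3 * ψ y ^ 2) with hF''
  have d1 : ∀ y, 0 < y → HasDerivAt F (F' y) y := fun y hy => by
    refine ((hasDerivAt_pow 3 y).mul ((h.hasDerivAt hy).pow 2)).congr_deriv ?_
    simp only [hF', Pi.pow_apply]; push_cast; ring
  have d2 : ∀ y, 0 < y → HasDerivAt F' (F'' y) y := fun y hy => by
    have h1 := ((hasDerivAt_pow 2 y).const_mul 3).mul ((h.hasDerivAt hy).pow 2)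
    have h2 := (((hasDerivAt_pow 3 y).const_mul 2).mul (h.hasDerivAt hy)).mul
      (h.hasDerivAt_deriv hy)
    refine (h1.add h2).congr_deriv ?_
    simp only [hF'', Pi.pow_apply, Pi.mul_apply]; rw [h.deriv_deriv hy]; push_cast; field_simp; ring
  obtain ⟨R, hR1, hR⟩ : ∃ R : ℝ, 1 ≤ R ∧ ∀ y, R ≤ y → V y ≤ ζ / 2 := by
    refine ⟨max 1 (384 * 2 / ζ), le_max_left _ _, fun y hy => ?_⟩
    have hy1 : 1 ≤ y := (le_max_left _ _).trans hy
    have hy2 : 384 * 2 / ζ ≤ y := (le_max_right _ _).trans hy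
    have h1 := V_mul_le (by linarith : 0 < y)
    rw [div_le_iff₀ hζ] at hy2
    have h2 : y ≤ (1 + y) ^ 2 := by nlinarith
    have h4 : V y * y ≤ 384 := by nlinarith [V_nonneg y]
    by_contra! H
    nlinarith
  have hRpos : 0 < R := by linarith
  have hconv : ∀ y, R ≤ y → 0 ≤ F'' y - κ ^ 2 * F y := fun y hy => by
    have hy0 : 0 < y := by linarith
    have h2 : 0 ≤ (ζ - 2 * V y) * (y ^ 3 * ψ y ^ 2) :=
      mul_nonneg (by linarith [hR y hy]) (by positivity)
    have h3 : 0 ≤ y * (6 * ψ y ^ 2 + 6 * ψ y * (y * deriv ψ y) + 2 * (y * deriv ψ y) ^ 2) := by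
      apply mul_nonneg hy0.le
      nlinarith [sq_nonneg (3 * ψ y + 2 * (y * deriv ψ y)), sq_nonneg (ψ y)]
    rw [hκ2]; simp only [hF'', hF]; linarith
  have hFnn : ∀ y, 0 < y → 0 ≤ F y := fun y hy => by simp only [hF]; positivity
  have dE : ∀ y, HasDerivAt (fun y => exp (κ * y)) (exp (κ * y) * κ) y := fun y =>
    ((hasDerivAt_id y).const_mul κ).exp.congr_deriv (by simp)
  have hE : ∀ y, exp (-(κ * y)) * exp (κ * y) = 1 := fun y => by rw [← Real.exp_add]; simp
  -- `e^{-κ y} (F' + κ F)` is nondecreasing. If it were positive somewhere, `F` would grow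
  -- exponentially.
  have mono : MonotoneOn (fun y => exp (-(κ * y)) * (F' y + κ * F y)) (Ici R) := by
    refine monotoneOn_Ici (f' := fun y => exp (-(κ * y)) * (F'' y - κ ^ 2 * F y)) (fun y hy => ?_)
      fun y hy => mul_nonneg (exp_pos _).le (hconv y hy)
    have hy0 := hRpos.trans_le hy
    refine ((((hasDerivAt_id y).const_mul κ).neg).exp.mul
      ((d2 y hy0).add ((d1 y hy0).const_mul κ))).congr_deriv ?_
    simp only [Pi.add_apply, Pi.neg_apply, id]; ring
  have hneg : ∀ y, R ≤ y → F' y + κ * F y ≤ 0 := fun y₁ hy₁ => by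
    by_contra! H
    set c := exp (-(κ * y₁)) * (F' y₁ + κ * F y₁) with hc
    have hc0 : 0 < c := mul_pos (exp_pos _) H
    clear_value c
    have mono2 : MonotoneOn (fun y => exp (κ * y) * F y - c / (2 * κ) * exp (κ * y) ^ 2)
        (Ici y₁) := by
      refine monotoneOn_Ici (f' := fun y => exp (κ * y) * (F' y + κ * F y - c * exp (κ * y)))
        (fun y hy => ?_) fun y hy => mul_nonneg (exp_pos _).le ?_
      · refine (((dE y).mul (d1 y (hRpos.trans_le (hy₁.trans hy)))).sub
          (((dE y).pow 2).const_mul _)).congr_deriv ?_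
        push_cast; field_simp; ring
      · have h1 : c ≤ exp (-(κ * y)) * (F' y + κ * F y) := hc.trans_le (mono hy₁ (hy₁.trans hy) hy)
        have h2 := mul_le_mul_of_nonneg_right h1 (exp_pos (κ * y)).le; rw [mul_right_comm, hE] at h2
        linarith
    have hlow : ∀ y, y₁ + 1 ≤ y → c / 2 ≤ F y := fun y hy => by
      have hy1 : y₁ ≤ y := (le_add_of_nonneg_right (by positivity)).trans hy
      have h1 := mono2 (mem_Ici.2 le_rfl) (mem_Ici.2 hy1) hy1
      beta_reduce at h1
      have h2 := mul_nonneg (exp_pos (κ * y₁)).le (hFnn y₁ (hRpos.trans_le hy₁))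
      have h3 : exp (κ * y₁) + κ ≤ exp (κ * y) := by
        have h4 := Real.one_le_exp (mul_nonneg hκ0.le (hRpos.le.trans hy₁))
        have h5 := Real.add_one_le_exp (κ * (y - y₁))
        have h6 := mul_le_mul_of_nonneg_left hy hκ0.le
        rw [show κ * y = κ * y₁ + κ * (y - y₁) by ring, Real.exp_add]
        nlinarith
      refine le_of_mul_le_mul_left ?_ (exp_pos (κ * y))
      have h4 : c / (2 * κ) * (exp (κ * y) * κ) ≤ c / (2 * κ)
          * (exp (κ * y) ^ 2 - exp (κ * y₁) ^ 2) := by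
        gcongr; nlinarith [exp_pos (κ * y₁), exp_pos (κ * y)]
      have e : c / (2 * κ) * (exp (κ * y) * κ) = exp (κ * y) * (c / 2) := by field_simp
      linarith
    have hi : IntegrableOn (fun _ : ℝ => c / 2) (Ioi (y₁ + 1)) := by
      have : 0 ≤ y₁ + 1 := by linarith
      refine Integrable.mono' (h.integrable_cube_sq.mono_set (Ioi_subset_Ioi this))
        aestronglyMeasurable_const ?_
      filter_upwards [ae_restrict_mem measurableSet_Ioi] with y hy
      rw [Real.norm_eq_abs, abs_of_pos (by positivity)]
      exact hlow y (le_of_lt hy)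
    rw [integrableOn_const_iff] at hi; simp [hc0.ne'] at hi
  have mono3 : MonotoneOn (fun y => -(exp (κ * y) * F y)) (Ici R) :=
    monotoneOn_Ici (f' := fun y => -(exp (κ * y) * (F' y + κ * F y)))
      (fun y hy => ((dE y).mul (d1 y (hRpos.trans_le hy))).neg.congr_deriv (by ring)) fun y hy =>
        neg_nonneg.2 (mul_nonpos_of_nonneg_of_nonpos (exp_pos _).le (hneg y hy))
  refine ⟨R, exp (κ * R) * F R + 1, hR1, ?_, fun y hy => ?_⟩
  · have := mul_nonneg (exp_pos (κ * R)).le (hFnn R hRpos); linarith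
  · have h1 := neg_le_neg_iff.1 (mono3 (mem_Ici.2 le_rfl) hy hy)
    have h6 := exp_pos (-(κ * y))
    calc y ^ 3 * ψ y ^ 2 = exp (-(κ * y)) * (exp (κ * y) * F y) := by rw [← mul_assoc, hE, one_mul]
      _ ≤ exp (-(κ * y)) * (exp (κ * R) * F R + 1) := by gcongr; linarith
      _ = _ := by ring

/-- Polynomial decay of the bound state, as used in the pairings with it. -/
theorem exists_decay (h : IsBoundState ψ ζ) :
    ∃ C : ℝ, 0 < C ∧ ∀ y, 0 < y → |ψ y| ≤ C / (1 + y) ^ 8 := by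
  obtain ⟨R, C, hR, hC, hb⟩ := h.exists_exp_bound
  obtain ⟨C', hC', hb'⟩ := h.exists_bound R
  have hκ0 : 0 < √ζ := Real.sqrt_pos.2 h.pos
  set κ := √ζ
  set D := C * exp κ * (Nat.factorial 16 : ℝ) / κ ^ 16 with hD
  have hD0 : 0 < D := by positivity
  refine ⟨max (C' * (1 + R) ^ 8) (√D), by positivity, fun y hy => ?_⟩
  rw [le_div_iff₀ (by positivity)]
  rcases le_total y R with hyR | hyR
  · refine le_trans ?_ (le_max_left _ _)
    have := (hb' y hy hyR).1
    gcongr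
  · refine (Real.le_sqrt_of_sq_le ?_).trans (le_max_right _ _)
    have h2 : ψ y ^ 2 ≤ C * exp (-(κ * y)) := (le_mul_of_one_le_left (sq_nonneg _)
      (one_le_pow₀ (hR.trans hyR))).trans (hb y hyR)
    have h3 : (κ * (1 + y)) ^ 16 / (Nat.factorial 16 : ℝ) ≤ exp (κ * (1 + y)) :=
      Real.pow_div_factorial_le_exp _ (by positivity) 16
    have h5 : exp (-(κ * y)) * exp (κ * (1 + y)) = exp κ := by rw [← Real.exp_add]; congr 1; ring
    rw [div_le_iff₀ (by positivity)] at h3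
    rw [hD, le_div_iff₀ (by positivity)]
    calc (|ψ y| * (1 + y) ^ 8) ^ 2 * κ ^ 16 = ψ y ^ 2 * (κ * (1 + y)) ^ 16 := by
          rw [mul_pow, sq_abs]; ring
      _ ≤ (C * exp (-(κ * y))) * (exp (κ * (1 + y)) * (Nat.factorial 16 : ℝ)) := by gcongr
      _ = _ := by rw [← h5]; ring

/-- The bound state is integrable against weights growing at most like `(1 + y)³`, with a
singularity up to `y⁻³` at the origin. -/
theorem integrable_weight_mul (h : IsBoundState ψ ζ) (hf : ContinuousOn f (Ioi 0))
    (hA : ∀ y, 0 < y → |y ^ 3 * f y| ≤ A * (1 + y) ^ 6) : Integrable (fun y => f y * ψ y) ϱ := by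
  obtain ⟨C, hC, hb⟩ := h.exists_decay
  refine integrable_radial_of_decay (A := A * C) (aesm_radial (hf.mul h.continuousOn))
    fun y hy => ?_
  rw [← mul_assoc, abs_mul]
  have hA0 : 0 ≤ A := nonneg_of_mul_nonneg_left ((abs_nonneg _).trans (hA y hy)) (by positivity)
  calc |y ^ 3 * f y| * |ψ y| ≤ A * (1 + y) ^ 6 * (C / (1 + y) ^ 8) := by
        gcongr
        exacts [hA y hy, hb y hy]
    _ = A * C / (1 + y) ^ 2 := by field_simp
    _ ≤ A * C / (1 + y ^ 2) := by gcongr; nlinarith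

/-- Cubic decay gives square integrability. -/
theorem _root_.CriticalWave.memLp_of_cubic_decay (hf : ContinuousOn f (Ioi 0))
    (hb : ∀ y, 0 < y → |f y| ≤ C / (1 + y) ^ 3) : MemLp f 2 ϱ := by
  refine memLp_radial_of_decay (A := C ^ 2) (aesm_radial hf) fun y hy => ?_
  have h1 := hb y hy; rw [le_div_iff₀ (by positivity)] at h1
  rw [abs_of_nonneg (by positivity), le_div_iff₀ (by positivity)]
  have h3 : y ^ 3 * (1 + y ^ 2) ≤ ((1 + y) ^ 3) ^ 2 := by
    have : 0 ≤ 1 + 6 * y + 15 * y ^ 2 + 19 * y ^ 3 + 15 * y ^ 4 + 5 * y ^ 5 + y ^ 6 := by positivity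
    linear_combination this
  calc y ^ 3 * f y ^ 2 * (1 + y ^ 2) = |f y| ^ 2 * (y ^ 3 * (1 + y ^ 2)) := by rw [sq_abs]; ring
    _ ≤ |f y| ^ 2 * ((1 + y) ^ 3) ^ 2 := by gcongr
    _ = (|f y| * (1 + y) ^ 3) ^ 2 := by ring
    _ ≤ C ^ 2 := by gcongr

theorem exists_decay_deriv (h : IsBoundState ψ ζ) :
    ∃ C : ℝ, 0 < C ∧ ∀ y, 0 < y → |deriv ψ y| ≤ C / (1 + y) ^ 3 := by
  obtain ⟨C, hC, hb⟩ := h.exists_decay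
  obtain ⟨C', hC', hb'⟩ := h.exists_bound 1
  have hζ := h.pos
  have hi : IntegrableOn (fun s => s ^ 3 * (V s * ψ s + -ζ * ψ s)) (Ioi 0) := by
    have h1 := continuous_V.continuousOn (s := Ioi (0 : ℝ))
    refine integrable_radial_iff.1 ((h.integrable_weight_mul (f := fun s => V s - ζ) (A := 3 + ζ)
      (by fun_prop) fun s hs => ?_).congr (Eventually.of_forall fun s => by ring))
    have hV : |V s - ζ| ≤ 3 + ζ := by
      have h2 : V s ≤ 3 := by unfold V; nlinarith [Q_le_one s, Q_pos s]
      have := V_nonneg s; rw [abs_le]; constructor <;> linarith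
    rw [abs_pow_mul hs, mul_comm]
    gcongr
    exact (pow_le_pow_left₀ hs.le (by linarith) 3).trans
      (pow_le_pow_right₀ (by linarith) (by norm_num))
  set I := ∫ s in Ioi 0, ‖s ^ 3 * (V s * ψ s + -ζ * ψ s)‖ with hI
  have hI0 : 0 ≤ I := integral_nonneg fun _ => norm_nonneg _
  refine ⟨8 * (C' + I), by positivity, fun y hy => ?_⟩
  rw [le_div_iff₀ (by positivity)]
  rcases le_total y 1 with hy1 | hy1
  · have h1 := (hb' y hy hy1).2
    have h2 : (1 + y) ^ 3 ≤ 2 ^ 3 := by gcongr; linarith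
    calc |deriv ψ y| * (1 + y) ^ 3 ≤ C' * 2 ^ 3 := by gcongr
      _ ≤ _ := by linarith
  · have hs : Ioc 1 y ⊆ Ioi 0 := fun s hs => one_pos.trans hs.1
    have hint : ∫ s in (1 : ℝ)..y, -(s ^ 3 * (V s * ψ s + (-ζ * ψ s)))
        = y ^ 3 * deriv ψ y - 1 ^ 3 * deriv ψ 1 := by
      refine intervalIntegral.integral_eq_sub_of_hasDerivAt
        (f := fun s => s ^ 3 * deriv ψ s) (fun s hs => ?_)
        ((intervalIntegrable_iff_integrableOn_Ioc_of_le hy1).2 (hi.mono_set hs)).neg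
      rw [uIcc_of_le hy1] at hs; exact h.hasDerivAt_cube_deriv (by linarith [hs.1])
    rw [intervalIntegral.integral_neg] at hint
    have hbd : |∫ s in (1 : ℝ)..y, s ^ 3 * (V s * ψ s + (-ζ * ψ s))| ≤ I := by
      rw [intervalIntegral.integral_of_le hy1]
      exact (norm_integral_le_integral_norm _).trans (setIntegral_mono_set hi.norm
        (Eventually.of_forall fun _ => norm_nonneg _) (Eventually.of_forall hs))
    have h1 := abs_le.1 (hb' 1 one_pos le_rfl).2
    have h4 : y ^ 3 * |deriv ψ y| ≤ C' + I := by
      rw [← abs_of_pos (pow_pos hy 3), ← abs_mul]; rw [abs_le] at hbd ⊢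
      constructor <;> linarith
    calc |deriv ψ y| * (1 + y) ^ 3 ≤ |deriv ψ y| * (2 * y) ^ 3 := by gcongr; linarith
      _ = 8 * (y ^ 3 * |deriv ψ y|) := by ring
      _ ≤ _ := by gcongr

theorem formDomain (h : IsBoundState ψ ζ) : FormDomain ψ where
  ac := locallyAC_of_hasDerivAt (fun _ hx => h.hasDerivAt hx) h.continuousOn_deriv
  grad := by
    obtain ⟨C, hC, hb⟩ := h.exists_decay_deriv; exact memLp_of_cubic_decay h.continuousOn_deriv hb
  wt := by
    have h2 : AEStronglyMeasurable (fun y => ψ y / (1 + y)) ϱ :=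
      aesm_radial (h.continuousOn.div (by fun_prop) fun y hy => by
        have : (0 : ℝ) < y := hy; positivity)
    refine h.memL2.mono h2 (ae_radial_of_forall fun y hy => ?_)
    rw [norm_div]
    refine div_le_self (norm_nonneg _) ?_
    rw [Real.norm_eq_abs, abs_of_pos (by linarith)]
    linarith

/-- A function that is square integrable with the weight `(1 + y)⁻²` is integrable against the
bound state. -/
theorem integrable_mul (h : IsBoundState ψ ζ) (hf : MemLp (fun y => f y / (1 + y)) 2 ϱ) :
    Integrable (fun y => f y * ψ y) ϱ := by
  obtain ⟨C, hC, hb⟩ := h.exists_decay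
  have hc : ContinuousOn (fun y => (1 + y) * ψ y) (Ioi 0) :=
    ContinuousOn.mul (by fun_prop) h.continuousOn
  have hm : MemLp (fun y => (1 + y) * ψ y) 2 ϱ := memLp_of_cubic_decay (C := C) hc fun y hy => by
    have h0 : 0 < 1 + y := by linarith
    rw [abs_mul, abs_of_pos h0]
    calc (1 + y) * |ψ y| ≤ (1 + y) * (C / (1 + y) ^ 8) := by gcongr; exact hb y hy
      _ = C / (1 + y) ^ 7 := by field_simp
      _ ≤ _ := by gcongr <;> linarith
  refine (hf.integrable_mul hm).congr (ae_radial_of_forall fun y hy => ?_)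
  have : 1 + y ≠ 0 := by positivity
  simp only [Pi.mul_apply]; field_simp

theorem form_right (h : IsBoundState ψ ζ) (hf : FormDomain f) : form f ψ = -ζ * ip f ψ := by
  obtain ⟨C, hC, hb⟩ := h.exists_decay_deriv
  have hi := h.integrable_mul hf.wt
  rw [form_eq_ip (S := fun y => -ζ * ψ y) hf h.formDomain (fun y hy => h.hasDerivAt hy)
    (fun y hy => h.hasDerivAt_cube_deriv hy) (continuousOn_const.mul h.continuousOn) hC hb]
  · unfold ip; rw [← integral_const_mul]
    congr 1; funext y; ring
  · exact (hi.const_mul (-ζ)).congr (Eventually.of_forall fun y => by simp only; ring)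

theorem ip_self_pos (h : IsBoundState ψ ζ) : 0 < ip ψ ψ := by
  obtain ⟨r, hr, hr0⟩ := h.nontrivial
  have h1 : IntegrableOn (fun y => y ^ 3 * (ψ y * ψ y)) (Ioi 0) := by
    simpa only [sq] using h.integrable_cube_sq
  unfold ip; rw [integral_radial]
  have hnn : ∀ y ∈ Ioi (0 : ℝ), 0 ≤ y ^ 3 * (ψ y * ψ y) := fun y hy =>
    mul_nonneg (pow_nonneg (le_of_lt hy) 3) (mul_self_nonneg _)
  have hsub : Icc r (r + 1) ⊆ Ioi 0 := fun y hy => lt_of_lt_of_le hr hy.1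
  have h2 : ∫ y in Icc r (r + 1), y ^ 3 * (ψ y * ψ y) ≤ ∫ y in Ioi 0, y ^ 3 * (ψ y * ψ y) :=
    setIntegral_mono_set h1 ((ae_restrict_iff' measurableSet_Ioi).2 (Eventually.of_forall hnn))
      (Eventually.of_forall hsub)
  refine lt_of_lt_of_le ?_ h2
  rw [integral_Icc_eq_integral_Ioc, ← intervalIntegral.integral_of_le (by linarith)]
  have hc : ContinuousOn (fun y => y ^ 3 * (ψ y * ψ y)) (Icc r (r + 1)) := by
    have := h.continuousOn.mono hsub; fun_prop
  refine intervalIntegral.integral_pos (by linarith) hc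
    (fun y hy => hnn y (hsub ⟨hy.1.le, hy.2⟩)) ⟨r, ⟨le_rfl, by linarith⟩, ?_⟩
  have := mul_self_pos.2 hr0; positivity

end IsBoundState

/-! ### The corrected form is nonnegative -/

/-- The form of `H` corrected in the direction of the bound state. -/
def formPlus (ψ : ℝ → ℝ) (ζ : ℝ) (f g : ℝ → ℝ) : ℝ := form f g + ζ / ip ψ ψ * (ip f ψ * ip g ψ)

namespace IsBoundState

theorem ip_comb (h : IsBoundState ψ ζ) (hf : FormDomain f) (hg : FormDomain g)
    (a b : ℝ) : ip (fun y => a * f y + b * g y) ψ = a * ip f ψ + b * ip g ψ :=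
  ip_eq_comb (h.integrable_mul hf.wt) (h.integrable_mul hg.wt) a b fun y _ => by ring

/-- `H` has a single negative direction: a function on which the corrected form were negative
would span with `ψ` a plane on which the form is negative definite, and this plane contains a
nonzero function vanishing at `√8`. -/
theorem formPlus_self_nonneg (h : IsBoundState ψ ζ) (hf : FormDomain f) : 0 ≤ formPlus ψ ζ f f := by
  have hN := h.ip_self_pos
  have hζ := h.pos
  have hψ := h.formDomain
  have key : ∀ a b : ℝ, a * f √8 + b * ψ √8 = 0 →
      0 ≤ a ^ 2 * form f f + 2 * a * b * (-ζ * ip f ψ) + b ^ 2 * (-ζ * ip ψ ψ) := by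
    intro a b hab
    have := (hf.comb hψ a b).form_nonneg_of_vanish hab
    rwa [hf.form_comb hψ, h.form_right hf, h.form_right hψ] at this
  have h1 : ψ √8 ≠ 0 := by
    intro h0
    have := key 0 1 (by rw [h0]; ring)
    nlinarith [mul_pos hζ hN]
  have h2 := key (ψ √8) (-f √8) (by ring)
  have h3 : (ψ √8) ^ 2 * form f f + 2 * ψ √8 * (-f √8) * (-ζ * ip f ψ)
      + (-f √8) ^ 2 * (-ζ * ip ψ ψ) = (ψ √8) ^ 2 * formPlus ψ ζ f f
        - ζ / ip ψ ψ * (ψ √8 * ip f ψ + (-f √8) * ip ψ ψ) ^ 2 := by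
    unfold formPlus; field_simp; ring
  rw [h3] at h2
  have h4 : 0 ≤ ζ / ip ψ ψ * (ψ √8 * ip f ψ + (-f √8) * ip ψ ψ) ^ 2 := by positivity
  have h5 : 0 < (ψ √8) ^ 2 := by positivity
  by_contra! H
  nlinarith

theorem formPlus_sq_le (h : IsBoundState ψ ζ) (hf : FormDomain f) (hg : FormDomain g) :
    formPlus ψ ζ f g ^ 2 ≤ formPlus ψ ζ f f * formPlus ψ ζ g g := by
  have key : ∀ t : ℝ, 0 ≤ formPlus ψ ζ g g * (t * t) + (2 * formPlus ψ ζ f g) * t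
      + formPlus ψ ζ f f := by
    intro t
    have h1 := h.formPlus_self_nonneg (hf.comb hg 1 t)
    unfold formPlus at h1 ⊢; rw [hf.form_comb hg, h.ip_comb hf hg] at h1
    convert h1 using 1
    ring
  have := discrim_le_zero key
  unfold discrim at this; nlinarith

end IsBoundState

/-! ### Integrals depending on the parameter `b` -/

/-- Differentiation under the radial integral for integrands supported in a fixed ball. -/
theorem hasDerivAt_radial_integral {k k' : ℝ → ℝ → ℝ} {s : Set ℝ} (hs : s ∈ 𝓝 b)
    (hm : ∀ β ∈ s, AEStronglyMeasurable (k β) ϱ)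
    (hm' : AEStronglyMeasurable (k' b) ϱ)
    (hi : Integrable (k b) ϱ)
    (hd : ∀ β ∈ s, ∀ y, 0 < y → HasDerivAt (fun β => k β y) (k' β y) β)
    (hb : ∀ β ∈ s, ∀ y, 0 < y → y ≤ R → |y ^ 3 * k' β y| ≤ A)
    (h0 : ∀ β ∈ s, ∀ y, R < y → k' β y = 0) :
    HasDerivAt (fun β => ∫ y, k β y ∂ϱ) (∫ y, k' b y ∂ϱ) b := by
  set bound : ℝ → ℝ := (Iic R).indicator fun y => |A| / y ^ 3 with hbd
  have hbi : Integrable bound ϱ := by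
    refine integrable_radial_of_le (R := R) (A := |A|) ?_ (fun y hy hyR => ?_) fun y hy => ?_
    · refine AEStronglyMeasurable.indicator ?_ measurableSet_Iic
      exact (by fun_prop : Measurable fun y : ℝ => |A| / y ^ 3).aestronglyMeasurable
    · rw [hbd, indicator_of_mem (show y ∈ Iic R from hyR), mul_div_cancel₀ _ (by positivity), abs_abs]
    · rw [hbd, indicator_of_notMem]; simpa using hy
  refine (hasDerivAt_integral_of_dominated_loc_of_deriv_le (bound := bound) hs ?_ hi hm' ?_ hbi ?_).2
  · filter_upwards [hs] with β hβ using hm β hβ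
  · refine ae_radial_of_forall fun y hy β hβ => ?_
    rcases le_or_gt y R with hyR | hyR
    · rw [hbd, indicator_of_mem (show y ∈ Iic R from hyR), Real.norm_eq_abs, le_div_iff₀ (by positivity)]
      have h1 := hb β hβ y hy hyR; rw [abs_pow_mul hy] at h1
      have := le_abs_self A; linarith
    · rw [h0 β hβ y hyR, norm_zero]; rw [hbd, indicator_of_notMem (by simpa using hyR)]
  · exact ae_radial_of_forall fun y hy β hβ => hd β hβ y hy

theorem hasDerivAt_primitive_param {g g' : ℝ → ℝ → ℝ} (hg : Continuous (Function.uncurry g))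
    (hg' : Continuous (Function.uncurry g'))
    (hd : ∀ b s, HasDerivAt (fun b => g b s) (g' b s) b) (b y : ℝ) :
    HasDerivAt (fun b => ∫ s in (0 : ℝ)..y, g b s) (∫ s in (0 : ℝ)..y, g' b s) b := by
  obtain ⟨C, hC⟩ := ((isCompact_Icc (a := b - 1) (b := b + 1)).prod
    (isCompact_uIcc (a := (0 : ℝ)) (b := y))).exists_bound_of_continuousOn hg'.continuousOn
  have hgb : ∀ β, Continuous (g β) := fun β => hg.comp (by fun_prop : Continuous fun s => (β, s))
  have hgb' : ∀ β, Continuous (g' β) := fun β => hg'.comp (by fun_prop : Continuous fun s => (β, s))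
  refine (intervalIntegral.hasDerivAt_integral_of_dominated_loc_of_deriv_le
    (bound := fun _ => C) (s := Icc (b - 1) (b + 1)) (Icc_mem_nhds (by linarith) (by linarith))
    (Eventually.of_forall fun β => (hgb β).aestronglyMeasurable) ((hgb b).intervalIntegrable _ _)
    (hgb' b).aestronglyMeasurable ?_ intervalIntegrable_const ?_).2
  · exact Eventually.of_forall fun s hs β hβ => hC (β, s) ⟨hβ, uIoc_subset_uIcc hs⟩
  · exact Eventually.of_forall fun s _ β _ => hd β s

section
variable {S S' : ℝ → ℝ → ℝ}

theorem continuous_uncurry_mul (hS : Continuous (Function.uncurry S)) :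
    Continuous (Function.uncurry fun b s => S b s * Lam Q s * s ^ 3) ∧
      Continuous (Function.uncurry fun b s => S b s * Gam s * s ^ 3) := by
  have hL : Continuous fun p : ℝ × ℝ => Lam Q p.2 := continuous_LamQ.comp continuous_snd
  have hG : Continuous fun p : ℝ × ℝ => Gam p.2 * p.2 ^ 3 :=
    continuous_cube_mul_Gam.comp continuous_snd
  exact ⟨(hS.mul hL).mul (by fun_prop),
    (hS.mul hG).congr fun p => by simp [Function.uncurry, mul_assoc]⟩

theorem hasDerivAt_Tinv_param (hS : Continuous (Function.uncurry S))
    (hS' : Continuous (Function.uncurry S'))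
    (hd : ∀ b s, HasDerivAt (fun b => S b s) (S' b s) b) (b y : ℝ) :
    HasDerivAt (fun b => Tinv (S b) y) (Tinv (S' b) y) b := by
  have e := continuous_uncurry_mul hS
  have e' := continuous_uncurry_mul hS'
  have h1 := hasDerivAt_primitive_param e.1 e'.1
    (fun b s => ((hd b s).mul_const (Lam Q s)).mul_const (s ^ 3)) b y
  have h2 := hasDerivAt_primitive_param e.2 e'.2
    (fun b s => ((hd b s).mul_const (Gam s)).mul_const (s ^ 3)) b y
  exact (h1.const_mul (Gam y)).sub (h2.const_mul (Lam Q y))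

theorem continuousOn_Tinv_param (hS : Continuous (Function.uncurry S)) :
    ContinuousOn (fun p : ℝ × ℝ => Tinv (S p.1) p.2) (univ ×ˢ Ioi 0) ∧
    ContinuousOn (fun p : ℝ × ℝ => dTinv (S p.1) p.2) (univ ×ˢ Ioi 0) := by
  have i1 := (intervalIntegral.continuous_parametric_primitive_of_continuous (a₀ := 0)
    (μ := volume) (continuous_uncurry_mul hS).1).continuousOn (s := univ ×ˢ Ioi 0)
  have i2 := (intervalIntegral.continuous_parametric_primitive_of_continuous (a₀ := 0)
    (μ := volume) (continuous_uncurry_mul hS).2).continuousOn (s := univ ×ˢ Ioi 0)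
  have g : ∀ {g : ℝ → ℝ}, ContinuousOn g (Ioi 0) →
      ContinuousOn (fun p : ℝ × ℝ => g p.2) (univ ×ˢ Ioi 0) :=
    fun hg => hg.comp continuousOn_snd fun p hp => hp.2
  exact ⟨((g continuousOn_Gam).mul i1).sub ((g continuous_LamQ.continuousOn).mul i2),
    ((g continuousOn_dGam).mul i1).sub ((g continuous_dLamQ.continuousOn).mul i2)⟩

/-- A function of two variables with continuous partial derivatives on `I × (0, ∞)` is
differentiable there. -/
theorem hasFDerivAt_of_partial {f f₁ f₂ : ℝ → ℝ → ℝ} {I : Set ℝ} (hI : IsOpen I)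
    (h1 : ∀ b ∈ I, ∀ y, 0 < y → HasDerivAt (fun b => f b y) (f₁ b y) b)
    (h2 : ∀ b ∈ I, ∀ y, 0 < y → HasDerivAt (f b) (f₂ b y) y)
    (c1 : ContinuousOn (Function.uncurry f₁) (I ×ˢ Ioi 0))
    (c2 : ContinuousOn (Function.uncurry f₂) (I ×ˢ Ioi 0)) (hb : b ∈ I) (hy : 0 < y) :
    HasFDerivAt (Function.uncurry f) ((ContinuousLinearMap.toSpanSingleton ℝ (f₁ b y)).coprod
        (ContinuousLinearMap.toSpanSingleton ℝ (f₂ b y))) (b, y) := by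
  have ho : I ×ˢ Ioi (0 : ℝ) ∈ 𝓝 (b, y) := (hI.prod isOpen_Ioi).mem_nhds ⟨hb, hy⟩
  have hc : Continuous fun x : ℝ => ContinuousLinearMap.toSpanSingleton ℝ x :=
    (ContinuousLinearMap.toSpanSingletonCLE (𝕜 := ℝ) (E := ℝ)).continuous
  exact (hasStrictFDerivAt_uncurry_coprod (u := (b, y)) (f := f)
    (f₁ := fun b y => ContinuousLinearMap.toSpanSingleton ℝ (f₁ b y))
    (f₂ := fun b y => ContinuousLinearMap.toSpanSingleton ℝ (f₂ b y))
    (by filter_upwards [ho] with p hp using (h1 p.1 hp.1 p.2 hp.2).hasFDerivAt)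
    (by filter_upwards [ho] with p hp using (h2 p.1 hp.1 p.2 hp.2).hasFDerivAt)
    (hc.continuousAt.comp (c1.continuousAt ho))
    (hc.continuousAt.comp (c2.continuousAt ho))).hasFDerivAt

end

/-! ### The cut-off and the normalization constant `c_b` -/

theorem cut_B0 (χ : ℝ → ℝ) (b y : ℝ) : cut χ (B0 b / 4) y = χ (2 * b * y) := by
  unfold cut B0
  congr 1
  rcases eq_or_ne b 0 with rfl | hb
  · simp
  · field_simp; ring

namespace IsCutoff

variable {χ : ℝ → ℝ}

theorem continuous (h : IsCutoff χ) : Continuous χ := h.smooth.continuous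

theorem continuous_deriv (h : IsCutoff χ) : Continuous (deriv χ) :=
  h.smooth.continuous_deriv (by simp)

theorem hasDerivAt (h : IsCutoff χ) (z : ℝ) : HasDerivAt χ (deriv χ z) z :=
  (h.smooth.differentiable (by simp) z).hasDerivAt

theorem _root_.CriticalWave.deriv_eq_zero_of_eqOn_const {s : Set ℝ} (hf : Differentiable ℝ f)
    (hs : UniqueDiffOn ℝ s) (h : ∀ z ∈ s, f z = c) {z : ℝ} (hz : z ∈ s) : deriv f z = 0 :=
  (hs z hz).eq_deriv _ (hf z).hasDerivAt.hasDerivWithinAt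
    ((hasDerivWithinAt_const z s c).congr h (h z hz))

theorem deriv_eq_zero_of_le (h : IsCutoff χ) {z : ℝ} (hz : z ≤ 1) : deriv χ z = 0 :=
  deriv_eq_zero_of_eqOn_const (h.smooth.differentiable (by simp)) (uniqueDiffOn_Iic 1) h.eq_one hz

theorem deriv_eq_zero_of_ge (h : IsCutoff χ) {z : ℝ} (hz : 2 ≤ z) : deriv χ z = 0 :=
  deriv_eq_zero_of_eqOn_const (h.smooth.differentiable (by simp)) (uniqueDiffOn_Ici 2) h.eq_zero hz

theorem exists_bound (h : IsCutoff χ) : ∃ C, 1 ≤ C ∧ ∀ z, |χ z| ≤ C ∧ |deriv χ z| ≤ C := by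
  obtain ⟨C₁, -, h1⟩ := exists_abs_le (a := 1) (b := 2) h.continuous.continuousOn
  obtain ⟨C₂, -, h2⟩ := exists_abs_le (a := 1) (b := 2) h.continuous_deriv.continuousOn
  refine ⟨max 1 (max C₁ C₂), le_max_left _ _, fun z => ?_⟩
  rcases le_total z 1 with hz | hz
  · rw [h.eq_one z hz, h.deriv_eq_zero_of_le hz]; simp
  rcases le_total 2 z with hz2 | hz2
  · rw [h.eq_zero z hz2, h.deriv_eq_zero_of_ge hz2]; simp
  · exact ⟨(h1 z hz hz2).trans ((le_max_left _ _).trans (le_max_right _ _)),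
      (h2 z hz hz2).trans ((le_max_right _ _).trans (le_max_right _ _))⟩

end IsCutoff

/-- `χ_{B₀/4} ΛQ`. -/
def cutLam (χ : ℝ → ℝ) (b s : ℝ) : ℝ := χ (2 * b * s) * Lam Q s

/-- `∂_b (χ_{B₀/4} ΛQ)`. -/
def dcutLam (χ : ℝ → ℝ) (b s : ℝ) : ℝ := 2 * s * deriv χ (2 * b * s) * Lam Q s

/-- The normalization `(χ_{B₀/4} ΛQ, ΛQ)`. -/
def massN (χ : ℝ → ℝ) (b : ℝ) : ℝ := ip (cutLam χ b) (Lam Q)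

/-- The derivative of `massN`. -/
def dmassN (χ : ℝ → ℝ) (b : ℝ) : ℝ := ip (dcutLam χ b) (Lam Q)

/-- A primitive of `s³ (ΛQ)²`. -/
def primLamQ (y : ℝ) : ℝ := 32 * (-log (Q y) + 5 * Q y - 4 * Q y ^ 2 + 4 / 3 * Q y ^ 3 - 7 / 3)

theorem hasDerivAt_primLamQ (y : ℝ) : HasDerivAt primLamQ (y ^ 3 * Lam Q y ^ 2) y := by
  have hq := hasDerivAt_Q y
  have hQ := Q_pos y
  have h := ((((((hq.log hQ.ne').neg).add (hq.const_mul 5)).sub ((hq.pow 2).const_mul 4)).add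
    ((hq.pow 3).const_mul (4 / 3))).sub_const (7 / 3)).const_mul 32
  refine h.congr_deriv ?_
  rw [Lam_Q]
  have e2 : y ^ 2 * Q y = 8 - 8 * Q y := by linarith [sq_mul_Q y]
  push_cast; field_simp
  linear_combination (-(4 * y * (2 * Q y - 1) ^ 2)) * e2

theorem primLamQ_zero : primLamQ 0 = 0 := by unfold primLamQ Q; norm_num

theorem integral_LamQ_sq (y : ℝ) : ∫ s in (0 : ℝ)..y, s ^ 3 * Lam Q s ^ 2 = primLamQ y := by
  rw [intervalIntegral.integral_eq_sub_of_hasDerivAt (fun s _ => hasDerivAt_primLamQ s),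
    primLamQ_zero, sub_zero]
  refine Continuous.intervalIntegrable ?_ _ _
  have := continuous_LamQ; fun_prop

theorem abs_neg_log_Q_sub_le (hb : 0 < b) (hb1 : b < 1) :
    |-log (Q (1 / b)) - 2 * (|log b|)| ≤ 8 := by
  have e : -log (Q (1 / b)) = log (8 * b ^ 2 + 1) - log 8 - 2 * log b := by
    unfold Q
    rw [one_div, Real.log_inv, neg_neg, show 1 + (1 / b) ^ 2 / 8 = (8 * b ^ 2 + 1) / 8 / b ^ 2 by
      field_simp, Real.log_div (by positivity) (by positivity),
      Real.log_div (by positivity) (by positivity), Real.log_pow]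
    push_cast; ring
  have h1 : 0 ≤ log (8 * b ^ 2 + 1) := Real.log_nonneg (by nlinarith)
  have h2 := Real.log_le_sub_one_of_pos (by positivity : 0 < 8 * b ^ 2 + 1)
  have h3 : 0 ≤ log 8 := Real.log_nonneg (by norm_num)
  have h4 := Real.log_le_sub_one_of_pos (by norm_num : (0 : ℝ) < 8)
  rw [e, abs_of_neg (Real.log_neg hb hb1), abs_le]
  constructor <;> nlinarith

theorem abs_primLamQ_sub_le (hb : 0 < b) (hb1 : b < 1) :
    |primLamQ (1 / b) - 64 * (|log b|)| ≤ 500 := by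
  have hQ := Q_pos (1 / b)
  have hQ1 := Q_le_one (1 / b)
  have h1 := abs_le.1 (abs_neg_log_Q_sub_le hb hb1)
  have h5 : 0 ≤ Q (1 / b) ^ 2 := by positivity
  have h6 : Q (1 / b) ^ 2 ≤ 1 := pow_le_one₀ hQ.le hQ1
  have h7 : 0 ≤ Q (1 / b) ^ 3 := by positivity
  have h8 : Q (1 / b) ^ 3 ≤ 1 := pow_le_one₀ hQ.le hQ1
  unfold primLamQ; rw [abs_le]; constructor <;> linarith

theorem Q_cube_mul_le (hy : 0 < y) : y ^ 3 * Q y ^ 2 ≤ 64 / y := by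
  have h3 : y ^ 2 * Q y ≤ 8 := by linarith [sq_mul_Q y, Q_pos y]
  have := Q_pos y; rw [le_div_iff₀ hy]
  calc y ^ 3 * Q y ^ 2 * y = (y ^ 2 * Q y) ^ 2 := by ring
    _ ≤ 8 ^ 2 := by gcongr
    _ = 64 := by norm_num

theorem LamQ_sq_mul_cube_le (hy : 0 < y) : y ^ 3 * Lam Q y ^ 2 ≤ 64 / y := by
  refine le_trans ?_ (Q_cube_mul_le hy)
  rw [← sq_abs (Lam Q y)]
  gcongr; exact abs_LamQ_le y

set_option linter.unusedSectionVars false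
variable {χ : ℝ → ℝ} [hχ : Fact (IsCutoff χ)]

theorem continuous_cutLam : Continuous (Function.uncurry (cutLam χ)) := by
  have h1 := hχ.1.continuous
  have hL : Continuous fun p : ℝ × ℝ => Lam Q p.2 := continuous_LamQ.comp continuous_snd
  unfold cutLam Function.uncurry; fun_prop

theorem continuous_dcutLam : Continuous (Function.uncurry (dcutLam χ)) := by
  have h1 := hχ.1.continuous_deriv
  have hL : Continuous fun p : ℝ × ℝ => Lam Q p.2 := continuous_LamQ.comp continuous_snd
  unfold dcutLam Function.uncurry; fun_prop

theorem continuous_cutLam' (b : ℝ) : Continuous (cutLam χ b) :=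
  continuous_cutLam.comp (by fun_prop : Continuous fun s => (b, s))

theorem continuous_dcutLam' (b : ℝ) : Continuous (dcutLam χ b) :=
  continuous_dcutLam.comp (by fun_prop : Continuous fun s => (b, s))

theorem hasDerivAt_cutLam (b s : ℝ) : HasDerivAt (fun b => cutLam χ b s) (dcutLam χ b s) b := by
  have h1 : HasDerivAt (fun b : ℝ => 2 * b * s) (2 * s) b := by
    simpa using ((hasDerivAt_id b).const_mul 2).mul_const s
  refine (((hχ.1.hasDerivAt (2 * b * s)).comp b h1).mul_const (Lam Q s)).congr_deriv ?_
  unfold dcutLam; ring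

theorem cutLam_eq_zero {s : ℝ} (hs : 1 ≤ b * s) : cutLam χ b s = 0 := by
  unfold cutLam; rw [hχ.1.eq_zero _ (by linarith), zero_mul]

theorem dcutLam_eq_zero {s : ℝ} (hs : 1 ≤ b * s) : dcutLam χ b s = 0 := by
  unfold dcutLam; rw [hχ.1.deriv_eq_zero_of_ge (by linarith)]; ring

theorem cutLam_eq {s : ℝ} (hs : 2 * b * s ≤ 1) : cutLam χ b s = Lam Q s := by
  unfold cutLam; rw [hχ.1.eq_one _ hs, one_mul]

theorem dcutLam_eq_zero' {s : ℝ} (hs : 2 * b * s ≤ 1) : dcutLam χ b s = 0 := by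
  unfold dcutLam; rw [hχ.1.deriv_eq_zero_of_le hs]; ring

theorem abs_cube_mul_dcutLam_le (hC : ∀ z, |χ z| ≤ C ∧ |deriv χ z| ≤ C) (hy : 0 < y) :
    |y ^ 3 * (dcutLam χ b y * Lam Q y)| ≤ 128 * C := by
  unfold dcutLam
  rw [show y ^ 3 * (2 * y * deriv χ (2 * b * y) * Lam Q y * Lam Q y)
    = 2 * (y * (y ^ 3 * Lam Q y ^ 2)) * deriv χ (2 * b * y) by ring, abs_mul,
    abs_of_nonneg (by positivity : 0 ≤ 2 * (y * (y ^ 3 * Lam Q y ^ 2)))]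
  have h2 := LamQ_sq_mul_cube_le hy; rw [le_div_iff₀ hy] at h2
  exact mul_le_mul (by linarith) (hC _).2 (abs_nonneg _) (by norm_num)

theorem cb_eq (χ : ℝ → ℝ) (b : ℝ) : cb χ b = ip Phi (Lam Q) / massN χ b := by
  unfold cb massN
  congr 2
  funext y
  rw [cut_B0]; rfl

theorem source_eq (χ : ℝ → ℝ) (b : ℝ) :
    source χ b = fun y => (-1) * Phi y + cb χ b * cutLam χ b y := by
  funext y
  unfold source; rw [cut_B0]
  unfold cutLam; ring

theorem massN_eq (hb : 0 < b) (hR : 1 ≤ b * R) :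
    massN χ b = ∫ s in (0 : ℝ)..R, s ^ 3 * (cutLam χ b s * Lam Q s) := by
  have hR0 : 0 < R := pos_of_mul_pos_right (one_pos.trans_le hR) hb.le
  refine integral_radial_eq_interval hR0.le fun y hy => ?_
  rw [cutLam_eq_zero (by nlinarith), zero_mul]

theorem exists_massN_bound : ∃ C, 1 ≤ C ∧ ∀ b, 0 < b → b < 1 →
    |massN χ b - 64 * (|log b|)| ≤ C ∧ |dmassN χ b| ≤ C / b := by
  obtain ⟨C, hC, hb⟩ := hχ.1.exists_bound
  refine ⟨500 + 128 * (C + 1), by linarith, fun b hb0 hb1 => ⟨?_, ?_⟩⟩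
  · have hR : 1 ≤ b * (1 / b) := by rw [mul_one_div_cancel hb0.ne']
    rw [massN_eq hb0 hR]
    have := continuous_cutLam' (χ := χ) b
    have := continuous_LamQ
    have hc1 : Continuous fun s => s ^ 3 * (cutLam χ b s * Lam Q s) := by fun_prop
    have hc2 : Continuous fun s => s ^ 3 * Lam Q s ^ 2 := by fun_prop
    have hd : |(∫ s in (0 : ℝ)..(1 / b), s ^ 3 * (cutLam χ b s * Lam Q s)) - primLamQ (1 / b)|
        ≤ (128 * (C + 1) * b) * (1 / b) := by
      rw [← integral_LamQ_sq, ← intervalIntegral.integral_sub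
        (hc1.intervalIntegrable _ _) (hc2.intervalIntegrable _ _)]
      refine abs_primitive_le (by positivity) fun s hs hsb => ?_
      rcases le_total (2 * b * s) 1 with h1 | h1
      · rw [cutLam_eq h1, show s ^ 3 * (Lam Q s * Lam Q s) - s ^ 3 * Lam Q s ^ 2 = 0 by ring,
          abs_zero]
        positivity
      · have h2 := LamQ_sq_mul_cube_le hs
        have h3 : 64 / s ≤ 128 * b := by rw [div_le_iff₀ hs]; nlinarith
        have h4 : |χ (2 * b * s) - 1| ≤ C + 1 := by
          refine (abs_sub _ _).trans ?_
          rw [abs_one]; linarith [(hb (2 * b * s)).1]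
        unfold cutLam
        rw [show s ^ 3 * (χ (2 * b * s) * Lam Q s * Lam Q s) - s ^ 3 * Lam Q s ^ 2
          = (s ^ 3 * Lam Q s ^ 2) * (χ (2 * b * s) - 1) by ring, abs_mul,
          abs_of_nonneg (by positivity : 0 ≤ s ^ 3 * Lam Q s ^ 2)]
        have h5 := mul_le_mul (h2.trans h3) h4 (abs_nonneg _) (by positivity)
        exact h5.trans_eq (by ring)
    rw [mul_assoc, mul_one_div_cancel hb0.ne', mul_one] at hd
    have h2 := abs_primLamQ_sub_le hb0 hb1; rw [abs_le] at *
    constructor <;> linarith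
  · have h1 : |dmassN χ b| ≤ (128 * C) * (1 / b) :=
      abs_integral_radial_le (by positivity) (fun s hs _ => abs_cube_mul_dcutLam_le hb hs)
        fun s hs => by rw [dcutLam_eq_zero ((div_lt_iff₀' hb0).1 hs).le, zero_mul]
    refine h1.trans ?_
    rw [mul_one_div]
    gcongr; linarith

theorem hasDerivAt_massN (hb : 0 < b) : HasDerivAt (massN χ) (dmassN χ b) b := by
  obtain ⟨C, hC, hbd⟩ := hχ.1.exists_bound
  have hz : ∀ β ∈ Ioi (b / 2), ∀ y, 2 / b < y → 1 ≤ β * y := by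
    intro β hβ y hy
    have hβ : b / 2 < β := hβ; rw [div_lt_iff₀ hb] at hy; nlinarith
  refine hasDerivAt_radial_integral (k := fun β y => cutLam χ β y * Lam Q y)
    (k' := fun β y => dcutLam χ β y * Lam Q y) (s := Ioi (b / 2)) (R := 2 / b) (A := 128 * C)
    (Ioi_mem_nhds (half_lt_self hb)) (fun β _ => ?_) ?_ ?_
    (fun β _ y _ => (hasDerivAt_cutLam β y).mul_const _)
    (fun β _ y hy _ => abs_cube_mul_dcutLam_le hbd hy)
    fun β hβ y hy => by rw [dcutLam_eq_zero (hz β hβ y hy), zero_mul]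
  · exact ((continuous_cutLam' β).mul continuous_LamQ).aestronglyMeasurable
  · exact ((continuous_dcutLam' b).mul continuous_LamQ).aestronglyMeasurable
  · simp_rw [mul_comm _ (Lam Q _)]
    exact integrable_mul_of_continuous continuous_LamQ (continuous_cutLam' b) fun y hy =>
      cutLam_eq_zero (hz b (half_lt_self hb) y hy)

theorem integral_Phi_LamQ (y : ℝ) :
    ∫ s in (0 : ℝ)..y, Phi s * Lam Q s * s ^ 3 = y ^ 4 * Lam Q y ^ 2 / 2 := by
  have hd : ∀ s, HasDerivAt (fun y => y ^ 4 * Lam Q y ^ 2 / 2) (Phi s * Lam Q s * s ^ 3) s := by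
    intro s
    have h := ((hasDerivAt_pow 4 s).mul ((hasDerivAt_LamQ s).pow 2)).div_const 2
    refine h.congr_deriv ?_
    have : Phi s = 2 * Lam Q s + s * dLamQ s := by unfold Phi Dop; rw [(hasDerivAt_LamQ s).deriv]
    rw [this]; simp only [Pi.pow_apply]; push_cast; ring
  rw [intervalIntegral.integral_eq_sub_of_hasDerivAt (fun s _ => hd s)]
  · simp
  · exact (continuous_mul_LamQ continuous_Phi).intervalIntegrable _ _

theorem fourth_mul_LamQ_sq (y : ℝ) :
    y ^ 4 * Lam Q y ^ 2 / 2 = 32 * ((1 - Q y) * (1 - 2 * Q y)) ^ 2 := by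
  have e := sq_mul_Q y
  rw [Lam_Q, show y ^ 4 * (2 * Q y ^ 2 - Q y) ^ 2 / 2
    = (y ^ 2 * Q y) ^ 2 * (2 * Q y - 1) ^ 2 / 2 by ring, e]
  ring

theorem abs_flux_le (y : ℝ) : |y ^ 4 * Lam Q y ^ 2 / 2| ≤ 32 ∧
    |32 - y ^ 4 * Lam Q y ^ 2 / 2| ≤ 192 * Q y := by
  rw [fourth_mul_LamQ_sq]
  have h1 := Q_le_one y
  have h2 := Q_pos y
  set t := (1 - Q y) * (1 - 2 * Q y) with ht
  have h3 : t ≤ 1 := by nlinarith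
  have h4 : -1 ≤ t := by nlinarith [sq_nonneg (Q y - 1)]
  have h5 : 1 - t ≤ 3 * Q y := by nlinarith
  have h6 : t ^ 2 ≤ 1 := by nlinarith
  constructor
  · rw [abs_of_nonneg (by positivity)]; linarith
  · rw [abs_of_nonneg (by linarith)]
    nlinarith

theorem tendsto_Q : Tendsto Q atTop (𝓝 0) := by
  have h : Tendsto (fun y : ℝ => 1 + y ^ 2 / 8) atTop atTop :=
    tendsto_atTop_add_const_left _ _ ((tendsto_pow_atTop (by norm_num)).atTop_div_const (by norm_num))
  exact (h.inv_tendsto_atTop).congr fun y => by simp [Q]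

theorem mul_Q_le (y : ℝ) : y * Q y ≤ 4 := by
  have := Q_le y
  refine (le_abs_self _).trans ?_
  rw [abs_mul, abs_of_pos (Q_pos y)]
  calc |y| * Q y ≤ |y| * (8 / (1 + y ^ 2)) := by gcongr
    _ = 8 * |y| / (1 + y ^ 2) := by ring
    _ ≤ 4 := by
      rw [div_le_iff₀ (by positivity)]
      nlinarith [sq_nonneg (|y| - 1), sq_abs y]

theorem integrable_Phi_mul (hf : AEStronglyMeasurable f ϱ)
    (hb : ∀ y, 0 < y → |f y| ≤ C * Q y) : Integrable (fun y => Phi y * f y) ϱ := by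
  refine integrable_radial_of_decay (A := 6 * C * 256)
    (continuous_Phi.aestronglyMeasurable.mul hf) fun y hy => ?_
  have h1 := abs_Phi_le y
  have h2 := hb y hy
  have hQ := Q_pos y
  have hC : 0 ≤ C := nonneg_of_mul_nonneg_left ((abs_nonneg _).trans h2) hQ
  rw [le_div_iff₀ (by positivity), abs_mul, abs_mul, abs_of_pos (pow_pos hy 3)]
  have h3 : y ^ 3 * Q y ^ 3 * (1 + y ^ 2) ≤ 256 := by
    have h4 := mul_Q_le y
    have h5 : Q y * (1 + y ^ 2) ≤ 8 := by
      have := Q_le y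
      rwa [le_div_iff₀ (by positivity)] at this
    have h6 : (y ^ 2 * Q y) ≤ 8 := by linarith [sq_mul_Q y]
    calc y ^ 3 * Q y ^ 3 * (1 + y ^ 2) = (y * Q y) * (y ^ 2 * Q y) * (Q y * (1 + y ^ 2)) := by ring
      _ ≤ 4 * 8 * 8 := by gcongr
      _ = 256 := by norm_num
  calc y ^ 3 * (|Phi y| * |f y|) * (1 + y ^ 2)
      ≤ y ^ 3 * ((6 * Q y ^ 2) * (C * Q y)) * (1 + y ^ 2) := by gcongr
    _ = 6 * C * (y ^ 3 * Q y ^ 3 * (1 + y ^ 2)) := by ring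
    _ ≤ _ := by gcongr

theorem ip_Phi_LamQ : ip Phi (Lam Q) = 32 := by
  have hi := integrable_Phi_mul (C := 1) continuous_LamQ.aestronglyMeasurable
    fun y _ => by rw [one_mul]; exact abs_LamQ_le y
  unfold ip; rw [integral_radial]
  have h1 := intervalIntegral_tendsto_integral_Ioi 0 (integrable_radial_iff.1 hi) tendsto_id
  refine tendsto_nhds_unique h1 ?_
  have h2 : Tendsto (fun y => 32 * ((1 - Q y) * (1 - 2 * Q y)) ^ 2) atTop
      (𝓝 (32 * ((1 - 0) * (1 - 2 * 0)) ^ 2)) :=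
    (((tendsto_Q.const_sub 1).mul ((tendsto_Q.const_mul 2).const_sub 1)).pow 2).const_mul 32
  norm_num at h2
  refine h2.congr fun y => ?_
  rw [← fourth_mul_LamQ_sq, ← integral_Phi_LamQ]
  refine intervalIntegral.integral_congr fun s _ => ?_
  ring

/-! ### Bounds for the inversion of `H` -/

/-- A primitive of `s³ Q²`. -/
def primQ (y : ℝ) : ℝ := 32 * (-log (Q y) + Q y - 1)

theorem hasDerivAt_primQ (y : ℝ) : HasDerivAt primQ (y ^ 3 * Q y ^ 2) y := by
  have hq := hasDerivAt_Q y
  have hQ := Q_pos y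
  have h := ((((hq.log hQ.ne').neg).add hq).sub_const 1).const_mul 32
  refine h.congr_deriv ?_
  have e2 : y ^ 2 * Q y = 8 - 8 * Q y := by linarith [sq_mul_Q y]
  field_simp
  linear_combination (-(4 * y)) * e2

theorem integral_Q_sq (y : ℝ) : ∫ s in (0 : ℝ)..y, s ^ 3 * Q s ^ 2 = primQ y := by
  rw [intervalIntegral.integral_eq_sub_of_hasDerivAt (fun s _ => hasDerivAt_primQ s)]
  · have : primQ 0 = 0 := by unfold primQ Q; norm_num
    rw [this, sub_zero]
  · refine Continuous.intervalIntegrable ?_ _ _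
    have := continuous_Q; fun_prop

theorem primQ_mono {z : ℝ} (hy : 0 ≤ y) (hyz : y ≤ z) : primQ y ≤ primQ z := by
  rw [← integral_Q_sq, ← integral_Q_sq]
  have hc : Continuous fun s => s ^ 3 * Q s ^ 2 := by
    have := continuous_Q; fun_prop
  refine intervalIntegral.integral_mono_interval le_rfl hy hyz ?_ (hc.intervalIntegrable _ _)
  filter_upwards [ae_restrict_mem measurableSet_Ioc] with s hs
  have : 0 < s := hs.1; simp only [Pi.zero_apply]; positivity

theorem primQ_inv_le (hb : 0 < b) (hL : 1 ≤ |log b|) (hb1 : b < 1) :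
    primQ (1 / b) ≤ 320 * |log b| := by
  have h1 := abs_le.1 (abs_neg_log_Q_sub_le hb hb1)
  unfold primQ; linarith [Q_le_one (1 / b)]

/-- The primitive of a function vanishing beyond `R` is controlled by its values up to `R`. -/
theorem abs_primitive_le_of_support (hf : Continuous f) (hy : 0 ≤ y)
    (hR : 0 ≤ R) (h0 : ∀ s, R ≤ s → f s = 0)
    (h : ∀ z, 0 ≤ z → z ≤ R → |∫ s in (0 : ℝ)..z, f s| ≤ A) : |∫ s in (0 : ℝ)..y, f s| ≤ A := by
  rcases le_total y R with hyR | hyR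
  · exact h y hy hyR
  · rw [← intervalIntegral.integral_add_adjacent_intervals (hf.intervalIntegrable 0 R)
      (hf.intervalIntegrable R y), intervalIntegral.integral_zero_ae (a := R), add_zero]
    · exact h R hR le_rfl
    · refine Eventually.of_forall fun s hs => h0 s ?_
      rw [uIoc_of_le hyR] at hs; exact hs.1.le

theorem Q_mul_le (y : ℝ) : Q y * (1 + y ^ 2) ≤ 8 := by
  have := Q_le y
  rwa [le_div_iff₀ (by positivity)] at this

theorem abs_LamQ_mul_sq_le (y : ℝ) : |Lam Q y| * (y * y) ≤ 8 := by
  refine (mul_le_mul (abs_LamQ_le y) ?_ (mul_self_nonneg y) (Q_pos y).le).trans (Q_mul_le y)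
  nlinarith

theorem abs_Gam_le_of_one_le (hG : |Gam y| ≤ c * (1 + 1 / y ^ 2)) (hc : 1 ≤ c) (hy : 1 ≤ y) :
    |Gam y| ≤ 2 * c := by
  have : 1 / y ^ 2 ≤ 1 := by rw [div_le_one (by positivity)]; nlinarith
  nlinarith

theorem abs_primitive_Gam_le (hG : ∀ y, 0 < y → |Gam y| ≤ c * (1 + 1 / y ^ 2)) (hc : 1 ≤ c)
    (hy : 0 < y) (hA : 0 ≤ A) (hS : ∀ s, 0 < s → s ≤ y → |S s| ≤ A * Q s) :
    |∫ s in (0 : ℝ)..y, S s * Gam s * s ^ 3| ≤ (8 * c * A * y) * y := by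
  refine abs_primitive_le hy.le fun s hs hsy => ?_
  rw [abs_mul, abs_mul, abs_of_pos (pow_pos hs 3)]
  have hQs := Q_pos s
  calc |S s| * |Gam s| * s ^ 3 ≤ (A * Q s) * (c * (1 + 1 / s ^ 2)) * s ^ 3 := by
        gcongr
        · exact hS s hs hsy
        · exact hG s hs
    _ = c * A * s * (Q s * (1 + s ^ 2)) := by field_simp; ring
    _ ≤ c * A * y * 8 := by
        have := Q_mul_le s
        gcongr
    _ = 8 * c * A * y := by ring

/-- If `|S| ≤ A Q` then `Tinv S` is controlled by `A` and by the flux `∫₀^y S ΛQ`. -/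
theorem exists_Tinv_bound : ∃ k : ℝ, 1 ≤ k ∧ ∀ (S : ℝ → ℝ) (A X y : ℝ), 0 < y → 0 ≤ A → 0 ≤ X →
    (∀ s, 0 < s → s ≤ y → |S s| ≤ A * Q s) → |∫ s in (0 : ℝ)..y, S s * Lam Q s * s ^ 3| ≤ X →
    |Tinv S y| ≤ k * (A + X) := by
  obtain ⟨k, hk, hG⟩ := abs_Gam_le
  obtain ⟨k', hk', hT⟩ := abs_Tinv_le
  refine ⟨64 * k + 2 * k', by linarith, fun S A X y hy hA hX hS hI => ?_⟩
  have p1 : 0 ≤ k * A := by positivity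
  have p2 : 0 ≤ k * X := by positivity
  have p3 : 0 ≤ k' * A := by positivity
  have p4 : 0 ≤ k' * X := by positivity
  rcases le_total y 1 with hy1 | hy1
  · have h1 := (hT S A y hy hA fun s hs hsy => (hS s hs hsy).trans
      (mul_le_of_le_one_right hA (Q_le_one s))).1
    refine h1.trans ?_
    have h2 : y ^ 2 ≤ 1 := pow_le_one₀ hy.le hy1
    have h4 : y ^ 4 ≤ 1 := pow_le_one₀ hy.le hy1
    calc k' * A * (y ^ 2 + y ^ 4) ≤ k' * A * (1 + 1) := by gcongr
      _ ≤ _ := by linarith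
  · have i2 := abs_primitive_Gam_le (fun y hy => (hG y hy).1) hk hy hA hS
    have hG1 := abs_Gam_le_of_one_le (hG y hy).1 hk hy1
    unfold Tinv
    refine (abs_sub _ _).trans ?_
    rw [abs_mul, abs_mul]
    calc |Gam y| * |∫ s in (0 : ℝ)..y, S s * Lam Q s * s ^ 3|
          + |Lam Q y| * |∫ s in (0 : ℝ)..y, S s * Gam s * s ^ 3|
        ≤ 2 * k * X + |Lam Q y| * ((8 * k * A * y) * y) := by gcongr
      _ = 2 * k * X + 8 * k * A * (|Lam Q y| * (y * y)) := by ring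
      _ ≤ 2 * k * X + 8 * k * A * 8 := by gcongr; exact abs_LamQ_mul_sq_le y
      _ ≤ _ := by linarith

theorem abs_flux_le_of_support (hS : Continuous S) (hb : 0 < b)
    (hL : 1 ≤ |log b|) (hb1 : b < 1) (hA : 0 ≤ A) (h : ∀ s, 0 < s → |S s| ≤ A * Q s)
    (h0 : ∀ s, 1 ≤ b * s → S s = 0) (hy : 0 ≤ y) :
    |∫ s in (0 : ℝ)..y, S s * Lam Q s * s ^ 3| ≤ A * (320 * |log b|) := by
  refine abs_primitive_le_of_support (R := 1 / b) (continuous_mul_LamQ hS) hy (by positivity)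
    (fun s hs => ?_) fun z hz hzb => ?_
  · rw [div_le_iff₀ hb] at hs; rw [h0 s (by linarith)]; ring
  · have hc : Continuous fun s => A * (s ^ 3 * Q s ^ 2) := by
      have := continuous_Q; fun_prop
    have h1 : |∫ s in (0 : ℝ)..z, S s * Lam Q s * s ^ 3|
        ≤ ∫ s in (0 : ℝ)..z, A * (s ^ 3 * Q s ^ 2) := by
      rw [← Real.norm_eq_abs]
      refine intervalIntegral.norm_integral_le_of_norm_le hz ?_ (hc.intervalIntegrable _ _)
      refine Eventually.of_forall fun s hs => ?_
      have hs0 : 0 < s := hs.1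
      have hQ := Q_pos s; rw [Real.norm_eq_abs, abs_mul, abs_mul, abs_of_pos (pow_pos hs0 3)]
      calc |S s| * |Lam Q s| * s ^ 3 ≤ (A * Q s) * Q s * s ^ 3 := by
            gcongr
            · exact h s hs0
            · exact abs_LamQ_le s
        _ = A * (s ^ 3 * Q s ^ 2) := by ring
    rw [intervalIntegral.integral_const_mul, integral_Q_sq] at h1
    refine h1.trans ?_
    gcongr; exact (primQ_mono hz hzb).trans (primQ_inv_le hb hL hb1)

/-- The inverse of a source of size `A Q` supported in `y ≤ 1 / b` is `O(A |log b|)`. -/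
theorem exists_Tinv_bound_of_support : ∃ k : ℝ, 1 ≤ k ∧ ∀ (S : ℝ → ℝ) (A b y : ℝ), Continuous S →
    0 < b → 1 ≤ |log b| → b < 1 → 0 ≤ A → (∀ s, 0 < s → |S s| ≤ A * Q s) →
    (∀ s, 1 ≤ b * s → S s = 0) → 0 < y → |Tinv S y| ≤ k * A * |log b| := by
  obtain ⟨k, hk, h⟩ := exists_Tinv_bound
  refine ⟨321 * k, by linarith, fun S A b y hS hb hL hb1 hA hSb h0 hy => ?_⟩
  refine (h S A _ y hy hA (by positivity) (fun s hs _ => hSb s hs)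
    (abs_flux_le_of_support hS hb hL hb1 hA hSb h0 hy.le)).trans ?_
  have : A ≤ A * |log b| := le_mul_of_one_le_right hA hL; nlinarith

theorem abs_cutLam_le (hC : ∀ z, |χ z| ≤ C ∧ |deriv χ z| ≤ C) (b s : ℝ) :
    |cutLam χ b s| ≤ C * Q s := by
  unfold cutLam; rw [abs_mul]
  exact mul_le_mul (hC _).1 (abs_LamQ_le s) (abs_nonneg _) ((abs_nonneg _).trans (hC 0).1)

theorem exists_Tinv_Phi_bound : ∃ k : ℝ, 1 ≤ k ∧ ∀ y, 0 < y → |Tinv Phi y| ≤ k := by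
  obtain ⟨k, hk, h⟩ := exists_Tinv_bound
  refine ⟨k * (6 + 32), by linarith, fun y hy => ?_⟩
  refine h Phi 6 32 y hy (by norm_num) (by norm_num) (fun s hs _ => ?_) ?_
  · refine (abs_Phi_le s).trans ?_
    have := Q_pos s
    have := Q_le_one s; nlinarith
  · rw [integral_Phi_LamQ]; exact (abs_flux_le y).1

theorem exists_Tinv_cutLam_bound : ∃ k : ℝ, 1 ≤ k ∧ ∀ b y, 0 < b →
    1 ≤ |log b| → b < 1 → 0 < y → |Tinv (cutLam χ b) y| ≤ k * |log b| := by
  obtain ⟨k, hk, h⟩ := exists_Tinv_bound_of_support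
  obtain ⟨C, hC, hb⟩ := hχ.1.exists_bound
  refine ⟨k * C, by nlinarith, fun b y hb0 hL hb1 hy => ?_⟩
  exact h _ C b y (continuous_cutLam' b) hb0 hL hb1 (by linarith)
    (fun s _ => abs_cutLam_le hb b s) (fun s hs => cutLam_eq_zero hs) hy

theorem exists_Tinv_dcutLam_bound : ∃ k : ℝ, 1 ≤ k ∧ ∀ b y, 0 < b → b < 1 →
    0 < y → |Tinv (dcutLam χ b) y| ≤ k / b := by
  obtain ⟨k, hk, h⟩ := exists_Tinv_bound
  obtain ⟨C, hC, hb⟩ := hχ.1.exists_bound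
  refine ⟨k * (130 * C), by nlinarith, fun b y hb0 hb1 hy => ?_⟩
  refine (h (dcutLam χ b) (2 * C / b) (128 * C * (1 / b)) y hy (by positivity) (by positivity)
    (fun s hs _ => ?_) ?_).trans (le_of_eq (by field_simp; ring))
  · rcases le_total 1 (b * s) with h1 | h1
    · rw [dcutLam_eq_zero h1, abs_zero]
      have := Q_pos s; positivity
    · unfold dcutLam; rw [abs_mul, abs_mul, abs_of_pos (by positivity : 0 < 2 * s)]
      have hs1 := (le_div_iff₀' hb0).2 h1
      calc 2 * s * |deriv χ (2 * b * s)| * |Lam Q s| ≤ 2 * (1 / b) * C * Q s := by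
            gcongr
            · exact (hb _).2
            · exact abs_LamQ_le s
        _ = _ := by ring
  · refine abs_primitive_le_of_support (R := 1 / b) (continuous_mul_LamQ (continuous_dcutLam' b))
      hy.le (by positivity) (fun s hs => ?_) fun z hz hzb => ?_
    · rw [div_le_iff₀ hb0] at hs; rw [dcutLam_eq_zero (by linarith)]; ring
    · refine (abs_primitive_le (A := 128 * C) hz fun s hs _ => ?_).trans (by gcongr)
      rw [mul_comm]; exact abs_cube_mul_dcutLam_le hb hs

/-- The thresholds on `b` under which the normalization `c_b` is `32 / (64 |log b| + O(1))`. -/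
theorem exists_cb_bound : ∃ C b₁ : ℝ, 1 ≤ C ∧ 0 < b₁ ∧ b₁ < 1 ∧
    ∀ b, 0 < b → b < b₁ → 1 ≤ |log b| ∧ |massN χ b - 64 * (|log b|)| ≤ C ∧
      |log b| ≤ massN χ b ∧ |dmassN χ b| ≤ C / b ∧ cb χ b = 32 / massN χ b := by
  obtain ⟨C, hC, h⟩ := exists_massN_bound (χ := χ)
  refine ⟨C, exp (-C), hC, exp_pos _, by rw [exp_lt_one_iff]; linarith, fun b hb0 hb => ?_⟩
  have hb1 : b < 1 := hb.trans (by rw [exp_lt_one_iff]; linarith)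
  have hlog : log b < -C := by rwa [Real.log_lt_iff_lt_exp hb0]
  have hl : |log b| = -log b := abs_of_neg (Real.log_neg hb0 hb1)
  obtain ⟨h1, h2⟩ := h b hb0 hb1
  refine ⟨by rw [hl]; linarith, h1, ?_, h2, by rw [cb_eq, ip_Phi_LamQ]⟩
  have := (abs_le.1 h1).1; linarith

/-- The derivative of `c_b`. -/
def dcb (χ : ℝ → ℝ) (b : ℝ) : ℝ := -(32 * dmassN χ b) / massN χ b ^ 2

theorem hasDerivAt_cb (hb : 0 < b) (hN : massN χ b ≠ 0) : HasDerivAt (cb χ) (dcb χ b) b := by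
  have h := (hasDerivAt_const b (32 : ℝ)).div (hasDerivAt_massN hb) hN
  have e : cb χ = (fun _ => (32 : ℝ)) / massN χ := by
    funext β
    rw [cb_eq, ip_Phi_LamQ]; rfl
  rw [e]
  refine h.congr_deriv ?_
  unfold dcb; ring

set_option maxHeartbeats 1000000 in
/-- For `y ≤ 1 / b` the flux of `-Φ + c_b χ ΛQ` almost cancels, which makes
`T̃₁` small away from the origin. -/
theorem exists_Ttilde_bound : ∃ C b₁ : ℝ, 1 ≤ C ∧ 0 < b₁ ∧
    ∀ b, 0 < b → b < b₁ → ∀ y, 0 < y → b * y ≤ 1 →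
      |(-1) * Tinv Phi y + cb χ b * Tinv (cutLam χ b) y|
        ≤ C * (1 / |log b| + 1 / (b * |log b| * y) + 1 / (1 + y)) := by
  obtain ⟨C, b₁, hC, hb1, hb1', hcb⟩ := exists_cb_bound (χ := χ)
  obtain ⟨Cχ, hCχ, hχb⟩ := hχ.1.exists_bound
  obtain ⟨k, hk, hG⟩ := abs_Gam_le
  obtain ⟨kP, hkP, hP⟩ := exists_Tinv_Phi_bound
  obtain ⟨kU, hkU, hU⟩ := exists_Tinv_cutLam_bound (χ := χ)
  have hkU0 : 0 < kU := by linarith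
  have hkP0 : 0 < kP := by linarith
  refine ⟨2 * (kP + 32 * kU) + (2 * k * (2048 * Cχ + 3072) + 2048 * k * Cχ + 3072 * k), b₁,
    by nlinarith, hb1, fun b hb0 hb y hy hby => ?_⟩
  obtain ⟨hL, -, hN, -, hcbe⟩ := hcb b hb0 hb
  set L := |log b| with hLd
  set N := massN χ b with hNd
  have hb1 : b < 1 := hb.trans hb1'
  have hL0 : 0 < L := by linarith
  have hN0 : 0 < N := by linarith
  have hcb0 : 0 < cb χ b := by rw [hcbe]; positivity
  have hcbL : cb χ b ≤ 32 / L := by rw [hcbe]; gcongr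
  have p1 : 0 ≤ 1 / L := by positivity
  have p2 : 0 ≤ 1 / (b * L * y) := by positivity
  have p3 : 0 ≤ 1 / (1 + y) := by positivity
  have key : ∀ {a₁ a₂ a₃ C : ℝ}, a₁ ≤ C → a₂ ≤ C → a₃ ≤ C →
      a₁ * (1 / L) + a₂ * (1 / (b * L * y)) + a₃ * (1 / (1 + y))
        ≤ C * (1 / L + 1 / (b * L * y) + 1 / (1 + y)) := fun h1 h2 h3 => by
    rw [mul_add, mul_add]; gcongr
  have hkC : 0 < k * Cχ := by positivity
  rcases le_total y 1 with hy1 | hy1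
  · have h1 : |(-1) * Tinv Phi y + cb χ b * Tinv (cutLam χ b) y| ≤ kP + 32 * kU := by
      refine (abs_add_le _ _).trans (add_le_add ?_ ?_)
      · rw [abs_mul, abs_neg, abs_one, one_mul]; exact hP y hy
      · rw [abs_mul, abs_of_pos hcb0]
        calc cb χ b * |Tinv (cutLam χ b) y| ≤ 32 / L * (kU * L) :=
              mul_le_mul hcbL (hU b y hb0 hL hb1 hy) (abs_nonneg _) (by positivity)
          _ = 32 * kU := by field_simp
    refine h1.trans ?_
    have h2 : 1 / 2 ≤ 1 / (1 + y) := one_div_le_one_div_of_le (by linarith) (by linarith)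
    exact le_trans (by nlinarith) (key (a₁ := 0) (a₂ := 0) (a₃ := 2 * (kP + 32 * kU))
      (by nlinarith) (by nlinarith) (by nlinarith))
  · set I1 := ∫ s in (0 : ℝ)..y, cutLam χ b s * Lam Q s * s ^ 3 with hI1
    set I2 := ∫ s in (0 : ℝ)..y, cutLam χ b s * Gam s * s ^ 3 with hI2
    set J2 := ∫ s in (0 : ℝ)..y, Phi s * Gam s * s ^ 3 with hJ2
    have e : (-1) * Tinv Phi y + cb χ b * Tinv (cutLam χ b) y
        = Gam y * (cb χ b * I1 - y ^ 4 * Lam Q y ^ 2 / 2) - Lam Q y * (cb χ b * I2 - J2) := by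
      unfold Tinv; rw [integral_Phi_LamQ]; ring
    have hG1 := abs_Gam_le_of_one_le (hG y hy).1 hk hy1
    have hyb : y ≤ 1 / b := (le_div_iff₀' hb0).2 hby
    have hNI : |I1 - N| ≤ 64 * Cχ / y * (1 / b) := by
      have hc := continuous_mul_LamQ (continuous_cutLam' (χ := χ) b)
      have e1 : N = ∫ s in (0 : ℝ)..(1 / b), cutLam χ b s * Lam Q s * s ^ 3 := by
        rw [hNd, massN_eq hb0 (by rw [mul_one_div_cancel hb0.ne'])]
        exact intervalIntegral.integral_congr fun s _ => by ring
      rw [abs_sub_comm, e1, hI1, intervalIntegral.integral_interval_sub_left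
        (hc.intervalIntegrable _ _) (hc.intervalIntegrable _ _)]
      rw [← Real.norm_eq_abs]
      refine (intervalIntegral.norm_integral_le_of_norm_le_const (C := 64 * Cχ / y)
        fun s hs => ?_).trans ?_
      · rw [uIoc_of_le hyb] at hs
        have hs0 : 0 < s := hy.trans hs.1
        unfold cutLam
        rw [Real.norm_eq_abs, show χ (2 * b * s) * Lam Q s * Lam Q s * s ^ 3
          = (s ^ 3 * Lam Q s ^ 2) * χ (2 * b * s) by ring, abs_mul,
          abs_of_nonneg (by positivity : 0 ≤ s ^ 3 * Lam Q s ^ 2)]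
        have h2 := LamQ_sq_mul_cube_le hs0
        calc s ^ 3 * Lam Q s ^ 2 * |χ (2 * b * s)| ≤ 64 / s * Cχ := by
              gcongr; exact (hχb _).1
          _ ≤ 64 / y * Cχ := by gcongr; exact hs.1.le
          _ = 64 * Cχ / y := by ring
      · rw [abs_of_nonneg (by linarith)]
        gcongr; linarith
    have hA : |cb χ b * I1 - y ^ 4 * Lam Q y ^ 2 / 2|
        ≤ 2048 * Cχ * (1 / (b * L * y)) + 3072 * (1 / (1 + y)) := by
      have e2 : cb χ b * I1 - y ^ 4 * Lam Q y ^ 2 / 2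
          = cb χ b * (I1 - N) + (32 - y ^ 4 * Lam Q y ^ 2 / 2) := by
        rw [hcbe]; field_simp; ring
      rw [e2]
      refine (abs_add_le _ _).trans (add_le_add ?_ ?_)
      · rw [abs_mul, abs_of_pos hcb0]
        calc cb χ b * |I1 - N| ≤ 32 / L * (64 * Cχ / y * (1 / b)) := by gcongr
          _ = _ := by field_simp; ring
      · refine (abs_flux_le y).2.trans ?_
        have h1 := Q_mul_le y; rw [mul_one_div, le_div_iff₀ (by positivity)]
        have := Q_pos y; nlinarith
    have hI2b : |I2| ≤ (8 * k * Cχ * y) * y := abs_primitive_Gam_le (fun y hy => (hG y hy).1) hk hy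
      (by linarith) fun s _ _ => abs_cutLam_le hχb b s
    have hJ2b : |J2| ≤ (192 * k) * y := by
      refine abs_primitive_le hy.le fun s hs hsy => ?_
      rw [abs_mul, abs_mul, abs_of_pos (pow_pos hs 3)]
      have hQs := Q_pos s
      calc |Phi s| * |Gam s| * s ^ 3 ≤ (6 * Q s ^ 2) * (k * (1 + 1 / s ^ 2)) * s ^ 3 := by
            gcongr
            · exact abs_Phi_le s
            · exact (hG s hs).1
        _ = 6 * k * (s * Q s) * (Q s * (1 + s ^ 2)) := by field_simp; ring
        _ ≤ 6 * k * 4 * 8 := by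
            have := Q_mul_le s
            have := mul_Q_le s
            gcongr
        _ = 192 * k := by ring
    have hL1 := abs_LamQ_mul_sq_le y
    have hL2 : |Lam Q y| * y ≤ 16 * (1 / (1 + y)) := by
      rw [mul_one_div, le_div_iff₀ (by positivity)]
      have := abs_nonneg (Lam Q y); nlinarith
    have hB : |Lam Q y * (cb χ b * I2 - J2)|
        ≤ 2048 * k * Cχ * (1 / L) + 3072 * k * (1 / (1 + y)) := by
      rw [abs_mul]
      have h1 : |cb χ b * I2 - J2| ≤ 32 / L * ((8 * k * Cχ * y) * y) + (192 * k) * y := by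
        refine (abs_sub _ _).trans (add_le_add ?_ hJ2b)
        rw [abs_mul, abs_of_pos hcb0]
        gcongr
      calc |Lam Q y| * |cb χ b * I2 - J2|
          ≤ |Lam Q y| * (32 / L * ((8 * k * Cχ * y) * y) + (192 * k) * y) := by gcongr
        _ = 256 * k * Cχ * (1 / L) * (|Lam Q y| * (y * y)) + 192 * k * (|Lam Q y| * y) := by ring
        _ ≤ 256 * k * Cχ * (1 / L) * 8 + 192 * k * (16 * (1 / (1 + y))) := by gcongr
        _ = _ := by ring
    rw [e]
    refine (abs_sub _ _).trans ?_
    rw [abs_mul]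
    have hC2 : |Gam y| * |cb χ b * I1 - y ^ 4 * Lam Q y ^ 2 / 2|
        ≤ 2 * k * (2048 * Cχ * (1 / (b * L * y)) + 3072 * (1 / (1 + y))) :=
      mul_le_mul hG1 hA (abs_nonneg _) (by positivity)
    exact le_trans (by linarith) (key (a₁ := 2048 * k * Cχ) (a₂ := 4096 * k * Cχ) (a₃ := 9216 * k)
      (by nlinarith) (by nlinarith) (by nlinarith))

/-! ### The profile `T₁` -/

/-- The localized direction `χ_M Φ`. -/
def phiM (χ : ℝ → ℝ) (M y : ℝ) : ℝ := cut χ M y * Phi y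

/-- `(χ_M Φ, ΛQ)`, which tends to `(Φ, ΛQ) = 32` as `M → ∞`. -/
def massM (χ : ℝ → ℝ) (M : ℝ) : ℝ := ip (phiM χ M) (Lam Q)

theorem continuous_phiM (M : ℝ) : Continuous (phiM χ M) := by
  have := hχ.1.continuous
  have := continuous_Phi
  unfold phiM cut; fun_prop

theorem phiM_eq_zero (hM : 1 ≤ M) (hy : 2 * M ≤ y) : phiM χ M y = 0 := by
  unfold phiM cut; rw [hχ.1.eq_zero _ (by rw [le_div_iff₀ (by linarith)]; linarith), zero_mul]

theorem exists_phiM_bound : ∃ C, 1 ≤ C ∧ ∀ M y, |phiM χ M y| ≤ C * Q y := by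
  obtain ⟨C, hC, hb⟩ := hχ.1.exists_bound
  refine ⟨6 * C, by linarith, fun M y => ?_⟩
  unfold phiM cut; rw [abs_mul]
  have h1 := Q_pos y
  have h2 := Q_le_one y
  calc |χ (y / M)| * |Phi y| ≤ C * (6 * Q y ^ 2) := by
        gcongr
        · exact (hb _).1
        · exact abs_Phi_le y
    _ ≤ 6 * C * Q y := by nlinarith [mul_nonneg (by linarith : 0 ≤ C) h1.le]

theorem exists_massM_bound : ∃ M₀ : ℝ, 1 ≤ M₀ ∧ ∀ M, M₀ ≤ M → 16 ≤ massM χ M := by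
  obtain ⟨C, hC, hb⟩ := hχ.1.exists_bound
  have ht : Tendsto (massM χ) atTop (𝓝 (ip Phi (Lam Q))) := by
    unfold massM ip
    refine tendsto_integral_filter_of_dominated_convergence
      (fun y => C * |Phi y * Lam Q y|) (Eventually.of_forall fun M => ?_)
      (Eventually.of_forall fun M => Eventually.of_forall fun y => ?_) ?_ ?_
    · exact ((continuous_phiM M).mul continuous_LamQ).aestronglyMeasurable
    · unfold phiM cut; rw [Real.norm_eq_abs, mul_assoc, abs_mul]
      gcongr; exact (hb _).1
    · have hi := integrable_Phi_mul (C := 1) continuous_LamQ.aestronglyMeasurable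
        fun y _ => by rw [one_mul]; exact abs_LamQ_le y
      exact hi.abs.const_mul C
    · refine ae_radial_of_forall fun y hy => tendsto_const_nhds.congr' ?_
      filter_upwards [eventually_ge_atTop y] with M hM
      unfold phiM cut; rw [hχ.1.eq_one _ (by rw [div_le_one (by linarith)]; exact hM), one_mul]
  rw [ip_Phi_LamQ] at ht
  obtain ⟨M₀, h0⟩ := eventually_atTop.1 (ht.eventually (lt_mem_nhds (by norm_num : (16 : ℝ) < 32)))
  exact ⟨max 1 M₀, le_max_left _ _, fun M hM => (h0 M ((le_max_right _ _).trans hM)).le⟩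

theorem integrable_mul_phiM (hM : 1 ≤ M)
    (hf : ContinuousOn f (Ioi 0)) (hA : ∀ y, 0 < y → |f y| ≤ A) :
    Integrable (fun y => f y * phiM χ M y) ϱ := by
  refine integrable_mul_of_bounded (R := 2 * M) (A := 2 * M * A) hf
    (continuous_phiM M).continuousOn (fun y hy hyR => ?_) fun y hy => phiM_eq_zero hM hy.le
  rw [abs_mul, abs_of_pos hy]
  have := hA y hy
  gcongr

/-- The parameters for which the profile is controlled. -/
structure Admissible (χ : ℝ → ℝ) (M b : ℝ) : Prop where
  one_le : 1 ≤ M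
  massM_ge : 16 ≤ massM χ M
  pos : 0 < b
  lt_one : b < 1
  log_ge : 1 ≤ |log b|
  four_mul : 4 * M * b < 1
  mass_ge : |log b| ≤ massN χ b

theorem Admissible.abs_log (h : Admissible χ M b) : |log b| = -log b :=
  abs_of_neg (Real.log_neg h.pos h.lt_one)

/-- The coefficient of `ΛQ` which makes `Tinv S - c ΛQ` orthogonal to `χ_M Φ`. -/
def tau (χ : ℝ → ℝ) (M : ℝ) (S : ℝ → ℝ) : ℝ := ip (Tinv S) (phiM χ M) / massM χ M

/-- The inverse of `H` normalized by orthogonality to `χ_M Φ`. -/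
def Tperp (χ : ℝ → ℝ) (M : ℝ) (S : ℝ → ℝ) (y : ℝ) : ℝ := Tinv S y - tau χ M S * Lam Q y

theorem T1_eq_Tperp (χ : ℝ → ℝ) (M b : ℝ) : T1 χ M b = Tperp χ M (source χ b) := rfl

theorem ip_Tperp (hM : 1 ≤ M) (hm : 16 ≤ massM χ M)
    (hS : Continuous S) (hA : ∀ y, 0 < y → |Tinv S y| ≤ A) : ip (Tperp χ M S) (phiM χ M) = 0 := by
  have i1 := integrable_mul_phiM (χ := χ) hM (continuousOn_Tinv hS) hA
  have i2 := integrable_mul_phiM (χ := χ) hM continuous_LamQ.continuousOn fun y _ => abs_LamQ_le_one y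
  rw [ip_eq_comb i1 i2 1 (-tau χ M S) fun y _ => by unfold Tperp; ring, ip_comm (Lam Q)]
  unfold tau; rw [show ip (phiM χ M) (Lam Q) = massM χ M from rfl]; field_simp; ring

theorem tau_add (hM : 1 ≤ M) {S' : ℝ → ℝ} {A' : ℝ}
    (hS : Continuous S) (hA : ∀ y, 0 < y → |Tinv S y| ≤ A)
    (hS' : Continuous S') (hA' : ∀ y, 0 < y → |Tinv S' y| ≤ A') (a b : ℝ) :
    tau χ M (fun s => a * S s + b * S' s) = a * tau χ M S + b * tau χ M S' := by
  have i1 := integrable_mul_phiM (χ := χ) hM (continuousOn_Tinv hS) hA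
  have i2 := integrable_mul_phiM (χ := χ) hM (continuousOn_Tinv hS') hA'
  unfold tau; rw [ip_eq_comb i1 i2 a b fun y _ => by rw [Tinv_add hS hS']; ring]
  ring

theorem Tperp_add (hM : 1 ≤ M) {S' : ℝ → ℝ} {A' : ℝ}
    (hS : Continuous S) (hA : ∀ y, 0 < y → |Tinv S y| ≤ A)
    (hS' : Continuous S') (hA' : ∀ y, 0 < y → |Tinv S' y| ≤ A') (a b y : ℝ) :
    Tperp χ M (fun s => a * S s + b * S' s) y = a * Tperp χ M S y + b * Tperp χ M S' y := by
  unfold Tperp; rw [tau_add hM hS hA hS' hA', Tinv_add hS hS']; ring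

/-- `Tinv` is local. -/
theorem Tinv_congr {S' : ℝ → ℝ} (hy : 0 ≤ y) (h : ∀ s, 0 ≤ s → s ≤ y → S s = S' s) :
    Tinv S y = Tinv S' y := by
  unfold Tinv
  congr 2 <;>
  · refine intervalIntegral.integral_congr fun s hs => ?_
    rw [uIcc_of_le hy] at hs; simp only [h s hs.1 hs.2]

theorem tau_congr (hM : 1 ≤ M) {S' : ℝ → ℝ}
    (h : ∀ s, 0 ≤ s → s ≤ 2 * M → S s = S' s) : tau χ M S = tau χ M S' := by
  unfold tau ip
  congr 1
  refine integral_radial_congr fun y hy => ?_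
  rcases le_total y (2 * M) with hyM | hyM
  · rw [Tinv_congr hy.le fun s hs hsy => h s hs (hsy.trans hyM)]
  · rw [phiM_eq_zero hM hyM]; ring

theorem tau_cutLam (hM : 1 ≤ M) (hb : 0 < b) (hb4 : 4 * M * b < 1) :
    tau χ M (cutLam χ b) = tau χ M (Lam Q) :=
  tau_congr hM fun s _ hsM => cutLam_eq (by nlinarith)

theorem tau_dcutLam (hM : 1 ≤ M) (hb : 0 < b) (hb4 : 4 * M * b < 1) :
    tau χ M (dcutLam χ b) = 0 := by
  rw [tau_congr (S' := fun _ => 0) hM fun s _ hsM => dcutLam_eq_zero' (by nlinarith)]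
  have : Tinv (fun _ => 0) = fun _ => 0 := by funext y; simp [Tinv]
  unfold tau ip; rw [this]; simp

/-- The `b`-derivative of `T₁`. -/
def dT1 (χ : ℝ → ℝ) (M b y : ℝ) : ℝ :=
  dcb χ b * Tperp χ M (cutLam χ b) y + cb χ b * Tperp χ M (dcutLam χ b) y

namespace Admissible

theorem mass_pos (h : Admissible χ M b) : 0 < massN χ b := by
  have := h.mass_ge; have := h.log_ge; linarith

theorem T1_eq (h : Admissible χ M b) (y : ℝ) :
    T1 χ M b y = (-1) * Tperp χ M Phi y + cb χ b * Tperp χ M (cutLam χ b) y := by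
  obtain ⟨kP, hkP, hP⟩ := exists_Tinv_Phi_bound
  obtain ⟨kU, hkU, hU⟩ := exists_Tinv_cutLam_bound (χ := χ); rw [T1_eq_Tperp, source_eq]
  exact Tperp_add h.one_le continuous_Phi hP (continuous_cutLam' b)
    (fun y hy => hU b y h.pos h.log_ge h.lt_one hy) _ _ y

theorem dT1_eq (h : Admissible χ M b) :
    dT1 χ M b = Tperp χ M fun s => dcb χ b * cutLam χ b s + cb χ b * dcutLam χ b s := by
  obtain ⟨kD, hkD, hD⟩ := exists_Tinv_dcutLam_bound (χ := χ)
  obtain ⟨kU, hkU, hU⟩ := exists_Tinv_cutLam_bound (χ := χ)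
  funext y
  exact (Tperp_add h.one_le (continuous_cutLam' b)
    (fun y hy => hU b y h.pos h.log_ge h.lt_one hy) (continuous_dcutLam' b)
    (fun y hy => hD b y h.pos h.lt_one hy) _ _ y).symm

/-- The parameters near an admissible one satisfy the constraints needed for `T1_eq`. -/
theorem eventually (h : Admissible χ M b) : ∀ᶠ β in 𝓝 b, ∀ y, T1 χ M β y = (-1) * Tperp χ M Phi y
      + cb χ β * (Tinv (cutLam χ β) y - tau χ M (Lam Q) * Lam Q y) := by
  obtain ⟨kP, hkP, hP⟩ := exists_Tinv_Phi_bound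
  obtain ⟨k, hk, hT⟩ := exists_Tinv_bound_of_support
  obtain ⟨C, hC, hχb⟩ := hχ.1.exists_bound
  have h1 : ∀ᶠ β in 𝓝 b, 4 * M * β < 1 :=
    (continuous_const.mul continuous_id).continuousAt.eventually (gt_mem_nhds h.four_mul)
  filter_upwards [h1, lt_mem_nhds h.pos] with β hβ hβ0 y
  -- enlarging the support makes the bound applicable to every positive parameter
  have h2 : 0 < min β (exp (-1)) := lt_min hβ0 (exp_pos _)
  have h3 : log (min β (exp (-1))) ≤ -1 := by rw [Real.log_le_iff_le_exp h2]; exact min_le_right _ _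
  have hb := fun y => hT (cutLam χ β) C _ y (continuous_cutLam' β) h2
    (by rw [abs_of_neg (by linarith)]; linarith)
    ((min_le_right _ _).trans_lt (by rw [exp_lt_one_iff]; norm_num)) (by linarith)
    (fun s _ => abs_cutLam_le hχb β s) fun s hs => cutLam_eq_zero <| hs.trans <|
      mul_le_mul_of_nonneg_right (min_le_left _ _)
        (pos_of_mul_pos_right (one_pos.trans_le hs) h2.le).le
  rw [T1_eq_Tperp, source_eq, Tperp_add h.one_le continuous_Phi hP (continuous_cutLam' β) hb]
  unfold Tperp; rw [tau_cutLam h.one_le hβ0 hβ]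

theorem hasDerivAt_T1 (h : Admissible χ M b) (y : ℝ) :
    HasDerivAt (fun β => T1 χ M β y) (dT1 χ M b y) b := by
  have h1 := hasDerivAt_Tinv_param (continuous_cutLam (χ := χ)) continuous_dcutLam
    hasDerivAt_cutLam b y
  have h2 := ((hasDerivAt_cb h.pos h.mass_pos.ne').mul
    (h1.sub_const (tau χ M (Lam Q) * Lam Q y))).const_add ((-1) * Tperp χ M Phi y)
  refine (h2.congr_of_eventuallyEq ?_).congr_deriv ?_
  · filter_upwards [h.eventually] with β hβ using hβ y
  · unfold dT1 Tperp
    rw [tau_cutLam h.one_le h.pos h.four_mul, tau_dcutLam h.one_le h.pos h.four_mul]; ring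

theorem differentiableAt_T1 (h : Admissible χ M b) (hy : 0 < y) :
    DifferentiableAt ℝ (Function.uncurry (T1 χ M)) (b, y) := by
  have hU : DifferentiableAt ℝ (Function.uncurry fun b y => Tinv (cutLam χ b) y) (b, y) :=
    (hasFDerivAt_of_partial (I := univ) isOpen_univ
      (fun b _ y _ => hasDerivAt_Tinv_param continuous_cutLam continuous_dcutLam
        hasDerivAt_cutLam b y)
      (fun b _ y hy => hasDerivAt_Tinv (continuous_cutLam' b) hy)
      (continuousOn_Tinv_param continuous_dcutLam).1
      (continuousOn_Tinv_param continuous_cutLam).2 (mem_univ b) hy).differentiableAt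
  have hL : DifferentiableAt ℝ (fun p : ℝ × ℝ => Lam Q p.2) (b, y) :=
    DifferentiableAt.comp (g := Lam Q) (f := Prod.snd) (b, y)
      (hasDerivAt_LamQ y).differentiableAt differentiableAt_snd
  have hc : DifferentiableAt ℝ (fun p : ℝ × ℝ => cb χ p.1) (b, y) :=
    DifferentiableAt.comp (g := cb χ) (f := Prod.fst) (b, y)
      (hasDerivAt_cb h.pos h.mass_pos.ne').differentiableAt differentiableAt_fst
  have hP : DifferentiableAt ℝ (fun p : ℝ × ℝ => Tinv Phi p.2) (b, y) :=
    DifferentiableAt.comp (g := Tinv Phi) (f := Prod.snd) (b, y)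
      (hasDerivAt_Tinv continuous_Phi hy).differentiableAt differentiableAt_snd
  have h2 := ((hP.sub (hL.const_mul (tau χ M Phi))).const_mul (-1)).add
    (hc.mul (hU.sub (hL.const_mul (tau χ M (Lam Q)))))
  refine h2.congr_of_eventuallyEq ?_
  filter_upwards [continuous_fst.continuousAt.eventually h.eventually] with p hp
  exact hp p.2

theorem _root_.CriticalWave.cb_eq_div (χ : ℝ → ℝ) (b : ℝ) : cb χ b = 32 / massN χ b := by rw [cb_eq, ip_Phi_LamQ]

theorem cb_pos (h : Admissible χ M b) : 0 < cb χ b := by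
  rw [cb_eq_div]; have := h.mass_pos; positivity

theorem cb_le (h : Admissible χ M b) : cb χ b ≤ 32 / |log b| := by
  rw [cb_eq_div]
  have := h.log_ge
  have := h.mass_ge
  gcongr

theorem ip_T1 (h : Admissible χ M b) : ip (T1 χ M b) (phiM χ M) = 0 := by
  obtain ⟨kP, hkP, hP⟩ := exists_Tinv_Phi_bound
  obtain ⟨kU, hkU, hU⟩ := exists_Tinv_cutLam_bound (χ := χ); rw [T1_eq_Tperp]
  refine ip_Tperp (A := kP + cb χ b * (kU * |log b|)) h.one_le h.massM_ge ?_ fun y hy => ?_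
  · rw [source_eq]
    exact (continuous_const.mul continuous_Phi).add (continuous_const.mul (continuous_cutLam' b))
  · rw [source_eq, Tinv_add continuous_Phi (continuous_cutLam' b)]
    refine (abs_add_le _ _).trans (add_le_add ?_ ?_)
    · rw [abs_mul, abs_neg, abs_one, one_mul]; exact hP y hy
    · rw [abs_mul, abs_of_pos h.cb_pos]
      exact mul_le_mul_of_nonneg_left (hU b y h.pos h.log_ge h.lt_one hy) h.cb_pos.le

end Admissible

/-- For fixed `M` and small `b` the profile `T₁` and its scaled derivative `b ∂_b T₁` are bounded,
and `T₁` is small in the range `1 ≪ y ≤ 1 / b`. -/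
theorem exists_T1_bound (hM : 1 ≤ M) (hm : 16 ≤ massM χ M) :
    ∃ C b₁ : ℝ, 1 ≤ C ∧ 0 < b₁ ∧ ∀ b, 0 < b → b < b₁ → Admissible χ M b ∧
      (∀ y, 0 < y → |T1 χ M b y| ≤ C ∧ b * |dT1 χ M b y| ≤ C) ∧
      ∀ y, 0 < y → b * y ≤ 1 →
        |T1 χ M b y| ≤ C * (1 / |log b| + 1 / (b * |log b| * y) + 1 / (1 + y)) := by
  obtain ⟨Cm, b₁, hCm, hb1, hb1', hcb⟩ := exists_cb_bound (χ := χ)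
  obtain ⟨CT, b₂, hCT, hb2, hTt⟩ := exists_Ttilde_bound (χ := χ)
  obtain ⟨kP, hkP, hP⟩ := exists_Tinv_Phi_bound
  obtain ⟨kU, hkU, hU⟩ := exists_Tinv_cutLam_bound (χ := χ)
  obtain ⟨kD, hkD, hD⟩ := exists_Tinv_dcutLam_bound (χ := χ)
  set τ₁ := tau χ M Phi
  set τ₂ := tau χ M (Lam Q)
  have hM0 : 0 < M := by linarith
  have hkP0 : 0 < kP := by linarith
  have hkU0 : 0 < kU := by linarith
  have hkD0 : 0 < kD := by linarith
  have hCT0 : 0 < CT := by linarith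
  have hCm0 : 0 < Cm := by linarith
  set D := kP + |τ₁| + 32 * (kU + |τ₂|) + 32 * Cm * (kU + |τ₂|) + 32 * kD
    + CT + 8 * (|τ₁| + 32 * |τ₂|) with hDd
  refine ⟨D, min (min b₁ b₂) (1 / (4 * M)), ?_, by positivity, fun b hb0 hb => ?_⟩
  · have : 0 ≤ kU + |τ₂| := by positivity
    have : 0 ≤ Cm * (kU + |τ₂|) := by positivity
    have := abs_nonneg τ₁
    have := abs_nonneg τ₂; rw [hDd]; linarith
  have hbb1 : b < b₁ := hb.trans_le ((min_le_left _ _).trans (min_le_left _ _))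
  have hbb2 : b < b₂ := hb.trans_le ((min_le_left _ _).trans (min_le_right _ _))
  have hb4 : 4 * M * b < 1 := by
    have := hb.trans_le (min_le_right _ _); rw [lt_div_iff₀ (by positivity)] at this
    linarith
  obtain ⟨hL, -, hN, hdN, -⟩ := hcb b hb0 hbb1
  have ha : Admissible χ M b := ⟨hM, hm, hb0, hbb1.trans hb1', hL, hb4, hN⟩
  refine ⟨ha, fun y hy => ⟨?_, ?_⟩, fun y hy hby => ?_⟩
  all_goals
    set L := |log b| with hLd
    have hL0 : 0 < L := by linarith
    have hcb0 := ha.cb_pos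
    have hcbL : cb χ b ≤ 32 / L := ha.cb_le
    have hΛ := abs_LamQ_le_one y
    have hUp : |Tperp χ M (cutLam χ b) y| ≤ (kU + |τ₂|) * L := by
      unfold Tperp; rw [tau_cutLam hM hb0 hb4]
      refine (abs_sub _ _).trans ?_
      rw [abs_mul]
      have h1 := hU b y hb0 hL ha.lt_one hy
      have h2 : |τ₂| * |Lam Q y| ≤ |τ₂| * L := by gcongr; linarith
      linarith
    have hτ1 := abs_nonneg τ₁
    have hτ2 := abs_nonneg τ₂
    have hx1 : 0 ≤ Cm * (kU + |τ₂|) := by positivity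
  · have hP1 : |Tperp χ M Phi y| ≤ kP + |τ₁| := by
      unfold Tperp
      refine (abs_sub _ _).trans (add_le_add (hP y hy) ?_)
      rw [abs_mul]; exact mul_le_of_le_one_right (abs_nonneg _) hΛ
    rw [ha.T1_eq]
    refine (abs_add_le _ _).trans ?_
    rw [abs_mul, abs_mul, abs_neg, abs_one, one_mul, abs_of_pos hcb0]
    have h2 : cb χ b * |Tperp χ M (cutLam χ b) y| ≤ 32 * (kU + |τ₂|) := by
      calc cb χ b * |Tperp χ M (cutLam χ b) y| ≤ 32 / L * ((kU + |τ₂|) * L) := by gcongr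
        _ = _ := by field_simp
    rw [hDd]; linarith
  · have hd : |dcb χ b| ≤ 32 * Cm / (b * L ^ 2) := by
      unfold dcb
      rw [abs_div, abs_neg, abs_mul, abs_of_pos (by norm_num : (0 : ℝ) < 32),
        abs_of_nonneg (by positivity : 0 ≤ massN χ b ^ 2)]
      calc 32 * |dmassN χ b| / massN χ b ^ 2 ≤ 32 * (Cm / b) / L ^ 2 := by gcongr
        _ = _ := by field_simp
    have hDp : |Tperp χ M (dcutLam χ b) y| ≤ kD / b := by
      unfold Tperp; rw [tau_dcutLam hM hb0 hb4, zero_mul, sub_zero]; exact hD b y hb0 ha.lt_one hy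
    have h3 : |dT1 χ M b y| ≤ 32 * Cm / (b * L ^ 2) * ((kU + |τ₂|) * L) + 32 / L * (kD / b) := by
      unfold dT1
      refine (abs_add_le _ _).trans ?_
      rw [abs_mul, abs_mul, abs_of_pos hcb0]
      gcongr
    calc b * |dT1 χ M b y|
        ≤ b * (32 * Cm / (b * L ^ 2) * ((kU + |τ₂|) * L) + 32 / L * (kD / b)) := by gcongr
      _ = (32 * Cm * (kU + |τ₂|) + 32 * kD) / L := by field_simp
      _ ≤ (32 * Cm * (kU + |τ₂|) + 32 * kD) / 1 := by gcongr
      _ ≤ D := by rw [hDd, div_one]; linarith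
  · have h1 := hTt b hb0 hbb2 y hy hby
    have e : T1 χ M b y = ((-1) * Tinv Phi y + cb χ b * Tinv (cutLam χ b) y)
        + (τ₁ - cb χ b * τ₂) * Lam Q y := by
      rw [ha.T1_eq]
      unfold Tperp; rw [tau_cutLam hM hb0 hb4]; ring
    rw [e]
    have h2 : |(τ₁ - cb χ b * τ₂) * Lam Q y| ≤ (|τ₁| + 32 * |τ₂|) * (8 * (1 / (1 + y))) := by
      rw [abs_mul]
      have h3 : cb χ b ≤ 32 := hcbL.trans (by rw [div_le_iff₀ hL0]; linarith)
      gcongr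
      · refine (abs_sub _ _).trans ?_
        rw [abs_mul, abs_of_pos hcb0]
        gcongr
      · refine (abs_LamQ_le y).trans ?_
        have h4 := Q_mul_le y
        have := Q_pos y
        have := Q_le_one y; rw [mul_one_div, le_div_iff₀ (by positivity)]
        rcases le_total y 1 with h5 | h5 <;> nlinarith
    have p1 : 0 ≤ 1 / L := by positivity
    have p2 : 0 ≤ 1 / (b * L * y) := by positivity
    have p3 : 0 ≤ 1 / (1 + y) := by positivity
    have hDC' : CT + 8 * (|τ₁| + 32 * |τ₂|) ≤ D := by rw [hDd]; linarith
    have hDC : CT ≤ D := by linarith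
    calc _ ≤ CT * (1 / L + 1 / (b * L * y) + 1 / (1 + y))
          + (|τ₁| + 32 * |τ₂|) * (8 * (1 / (1 + y))) :=
        (abs_add_le _ _).trans (add_le_add h1 h2)
      _ = CT * (1 / L) + CT * (1 / (b * L * y))
          + (CT + 8 * (|τ₁| + 32 * |τ₂|)) * (1 / (1 + y)) := by ring
      _ ≤ D * (1 / L) + D * (1 / (b * L * y)) + D * (1 / (1 + y)) := by gcongr
      _ = _ := by ring

/-! ### Regularity of the profile `P_{B₁}` -/

/-- A function continuous away from the origin, `O(1 / y)` at the origin and compactly supported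
is square integrable. -/
theorem memLp_of_continuousOn {h : ℝ → ℝ} {δ : ℝ} (hc : ContinuousOn h (Ioi 0)) (hδ : 0 < δ)
    (h1 : ∀ y, 0 < y → y < δ → |y * h y| ≤ C) (h0 : ∀ y, R < y → h y = 0) :
    MemLp h 2 ϱ := by
  obtain ⟨B, -, hB⟩ := exists_abs_le (a := δ) (b := R) (hc.mono fun y hy => hδ.trans_le hy.1)
  refine memLp_radial_of_le (R := R) (A := max (δ * C ^ 2) (|R| ^ 3 * B ^ 2)) (aesm_radial hc)
    (fun y hy hyR => ?_) h0
  rw [abs_of_nonneg (by positivity)]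
  rcases lt_or_ge y δ with hyd | hyd
  · refine le_trans ?_ (le_max_left _ _)
    calc y ^ 3 * h y ^ 2 = y * |y * h y| ^ 2 := by rw [sq_abs]; ring
      _ ≤ δ * C ^ 2 := by
        have := h1 y hy hyd
        gcongr
  · refine le_trans ?_ (le_max_right _ _)
    have h2 := hB y hyd hyR; rw [← sq_abs (h y)]
    have := hyR.trans (le_abs_self R)
    gcongr

theorem formDomain_of_contDiffOn {δ : ℝ} (hc : ContDiffOn ℝ 1 f (Ioi 0))
    (hδ : 0 < δ) (h1 : ∀ y, 0 < y → y < δ → |f y| ≤ C ∧ |y * deriv f y| ≤ C)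
    (h0 : ∀ y, R < y → f y = 0) : FormDomain f := by
  have hd : ∀ y, 0 < y → HasDerivAt f (deriv f y) y := fun y hy =>
    ((hc.differentiableOn (by simp)).differentiableAt (Ioi_mem_nhds hy)).hasDerivAt
  have hcd : ContinuousOn (deriv f) (Ioi 0) := hc.continuousOn_deriv_of_isOpen isOpen_Ioi le_rfl
  refine ⟨locallyAC_of_hasDerivAt hd hcd, ?_, ?_⟩
  · refine memLp_of_continuousOn (R := R) hcd hδ (fun y hy hyd => (h1 y hy hyd).2) fun y hy => ?_
    have : f =ᶠ[𝓝 y] fun _ => 0 := by filter_upwards [lt_mem_nhds hy] with z hz using h0 z hz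
    rw [this.deriv_eq, deriv_const]
  · refine memLp_of_continuousOn (R := R) (C := C) ?_ hδ (fun y hy hyd => ?_) fun y hy => ?_
    · exact hc.continuousOn.div (by fun_prop) fun y hy => by have : (0 : ℝ) < y := hy; positivity
    · have h2 := (h1 y hy hyd).1
      have h3 : |y * (f y / (1 + y))| = |f y| * (y / (1 + y)) := by
        rw [abs_mul, abs_div, abs_of_pos hy, abs_of_pos (by positivity : 0 < 1 + y)]; ring
      rw [h3]
      refine (mul_le_of_le_one_right (abs_nonneg _) ?_).trans h2
      rw [div_le_one (by positivity)]; linarith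
    · rw [h0 y hy, zero_div]

theorem formDomain_of_decay {f' : ℝ → ℝ} (hd : ∀ y, 0 < y → HasDerivAt f (f' y) y)
    (hc : ContinuousOn f' (Ioi 0)) (h1 : ∀ y, 0 < y → |f y| ≤ C * Q y)
    (h2 : ∀ y, 0 < y → |y * f' y| ≤ C * Q y) : FormDomain f := by
  have hcf : ContinuousOn f (Ioi 0) := fun y hy => (hd y hy).continuousAt.continuousWithinAt
  have key : ∀ y, 0 < y → y * (C * Q y) ^ 2 ≤ 256 * C ^ 2 / (1 + y ^ 2) := fun y hy => by
    rw [le_div_iff₀ (by positivity)]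
    have hq := Q_pos y
    calc y * (C * Q y) ^ 2 * (1 + y ^ 2) = C ^ 2 * (y * Q y) * (Q y * (1 + y ^ 2)) := by ring
      _ ≤ C ^ 2 * 4 * 8 := by
        have := mul_Q_le y
        have := Q_mul_le y
        gcongr
      _ ≤ 256 * C ^ 2 := by nlinarith [sq_nonneg C]
  refine ⟨locallyAC_of_hasDerivAt hd hc, ?_, ?_⟩
  · have : MemLp f' 2 ϱ := by
      refine memLp_radial_of_decay (A := 256 * C ^ 2) (aesm_radial hc) fun y hy => ?_
      refine le_trans ?_ (key y hy)
      rw [abs_of_nonneg (by positivity)]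
      calc y ^ 3 * f' y ^ 2 = y * |y * f' y| ^ 2 := by rw [sq_abs]; ring
        _ ≤ y * (C * Q y) ^ 2 := by
          have := h2 y hy
          gcongr
    exact this.ae_eq (ae_radial_of_forall fun y hy => (hd y hy).deriv.symm)
  · refine memLp_radial_of_decay (A := 256 * C ^ 2) (aesm_radial ?_) fun y hy => ?_
    · exact hcf.div (by fun_prop) fun y hy => by have : (0 : ℝ) < y := hy; positivity
    · refine le_trans ?_ (key y hy)
      rw [abs_of_nonneg (by positivity)]
      calc y ^ 3 * (f y / (1 + y)) ^ 2 = y * (|f y| * (y / (1 + y))) ^ 2 := by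
            rw [mul_pow, sq_abs]; ring
        _ ≤ y * ((C * Q y) * 1) ^ 2 := by
          have h3 := h1 y hy
          have h4 : y / (1 + y) ≤ 1 := by rw [div_le_one (by positivity)]; linarith
          have h5 := mul_le_mul h3 h4 (by positivity) ((abs_nonneg _).trans h3)
          gcongr
        _ = _ := by ring

theorem FormDomain.congr (hf : FormDomain f) (h : ∀ y, 0 < y → f y = g y) : FormDomain g where
  ac := hf.ac.congr h
  grad := hf.grad.ae_eq (ae_radial_of_forall fun y hy => by
    have : f =ᶠ[𝓝 y] g := by filter_upwards [lt_mem_nhds hy] with z hz using h z hz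
    exact this.deriv_eq)
  wt := hf.wt.ae_eq (ae_radial_of_forall fun y hy => by rw [h y hy])

theorem FormDomain.add (hf : FormDomain f) (hg : FormDomain g) : FormDomain fun y => f y + g y :=
  (hf.comb hg 1 1).congr fun y _ => by ring

theorem formDomain_Q : FormDomain Q := by
  refine formDomain_of_decay (C := 2) (fun y _ => (hasDerivAt_Q y).differentiableAt.hasDerivAt)
    ((contDiff_Q.of_le (m := 1) (by norm_cast)).continuous_deriv le_rfl).continuousOn (fun y _ => ?_) fun y _ => ?_
  · rw [abs_of_pos (Q_pos y)]; linarith [Q_pos y]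
  · rw [mul_deriv_Q]
    have h1 := Q_pos y
    have h2 := Q_le_one y; rw [abs_le]; constructor <;> nlinarith

theorem formDomain_LamQ : FormDomain (Lam Q) := by
  refine formDomain_of_decay (C := 6) (fun y _ => hasDerivAt_LamQ y)
    continuous_dLamQ.continuousOn (fun y _ => ?_) fun y _ => abs_mul_dLamQ_le y
  linarith [abs_LamQ_le y, Q_pos y]

theorem lap_congr (h : f =ᶠ[𝓝 y] g) : lap f y = lap g y := by
  unfold lap; rw [h.deriv.deriv_eq, h.deriv_eq]

theorem contDiffOn_two {f' f'' : ℝ → ℝ} (h1 : ∀ y, 0 < y → HasDerivAt f (f' y) y)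
    (h2 : ∀ y, 0 < y → HasDerivAt f' (f'' y) y) (hc : ContinuousOn f'' (Ioi 0)) :
    ContDiffOn ℝ 2 f (Ioi 0) := by
  have e1 : ∀ y ∈ Ioi (0 : ℝ), deriv f y = f' y := fun y hy => (h1 y hy).deriv
  have e2 : ∀ y ∈ Ioi (0 : ℝ), deriv f' y = f'' y := fun y hy => (h2 y hy).deriv
  rw [show (2 : WithTop ℕ∞) = 1 + 1 by norm_num, contDiffOn_succ_iff_deriv_of_isOpen isOpen_Ioi]
  refine ⟨fun y hy => (h1 y hy).differentiableAt.differentiableWithinAt, by simp, ?_⟩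
  have : ContDiffOn ℝ 1 f' (Ioi 0) := by
    rw [show (1 : WithTop ℕ∞) = 0 + 1 by norm_num, contDiffOn_succ_iff_deriv_of_isOpen isOpen_Ioi]
    refine ⟨fun y hy => (h2 y hy).differentiableAt.differentiableWithinAt, by simp, ?_⟩
    rw [contDiffOn_zero]; exact hc.congr e2
  exact this.congr e1

theorem continuousOn_lap (h : ContDiffOn ℝ 2 f (Ioi 0)) : ContinuousOn (lap f) (Ioi 0) := by
  have h1 := h.continuousOn_deriv_of_isOpen isOpen_Ioi (by norm_num)
  have h2 : ContDiffOn ℝ 1 (deriv f) (Ioi 0) :=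
    ((contDiffOn_succ_iff_deriv_of_isOpen (n := 1) isOpen_Ioi).1 h).2.2
  have h3 := h2.continuousOn_deriv_of_isOpen isOpen_Ioi le_rfl
  exact h3.add ((continuousOn_const.div continuousOn_id fun y hy => (ne_of_gt hy)).mul h1)

/-- The derivative of `Tperp`. -/
def dTperp (χ : ℝ → ℝ) (M : ℝ) (S : ℝ → ℝ) (y : ℝ) : ℝ := dTinv S y - tau χ M S * dLamQ y

theorem hasDerivAt_Tperp (hS : Continuous S) (hy : 0 < y) :
    HasDerivAt (Tperp χ M S) (dTperp χ M S y) y :=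
  (hasDerivAt_Tinv hS hy).sub ((hasDerivAt_LamQ y).const_mul _)

theorem hasDerivAt_cube_dTperp (hS : Continuous S) (hy : 0 < y) :
    HasDerivAt (fun y => y ^ 3 * dTperp χ M S y) (-(y ^ 3 * (V y * Tperp χ M S y + S y))) y := by
  have h := (hasDerivAt_cube_dTinv hS hy).sub ((hasDerivAt_cube_dLamQ y).const_mul (tau χ M S))
  have e : (fun y => y ^ 3 * dTperp χ M S y) = (fun y => y ^ 3 * dTinv S y)
      - fun y => tau χ M S * (y ^ 3 * dLamQ y) := by
    funext z; simp only [Pi.sub_apply, dTperp]; ring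
  rw [e]
  refine h.congr_deriv ?_
  unfold Tperp; ring

theorem hasDerivAt_dTperp (hS : Continuous S) (hy : 0 < y) : HasDerivAt (dTperp χ M S)
      (-(V y * Tperp χ M S y + S y) - 3 / y * dTperp χ M S y) y := by
  have h3 := (hasDerivAt_cube_dTperp (χ := χ) (M := M) hS hy).mul
    ((hasDerivAt_pow 3 y).inv (by positivity))
  have h4 : (fun y => y ^ 3 * dTperp χ M S y) * (fun y : ℝ => y ^ 3)⁻¹ =ᶠ[𝓝 y] dTperp χ M S := by
    filter_upwards [lt_mem_nhds hy] with z hz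
    simp only [Pi.mul_apply, Pi.inv_apply]; field_simp
  refine (h3.congr_of_eventuallyEq h4.symm).congr_deriv ?_
  simp only [Pi.inv_apply]; push_cast; field_simp; ring

theorem contDiffOn_Tperp (hS : Continuous S) : ContDiffOn ℝ 2 (Tperp χ M S) (Ioi 0) := by
  refine contDiffOn_two (fun y hy => hasDerivAt_Tperp hS hy) (fun y hy => hasDerivAt_dTperp hS hy) ?_
  have h1 : ContinuousOn (Tperp χ M S) (Ioi 0) := fun y hy =>
    (hasDerivAt_Tperp hS hy).continuousAt.continuousWithinAt
  have h2 : ContinuousOn (dTperp χ M S) (Ioi 0) := fun y hy =>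
    (hasDerivAt_dTperp hS hy).continuousAt.continuousWithinAt
  exact ((continuous_V.continuousOn.mul h1).add hS.continuousOn).neg.sub
    ((continuousOn_const.div continuousOn_id fun y hy => (ne_of_gt hy)).mul h2)

/-- `Tperp S`, its scaling derivative and its Laplacian are bounded near the origin. -/
theorem exists_Tperp_bound_zero (hS : Continuous S) : ∃ C, ∀ y, 0 < y → y < 1 →
    |Tperp χ M S y| ≤ C ∧ |y * dTperp χ M S y| ≤ C ∧ |V y * Tperp χ M S y + S y| ≤ C := by
  obtain ⟨k, hk, h⟩ := abs_Tinv_le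
  obtain ⟨A, hA0, hA⟩ := exists_abs_le (a := 0) (b := 1) hS.continuousOn
  set B := k * A * (1 + 1) + |tau χ M S| * 6 with hB
  have hB0 : 0 ≤ B := by positivity
  refine ⟨4 * B + A, fun y hy hy1 => ?_⟩
  obtain ⟨h1, h2⟩ := h S A y hy hA0.le fun s hs hsy => hA s hs.le (hsy.trans hy1.le)
  have h3 : k * A * (y ^ 2 + y ^ 4) ≤ k * A * (1 + 1) := by
    have := pow_le_one₀ (n := 2) hy.le hy1.le
    have := pow_le_one₀ (n := 4) hy.le hy1.le
    gcongr
  have hq := Q_pos y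
  have hq1 := Q_le_one y
  have h4 : |Tperp χ M S y| ≤ B := by
    unfold Tperp
    refine (abs_sub _ _).trans (add_le_add (h1.trans h3) ?_)
    rw [abs_mul]
    have := abs_LamQ_le_one y
    gcongr; linarith
  have h5 : |y * dTperp χ M S y| ≤ B := by
    unfold dTperp
    rw [show y * (dTinv S y - tau χ M S * dLamQ y) = y * dTinv S y - tau χ M S * (y * dLamQ y) by
      ring]
    refine (abs_sub _ _).trans (add_le_add (h2.trans h3) ?_)
    rw [abs_mul]
    have := abs_mul_dLamQ_le y
    gcongr; linarith
  refine ⟨by linarith, by linarith, (abs_add_le _ _).trans (add_le_add ?_ (hA y hy.le hy1.le))⟩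
  rw [abs_mul, abs_of_nonneg (V_nonneg y)]
  have : V y ≤ 3 := by unfold V; nlinarith
  have := abs_nonneg (Tperp χ M S y)
  have := V_nonneg y; nlinarith

theorem cut_B1 (χ : ℝ → ℝ) (b y : ℝ) : cut χ (B1 b) y = χ (b / |log b| * y) := by
  unfold cut B1
  congr 1
  rw [div_div_eq_mul_div]; ring

theorem continuous_source (b : ℝ) : Continuous (source χ b) := by
  rw [source_eq]
  exact (continuous_const.mul continuous_Phi).add (continuous_const.mul (continuous_cutLam' b))

namespace Admissible

theorem cut_eq_one (h : Admissible χ M b) (hy : b * y ≤ |log b|) : cut χ (B1 b) y = 1 := by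
  have := h.log_ge; rw [cut_B1, hχ.1.eq_one]; rw [div_mul_eq_mul_div, div_le_one (by linarith)]
  exact hy

theorem cut_eq_zero (h : Admissible χ M b) (hy : 2 * |log b| ≤ b * y) : cut χ (B1 b) y = 0 := by
  have := h.log_ge; rw [cut_B1, hχ.1.eq_zero]; rw [div_mul_eq_mul_div, le_div_iff₀ (by linarith)]
  exact hy

theorem PB1_eq (h : Admissible χ M b) (hy : b * y ≤ |log b|) :
    PB1 χ M b y = Q y + b ^ 2 * T1 χ M b y := by
  unfold PB1; rw [h.cut_eq_one hy, one_mul]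

theorem PB1_eq_Q (h : Admissible χ M b) (hy : 2 * |log b| ≤ b * y) : PB1 χ M b y = Q y := by
  unfold PB1; rw [h.cut_eq_zero hy, zero_mul, add_zero]

theorem hasDerivAt_cut (h : Admissible χ M b) (y : ℝ) : HasDerivAt (fun β => cut χ (B1 β) y)
      (deriv χ (b / |log b| * y) * ((1 / |log b| + 1 / |log b| ^ 2) * y)) b := by
  have hl : log b ≠ 0 := (Real.log_neg h.pos h.lt_one).ne
  have h1 : HasDerivAt (fun β => -(β / log β) * y) ((1 / |log b| + 1 / |log b| ^ 2) * y) b := by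
    refine ((((hasDerivAt_id b).div (Real.hasDerivAt_log h.pos.ne') hl).neg).mul_const y).congr_deriv ?_
    rw [h.abs_log]
    have := h.pos.ne'; simp only [id]; field_simp; ring
  have e : b / |log b| * y = -(b / log b) * y := by rw [h.abs_log, div_neg]
  have h2 := (hχ.1.hasDerivAt (-(b / log b) * y)).comp b h1; rw [e]
  refine h2.congr_of_eventuallyEq ?_
  filter_upwards [gt_mem_nhds h.lt_one, lt_mem_nhds h.pos] with β hβ hβ0
  rw [cut_B1, abs_of_neg (Real.log_neg hβ0 hβ), div_neg]; rfl

theorem hasDerivAt_PB1 (h : Admissible χ M b) (y : ℝ) :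
    HasDerivAt (fun β => PB1 χ M β y) (dbPB1 χ M b y) b := by
  have h1 := ((h.hasDerivAt_cut y).mul ((hasDerivAt_pow 2 b).mul (h.hasDerivAt_T1 y))).const_add
    (Q y)
  exact h1.differentiableAt.hasDerivAt

theorem dbPB1_eq (h : Admissible χ M b) (y : ℝ) :
    dbPB1 χ M b y = deriv χ (b / |log b| * y) * ((1 / |log b| + 1 / |log b| ^ 2) * y)
      * (b ^ 2 * T1 χ M b y)
      + cut χ (B1 b) y * (2 * b * T1 χ M b y + b ^ 2 * dT1 χ M b y) := by
  have h1 := ((h.hasDerivAt_cut y).mul ((hasDerivAt_pow 2 b).mul (h.hasDerivAt_T1 y))).const_add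
    (Q y)
  unfold dbPB1
  refine h1.deriv.trans ?_
  simp only [Pi.mul_apply]; norm_num

theorem dbPB1_eq' (h : Admissible χ M b) (hy : b * y ≤ |log b|) :
    dbPB1 χ M b y = 2 * b * T1 χ M b y + b ^ 2 * dT1 χ M b y := by
  have := h.log_ge; rw [h.dbPB1_eq, h.cut_eq_one hy, hχ.1.deriv_eq_zero_of_le]
  · ring
  · rw [div_mul_eq_mul_div, div_le_one (by linarith)]
    exact hy

theorem dbPB1_eq_zero (h : Admissible χ M b) (hy : 2 * |log b| ≤ b * y) : dbPB1 χ M b y = 0 := by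
  have := h.log_ge; rw [h.dbPB1_eq, h.cut_eq_zero hy, hχ.1.deriv_eq_zero_of_ge]
  · ring
  · rw [div_mul_eq_mul_div, le_div_iff₀ (by linarith)]
    exact hy

theorem differentiableAt_PB1 (h : Admissible χ M b) (hy : 0 < y) :
    DifferentiableAt ℝ (Function.uncurry (PB1 χ M)) (b, y) := by
  have hT := h.differentiableAt_T1 hy
  have hl : log b ≠ 0 := (Real.log_neg h.pos h.lt_one).ne
  have hq : DifferentiableAt ℝ (fun p : ℝ × ℝ => Q p.2) (b, y) :=
    DifferentiableAt.comp (g := Q) (f := Prod.snd) (b, y)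
      (hasDerivAt_Q y).differentiableAt differentiableAt_snd
  have hk : DifferentiableAt ℝ (fun p : ℝ × ℝ => -(p.1 / log p.1) * p.2) (b, y) := by
    have h0 : DifferentiableAt ℝ (fun p : ℝ × ℝ => p.1 / log p.1) (b, y) :=
      DifferentiableAt.comp (g := fun x => x / log x) (f := Prod.fst) (b, y)
        ((hasDerivAt_id b).div (Real.hasDerivAt_log h.pos.ne') hl).differentiableAt
        differentiableAt_fst
    exact h0.neg.mul differentiableAt_snd
  have hc : DifferentiableAt ℝ (fun p : ℝ × ℝ => χ (-(p.1 / log p.1) * p.2)) (b, y) :=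
    DifferentiableAt.comp (g := χ) (b, y) (hχ.1.hasDerivAt _).differentiableAt hk
  have h2 := hq.add (hc.mul ((differentiableAt_fst.pow 2).mul hT))
  refine h2.congr_of_eventuallyEq ?_
  filter_upwards [continuous_fst.continuousAt.eventually (gt_mem_nhds h.lt_one),
    continuous_fst.continuousAt.eventually (lt_mem_nhds h.pos)] with p hβ hβ0
  show PB1 χ M p.1 p.2 = _
  unfold PB1; rw [cut_B1, abs_of_neg (Real.log_neg hβ0 hβ), div_neg]; rfl

theorem contDiffOn_PB1 (b : ℝ) : ContDiffOn ℝ 2 (PB1 χ M b) (Ioi 0) := by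
  have h1 : ContDiffOn ℝ 2 (T1 χ M b) (Ioi 0) := contDiffOn_Tperp (continuous_source b)
  have h2 : ContDiff ℝ 2 χ := hχ.1.smooth.of_le (by norm_cast)
  have h3 : ContDiff ℝ 2 Q := contDiff_Q.of_le (by norm_cast)
  have h4 : ContDiff ℝ 2 (cut χ (B1 b)) := h2.comp (contDiff_id.div_const _)
  exact h3.contDiffOn.add (h4.contDiffOn.mul (contDiffOn_const.mul h1))

theorem contDiffOn_dbPB1 (h : Admissible χ M b) : ContDiffOn ℝ 1 (dbPB1 χ M b) (Ioi 0) := by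
  have h1 : ContDiffOn ℝ 1 (T1 χ M b) (Ioi 0) :=
    (contDiffOn_Tperp (continuous_source b)).of_le (by norm_num)
  have h1' : ContDiffOn ℝ 1 (dT1 χ M b) (Ioi 0) := by
    rw [h.dT1_eq]
    refine (contDiffOn_Tperp ?_).of_le (by norm_num)
    exact (continuous_const.mul (continuous_cutLam' b)).add
      (continuous_const.mul (continuous_dcutLam' b))
  have h2 : ContDiff ℝ 1 χ := hχ.1.smooth.of_le (by norm_cast)
  have h2' : ContDiff ℝ 1 (deriv χ) := by
    have := (contDiff_succ_iff_deriv (n := 1)).1 (hχ.1.smooth.of_le (by norm_cast))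
    exact this.2.2
  have h4 : ContDiff ℝ 1 (cut χ (B1 b)) := h2.comp (contDiff_id.div_const _)
  have h5 : ContDiff ℝ 1 fun y => deriv χ (b / |log b| * y) := h2'.comp (contDiff_const.mul contDiff_id)
  have h6 : ContDiff ℝ 1 fun y : ℝ => (1 / |log b| + 1 / |log b| ^ 2) * y :=
    contDiff_const.mul contDiff_id
  have h7 := ((h5.mul h6).contDiffOn.mul ((contDiffOn_const (c := b ^ 2)).mul h1)).add
    (h4.contDiffOn.mul (((contDiffOn_const (c := 2 * b)).mul h1).add
      ((contDiffOn_const (c := b ^ 2)).mul h1')))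
  exact h7.congr fun y _ => h.dbPB1_eq y

/-- The cut-off `χ_{B₁}` is trivial on `b y < |log b|`. -/
theorem eventuallyEq_PB1 (h : Admissible χ M b) (hy : b * y < |log b|) :
    PB1 χ M b =ᶠ[𝓝 y] fun y => Q y + b ^ 2 * T1 χ M b y := by
  filter_upwards [(continuous_const.mul continuous_id).continuousAt.eventually_lt_const hy] with z hz
  exact h.PB1_eq hz.le

theorem hasDerivAt_Q_add_T1 (b : ℝ) (hy : 0 < y) : HasDerivAt (fun y => Q y + b ^ 2 * T1 χ M b y)
      (deriv Q y + b ^ 2 * dTperp χ M (source χ b) y) y :=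
  (hasDerivAt_Q y).differentiableAt.hasDerivAt.add
    ((hasDerivAt_Tperp (continuous_source b) hy).const_mul _)

theorem lap_PB1 (h : Admissible χ M b) (hy0 : 0 < y) (hy : b * y < |log b|) :
    lap (PB1 χ M b) y = -Q y ^ 3 + b ^ 2 * -(V y * T1 χ M b y + source χ b y) := by
  rw [lap_congr (h.eventuallyEq_PB1 hy)]
  refine lap_eq_of_hasDerivAt hy0 (fun z hz => hasDerivAt_Q_add_T1 b hz) ?_
  have hQ2 : HasDerivAt (fun y => y ^ 3 * deriv Q y) (y ^ 3 * -Q y ^ 3) y := by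
    have e : (fun y => y ^ 3 * deriv Q y) = fun y => y ^ 2 * (2 * Q y ^ 2 - 2 * Q y) := by
      funext z; rw [← mul_deriv_Q]; ring
    rw [e]
    refine ((hasDerivAt_pow 2 y).mul ((((hasDerivAt_Q y).pow 2).const_mul 2).sub
      ((hasDerivAt_Q y).const_mul 2))).congr_deriv ?_
    have e2 : y ^ 2 * Q y = 8 - 8 * Q y := by linarith [sq_mul_Q y]
    simp only [Pi.pow_apply, Pi.sub_apply]; push_cast
    linear_combination (y * Q y / 2) * e2
  have h5 := hQ2.add ((hasDerivAt_cube_dTperp (χ := χ) (M := M) (continuous_source (χ := χ) b) hy0).const_mul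
    (b ^ 2))
  have e : (fun y => y ^ 3 * (deriv Q y + b ^ 2 * dTperp χ M (source χ b) y))
      = (fun y => y ^ 3 * deriv Q y) + fun y => b ^ 2 * (y ^ 3 * dTperp χ M (source χ b) y) := by
    funext z; simp only [Pi.add_apply]; ring
  rw [e]
  refine h5.congr_deriv ?_
  rw [T1_eq_Tperp]; ring

theorem exists_PB1_bound_zero (h : Admissible χ M b) : ∃ C, ∀ y, 0 < y → y < 1 →
    |PB1 χ M b y| ≤ C ∧ |y * deriv (PB1 χ M b) y| ≤ C ∧ |lap (PB1 χ M b) y| ≤ C := by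
  obtain ⟨C, hC⟩ := exists_Tperp_bound_zero (χ := χ) (M := M) (continuous_source (χ := χ) b)
  refine ⟨2 + b ^ 2 * C, fun y hy hy1 => ?_⟩
  have hb := h.pos
  have hq := Q_pos y
  have hq1 := Q_le_one y
  have hby : b * y < |log b| := by nlinarith [h.log_ge, h.lt_one]
  have he := h.eventuallyEq_PB1 hby
  obtain ⟨h1, h2, h3⟩ := hC y hy hy1
  refine ⟨?_, ?_, ?_⟩
  · rw [he.eq_of_nhds]
    refine (abs_add_le _ _).trans (add_le_add ?_ ?_)
    · rw [abs_of_pos hq]; linarith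
    · rw [abs_pow_mul hb]; exact mul_le_mul_of_nonneg_left h1 (by positivity)
  · rw [he.deriv_eq, (hasDerivAt_Q_add_T1 b hy).deriv, mul_add, mul_deriv_Q]
    refine (abs_add_le _ _).trans (add_le_add ?_ ?_)
    · rw [abs_le]; constructor <;> nlinarith
    · rw [mul_left_comm, abs_pow_mul hb]; exact mul_le_mul_of_nonneg_left h2 (by positivity)
  · rw [h.lap_PB1 hy hby]
    refine (abs_add_le _ _).trans (add_le_add ?_ ?_)
    · rw [abs_neg, abs_of_pos (by positivity)]
      exact (pow_le_one₀ hq.le hq1).trans (by norm_num)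
    · rw [abs_mul, abs_neg, abs_of_pos (pow_pos hb 2)]
      exact mul_le_mul_of_nonneg_left h3 (by positivity)

end Admissible

namespace Admissible
theorem formDomain_PB1 (h : Admissible χ M b) : FormDomain (PB1 χ M b) := by
  obtain ⟨C, hC⟩ := h.exists_PB1_bound_zero
  have hb := h.pos
  have hf : FormDomain fun y => PB1 χ M b y - Q y := by
    have hc := ((contDiffOn_PB1 (χ := χ) (M := M) b).of_le (m := 1) (by norm_num)).sub
      (contDiff_Q (n := 1)).contDiffOn
    refine formDomain_of_contDiffOn (δ := 1) (C := C + 2) (R := 2 * |log b| / b) hc one_pos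
      (fun y hy hy1 => ?_) fun y hy => ?_
    · obtain ⟨h1, h2, -⟩ := hC y hy hy1
      have hq := Q_pos y
      have hq1 := Q_le_one y
      have hd : deriv (fun y => PB1 χ M b y - Q y) y = deriv (PB1 χ M b) y - deriv Q y :=
        deriv_fun_sub (((contDiffOn_PB1 (M := M) b).differentiableOn (by simp)).differentiableAt
          (Ioi_mem_nhds hy)) (hasDerivAt_Q y).differentiableAt
      refine ⟨(abs_sub _ _).trans (add_le_add h1 ?_), ?_⟩
      · rw [abs_of_pos hq]; linarith
      · rw [hd, mul_sub, mul_deriv_Q]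
        refine (abs_sub _ _).trans (add_le_add h2 ?_)
        rw [abs_le]; constructor <;> nlinarith
    · rw [div_lt_iff₀ hb] at hy; rw [h.PB1_eq_Q (by linarith), sub_self]
  exact (hf.add formDomain_Q).congr fun y _ => by ring

theorem hasDerivAt_PB1_right (b : ℝ) (hy : 0 < y) :
    HasDerivAt (PB1 χ M b) (deriv (PB1 χ M b) y) y :=
  (((contDiffOn_PB1 (M := M) b).differentiableOn (by simp)).differentiableAt
    (Ioi_mem_nhds hy)).hasDerivAt

theorem contDiffOn_deriv_PB1 (b : ℝ) : ContDiffOn ℝ 1 (deriv (PB1 χ M b)) (Ioi 0) :=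
  ((contDiffOn_succ_iff_deriv_of_isOpen (n := 1) isOpen_Ioi).1 (contDiffOn_PB1 b)).2.2

theorem formDomain_Lam_PB1 (h : Admissible χ M b) : FormDomain (Lam (PB1 χ M b)) := by
  obtain ⟨C, hC⟩ := h.exists_PB1_bound_zero
  have hb := h.pos
  have hc2 := contDiffOn_deriv_PB1 (χ := χ) (M := M) b
  have hc : ContDiffOn ℝ 1 (Lam (PB1 χ M b)) (Ioi 0) :=
    ((contDiffOn_PB1 (M := M) b).of_le (by norm_num)).add (contDiffOn_id.mul hc2)
  have hf : FormDomain fun y => Lam (PB1 χ M b) y - Lam Q y := by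
    refine formDomain_of_contDiffOn (δ := 1) (C := 2 * C + 6) (R := 2 * |log b| / b)
      (hc.sub contDiff_LamQ.contDiffOn) one_pos (fun y hy hy1 => ?_) fun y hy => ?_
    · obtain ⟨h1, h2, h3⟩ := hC y hy hy1
      have hC0 : 0 ≤ C := (abs_nonneg _).trans h1
      have hq := Q_pos y
      have hq1 := Q_le_one y
      have hd2 : HasDerivAt (deriv (PB1 χ M b)) (deriv (deriv (PB1 χ M b)) y) y :=
        ((hc2.differentiableOn (by simp)).differentiableAt (Ioi_mem_nhds hy)).hasDerivAt
      have hd : HasDerivAt (fun y => Lam (PB1 χ M b) y - Lam Q y)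
          (deriv (PB1 χ M b) y + (1 * deriv (PB1 χ M b) y + y * deriv (deriv (PB1 χ M b)) y)
            - dLamQ y) y :=
        ((hasDerivAt_PB1_right b hy).add ((hasDerivAt_id y).mul hd2)).sub (hasDerivAt_LamQ y)
      refine ⟨(abs_sub _ _).trans (add_le_add ?_ ?_), ?_⟩
      · unfold Lam; exact (abs_add_le _ _).trans (by linarith)
      · exact (abs_LamQ_le_one y).trans (by norm_num)
      · rw [hd.deriv]
        have e : y * (deriv (PB1 χ M b) y + (1 * deriv (PB1 χ M b) y
            + y * deriv (deriv (PB1 χ M b)) y) - dLamQ y)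
            = y ^ 2 * lap (PB1 χ M b) y - y * deriv (PB1 χ M b) y - y * dLamQ y := by
          unfold lap; field_simp; ring
        rw [e]
        refine (abs_sub _ _).trans (add_le_add ((abs_sub _ _).trans ?_) ?_)
        · rw [abs_pow_mul hy]
          have h4 : y ^ 2 ≤ 1 := pow_le_one₀ hy.le hy1.le
          have h5 : y ^ 2 * |lap (PB1 χ M b) y| ≤ 1 * C := by gcongr
          linarith
        · refine (abs_mul_dLamQ_le y).trans ?_
          linarith
    · rw [div_lt_iff₀ hb] at hy
      have he : PB1 χ M b =ᶠ[𝓝 y] Q := by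
        have : ∀ᶠ z in 𝓝 y, 2 * |log b| < z * b :=
          (continuous_id.mul continuous_const).continuousAt.eventually (lt_mem_nhds hy)
        filter_upwards [this] with z hz
        exact h.PB1_eq_Q (by linarith)
      unfold Lam; rw [he.eq_of_nhds, he.deriv_eq, sub_self]
  exact (hf.add formDomain_LamQ).congr fun y _ => by ring

theorem memLp_lap_PB1 (h : Admissible χ M b) : MemLp (lap (PB1 χ M b)) 2 ϱ := by
  obtain ⟨C, hC⟩ := h.exists_PB1_bound_zero
  have hb := h.pos
  have hc : Continuous fun y => Q y ^ 3 := by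
    have := continuous_Q; fun_prop
  have h1 : MemLp (fun y => lap (PB1 χ M b) y + Q y ^ 3) 2 ϱ := by
    refine memLp_of_continuousOn (δ := 1) (C := C + 1) (R := 2 * |log b| / b)
      ((continuousOn_lap (contDiffOn_PB1 b)).add hc.continuousOn) one_pos
      (fun y hy hy1 => ?_) fun y hy => ?_
    · have hq := Q_pos y
      have h2 : |lap (PB1 χ M b) y + Q y ^ 3| ≤ C + 1 := by
        refine (abs_add_le _ _).trans (add_le_add (hC y hy hy1).2.2 ?_)
        rw [abs_of_pos (by positivity)]
        exact pow_le_one₀ hq.le (Q_le_one y)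
      rw [abs_mul, abs_of_pos hy]
      calc y * |lap (PB1 χ M b) y + Q y ^ 3| ≤ 1 * |lap (PB1 χ M b) y + Q y ^ 3| := by gcongr
        _ ≤ _ := by rw [one_mul]; exact h2
    · have hL := h.log_ge
      have hy0 : 0 < y := lt_trans (by positivity) hy
      rw [div_lt_iff₀ hb] at hy
      have he : PB1 χ M b =ᶠ[𝓝 y] Q := by
        have : ∀ᶠ z in 𝓝 y, 2 * |log b| < z * b :=
          (continuous_id.mul continuous_const).continuousAt.eventually (lt_mem_nhds hy)
        filter_upwards [this] with z hz
        exact h.PB1_eq_Q (by linarith)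
      rw [lap_congr he, lap_Q hy0]; ring
  have h2 : MemLp (fun y => Q y ^ 3) 2 ϱ := by
    refine memLp_radial_of_decay (A := 512) hc.aestronglyMeasurable fun y hy => ?_
    have hq := Q_pos y; rw [abs_of_pos (by positivity), le_div_iff₀ (by positivity)]
    calc y ^ 3 * (Q y ^ 3) ^ 2 * (1 + y ^ 2)
        = (y * Q y) ^ 3 * (Q y * (1 + y ^ 2)) * Q y ^ 2 := by ring
      _ ≤ 4 ^ 3 * 8 * 1 := by
        have := mul_Q_le y
        have := Q_mul_le y
        have := pow_le_one₀ (n := 2) hq.le (Q_le_one y)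
        gcongr
      _ = 512 := by norm_num
  exact (h1.sub h2).ae_eq (ae_radial_of_forall fun y _ => by simp)

theorem abs_dbPB1_le (h : Admissible χ M b) {Cχ : ℝ} (hCχ : ∀ z, |χ z| ≤ Cχ ∧ |deriv χ z| ≤ Cχ)
    (hT : ∀ y, 0 < y → |T1 χ M b y| ≤ C ∧ b * |dT1 χ M b y| ≤ C) (hy : 0 < y) :
    |dbPB1 χ M b y| ≤ 7 * Cχ * C * b := by
  have hb := h.pos
  have hL := h.log_ge
  have hL0 : 0 < |log b| := by linarith
  obtain ⟨h1, h2⟩ := hT y hy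
  have hC0 : 0 ≤ C := (abs_nonneg _).trans h1
  have hCχ0 : 0 ≤ Cχ := (abs_nonneg _).trans (hCχ 0).1
  rcases le_total (2 * |log b|) (b * y) with h3 | h3
  · rw [h.dbPB1_eq_zero h3, abs_zero]; positivity
  · rw [h.dbPB1_eq]
    have h4 : (1 / |log b| + 1 / |log b| ^ 2) * y ≤ 4 / b := by
      have h5 : 1 / |log b| ^ 2 ≤ 1 / |log b| := by
        apply one_div_le_one_div_of_le hL0; nlinarith
      rw [le_div_iff₀ hb]
      calc (1 / |log b| + 1 / |log b| ^ 2) * y * b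
          ≤ (1 / |log b| + 1 / |log b|) * y * b := by gcongr
        _ = 2 / |log b| * (b * y) := by ring
        _ ≤ 2 / |log b| * (2 * |log b|) := by gcongr
        _ = 4 := by field_simp; norm_num
    refine (abs_add_le _ _).trans ?_
    rw [abs_mul, abs_mul (deriv χ _),
      abs_of_nonneg (by positivity : 0 ≤ (1 / |log b| + 1 / |log b| ^ 2) * y), abs_mul (b ^ 2),
      abs_of_pos (pow_pos hb 2), abs_mul (cut χ (B1 b) y)]
    have h6 : |2 * b * T1 χ M b y + b ^ 2 * dT1 χ M b y| ≤ 3 * C * b := by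
      refine (abs_add_le _ _).trans ?_
      rw [abs_mul (2 * b), abs_mul (b ^ 2), abs_of_pos (by positivity : 0 < 2 * b),
        abs_of_pos (pow_pos hb 2)]
      nlinarith
    calc |deriv χ (b / |log b| * y)| * ((1 / |log b| + 1 / |log b| ^ 2) * y)
          * (b ^ 2 * |T1 χ M b y|)
          + |cut χ (B1 b) y| * |2 * b * T1 χ M b y + b ^ 2 * dT1 χ M b y|
        ≤ Cχ * (4 / b) * (b ^ 2 * C) + Cχ * (3 * C * b) := by
          gcongr
          · exact (hCχ _).2
          · exact (hCχ _).1
      _ = _ := by field_simp; ring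

theorem formDomain_dbPB1 (h : Admissible χ M b) : FormDomain (dbPB1 χ M b) := by
  have hb := h.pos
  have hS' : Continuous fun s => dcb χ b * cutLam χ b s + cb χ b * dcutLam χ b s :=
    (continuous_const.mul (continuous_cutLam' b)).add (continuous_const.mul (continuous_dcutLam' b))
  obtain ⟨C, hC⟩ := exists_Tperp_bound_zero (χ := χ) (M := M) (continuous_source (χ := χ) b)
  obtain ⟨C', hC'⟩ := exists_Tperp_bound_zero (χ := χ) (M := M) hS'
  refine formDomain_of_contDiffOn (δ := 1) (C := 2 * b * C + b ^ 2 * C')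
    (R := 2 * |log b| / b) h.contDiffOn_dbPB1 one_pos (fun y hy hy1 => ?_) fun y hy => ?_
  · obtain ⟨h1, h2, -⟩ := hC y hy hy1
    obtain ⟨h1', h2', -⟩ := hC' y hy hy1
    have he : dbPB1 χ M b =ᶠ[𝓝 y] fun y => 2 * b * Tperp χ M (source χ b) y
        + b ^ 2 * Tperp χ M (fun s => dcb χ b * cutLam χ b s + cb χ b * dcutLam χ b s) y := by
      filter_upwards [gt_mem_nhds hy1, lt_mem_nhds hy] with z hz hz0
      rw [h.dbPB1_eq' (by nlinarith [h.log_ge, h.lt_one]), h.dT1_eq, T1_eq_Tperp]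
    have hd := ((hasDerivAt_Tperp (χ := χ) (M := M) (continuous_source (χ := χ) b) hy).const_mul
      (2 * b)).add ((hasDerivAt_Tperp (χ := χ) (M := M) hS' hy).const_mul (b ^ 2))
    have hb2 : 0 < 2 * b := by positivity
    have hb3 : 0 < b ^ 2 := by positivity
    constructor
    · rw [he.eq_of_nhds]
      refine (abs_add_le _ _).trans ?_
      rw [abs_mul (2 * b), abs_mul (b ^ 2), abs_of_pos hb2, abs_of_pos hb3]
      gcongr
    · rw [he.deriv_eq]
      refine (congrArg (fun x => |y * x|) hd.deriv).le.trans ?_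
      simp only [mul_add]; rw [mul_left_comm y (2 * b), mul_left_comm y (b ^ 2)]
      refine (abs_add_le _ _).trans ?_
      rw [abs_mul (2 * b), abs_mul (b ^ 2), abs_of_pos hb2, abs_of_pos hb3]
      gcongr
  · rw [div_lt_iff₀ hb] at hy; exact h.dbPB1_eq_zero (by linarith)

theorem ip_dT1 (h : Admissible χ M b)
    (hT : ∀ y, 0 < y → |dT1 χ M b y| ≤ C) : ip (dT1 χ M b) (phiM χ M) = 0 := by
  rw [h.dT1_eq] at hT ⊢
  refine ip_Tperp (A := C + |tau χ M fun s => dcb χ b * cutLam χ b s + cb χ b * dcutLam χ b s|)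
    h.one_le h.massM_ge ((continuous_const.mul (continuous_cutLam' b)).add
      (continuous_const.mul (continuous_dcutLam' b))) fun y hy => ?_
  have h1 := hT y hy
  have h2 := abs_LamQ_le_one y
  unfold Tperp at h1
  set τ := tau χ M fun s => dcb χ b * cutLam χ b s + cb χ b * dcutLam χ b s
  set x := Tinv (fun s => dcb χ b * cutLam χ b s + cb χ b * dcutLam χ b s) y
  calc |x| = |(x - τ * Lam Q y) + τ * Lam Q y| := by ring_nf
    _ ≤ |x - τ * Lam Q y| + |τ * Lam Q y| := abs_add_le _ _
    _ ≤ C + |τ| := by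
      refine add_le_add h1 ?_
      rw [abs_mul]; exact mul_le_of_le_one_right (abs_nonneg _) h2

theorem ip_dbPB1 (h : Admissible χ M b)
    (hT : ∀ y, 0 < y → |T1 χ M b y| ≤ C ∧ b * |dT1 χ M b y| ≤ C) :
    ip (dbPB1 χ M b) (phiM χ M) = 0 := by
  have hb := h.pos
  have hM := h.one_le
  have hdT : ∀ y, 0 < y → |dT1 χ M b y| ≤ C / b := fun y hy => by
    rw [le_div_iff₀ hb]; linarith [(hT y hy).2]
  have h1 := h.ip_T1
  have h2 := h.ip_dT1 hdT
  have i1 : Integrable (fun y => T1 χ M b y * phiM χ M y) ϱ := by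
    refine integrable_mul_phiM (A := C) hM ?_ fun y hy => (hT y hy).1
    exact (contDiffOn_Tperp (continuous_source b)).continuousOn
  have i2 : Integrable (fun y => dT1 χ M b y * phiM χ M y) ϱ := by
    refine integrable_mul_phiM (A := C / b) hM ?_ hdT
    rw [h.dT1_eq]
    exact (contDiffOn_Tperp ((continuous_const.mul (continuous_cutLam' b)).add
      (continuous_const.mul (continuous_dcutLam' b)))).continuousOn
  rw [ip_eq_comb i1 i2 (2 * b) (b ^ 2) fun y _ => ?_, h1, h2]
  · ring
  rcases le_total y (2 * M) with hyM | hyM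
  · rw [h.dbPB1_eq' (by nlinarith [h.log_ge, h.four_mul])]; ring
  · rw [phiM_eq_zero hM hyM]; ring

/-- The profile and the ground state have the same product with `χ_M Φ`. -/
theorem ip_PB1 (h : Admissible χ M b)
    (hT : ∀ y, 0 < y → |T1 χ M b y| ≤ C) : ip (PB1 χ M b) (phiM χ M) = ip Q (phiM χ M) := by
  have hM := h.one_le
  have i1 : Integrable (fun y => T1 χ M b y * phiM χ M y) ϱ := by
    refine integrable_mul_phiM (A := C) hM ?_ hT
    exact (contDiffOn_Tperp (continuous_source b)).continuousOn
  have i2 : Integrable (fun y => Q y * phiM χ M y) ϱ :=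
    integrable_mul_phiM (A := 1) hM continuous_Q.continuousOn fun y _ => by
      rw [abs_of_pos (Q_pos y)]; exact Q_le_one y
  rw [ip_eq_comb i2 i1 1 (b ^ 2) fun y _ => ?_, h.ip_T1]
  · ring
  rcases le_total y (2 * M) with hyM | hyM
  · rw [h.PB1_eq (by nlinarith [h.log_ge, h.four_mul, h.pos])]; ring
  · rw [phiM_eq_zero hM hyM]; ring

end Admissible

/-! ### Test functions -/

/-- Integration by parts for the scaling operator against a compactly supported function. -/
theorem ip_Lam_left {f' Y : ℝ → ℝ} (hd : ∀ y, 0 < y → HasDerivAt f (f' y) y)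
    (hc : ContinuousOn f' (Ioi 0)) (hY : ContDiff ℝ 1 Y) (hR : 0 < R) (h0 : ∀ y, R ≤ y → Y y = 0)
    (hb : ∀ y, 0 < y → y ≤ R → |y * f y| ≤ A ∧ |y ^ 2 * f' y| ≤ A) :
    Integrable (fun y => Lam f y * Y y) ϱ ∧
    Integrable (fun y => f y * (Y y + Dop Y y)) ϱ ∧
    ip (Lam f) Y = -ip f (fun y => Y y + Dop Y y) := by
  have hcf : ContinuousOn f (Ioi 0) := fun y hy => (hd y hy).continuousAt.continuousWithinAt
  have hYc : Continuous Y := hY.continuous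
  have hYc' : Continuous (deriv Y) := hY.continuous_deriv le_rfl
  have hYd : ∀ y, HasDerivAt Y (deriv Y y) y := fun y => (hY.differentiable (by simp) y).hasDerivAt
  have hWc : Continuous fun y => Y y + Dop Y y := by unfold Dop; fun_prop
  obtain ⟨B, -, hB⟩ := exists_abs_le (a := 0) (b := R) hYc.continuousOn
  have hd0 : ∀ y, R < y → Y y + Dop Y y = 0 := fun y hy => by
    have : Y =ᶠ[𝓝 y] fun _ => 0 := by filter_upwards [lt_mem_nhds hy] with z hz using h0 z hz.le
    unfold Dop; rw [h0 y hy.le, this.deriv_eq, deriv_const, mul_zero, mul_zero, add_zero, add_zero]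
  have hL : ∀ y, 0 < y → Lam f y = f y + y * f' y := fun y hy => by unfold Lam; rw [(hd y hy).deriv]
  have hLc : ContinuousOn (Lam f) (Ioi 0) := (hcf.add (continuousOn_id.mul hc)).congr hL
  have hLb : ∀ y, 0 < y → y ≤ R → |y * Lam f y| ≤ 2 * A := fun y hy hyR => by
    rw [hL y hy, show y * (f y + y * f' y) = y * f y + y ^ 2 * f' y by ring]
    obtain ⟨h1, h2⟩ := hb y hy hyR; exact (abs_add_le _ _).trans (by linarith)
  have i1 := integrable_mul_of_bounded hLc hYc.continuousOn hLb fun y hy => h0 y hy.le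
  have i2 := integrable_mul_of_bounded hcf hWc.continuousOn (fun y hy hyR => (hb y hy hyR).1) hd0
  refine ⟨i1, i2, ?_⟩
  rw [eq_neg_iff_add_eq_zero]
  unfold ip
  rw [← integral_add i1 i2, integral_radial_eq_interval (R := R) hR.le fun y hy => by
    rw [hd0 y hy, h0 y hy.le]; ring]
  have hF : ∀ y ∈ Ioo 0 R, HasDerivAt (fun y => y ^ 4 * f y * Y y)
      (y ^ 3 * (Lam f y * Y y + f y * (Y y + Dop Y y))) y := fun y hy => by
    refine (((hasDerivAt_pow 4 y).mul (hd y hy.1)).mul (hYd y)).congr_deriv ?_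
    rw [hL y hy.1]
    unfold Dop; simp only [Pi.mul_apply]; push_cast; ring
  have hFc : ContinuousOn (fun y => y ^ 4 * f y * Y y) (Icc 0 R) := by
    intro y hy
    rcases hy.1.eq_or_lt with rfl | hy0
    · have h1 : Tendsto (fun y : ℝ => y ^ 3 * (A * B)) (𝓝[Icc 0 R] 0) (𝓝 0) := by
        have : Continuous fun y : ℝ => y ^ 3 * (A * B) := by fun_prop
        have := (this.tendsto 0).mono_left (nhdsWithin_le_nhds (s := Icc 0 R)); simpa using this
      have : Tendsto (fun y => y ^ 4 * f y * Y y) (𝓝[Icc 0 R] 0) (𝓝 0) := by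
        refine squeeze_zero_norm' ?_ h1
        filter_upwards [self_mem_nhdsWithin] with z hz
        rcases hz.1.eq_or_lt with rfl | hz0
        · simp
        · have h2 := (hb z hz0 hz.2).1
          have h3 := hB z hz.1 hz.2
          rw [Real.norm_eq_abs, show z ^ 4 * f z * Y z = z ^ 3 * ((z * f z) * Y z) by ring,
            abs_pow_mul hz0, abs_mul]
          have := (abs_nonneg _).trans h2
          gcongr
      show Tendsto _ _ _
      simpa using this
    · exact (((continuousAt_id.pow 4).mul (hcf.continuousAt (Ioi_mem_nhds hy0))).mul
        hYc.continuousAt).continuousWithinAt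
  have hI : IntervalIntegrable (fun y => y ^ 3 * (Lam f y * Y y + f y * (Y y + Dop Y y)))
      volume 0 R := by
    rw [intervalIntegrable_iff_integrableOn_Ioc_of_le hR.le]
    exact (integrable_radial_iff.1 (i1.add i2)).mono_set Ioc_subset_Ioi_self
  have := intervalIntegral.integral_eq_sub_of_hasDerivAt_of_le hR.le hFc hF hI
  rw [this, h0 R le_rfl]; simp

/-- The iterates of `z ∂_z` on the cut-off. -/
def theta (χ : ℝ → ℝ) : ℕ → ℝ → ℝ
  | 0 => χ
  | i + 1 => fun z => z * deriv (theta χ i) z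

/-- The test functions used at scale `1 / b`: the linear span of the families
`((z ∂_z)ⁱ χ)(2 b y) Q(y)ʲ⁺¹`. It contains `P̃_{B₀}` and is stable under `y ∂_y` and `b ∂_b`. -/
inductive IsTest (χ : ℝ → ℝ) : (ℝ → ℝ → ℝ) → Prop
  | gen (i j : ℕ) : IsTest χ fun b y => theta χ i (2 * b * y) * Q y ^ (j + 1)
  | add {Y Y' : ℝ → ℝ → ℝ} : IsTest χ Y → IsTest χ Y' → IsTest χ fun b y => Y b y + Y' b y
  | smul (c : ℝ) {Y : ℝ → ℝ → ℝ} : IsTest χ Y → IsTest χ fun b y => c * Y b y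

/-- The operator `y ∂_y` on families of functions. -/
def yscale (Y : ℝ → ℝ → ℝ) (b y : ℝ) : ℝ := y * deriv (Y b) y

/-- The operator `b ∂_b` on families of functions. -/
def bscale (Y : ℝ → ℝ → ℝ) (b y : ℝ) : ℝ := b * deriv (fun β => Y β y) b

theorem contDiff_theta (i : ℕ) : ContDiff ℝ ∞ (theta χ i) := by
  induction i with
  | zero => exact hχ.1.smooth
  | succ i ih =>
    exact contDiff_id.mul ((contDiff_infty_iff_deriv.1 ih).2)

theorem theta_const (i : ℕ) :
    (∃ c, ∀ z ∈ Iic (1 : ℝ), theta χ i z = c) ∧ ∀ z ∈ Ici (2 : ℝ), theta χ i z = 0 := by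
  induction i with
  | zero => exact ⟨⟨1, fun z hz => hχ.1.eq_one z hz⟩, fun z hz => hχ.1.eq_zero z hz⟩
  | succ i ih =>
    obtain ⟨⟨c, hc⟩, h0⟩ := ih
    have hd : Differentiable ℝ (theta χ i) := (contDiff_theta i).differentiable (by simp)
    exact ⟨⟨0, fun z hz => mul_eq_zero_of_right z <|
      deriv_eq_zero_of_eqOn_const hd (uniqueDiffOn_Iic 1) hc hz⟩, fun z hz =>
      mul_eq_zero_of_right z <| deriv_eq_zero_of_eqOn_const hd (uniqueDiffOn_Ici 2) h0 hz⟩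

theorem exists_theta_bound (i : ℕ) : ∃ C, 0 ≤ C ∧ ∀ z, |theta χ i z| ≤ C := by
  obtain ⟨⟨c, hc⟩, h0⟩ := theta_const (χ := χ) i
  obtain ⟨C, -, hC⟩ := exists_abs_le (a := 1) (b := 2)
    (contDiff_theta (χ := χ) i).continuous.continuousOn
  refine ⟨max |c| C, (abs_nonneg c).trans (le_max_left _ _), fun z => ?_⟩
  rcases le_total z 1 with h1 | h1
  · rw [hc z h1]; exact le_max_left _ _
  · rcases le_total 2 z with h2 | h2
    · rw [h0 z h2, abs_zero]; exact (abs_nonneg c).trans (le_max_left _ _)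
    · exact (hC z h1 h2).trans (le_max_right _ _)

namespace IsTest
variable {Y' : ℝ → ℝ → ℝ}

theorem contDiff (h : IsTest χ Y) : ContDiff ℝ ∞ (Function.uncurry Y) := by
  induction h with
  | gen i j =>
    have h1 : ContDiff ℝ ∞ fun p : ℝ × ℝ => theta χ i (2 * p.1 * p.2) :=
      (contDiff_theta i).comp ((contDiff_const.mul contDiff_fst).mul contDiff_snd)
    have h2 : ContDiff ℝ ∞ fun p : ℝ × ℝ => Q p.2 ^ (j + 1) := (contDiff_Q.comp contDiff_snd).pow _
    exact h1.mul h2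
  | add _ _ h1 h2 => exact h1.add h2
  | smul c _ h1 => exact contDiff_const.mul h1

theorem contDiff_right (h : IsTest χ Y) (b : ℝ) : ContDiff ℝ ∞ (Y b) :=
  h.contDiff.comp (contDiff_const.prodMk contDiff_id)

theorem contDiff_left (h : IsTest χ Y) (y : ℝ) : ContDiff ℝ ∞ fun b => Y b y :=
  h.contDiff.comp (contDiff_id.prodMk contDiff_const)

theorem continuous (h : IsTest χ Y) (b : ℝ) : Continuous (Y b) := (h.contDiff_right b).continuous

theorem hasDerivAt_right (h : IsTest χ Y) (b y : ℝ) : HasDerivAt (Y b) (deriv (Y b) y) y :=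
  ((h.contDiff_right b).differentiable (by simp) y).hasDerivAt

theorem hasDerivAt_left (h : IsTest χ Y) (b y : ℝ) :
    HasDerivAt (fun b => Y b y) (deriv (fun b => Y b y) b) b :=
  ((h.contDiff_left y).differentiable (by simp) b).hasDerivAt

theorem eq_zero (h : IsTest χ Y) (hy : 1 ≤ b * y) : Y b y = 0 := by
  induction h with
  | gen i j => beta_reduce; rw [(theta_const i).2 _ (by simp only [mem_Ici]; linarith), zero_mul]
  | add _ _ h1 h2 => beta_reduce; rw [h1, h2, add_zero]
  | smul c _ h1 => beta_reduce; rw [h1, mul_zero]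

theorem exists_bound (h : IsTest χ Y) : ∃ A, 0 ≤ A ∧ ∀ b y, |Y b y| ≤ A * Q y := by
  induction h with
  | gen i j =>
    obtain ⟨C, hC0, hC⟩ := exists_theta_bound (χ := χ) i
    refine ⟨C, hC0, fun b y => ?_⟩
    have hq := Q_pos y; rw [abs_mul, abs_of_pos (by positivity : 0 < Q y ^ (j + 1))]
    have h1 : Q y ^ (j + 1) ≤ Q y := by
      rw [pow_succ]; exact mul_le_of_le_one_left hq.le (pow_le_one₀ hq.le (Q_le_one y))
    have := hC (2 * b * y)
    gcongr
  | add _ _ h1 h2 =>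
    obtain ⟨A, hA0, hA⟩ := h1
    obtain ⟨A', hA0', hA'⟩ := h2
    refine ⟨A + A', by positivity, fun b y => (abs_add_le _ _).trans ?_⟩
    linarith [hA b y, hA' b y]
  | smul c _ h1 =>
    obtain ⟨A, hA0, hA⟩ := h1
    refine ⟨|c| * A, by positivity, fun b y => ?_⟩
    rw [abs_mul, mul_assoc]; exact mul_le_mul_of_nonneg_left (hA b y) (abs_nonneg c)

theorem yscale_gen (i j : ℕ) :
    (CriticalWave.yscale fun b y => theta χ i (2 * b * y) * Q y ^ (j + 1)) = fun b y =>
      theta χ (i + 1) (2 * b * y) * Q y ^ (j + 1)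
        + (2 * (j + 1)) * (theta χ i (2 * b * y) * Q y ^ (j + 1 + 1)
          + (-1) * (theta χ i (2 * b * y) * Q y ^ (j + 1))) := by
  funext b y
  have h1 : HasDerivAt (fun y : ℝ => 2 * b * y) (2 * b) y := by
    simpa using (hasDerivAt_id y).const_mul (2 * b)
  have h2 := (((contDiff_theta (χ := χ) i).differentiable (by simp) (2 * b * y)).hasDerivAt.comp y h1).mul
    ((hasDerivAt_Q y).differentiableAt.hasDerivAt.pow (j + 1))
  have h3 : deriv (fun y => theta χ i (2 * b * y) * Q y ^ (j + 1)) y = _ := h2.deriv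
  unfold CriticalWave.yscale; rw [h3]; simp only [Function.comp, Pi.pow_apply, theta]
  have h4 := mul_deriv_Q y; push_cast
  linear_combination (theta χ i (2 * b * y) * (j + 1) * Q y ^ j) * h4

theorem bscale_gen (i j : ℕ) :
    (CriticalWave.bscale fun b y => theta χ i (2 * b * y) * Q y ^ (j + 1)) = fun b y =>
      theta χ (i + 1) (2 * b * y) * Q y ^ (j + 1) := by
  funext b y
  have h1 : HasDerivAt (fun b : ℝ => 2 * b * y) (2 * y) b := by
    simpa using ((hasDerivAt_id b).const_mul 2).mul_const y
  have h2 := (((contDiff_theta (χ := χ) i).differentiable (by simp) (2 * b * y)).hasDerivAt.comp b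
    h1).mul_const (Q y ^ (j + 1))
  have h3 : deriv (fun b => theta χ i (2 * b * y) * Q y ^ (j + 1)) b = _ := h2.deriv
  unfold CriticalWave.bscale; rw [h3]; simp only [theta]; ring

theorem yscale_add (hY : IsTest χ Y) (hY' : IsTest χ Y') :
    (CriticalWave.yscale fun b y => Y b y + Y' b y) = fun b y =>
      CriticalWave.yscale Y b y + CriticalWave.yscale Y' b y := by
  funext b y
  unfold CriticalWave.yscale
  rw [deriv_fun_add (hY.hasDerivAt_right b y).differentiableAt
    (hY'.hasDerivAt_right b y).differentiableAt]
  ring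

theorem bscale_add (hY : IsTest χ Y) (hY' : IsTest χ Y') :
    (CriticalWave.bscale fun b y => Y b y + Y' b y) = fun b y =>
      CriticalWave.bscale Y b y + CriticalWave.bscale Y' b y := by
  funext b y
  unfold CriticalWave.bscale
  rw [deriv_fun_add (hY.hasDerivAt_left b y).differentiableAt
    (hY'.hasDerivAt_left b y).differentiableAt]
  ring

theorem yscale_smul (c : ℝ) (hY : IsTest χ Y) :
    (CriticalWave.yscale fun b y => c * Y b y) = fun b y => c * CriticalWave.yscale Y b y := by
  funext b y
  unfold CriticalWave.yscale; rw [deriv_const_mul _ (hY.hasDerivAt_right b y).differentiableAt]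
  ring

theorem bscale_smul (c : ℝ) (hY : IsTest χ Y) :
    (CriticalWave.bscale fun b y => c * Y b y) = fun b y => c * CriticalWave.bscale Y b y := by
  funext b y
  unfold CriticalWave.bscale; rw [deriv_const_mul _ (hY.hasDerivAt_left b y).differentiableAt]; ring

protected theorem yscale (h : IsTest χ Y) : IsTest χ (yscale Y) := by
  induction h with
  | gen i j =>
    rw [yscale_gen]; exact (gen (i + 1) j).add (smul _ ((gen i (j + 1)).add (smul _ (gen i j))))
  | add hY hY' h1 h2 => rw [yscale_add hY hY']; exact h1.add h2
  | smul c hY h1 => rw [yscale_smul c hY]; exact smul c h1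

protected theorem bscale (h : IsTest χ Y) : IsTest χ (bscale Y) := by
  induction h with
  | gen i j => rw [bscale_gen]; exact gen (i + 1) j
  | add hY hY' h1 h2 => rw [bscale_add hY hY']; exact h1.add h2
  | smul c hY h1 => rw [bscale_smul c hY]; exact smul c h1

theorem bscale_yscale (h : IsTest χ Y) :
    CriticalWave.bscale (CriticalWave.yscale Y) = CriticalWave.yscale (CriticalWave.bscale Y) := by
  induction h with
  | gen i j =>
    rw [yscale_gen, bscale_add (gen (i + 1) j) (smul _ ((gen i (j + 1)).add (smul _ (gen i j)))),
      bscale_smul _ ((gen i (j + 1)).add (smul _ (gen i j))),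
      bscale_add (gen i (j + 1)) (smul _ (gen i j)), bscale_smul _ (gen i j), bscale_gen,
      bscale_gen, bscale_gen, yscale_gen]
  | add hY hY' h1 h2 =>
    rw [yscale_add hY hY', bscale_add hY.yscale hY'.yscale, h1, h2,
      bscale_add hY hY', yscale_add hY.bscale hY'.bscale]
  | smul c hY h1 =>
    rw [yscale_smul c hY, bscale_smul c hY.yscale, h1, bscale_smul c hY, yscale_smul c hY.bscale]

/-- The operators `b ∂_b` and `D` commute. -/
theorem bscale_Dop (h : IsTest χ Y) (b : ℝ) :
    CriticalWave.bscale (fun b => CriticalWave.Dop (Y b)) b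
      = CriticalWave.Dop (CriticalWave.bscale Y b) := by
  have e : (fun b => CriticalWave.Dop (Y b)) = fun b y => 2 * Y b y + CriticalWave.yscale Y b y := rfl
  rw [e, bscale_add (smul 2 h) h.yscale, bscale_smul 2 h, bscale_yscale h]; rfl

protected theorem Lam (h : IsTest χ Y) : IsTest χ fun b => Lam (Y b) := h.add h.yscale

protected theorem Dop (h : IsTest χ Y) : IsTest χ fun b => Dop (Y b) := (smul 2 h).add h.yscale

theorem integrable_mul (h : IsTest χ Y) (hb : 0 < b)
    (hf : ContinuousOn f (Ioi 0)) (hA : ∀ y, 0 < y → b * y ≤ 1 → |y ^ 3 * f y| ≤ A) :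
    Integrable (fun y => f y * Y b y) ϱ := by
  obtain ⟨B, hB0, hB⟩ := h.exists_bound
  refine integrable_radial_of_le (R := 1 / b) (A := A * (B * 1))
    (aesm_radial (hf.mul (h.continuous b).continuousOn)) (fun y hy hyR => ?_) fun y hy => ?_
  · have h1 := hA y hy ((le_div_iff₀' hb).1 hyR); rw [← mul_assoc, abs_mul]
    have := (abs_nonneg _).trans h1
    gcongr; exact (hB b y).trans (by have := Q_le_one y; gcongr)
  · rw [h.eq_zero ((div_lt_iff₀' hb).1 hy).le, mul_zero]

/-- Products with a test function see only the range `y ≤ 1 / b`. -/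
theorem abs_ip_le (h : IsTest χ Y) (hb : 0 < b)
    (hA : ∀ y, 0 < y → b * y ≤ 1 → |y ^ 3 * (f y * Y b y)| ≤ A) : |ip f (Y b)| ≤ A / b := by
  have := abs_integral_radial_le (R := 1 / b) (A := A) (f := fun y => f y * Y b y) (by positivity)
    (fun y hy hyR => hA y hy ((le_div_iff₀' hb).1 hyR)) fun y hy => by
      rw [h.eq_zero ((div_lt_iff₀' hb).1 hy).le, mul_zero]
  rwa [mul_one_div] at this

end IsTest

/-- If `f` lives in `y ≥ 1 / (2 b)`, `g` in `y ≤ 1 / b` and both are `O(Q)`, then `(f, g) = O(1)`. -/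
theorem abs_ip_le_of_annulus {A' : ℝ} (hb : 0 < b) (hA : 0 ≤ A) (hA' : 0 ≤ A')
    (hf : ∀ y, 0 < y → |f y| ≤ A * Q y) (hg : ∀ y, 0 < y → |g y| ≤ A' * Q y)
    (hf0 : ∀ y, 0 < y → 2 * b * y ≤ 1 → f y = 0) (hg0 : ∀ y, 1 ≤ b * y → g y = 0) :
    |ip f g| ≤ 128 * A * A' := by
  have := abs_integral_radial_le (R := 1 / b) (A := 128 * A * A' * b) (f := fun y => f y * g y)
    (by positivity) (fun y hy hyR => ?_) fun y hy => by
      rw [hg0 y ((div_lt_iff₀' hb).1 hy).le, mul_zero]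
  · exact this.trans_eq (by field_simp)
  · rcases le_total (2 * b * y) 1 with h1 | h1
    · rw [hf0 y hy h1, zero_mul, mul_zero, abs_zero]; positivity
    · have h2 := Q_cube_mul_le hy
      have h3 : 64 / y ≤ 128 * b := by rw [div_le_iff₀ hy]; nlinarith
      have hq := Q_pos y; rw [abs_mul, abs_mul, abs_of_pos (pow_pos hy 3)]
      calc y ^ 3 * (|f y| * |g y|) ≤ y ^ 3 * ((A * Q y) * (A' * Q y)) := by
            gcongr
            · exact hf y hy
            · exact hg y hy
        _ = (y ^ 3 * Q y ^ 2) * (A * A') := by ring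
        _ ≤ (128 * b) * (A * A') := mul_le_mul_of_nonneg_right (h2.trans h3) (by positivity)
        _ = _ := by ring

/-- Derivative in `b` of the product of a parameter-dependent function with a test function. -/
theorem hasDerivAt_ip_test (hY : IsTest χ Y) (hb : 0 < b)
    {f f' : ℝ → ℝ → ℝ} {s : Set ℝ} (hs : s ∈ 𝓝 b)
    (hf : ∀ β ∈ s, ContinuousOn (f β) (Ioi 0)) (hf' : ContinuousOn (f' b) (Ioi 0))
    (hd : ∀ β ∈ s, ∀ y, 0 < y → HasDerivAt (fun β => f β y) (f' β y) β)
    (hA : ∀ β ∈ s, ∀ y, 0 < y → |f β y| ≤ A ∧ |f' β y| ≤ A) :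
    HasDerivAt (fun β => ip (f β) (Y β)) (ip (f' b) (Y b) + b⁻¹ * ip (f b) (bscale Y b)) b := by
  have hYb := hY.bscale
  obtain ⟨B, hB0, hB⟩ := hY.exists_bound
  obtain ⟨B', hB0', hB'⟩ := hYb.exists_bound
  have hA0 : 0 ≤ A := (abs_nonneg _).trans (hA b (mem_of_mem_nhds hs) 1 one_pos).1
  have hz : ∀ β ∈ s ∩ Ioi (b / 2), ∀ y, 2 / b < y → 1 ≤ β * y := by
    intro β hβ y hy
    have hβ : b / 2 < β := hβ.2; rw [div_lt_iff₀ hb] at hy; nlinarith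
  have key : ∀ {g : ℝ → ℝ}, (∀ y, 0 < y → |g y| ≤ A) → ∀ y, 0 < y → b * y ≤ 1 →
      |y ^ 3 * g y| ≤ (1 / b) ^ 3 * A := fun {g} hg y hy hby => by
    have h1 := (le_div_iff₀' hb).2 hby
    rw [abs_pow_mul hy]
    have := hg y hy
    gcongr
  have hb0 := mem_of_mem_nhds hs
  have i1 : Integrable (fun y => f' b y * Y b y) ϱ :=
    hY.integrable_mul hb hf' (key fun y hy => (hA b hb0 y hy).2)
  have i2 : Integrable (fun y => f b y * bscale Y b y) ϱ :=
    hYb.integrable_mul hb (hf b hb0) (key fun y hy => (hA b hb0 y hy).1)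
  have i3 : Integrable (fun y => f b y * Y b y) ϱ :=
    hY.integrable_mul hb (hf b hb0) (key fun y hy => (hA b hb0 y hy).1)
  have h1 := hasDerivAt_radial_integral (k := fun β y => f β y * Y β y)
    (k' := fun β y => f' β y * Y β y + β⁻¹ * (f β y * bscale Y β y)) (s := s ∩ Ioi (b / 2))
    (R := 2 / b) (A := (2 / b) ^ 3 * (A * B + 2 / b * (A * B')))
    (inter_mem hs (Ioi_mem_nhds (half_lt_self hb)))
    (fun β hβ => aesm_radial ((hf β hβ.1).mul (hY.continuous β).continuousOn))
    (i1.add (i2.const_mul _)).aestronglyMeasurable i3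
    (fun β hβ y hy => by
      have hβ0 : 0 < β := (half_pos hb).trans hβ.2
      refine ((hd β hβ.1 y hy).mul (hY.hasDerivAt_left β y)).congr_deriv ?_
      unfold bscale; field_simp)
    (fun β hβ y hy hyR => by
      have hβ0 : b / 2 < β := hβ.2
      have hβ00 : 0 < β := (half_pos hb).trans hβ0
      have hβ1 : β⁻¹ ≤ 2 / b := by rw [inv_le_comm₀ hβ00 (by positivity), inv_div]; exact hβ0.le
      have hq := Q_pos y
      have hq1 := Q_le_one y
      obtain ⟨h3, h4⟩ := hA β hβ.1 y hy
      have h5 : |Y β y| ≤ B := (hB β y).trans (mul_le_of_le_one_right hB0 hq1)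
      have h6 : |bscale Y β y| ≤ B' := (hB' β y).trans (mul_le_of_le_one_right hB0' hq1)
      rw [abs_pow_mul hy]
      refine mul_le_mul (by gcongr) ((abs_add_le _ _).trans ?_) (abs_nonneg _) (by positivity)
      rw [abs_mul, abs_mul, abs_mul, abs_of_pos (by positivity : 0 < β⁻¹)]
      gcongr)
    (fun β hβ y hy => by rw [hY.eq_zero (hz β hβ y hy), hYb.eq_zero (hz β hβ y hy)]; ring)
  refine h1.congr_deriv ?_
  unfold ip; rw [integral_add i1 (i2.const_mul _), integral_const_mul]

theorem hasDerivAt_ip_test_test {Y' : ℝ → ℝ → ℝ} (hY : IsTest χ Y)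
    (hY' : IsTest χ Y') (hb : 0 < b) :
    HasDerivAt (fun β => ip (Y β) (Y' β))
      (b⁻¹ * (ip (bscale Y b) (Y' b) + ip (Y b) (bscale Y' b))) b := by
  have hYb := hY.bscale
  obtain ⟨B, hB0, hB⟩ := hY.exists_bound
  obtain ⟨B', hB0', hB'⟩ := hYb.exists_bound
  have h := hasDerivAt_ip_test hY' hb (f := Y) (f' := fun β y => β⁻¹ * bscale Y β y)
    (s := Ioi (b / 2)) (A := B + 2 / b * B') (Ioi_mem_nhds (half_lt_self hb))
    (fun β _ => (hY.continuous β).continuousOn)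
    ((hYb.continuous b).const_mul _).continuousOn
    (fun β hβ y _ => by
      have hβ0 : 0 < β := (half_pos hb).trans hβ
      refine (hY.hasDerivAt_left β y).congr_deriv ?_
      unfold bscale; field_simp)
    (fun β hβ y hy => by
      have hβ0 : b / 2 < β := hβ
      have hβ00 : 0 < β := (half_pos hb).trans hβ0
      have hβ1 : β⁻¹ ≤ 2 / b := by rw [inv_le_comm₀ hβ00 (by positivity), inv_div]; exact hβ0.le
      have hq1 := Q_le_one y
      have h5 : |Y β y| ≤ B := (hB β y).trans (mul_le_of_le_one_right hB0 hq1)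
      have h6 : |bscale Y β y| ≤ B' := (hB' β y).trans (mul_le_of_le_one_right hB0' hq1)
      rw [abs_mul, abs_of_pos (by positivity : 0 < β⁻¹)]
      have h7 : β⁻¹ * |bscale Y β y| ≤ 2 / b * B' := by gcongr
      have : 0 ≤ 2 / b * B' := by positivity
      have : 0 ≤ β⁻¹ * |bscale Y β y| := by positivity
      constructor <;> linarith)
  refine h.congr_deriv ?_
  have : ip (fun y => b⁻¹ * bscale Y b y) (Y' b) = b⁻¹ * ip (bscale Y b) (Y' b) := by
    unfold ip; rw [← integral_const_mul]
    congr 1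
    funext y
    ring
  rw [this]; ring

/-! ### The functional `G` -/

/-- The test function `ΛP̃_{B₀}`. -/
def Ztest (χ : ℝ → ℝ) (b : ℝ) : ℝ → ℝ := Lam (Ptilde χ b)

theorem Ptilde_eq (χ : ℝ → ℝ) : Ptilde χ = fun b y => theta χ 0 (2 * b * y) * Q y ^ (0 + 1) := by
  funext b y
  unfold Ptilde; rw [cut_B0, zero_add, pow_one]; rfl

theorem isTest_Ptilde (χ : ℝ → ℝ) : IsTest χ (Ptilde χ) := by rw [Ptilde_eq]; exact IsTest.gen 0 0

theorem isTest_Ztest : IsTest χ (Ztest χ) := (isTest_Ptilde χ).Lam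

theorem Ztest_eq (b y : ℝ) :
    Ztest χ b y = χ (2 * b * y) * Lam Q y + theta χ 1 (2 * b * y) * Q y := by
  have h1 : HasDerivAt (fun y : ℝ => 2 * b * y) (2 * b) y := by
    simpa using (hasDerivAt_id y).const_mul (2 * b)
  have h2 := ((hχ.1.hasDerivAt (2 * b * y)).comp y h1).mul
    (hasDerivAt_Q y).differentiableAt.hasDerivAt
  have e : Ptilde χ b = (χ ∘ fun y => 2 * b * y) * Q := by
    funext y
    unfold Ptilde; rw [cut_B0]; rfl
  unfold Ztest Lam; rw [e, h2.deriv]; simp only [Pi.mul_apply, Function.comp, theta]; ring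

theorem Ztest_eq_LamQ (h : 2 * b * y ≤ 1) : Ztest χ b y = Lam Q y := by
  rw [Ztest_eq, hχ.1.eq_one _ h]; simp only [theta]; rw [hχ.1.deriv_eq_zero_of_le h]; ring

theorem abs_ip_sub_le_of_annulus {f' : ℝ → ℝ} {A' : ℝ} (cf : Continuous f) (cf' : Continuous f')
    (cg : Continuous g) (hb : 0 < b) (hA : 0 ≤ A) (hA' : 0 ≤ A')
    (hf : ∀ y, |f y| ≤ A * Q y) (hf' : ∀ y, |f' y| ≤ Q y) (hg : ∀ y, |g y| ≤ A' * Q y)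
    (hf0 : ∀ y, 2 * b * y ≤ 1 → f y = f' y) (hg0 : ∀ y, 1 ≤ b * y → g y = 0) :
    |ip f g - ip f' g| ≤ 128 * (A + 1) * A' := by
  have h0 : ∀ y, 1 / b < y → g y = 0 := fun y hy => hg0 y ((div_lt_iff₀' hb).1 hy).le
  have e := ip_eq_comb (F := fun y => f y - f' y) (integrable_mul_of_continuous cf cg h0)
    (integrable_mul_of_continuous cf' cg h0) 1 (-1) fun y _ => by ring
  rw [show ip f g - ip f' g = ip (fun y => f y - f' y) g by linarith]
  exact abs_ip_le_of_annulus hb (by linarith) hA'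
    (fun y _ => (abs_sub _ _).trans (by linarith [hf y, hf' y])) (fun y _ => hg y)
    (fun y _ h => sub_eq_zero.2 (hf0 y h)) hg0

theorem exists_ip_Ztest_bound : ∃ C, 0 ≤ C ∧ ∀ b, 0 < b → b < 1 →
    |ip (Ztest χ b) (Ztest χ b) - 64 * (|log b|)| ≤ C ∧
    |ip (Ztest χ b) (Ztest χ b) - ip (Lam Q) (Ztest χ b)| ≤ C ∧
    |ip (cutLam χ b) (Ztest χ b) - massN χ b| ≤ C := by
  obtain ⟨A, hA0, hA⟩ := isTest_Ztest.exists_bound (χ := χ)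
  obtain ⟨Cχ, hCχ, hχb⟩ := hχ.1.exists_bound
  obtain ⟨Cm, hCm, hm⟩ := exists_massN_bound (χ := χ)
  have hZ := isTest_Ztest (χ := χ)
  have hC0 : 0 ≤ Cχ := by linarith
  have p1 : 0 ≤ 128 * (A + 1) * A := by positivity
  have p2 : 0 ≤ 128 * (A + 1) * Cχ := by positivity
  have p3 : 0 ≤ 128 * (Cχ + 1) * A := by positivity
  refine ⟨Cm + 128 * (A + 1) * A + 128 * (A + 1) * Cχ + 128 * (Cχ + 1) * A, by linarith,
    fun b hb hb1 => ?_⟩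
  have hc := continuous_cutLam' (χ := χ) b
  have h1 := abs_ip_sub_le_of_annulus (hZ.continuous b) continuous_LamQ (hZ.continuous b) hb hA0 hA0
    (hA b) abs_LamQ_le (hA b) (fun y => Ztest_eq_LamQ) fun y => hZ.eq_zero
  have h2 := abs_ip_sub_le_of_annulus (hZ.continuous b) continuous_LamQ hc hb hA0 hC0
    (hA b) abs_LamQ_le (abs_cutLam_le hχb b) (fun y => Ztest_eq_LamQ) fun y => cutLam_eq_zero
  have h3 := abs_ip_sub_le_of_annulus hc continuous_LamQ (hZ.continuous b) hb hC0 hA0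
    (abs_cutLam_le hχb b) abs_LamQ_le (hA b) (fun y => cutLam_eq) fun y => hZ.eq_zero
  have h4 := (hm b hb hb1).1
  rw [ip_comm _ (cutLam χ b), ip_comm (Lam Q), show ip (cutLam χ b) (Lam Q) = massN χ b from rfl]
    at h2
  refine ⟨?_, by linarith, by linarith⟩
  rw [abs_le] at *
  constructor <;> linarith

/-- The integrand in the definition of `G`. -/
theorem mul_ip_dbPtilde (χ : ℝ → ℝ) (b : ℝ) :
    b * ip (dbPtilde χ b) (Lam (Ptilde χ b)) = ip (bscale (Ptilde χ) b) (Ztest χ b) := by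
  unfold ip; rw [← integral_const_mul]
  congr 1
  funext y
  unfold bscale dbPtilde Ztest; ring

theorem exists_ip_bscale_bound : ∃ C, 0 ≤ C ∧ ∀ b, 0 < b →
    |ip (bscale (Ptilde χ) b) (Ztest χ b)| ≤ C ∧ |ip (bscale (Ztest χ) b) (Ztest χ b)| ≤ C := by
  have hZ := isTest_Ztest (χ := χ)
  have hP := isTest_Ptilde χ
  obtain ⟨A, hA0, hA⟩ := hZ.exists_bound
  obtain ⟨A₁, hA1, hA1b⟩ := hZ.bscale.exists_bound
  obtain ⟨A₂, hA2, hA2b⟩ := hP.bscale.exists_bound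
  refine ⟨128 * A₂ * A + 128 * A₁ * A, by positivity, fun b hb => ?_⟩
  have e : ∀ {Y : ℝ → ℝ → ℝ} {q : ℝ → ℝ}, IsTest χ Y → (∀ β y, 2 * β * y ≤ 1 → Y β y = q y) →
      ∀ y, 0 < y → 2 * b * y ≤ 1 → bscale Y b y = 0 := fun {Y q} hY hq y hy hby => by
    have h1 : deriv (fun β => Y β y) b = 0 := by
      refine deriv_eq_zero_of_eqOn_const (s := Iic (1 / (2 * y))) (c := q y)
        ((hY.contDiff_left y).differentiable (by simp)) (uniqueDiffOn_Iic _) (fun β hβ => ?_) ?_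
      · have : β ≤ 1 / (2 * y) := hβ; rw [le_div_iff₀ (by positivity)] at this
        exact hq β y (by linarith)
      · rw [mem_Iic, le_div_iff₀ (by positivity)]; linarith
    unfold bscale; rw [h1, mul_zero]
  have e1 := e hP (q := Q) fun β y h => by unfold Ptilde; rw [cut_B0, hχ.1.eq_one _ h, one_mul]
  have e2 := e hZ (q := Lam Q) fun β y h => Ztest_eq_LamQ h
  have p1 : 0 ≤ 128 * A₁ * A := by positivity
  have p2 : 0 ≤ 128 * A₂ * A := by positivity
  have h1 := abs_ip_le_of_annulus hb hA2 hA0 (fun y _ => hA2b b y) (fun y _ => hA b y) e1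
    fun y hy => hZ.eq_zero hy
  have h2 := abs_ip_le_of_annulus hb hA1 hA0 (fun y _ => hA1b b y) (fun y _ => hA b y) e2
    fun y hy => hZ.eq_zero hy
  constructor <;> linarith

theorem G_eq (χ : ℝ → ℝ) (b : ℝ) : G χ b = b * ip (Ztest χ b) (Ztest χ b)
    + ∫ β in (0 : ℝ)..b, ip (bscale (Ptilde χ) β) (Ztest χ β) := by
  unfold G
  congr 1
  exact intervalIntegral.integral_congr fun β _ => mul_ip_dbPtilde χ β

theorem exists_G_bound : ∃ C, 0 ≤ C ∧ ∀ b, 0 < b → b < 1 →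
    |G χ b - 64 * b * (|log b|)| ≤ C * b := by
  obtain ⟨C, hC0, hC⟩ := exists_ip_Ztest_bound (χ := χ)
  obtain ⟨C', hC0', hC'⟩ := exists_ip_bscale_bound (χ := χ)
  refine ⟨C + C', by positivity, fun b hb hb1 => ?_⟩
  have h1 := (hC b hb hb1).1
  have h2 : |∫ β in (0 : ℝ)..b, ip (bscale (Ptilde χ) β) (Ztest χ β)| ≤ C' * b :=
    abs_primitive_le hb.le fun β hβ _ => (hC' β hβ).1
  rw [G_eq, show b * ip (Ztest χ b) (Ztest χ b)
    + (∫ β in (0 : ℝ)..b, ip (bscale (Ptilde χ) β) (Ztest χ β)) - 64 * b * |log b|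
    = b * (ip (Ztest χ b) (Ztest χ b) - 64 * (|log b|))
      + ∫ β in (0 : ℝ)..b, ip (bscale (Ptilde χ) β) (Ztest χ β) by ring]
  refine (abs_add_le _ _).trans ?_
  rw [abs_mul, abs_of_pos hb]; nlinarith

theorem hasDerivAt_G (hb : 0 < b) :
    HasDerivAt (G χ) (ip (Ztest χ b) (Ztest χ b) + 2 * ip (bscale (Ztest χ) b) (Ztest χ b)
      + ip (bscale (Ptilde χ) b) (Ztest χ b)) b := by
  have hZ := isTest_Ztest (χ := χ)
  have hP := isTest_Ptilde χ
  obtain ⟨C', hC0', hC'⟩ := exists_ip_bscale_bound (χ := χ)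
  have h1 := (hasDerivAt_id b).mul (hasDerivAt_ip_test_test hZ hZ hb)
  have hc : ContinuousOn (fun β => ip (bscale (Ptilde χ) β) (Ztest χ β)) (Ioi 0) := fun β hβ =>
    (hasDerivAt_ip_test_test hP.bscale hZ hβ).continuousAt.continuousWithinAt
  have hint : IntervalIntegrable (fun β => ip (bscale (Ptilde χ) β) (Ztest χ β)) volume 0 b := by
    rw [intervalIntegrable_iff_integrableOn_Ioc_of_le hb.le]
    refine Integrable.of_bound (C := C') ?_ ?_
    · exact (hc.mono fun β hβ => hβ.1).aestronglyMeasurable measurableSet_Ioc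
    · filter_upwards [ae_restrict_mem measurableSet_Ioc] with β hβ
      exact (hC' β hβ.1).1
  have h2 := intervalIntegral.integral_hasDerivAt_right hint
    (hc.stronglyMeasurableAtFilter isOpen_Ioi b hb) (hc.continuousAt (Ioi_mem_nhds hb))
  have e : G χ = fun b => b * ip (Ztest χ b) (Ztest χ b)
    + ∫ β in (0 : ℝ)..b, ip (bscale (Ptilde χ) β) (Ztest χ β) := by
    funext b; exact G_eq χ b
  rw [e]
  refine (h1.add h2).congr_deriv ?_
  rw [ip_comm (Ztest χ b) (bscale (Ztest χ) b)]; simp only [id]; field_simp; ring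

/-! ### Pointwise control by `Hε` -/

/-- The operator `H = -Δ - V`. -/
def Hop (f : ℝ → ℝ) (y : ℝ) : ℝ := -lap f y - V y * f y

/-- The `L²` norm. -/
def l2 (f : ℝ → ℝ) : ℝ := √(∫ r, f r ^ 2 ∂ϱ)

theorem l2_nonneg (f : ℝ → ℝ) : 0 ≤ l2 f := Real.sqrt_nonneg _

/-- The Cauchy-Schwarz inequality on an interval. -/
theorem abs_integral_interval_mul_le {h : ℝ → ℝ} {X : ℝ} (hg : MemLp g 2 ϱ)
    (ha : 0 ≤ a) (hab : a ≤ b) (hX : 0 ≤ X) (hh : ContinuousOn h (Ioi 0))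
    (hi : IntervalIntegrable (fun s => s ^ 3 * h s ^ 2) volume a b)
    (hle : ∫ s in a..b, s ^ 3 * h s ^ 2 ≤ X ^ 2) :
    |∫ s in a..b, s ^ 3 * (g s * h s)| ≤ l2 g * X := by
  have hsub : Ioc a b ⊆ Ioi 0 := fun s hs => ha.trans_lt hs.1
  set H := (Ioc a b).indicator h with hH
  have e1 : ∀ F : ℝ → ℝ → ℝ, (∀ s, F s 0 = 0) → ∫ s, F s (H s) ∂ϱ
      = ∫ s in a..b, s ^ 3 * F s (h s) := fun F hF => by
    rw [integral_radial, intervalIntegral.integral_of_le hab]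
    rw [setIntegral_eq_of_subset_of_forall_sdiff_eq_zero measurableSet_Ioi hsub fun s hs => by
      rw [hH, indicator_of_notMem hs.2, hF, mul_zero]]
    refine setIntegral_congr_fun measurableSet_Ioc fun s hs => ?_
    simp only [hH, indicator_of_mem hs]
  have hm : AEStronglyMeasurable H ϱ := (aesm_radial hh).indicator measurableSet_Ioc
  have hHL : MemLp H 2 ϱ := by
    rw [memLp_two_iff_integrable_sq hm, integrable_radial_iff]
    refine IntegrableOn.of_forall_sdiff_eq_zero (s := Ioc a b) ?_ measurableSet_Ioi fun s hs => by
      rw [hH, indicator_of_notMem hs.2]; simp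
    rw [intervalIntegrable_iff_integrableOn_Ioc_of_le hab] at hi
    refine hi.congr_fun (fun s hs => ?_) measurableSet_Ioc
    simp only [hH, indicator_of_mem hs]
  have h1 := abs_ip_le hg hHL
  unfold ip at h1
  rw [e1 (fun s x => g s * x) fun s => mul_zero _, e1 (fun _ x => x ^ 2) fun s => by simp] at h1
  refine h1.trans (mul_le_mul_of_nonneg_left ?_ (Real.sqrt_nonneg _))
  rw [Real.sqrt_le_left hX]; exact hle

/-- The Wronskian of `f` with a solution `k` of `H k = 0` has derivative `-y³ k Hf`. -/
theorem wronskian_sub {k k' : ℝ → ℝ} (hf : ∀ y, 0 < y → DifferentiableAt ℝ f y)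
    (hac : LocallyAC (deriv f)) (hk : ∀ y, 0 < y → HasDerivAt k (k' y) y)
    (hkc : ContinuousOn k' (Ioi 0))
    (hk' : ∀ y, 0 < y → HasDerivAt (fun y => y ^ 3 * k' y) (-(y ^ 3 * (V y * k y))) y)
    (ha : 0 < a) (hb : 0 < b) :
    (b ^ 3 * (deriv f b * k b - f b * k' b)) - (a ^ 3 * (deriv f a * k a - f a * k' a))
      = -∫ s in a..b, s ^ 3 * (Hop f s * k s) := by
  have hcd := hac.continuousOn
  have hfac : LocallyAC f := locallyAC_of_hasDerivAt (fun y hy => (hf y hy).hasDerivAt) hcd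
  have hkac : LocallyAC k := locallyAC_of_hasDerivAt hk hkc
  have hk3 : LocallyAC fun y => y ^ 3 * k' y := by
    refine locallyAC_of_hasDerivAt hk' ?_
    have : ContinuousOn k (Ioi 0) := fun y hy => (hk y hy).continuousAt.continuousWithinAt
    exact ((continuousOn_id.pow 3).mul (continuous_V.continuousOn.mul this)).neg
  have h3 : LocallyAC fun y : ℝ => y ^ 3 :=
    locallyAC_of_hasDerivAt (f' := fun y => 3 * y ^ 2) (fun y _ => by
      simpa using hasDerivAt_pow 3 y) (by fun_prop)
  have hA : LocallyAC fun y => y ^ 3 * (deriv f y * k y - f y * k' y) :=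
    (((h3.mul hac).mul hkac).sub (hfac.mul hk3)).congr fun y _ => by ring
  rw [← hA.integral_deriv ha hb, ← intervalIntegral.integral_neg]
  refine intervalIntegral.integral_congr_ae ?_
  filter_upwards [hac.ae_differentiableAt] with y hy hyab
  have hy0 : 0 < y := lt_of_lt_of_le (lt_min ha hb) (uIoc_subset_uIcc hyab).1
  have hd2 := (hy hy0).hasDerivAt
  have h5 := ((((hasDerivAt_pow 3 y).mul hd2).mul (hk y hy0)).sub
    ((hf y hy0).hasDerivAt.mul (hk' y hy0)))
  have e : (fun y => y ^ 3 * (deriv f y * k y - f y * k' y))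
      = ((fun y => y ^ 3) * deriv f) * k - f * fun y => y ^ 3 * k' y := by
    funext z; simp only [Pi.sub_apply, Pi.mul_apply]; ring
  rw [e, h5.deriv]
  unfold Hop lap; simp only [Pi.mul_apply]; push_cast; field_simp; ring

theorem abs_wronskian_LamQ_le (hf : ∀ y, 0 < y → DifferentiableAt ℝ f y)
    (hac : LocallyAC (deriv f)) (hgrad : MemLp (deriv f) 2 ϱ) {C₀ : ℝ}
    (h0 : ∀ y, 0 < y → y ≤ 1 → |f y| ≤ C₀ / y) (hH : MemLp (Hop f) 2 ϱ)
    {X : ℝ} (hy : 0 < y) (hX : 0 ≤ X) (hle : primLamQ y ≤ X ^ 2) :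
    |y ^ 3 * (deriv f y * Lam Q y - f y * dLamQ y)| ≤ l2 (Hop f) * X := by
  have hC0 : 0 ≤ C₀ := by
    have := (abs_nonneg _).trans (h0 1 one_pos le_rfl); simpa using this
  refine le_of_forall_pos_le_add fun η hη => ?_
  set δ := min (min 1 y) (η / (2 * (1 + 6 * C₀))) with hδ
  have hδ0 : 0 < δ := by positivity
  obtain ⟨a, ha, had, hsm⟩ := exists_small_near_zero hgrad.integrable_sq (ε := (η / 2) ^ 2)
    (by positivity) hδ0
  have ha1 : a < 1 := had.trans_le ((min_le_left _ _).trans (min_le_left _ _))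
  have hay : a < y := had.trans_le ((min_le_left _ _).trans (min_le_right _ _))
  have haη : a < η / (2 * (1 + 6 * C₀)) := had.trans_le (min_le_right _ _)
  have hw := wronskian_sub hf hac (fun y _ => hasDerivAt_LamQ y) continuous_dLamQ.continuousOn
    (fun y _ => hasDerivAt_cube_dLamQ y) ha hy
  have hcont : Continuous fun s => s ^ 3 * Lam Q s ^ 2 := by
    have := continuous_LamQ; fun_prop
  have hint : |∫ s in a..y, s ^ 3 * (Hop f s * Lam Q s)| ≤ l2 (Hop f) * X := by
    refine abs_integral_interval_mul_le hH ha.le hay.le hX continuous_LamQ.continuousOn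
      (hcont.intervalIntegrable _ _) (le_trans ?_ hle)
    rw [← integral_LamQ_sq]
    refine intervalIntegral.integral_mono_interval ha.le hay.le le_rfl ?_
      (hcont.intervalIntegrable _ _)
    filter_upwards [ae_restrict_mem measurableSet_Ioc] with s hs
    have : 0 < s := hs.1; simp only [Pi.zero_apply]; positivity
  have h1 : |a ^ 3 * (deriv f a * Lam Q a - f a * dLamQ a)| ≤ η := by
    have h2 : a ^ 2 * |deriv f a| ≤ η / 2 := by
      refine le_of_lt (lt_of_pow_lt_pow_left₀ 2 (by positivity) ?_)
      rw [mul_pow, sq_abs, ← pow_mul]; exact hsm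
    have h3 : a * |f a| ≤ C₀ := by
      have := h0 a ha ha1.le; rw [le_div_iff₀ ha] at this; linarith
    have h4 := abs_LamQ_le_one a
    have h5 : |a * dLamQ a| ≤ 6 := by
      have := abs_mul_dLamQ_le a
      have := Q_le_one a; linarith
    have haη2 : a * (2 * (1 + 6 * C₀)) < η := by rwa [lt_div_iff₀ (by positivity)] at haη
    rw [show a ^ 3 * (deriv f a * Lam Q a - f a * dLamQ a)
      = a * (a ^ 2 * deriv f a) * Lam Q a - a * (a * f a) * (a * dLamQ a) by ring]
    refine (abs_sub _ _).trans ?_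
    rw [abs_mul, abs_mul, abs_mul, abs_mul (a * (a * f a)), abs_mul a, abs_mul a (f a),
      abs_of_pos ha, abs_of_pos (pow_pos ha 2)]
    have h6 : a * (a ^ 2 * |deriv f a|) * |Lam Q a| ≤ 1 * (η / 2) * 1 := by gcongr
    have h7 : a * (a * |f a|) * |a * dLamQ a| ≤ a * C₀ * 6 := by gcongr
    nlinarith
  have e : y ^ 3 * (deriv f y * Lam Q y - f y * dLamQ y)
      = a ^ 3 * (deriv f a * Lam Q a - f a * dLamQ a)
        - ∫ s in a..y, s ^ 3 * (Hop f s * Lam Q s) := by linarith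
  rw [e]; exact (abs_sub _ _).trans (by linarith)

theorem primLamQ_le_of_le_one (hy : 0 ≤ y) : primLamQ y ≤ (y ^ 2) ^ 2 := by
  rw [← integral_LamQ_sq]
  have h1 : |∫ s in (0 : ℝ)..y, s ^ 3 * Lam Q s ^ 2| ≤ y ^ 3 * y := by
    refine abs_primitive_le hy fun s hs hsy => ?_
    have := abs_LamQ_le_one s; rw [abs_pow_mul hs, abs_pow]
    calc s ^ 3 * |Lam Q s| ^ 2 ≤ y ^ 3 * 1 ^ 2 := by gcongr
      _ = y ^ 3 := by ring
  calc _ ≤ _ := le_abs_self _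
    _ ≤ _ := h1
    _ = _ := by ring

theorem primLamQ_le_log (hy : 1 ≤ y) : primLamQ y ≤ (8 * (1 + √(log y))) ^ 2 := by
  have hy0 : 0 < y := by linarith
  have hq := Q_pos y
  have hq1 := Q_le_one y
  have h1 : -log (Q y) ≤ 1 + 2 * log y := by
    unfold Q; rw [one_div, Real.log_inv, neg_neg]
    have h2 : 1 + y ^ 2 / 8 ≤ 2 * y ^ 2 := by nlinarith
    have h3 := Real.log_le_log (by positivity) h2
    rw [Real.log_mul (by norm_num) (by positivity), Real.log_pow] at h3
    have := Real.log_two_lt_d9; push_cast at h3; linarith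
  have hl := Real.log_nonneg hy
  have hs := Real.sq_sqrt hl
  have hs0 := Real.sqrt_nonneg (log y)
  have h4 : primLamQ y ≤ 32 * (-log (Q y) + 1) := by
    unfold primLamQ
    have : 5 * Q y - 4 * Q y ^ 2 + 4 / 3 * Q y ^ 3 - 7 / 3 ≤ 1 := by
      nlinarith [mul_pos hq hq, pow_le_one₀ (n := 3) hq.le hq1, sq_nonneg (Q y - 1)]
    linarith
  nlinarith

/-- Pointwise control of a function orthogonal to `χ_M Φ` by `H f` in `L²`. -/
theorem exists_inversion_bound (hM : 1 ≤ M)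
    (hm : 16 ≤ massM χ M) : ∃ C, 1 ≤ C ∧ ∀ f : ℝ → ℝ, (∀ y, 0 < y → DifferentiableAt ℝ f y) →
    LocallyAC (deriv f) → MemLp (deriv f) 2 ϱ →
    (∃ C₀, ∀ y, 0 < y → y ≤ 1 → |f y| ≤ C₀ / y) → MemLp (Hop f) 2 ϱ →
    ip f (phiM χ M) = 0 → ∀ y, 0 < y →
      (y ≤ 1 → |f y| ≤ C * l2 (Hop f) / y ∧ |y * deriv f y| ≤ C * l2 (Hop f) / y) ∧
      (1 ≤ y → |f y| ≤ C * l2 (Hop f) * (1 + √(log y)) ∧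
        |y * deriv f y| ≤ C * l2 (Hop f) * (1 + √(log y))) := by
  obtain ⟨k, hk, hG⟩ := abs_Gam_le
  obtain ⟨Cφ, hCφ, hφ⟩ := exists_phiM_bound (χ := χ)
  have hk0 : 0 < k := by linarith
  set D := 112 * k * Cφ * ((2 * M) ^ 2 + (2 * M) ^ 3 + (2 * M) ^ 4) * (2 * M) with hD
  have hD0 : 0 ≤ D := by positivity
  refine ⟨6 * D + 112 * k, by linarith, fun f hf hac hgrad ⟨C₀, h0⟩ hH horth => ?_⟩
  set n := l2 (Hop f) with hn
  have hn0 : 0 ≤ n := l2_nonneg _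
  set α : ℝ → ℝ := fun y => y ^ 3 * (deriv f y * Lam Q y - f y * dLamQ y) with hα
  set β : ℝ → ℝ := fun y => y ^ 3 * (deriv f y * Gam y - f y * dGam y) with hβ
  have hβs : ∀ y, 0 < y → β y - β 1 = -∫ s in (1 : ℝ)..y, s ^ 3 * (Hop f s * Gam s) := fun y hy =>
    wronskian_sub hf hac (fun y hy => hasDerivAt_Gam hy) continuousOn_dGam
      (fun y hy => hasDerivAt_cube_dGam hy) one_pos hy
  have hI : ∀ {a b X C : ℝ}, 0 < a → a ≤ b → 0 ≤ X → (∀ s ∈ Ioc a b, s ^ 3 * Gam s ^ 2 ≤ C) →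
      C * (b - a) ≤ X ^ 2 → |∫ s in a..b, s ^ 3 * (Hop f s * Gam s)| ≤ n * X := by
    intro a b X C ha hab hX hC hCX
    refine abs_integral_interval_mul_le hH ha.le hab hX continuousOn_Gam ?_ ?_
    · refine (((continuousOn_id.pow 3).mul (continuousOn_Gam.pow 2)).mono
        fun s hs => ?_).intervalIntegrable
      rw [uIcc_of_le hab] at hs; exact ha.trans_le hs.1
    · have h1 := intervalIntegral.norm_integral_le_of_norm_le_const (a := a) (b := b)
        (C := C) (f := fun s => s ^ 3 * Gam s ^ 2) fun s hs => by
          rw [uIoc_of_le hab] at hs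
          have hs0 : 0 < s := ha.trans hs.1; rw [Real.norm_eq_abs, abs_of_nonneg (by positivity)]
          exact hC s hs
      rw [abs_of_nonneg (sub_nonneg.2 hab)] at h1; exact (le_abs_self _).trans (h1.trans hCX)
  have hGs : ∀ {s x : ℝ}, 0 < s → |Gam s| ≤ x → s ^ 3 * Gam s ^ 2 ≤ s ^ 3 * x ^ 2 :=
    fun {s x} hs h => by rw [← sq_abs (Gam s)]; gcongr
  have hk1 : ∀ {y}, 1 ≤ y → k * (1 + 1 / y ^ 2) ≤ 2 * k := fun {y} hy => by
    have : 1 / y ^ 2 ≤ 1 := by rw [div_le_one (by positivity)]; nlinarith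
    nlinarith
  have hk2 : ∀ {y}, 0 < y → y ≤ 1 → k * (1 + 1 / y ^ 2) ≤ 2 * k / y ^ 2 := fun {y} hy hy1 => by
    have : 1 ≤ 1 / y ^ 2 := by rw [le_div_iff₀ (by positivity)]; nlinarith
    rw [show 2 * k / y ^ 2 = k * (1 / y ^ 2 + 1 / y ^ 2) by ring]
    gcongr
  have hΛy : ∀ y, |Lam Q y| ≤ 6 ∧ |Lam Q y| * y ^ 2 ≤ 48 ∧ |y * dLamQ y| ≤ 6 ∧
      |y * dLamQ y| * y ^ 2 ≤ 48 := fun y => by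
    have h1 := abs_LamQ_le y
    have h2 := abs_mul_dLamQ_le y
    have h3 := Q_mul_le y
    have h4 := Q_le_one y
    have h5 := Q_pos y
    have h6 := sq_nonneg y
    refine ⟨by linarith, ?_, by linarith, ?_⟩ <;> nlinarith
  -- The part of `f` that is controlled before the orthogonality condition is used.
  have hρ : ∀ {y W : ℝ}, 0 < y → (y ≤ 1 ∧ W = 1 / y ∨ 1 ≤ y ∧ W = 1 + √(log y)) →
      ∀ {L G}, |L| ≤ 6 → |L| * y ^ 2 ≤ 48 → |G| ≤ k * (1 + 1 / y ^ 2) →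
        |(β y - β 1) * L - α y * G| ≤ 112 * k * n * W := by
    intro y W hy hW L G hL hL2 hGy
    refine (abs_sub _ _).trans ?_
    rw [abs_mul (β y - β 1), abs_mul (α y)]
    rcases hW with ⟨hy1, rfl⟩ | ⟨hy1, rfl⟩
    · have h6 : |β y - β 1| ≤ n * (2 * k / y) := by
        rw [hβs y hy, intervalIntegral.integral_symm, neg_neg]
        refine hI (C := 4 * k ^ 2 / y) hy hy1 (by positivity) (fun s hs => ?_) ?_
        · have hs0 : 0 < s := hy.trans hs.1
          calc _ ≤ s ^ 3 * (2 * k / s ^ 2) ^ 2 := hGs hs0 ((hG s hs0).1.trans (hk2 hs0 hs.2))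
            _ = 4 * k ^ 2 / s := by field_simp; ring
            _ ≤ 4 * k ^ 2 / y := by gcongr; exact hs.1.le
        · rw [show (2 * k / y) ^ 2 = 4 * k ^ 2 / y * (1 / y) by ring]
          have : 1 ≤ 1 / y := by rwa [le_div_iff₀ hy, one_mul]
          gcongr; linarith
      have h7 : |α y| ≤ n * y ^ 2 := abs_wronskian_LamQ_le hf hac hgrad h0 hH hy (by positivity)
        (primLamQ_le_of_le_one hy.le)
      have h8 := hGy.trans (hk2 hy hy1)
      calc |β y - β 1| * |L| + |α y| * |G|
          ≤ n * (2 * k / y) * 6 + n * y ^ 2 * (2 * k / y ^ 2) := by gcongr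
        _ = k * n * (12 / y + 2) := by field_simp; ring
        _ ≤ k * n * (112 / y) := by
          gcongr
          rw [← sub_nonneg, show 112 / y - (12 / y + 2) = (100 - 2 * y) / y by field_simp; ring]
          exact div_nonneg (by linarith) hy.le
        _ = _ := by ring
    · have h6 : |β y - β 1| ≤ n * (2 * k * y ^ 2) := by
        rw [hβs y hy, abs_neg]
        refine hI (C := y ^ 3 * (2 * k) ^ 2) one_pos hy1 (by positivity) (fun s hs => ?_) ?_
        · have hs0 : 0 < s := one_pos.trans hs.1
          refine (hGs hs0 ((hG s hs0).1.trans (hk1 hs.1.le))).trans ?_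
          gcongr; exact hs.2
        · rw [show (2 * k * y ^ 2) ^ 2 = y ^ 3 * (2 * k) ^ 2 * y by ring]
          gcongr; linarith
      have h7 : |α y| ≤ n * (8 * (1 + √(log y))) :=
        abs_wronskian_LamQ_le hf hac hgrad h0 hH hy (by positivity) (primLamQ_le_log hy1)
      have h8 := hGy.trans (hk1 hy1)
      calc |β y - β 1| * |L| + |α y| * |G|
          ≤ n * (2 * k * y ^ 2) * |L| + n * (8 * (1 + √(log y))) * (2 * k) := by gcongr
        _ = 2 * k * n * (|L| * y ^ 2) + 16 * k * n * (1 + √(log y)) := by ring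
        _ ≤ 2 * k * n * (48 * (1 + √(log y))) + 16 * k * n * (1 + √(log y)) :=
          add_le_add_left (mul_le_mul_of_nonneg_left (hL2.trans
            (by linarith [Real.sqrt_nonneg (log y)])) (by positivity)) _
        _ = _ := by ring
  have hw : ∀ {y : ℝ}, 0 < y → y ^ 3 * (dGam y * Lam Q y - Gam y * dLamQ y) = -1 := fun {y} hy => by
    rw [wronskian hy]; field_simp
  have hrep : ∀ {y}, 0 < y → f y = β y * Lam Q y - α y * Gam y := fun {y} hy => by
    simp only [hα, hβ]
    linear_combination f y * hw hy
  have hrep' : ∀ {y}, 0 < y → y * deriv f y = β y * (y * dLamQ y) - α y * (y * dGam y) :=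
    fun {y} hy => by
      simp only [hα, hβ]
      linear_combination y * deriv f y * hw hy
  have hβD : |β 1| ≤ D * n := by
    set ρ : ℝ → ℝ := fun y => f y - β 1 * Lam Q y with hρd
    have hρb : ∀ y, 0 < y → |ρ y| ≤ 112 * k * n * (1 / y + 1 + y) := fun y hy => by
      have e : ρ y = (β y - β 1) * Lam Q y - α y * Gam y := by simp only [hρd]; rw [hrep hy]; ring
      have hy' : 0 < 1 / y := by positivity
      rw [e]
      obtain ⟨hL, hL2, -⟩ := hΛy y
      rcases le_total y 1 with h1 | h1
      · refine (hρ hy (.inl ⟨h1, rfl⟩) hL hL2 (hG y hy).1).trans ?_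
        gcongr; linarith
      · refine (hρ hy (.inr ⟨h1, rfl⟩) hL hL2 (hG y hy).1).trans ?_
        have : √(log y) ≤ y := by
          rw [Real.sqrt_le_left hy.le]; nlinarith [Real.log_le_sub_one_of_pos hy]
        gcongr; linarith
    have hb : ∀ y, 0 < y → y ≤ 2 * M → |y ^ 3 * (ρ y * phiM χ M y)|
        ≤ 112 * k * Cφ * ((2 * M) ^ 2 + (2 * M) ^ 3 + (2 * M) ^ 4) * n := fun y hy hyM => by
      have h1 := hρb y hy
      have h2 : |phiM χ M y| ≤ Cφ :=
        (hφ M y).trans (mul_le_of_le_one_right (by linarith) (Q_le_one y))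
      rw [abs_mul, abs_mul, abs_of_pos (pow_pos hy 3)]
      calc y ^ 3 * (|ρ y| * |phiM χ M y|)
          ≤ y ^ 3 * ((112 * k * n * (1 / y + 1 + y)) * Cφ) := by gcongr
        _ = 112 * k * Cφ * (y ^ 2 + y ^ 3 + y ^ 4) * n := by field_simp
        _ ≤ _ := by gcongr
    have hz : ∀ y, 2 * M < y → ρ y * phiM χ M y = 0 := fun y hy => by
      rw [phiM_eq_zero hM hy.le, mul_zero]
    have hcρ : ContinuousOn ρ (Ioi 0) :=
      ContinuousOn.sub (fun y hy => (hf y hy).continuousAt.continuousWithinAt)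
        (continuous_const.mul continuous_LamQ).continuousOn
    have i1 : Integrable (fun y => ρ y * phiM χ M y) ϱ :=
      integrable_radial_of_le (aesm_radial (hcρ.mul (continuous_phiM M).continuousOn)) hb hz
    have i2 : Integrable (fun y => Lam Q y * phiM χ M y) ϱ :=
      integrable_mul_phiM hM continuous_LamQ.continuousOn fun y _ => abs_LamQ_le_one y
    have h1 : |ip ρ (phiM χ M)| ≤ D * n :=
      (abs_integral_radial_le (by positivity) hb hz).trans_eq (by rw [hD]; ring)
    have h2 : ip f (phiM χ M) = ip ρ (phiM χ M) + β 1 * massM χ M := by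
      unfold massM
      rw [ip_comm (phiM χ M), ip_eq_comb i1 i2 1 (β 1) fun y _ => by simp only [hρd]; ring, one_mul]
    have h3 : β 1 * massM χ M = -ip ρ (phiM χ M) := by linarith
    rw [← abs_neg, ← h3, abs_mul, abs_of_pos (by linarith : 0 < massM χ M)] at h1
    nlinarith [abs_nonneg (β 1)]
  have key : ∀ {y W : ℝ}, 0 < y → (y ≤ 1 ∧ W = 1 / y ∨ 1 ≤ y ∧ W = 1 + √(log y)) →
      ∀ {L G}, |L| ≤ 6 → |L| * y ^ 2 ≤ 48 → |G| ≤ k * (1 + 1 / y ^ 2) →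
        |β y * L - α y * G| ≤ (6 * D + 112 * k) * n * W := by
    intro y W hy hW L G hL hL2 hGy
    have hW1 : 1 ≤ W := by
      rcases hW with ⟨h, rfl⟩ | ⟨h, rfl⟩
      · rwa [le_div_iff₀ hy, one_mul]
      · linarith [Real.sqrt_nonneg (log y)]
    rw [show β y * L - α y * G = β 1 * L + ((β y - β 1) * L - α y * G) by ring]
    refine (abs_add_le _ _).trans ((add_le_add (b := D * n * 6 * W) ?_
      (hρ hy hW hL hL2 hGy)).trans_eq (by ring))
    rw [abs_mul]
    exact (mul_le_mul hβD hL (abs_nonneg _) (by positivity)).trans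
      (le_mul_of_one_le_right (by positivity) hW1)
  have both : ∀ {y W : ℝ}, 0 < y → (y ≤ 1 ∧ W = 1 / y ∨ 1 ≤ y ∧ W = 1 + √(log y)) →
      |f y| ≤ (6 * D + 112 * k) * n * W ∧ |y * deriv f y| ≤ (6 * D + 112 * k) * n * W := by
    intro y W hy hW
    obtain ⟨h1, h2, h3, h4⟩ := hΛy y; rw [hrep' hy, hrep hy]
    exact ⟨key hy hW h1 h2 (hG y hy).1, key hy hW h3 h4 (hG y hy).2⟩
  refine fun y hy => ⟨fun h => ?_, fun h => both hy (.inr ⟨h, rfl⟩)⟩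
  rw [div_eq_mul_one_div]; exact both hy (.inl ⟨h, rfl⟩)

/-! ### Pairing of the form domain with test functions -/

theorem primitive_eq_of_support (hR : 0 ≤ R) (hy : R ≤ y)
    (h0 : ∀ s, R ≤ s → f s = 0) : ∫ s in (0 : ℝ)..y, f s = ∫ s in (0 : ℝ)..R, f s := by
  rw [intervalIntegral.integral_of_le hR, intervalIntegral.integral_of_le (hR.trans hy)]
  refine setIntegral_eq_of_subset_of_forall_sdiff_eq_zero measurableSet_Ioc
    (Ioc_subset_Ioc_right hy) fun s hs => h0 s ?_
  by_contra h
  exact hs.2 ⟨hs.1.1, (not_le.1 h).le⟩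

theorem abs_ip_le_of_bounded {B : ℝ} (hg : Integrable g ϱ)
    (hf : ∀ y, 0 < y → |f y| ≤ B) : |ip f g| ≤ B * ∫ y, |g y| ∂ϱ := by
  unfold ip; rw [← integral_const_mul, ← Real.norm_eq_abs]
  refine norm_integral_le_of_norm_le (hg.abs.const_mul B) (ae_radial_of_forall fun y hy => ?_)
  rw [Real.norm_eq_abs, abs_mul]; exact mul_le_mul_of_nonneg_right (hf y hy) (abs_nonneg _)

/-- If `S` has compact support and is orthogonal to `ΛQ`, then `Tinv S` is a multiple of `ΛQ` near
infinity, so that it decays. -/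
theorem exists_Tinv_decay (hS : Continuous S) (hR : 1 ≤ R)
    (h0 : ∀ s, R ≤ s → S s = 0) (hflux : ∫ s in (0 : ℝ)..R, S s * Lam Q s * s ^ 3 = 0) :
    ∃ C, 0 < C ∧ ∀ y, 0 < y → |Tinv S y| ≤ C * Q y ∧ |y * dTinv S y| ≤ C * Q y ∧
      |dTinv S y| ≤ C / (1 + y) ^ 3 := by
  have hR0 : 0 < R := by linarith
  obtain ⟨k, hk, h⟩ := abs_Tinv_le
  obtain ⟨A, hA0, hA⟩ := exists_abs_le (a := 0) (b := R) hS.continuousOn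
  set J := ∫ s in (0 : ℝ)..R, S s * Gam s * s ^ 3 with hJ
  have hqR := Q_pos R
  set B := k * A * (R ^ 2 + R ^ 4) with hB
  have hB0 : 0 ≤ B := by positivity
  set B' := k * A * (R + R ^ 3) with hB'
  have hB0' : 0 ≤ B' := by positivity
  refine ⟨B / Q R + B' * (1 + R) ^ 3 + 384 * |J| + 1, by positivity, fun y hy => ?_⟩
  have hq := Q_pos y
  have h1R : 0 ≤ B / Q R := by positivity
  have h2R : 0 ≤ B' * (1 + R) ^ 3 := by positivity
  have h3R := abs_nonneg J
  rcases le_total y R with hyR | hyR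
  · obtain ⟨h1, h2⟩ := h S A y hy hA0.le fun s hs hsy => hA s hs.le (hsy.trans hyR)
    have h3 : k * A * (y ^ 2 + y ^ 4) ≤ B := by rw [hB]; gcongr
    have hQ : Q R ≤ Q y := by unfold Q; gcongr
    have h4 : B ≤ B / Q R * Q y := by
      calc B = B / Q R * Q R := by field_simp
        _ ≤ _ := by gcongr
    have h5 : B / Q R * Q y ≤ (B / Q R + B' * (1 + R) ^ 3 + 384 * |J| + 1) * Q y := by
      refine mul_le_mul_of_nonneg_right ?_ hq.le
      linarith
    refine ⟨by linarith, by linarith, ?_⟩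
    have h6 : |dTinv S y| ≤ B' := by
      have e : y * |dTinv S y| ≤ y * (k * A * (y + y ^ 3)) := by
        rw [abs_mul, abs_of_pos hy] at h2; exact h2.trans_eq (by ring)
      refine (le_of_mul_le_mul_left e hy).trans ?_
      rw [hB']; gcongr
    rw [le_div_iff₀ (by positivity)]
    calc |dTinv S y| * (1 + y) ^ 3 ≤ B' * (1 + R) ^ 3 := by gcongr
      _ ≤ _ := by linarith
  · have hy1 : 1 ≤ y := hR.trans hyR
    have e1 : ∫ s in (0 : ℝ)..y, S s * Lam Q s * s ^ 3 = 0 := by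
      rw [primitive_eq_of_support hR0.le hyR fun s hs => by rw [h0 s hs]; ring, hflux]
    have e2 : ∫ s in (0 : ℝ)..y, S s * Gam s * s ^ 3 = J :=
      primitive_eq_of_support hR0.le hyR fun s hs => by rw [h0 s hs]; ring
    have h1 := abs_LamQ_le y
    have h2 := abs_mul_dLamQ_le y
    have h3 : 6 * |J| * Q y ≤ (B / Q R + B' * (1 + R) ^ 3 + 384 * |J| + 1) * Q y := by
      refine mul_le_mul_of_nonneg_right ?_ hq.le
      linarith
    have h4 : |y * dTinv S y| ≤ 6 * |J| * Q y := by
      unfold dTinv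
      rw [e1, e2, show y * (dGam y * 0 - dLamQ y * J) = -(y * dLamQ y * J) by ring, abs_neg,
        abs_mul]
      calc |y * dLamQ y| * |J| ≤ 6 * Q y * |J| := by gcongr
        _ = _ := by ring
    refine ⟨?_, h4.trans h3, ?_⟩
    · unfold Tinv; rw [e1, e2, mul_zero, zero_sub, abs_neg, abs_mul]
      calc |Lam Q y| * |J| ≤ Q y * |J| := by gcongr
        _ ≤ 6 * |J| * Q y := by nlinarith [mul_nonneg hq.le h3R]
        _ ≤ _ := h3
    · rw [le_div_iff₀ (by positivity)]
      have h5 : (1 + y) ^ 3 ≤ 8 * y ^ 3 := by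
        calc (1 + y) ^ 3 ≤ (y + y) ^ 3 := by gcongr
          _ = _ := by ring
      have h6 := Q_mul_le y
      calc |dTinv S y| * (1 + y) ^ 3 ≤ |dTinv S y| * (8 * y ^ 3) := by gcongr
        _ = |y * dTinv S y| * (8 * y ^ 2) := by rw [abs_mul, abs_of_pos hy]; ring
        _ ≤ 6 * |J| * Q y * (8 * y ^ 2) := by gcongr
        _ = 48 * |J| * (Q y * y ^ 2) := by ring
        _ ≤ 48 * |J| * 8 := by gcongr; nlinarith
        _ ≤ _ := by linarith

theorem formDomain_Tinv (hS : Continuous S) (hR : 1 ≤ R)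
    (h0 : ∀ s, R ≤ s → S s = 0) (hflux : ∫ s in (0 : ℝ)..R, S s * Lam Q s * s ^ 3 = 0) :
    FormDomain (Tinv S) := by
  obtain ⟨C, -, h⟩ := exists_Tinv_decay hS hR h0 hflux
  exact formDomain_of_decay (fun y hy => hasDerivAt_Tinv hS hy) (continuousOn_dTinv hS)
    (fun y hy => (h y hy).1) fun y hy => (h y hy).2.1

/-- A function of the form domain is paired with `S = H (Tinv S)` through the form of `H`. -/
theorem form_Tinv {η : ℝ → ℝ} (hS : Continuous S) (hR : 1 ≤ R)
    (h0 : ∀ s, R ≤ s → S s = 0) (hflux : ∫ s in (0 : ℝ)..R, S s * Lam Q s * s ^ 3 = 0)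
    (hη : FormDomain η) (hi : Integrable (fun y => η y * S y) ϱ) :
    form η (Tinv S) = ip η S := by
  obtain ⟨C, hC, h⟩ := exists_Tinv_decay hS hR h0 hflux
  exact form_eq_ip hη (formDomain_Tinv hS hR h0 hflux) (fun y hy => hasDerivAt_Tinv hS hy)
    (fun y hy => hasDerivAt_cube_dTinv hS hy) hS.continuousOn hC (fun y hy => (h y hy).2.2) hi

theorem FormDomain.integrable_mul {η : ℝ → ℝ} (hη : FormDomain η) (hS : Continuous S)
    (hR : 0 < R) (h0 : ∀ s, R ≤ s → S s = 0) : Integrable (fun y => η y * S y) ϱ := by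
  obtain ⟨A, -, hA⟩ := exists_abs_le (a := 0) (b := R) (f := fun y => y * ((1 + y) * S y))
    (by fun_prop)
  have h1 : MemLp (fun y => (1 + y) * S y) 2 ϱ :=
    memLp_of_continuousOn (δ := R) (R := R) (C := A) (by fun_prop) hR 
    (fun y hy hy1 => hA y hy.le hy1.le) fun y hy => by rw [h0 y hy.le, mul_zero]
  refine (hη.wt.integrable_mul h1).congr (ae_radial_of_forall fun y hy => ?_)
  have : 1 + y ≠ 0 := by positivity
  simp only [Pi.mul_apply]; field_simp

theorem IsBoundState.integrable (h : IsBoundState ψ ζ) : Integrable ψ ϱ := by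
  simpa using h.integrable_weight_mul (f := fun _ => 1) (A := 1) continuousOn_const fun y hy => by
    rw [mul_one, one_mul, abs_of_pos (pow_pos hy 3)]
    exact (pow_le_pow_left₀ hy.le (by linarith) 3).trans
      (pow_le_pow_right₀ (by linarith) (by norm_num))

theorem integrable_phiM (hM : 1 ≤ M) : Integrable (phiM χ M) ϱ := by
  simpa using integrable_mul_phiM hM (f := fun _ => 1) (A := 1) continuousOn_const
    fun _ _ => by simp

set_option maxHeartbeats 1000000 in
/-- The weak norm of `η` against a test function `Y` living on `y ≤ 1/b`: up to a multiple of
`χ_M Φ`, `Y` is `H f` with `f` in the form domain, and the Cauchy-Schwarz inequality for the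
nonnegative form `formPlus` applies. -/
theorem exists_duality_bound (hψ : IsBoundState ψ ζ)
    (hM : 1 ≤ M) (hm : 16 ≤ massM χ M) : ∃ C, 1 ≤ C ∧ ∀ (b A : ℝ) (Y η : ℝ → ℝ), 0 < b →
      1 ≤ |log b| → b < 1 → 2 * M * b ≤ 1 → 0 ≤ A → Continuous Y →
      (∀ s, 0 < s → |Y s| ≤ A * Q s) → (∀ s, 1 ≤ b * s → Y s = 0) → FormDomain η →
      |ip η Y| ≤ C * A * (√|log b| / b * √(formPlus ψ ζ η η)
        + |log b| * (|ip η ψ| + |ip η (phiM χ M)|)) := by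
  obtain ⟨k₁, hk₁, hT⟩ := exists_Tinv_bound_of_support
  obtain ⟨Cφ, hCφ, hφ⟩ := exists_phiM_bound (χ := χ)
  set k₂ := k₁ * Cφ * |log (1 / (4 * M))| with hk₂
  have hk₂0 : 0 ≤ k₂ := by positivity
  have hTφ : ∀ y, 0 < y → |Tinv (phiM χ M) y| ≤ k₂ := fun y hy => by
    refine hT (phiM χ M) Cφ (1 / (4 * M)) y (continuous_phiM M) (by positivity) ?_ ?_
      (by linarith) (fun s _ => hφ M s) (fun s hs => phiM_eq_zero hM ?_) hy
    · rw [one_div, Real.log_inv, abs_neg]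
      refine le_trans ?_ (le_abs_self _)
      rw [Real.le_log_iff_exp_le (by positivity)]
      linarith [Real.exp_one_lt_d9]
    · rw [div_lt_one (by positivity)]; linarith
    · rw [one_div, inv_mul_eq_div, le_div_iff₀ (by positivity)] at hs
      linarith
  set k₃ := k₁ + 20 * k₂ with hk₃
  have hk₃0 : 0 < k₃ := by positivity
  set Kφ := ∫ y, |phiM χ M y| ∂ϱ with hKφ
  have hKφ0 : 0 ≤ Kφ := integral_nonneg fun _ => abs_nonneg _
  set Kψ := ∫ y, |ψ y| ∂ϱ with hKψ
  have hKψ0 : 0 ≤ Kψ := integral_nonneg fun _ => abs_nonneg _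
  set κ := ζ / ip ψ ψ with hκ
  have hκ0 : 0 < κ := div_pos hψ.pos hψ.ip_self_pos
  set k₅ := k₃ * (8 + 20 * Kφ) + κ * (k₃ * Kψ) ^ 2 with hk₅
  have hk₅0 : 0 ≤ k₅ := by positivity
  refine ⟨1 + √k₅ + κ * k₃ * Kψ + 20, by
    have := Real.sqrt_nonneg k₅
    have : 0 ≤ κ * k₃ * Kψ := by positivity
    linarith, fun b A Y η hb hL hb1 hMb hA hY hYb hY0 hη => ?_⟩
  set L := |log b| with hLdef
  have hL0 : 0 < L := by linarith
  have hLb : L ≤ 1 / b := by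
    rw [hLdef, abs_of_neg (Real.log_neg hb hb1), ← Real.log_inv, one_div]
    exact (Real.log_le_sub_one_of_pos (by positivity)).trans (by linarith)
  set R := 1 / b with hR
  have hR1 : 2 * M ≤ R := by rw [hR, le_div_iff₀ hb]; exact hMb
  have hbs : ∀ s, R ≤ s → 1 ≤ b * s := fun s hs => by rw [hR, div_le_iff₀ hb] at hs; linarith
  set F := ∫ s in (0 : ℝ)..R, Y s * Lam Q s * s ^ 3 with hF
  have hFb : |F| ≤ A * (320 * L) := abs_flux_le_of_support hY hb hL hb1 hA hYb hY0 (by positivity)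
  have hFm : ∫ s in (0 : ℝ)..R, phiM χ M s * Lam Q s * s ^ 3 = massM χ M := by
    unfold massM ip
    rw [integral_radial_eq_interval (R := R) (by positivity) fun y hy => by
      rw [phiM_eq_zero hM (hR1.trans hy.le), zero_mul]]
    congr 1; funext s; ring
  -- With this `c` the source `Y - c χ_M Φ` is orthogonal to `ΛQ`, so that its inverse decays.
  set c := F / massM χ M with hc
  have hm0 : 0 < massM χ M := by linarith
  have hcb : |c| ≤ 20 * A * L := by
    rw [hc, abs_div, abs_of_pos hm0, div_le_iff₀ hm0]
    refine hFb.trans ?_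
    have : 0 ≤ A * L := by positivity
    nlinarith
  set S : ℝ → ℝ := fun s => 1 * Y s + -c * phiM χ M s with hS
  have hφc := continuous_phiM (χ := χ) M
  have hSc : Continuous S := by fun_prop
  have hS0 : ∀ s, R ≤ s → S s = 0 := fun s hs => by
    simp only [hS]; rw [hY0 s (hbs s hs), phiM_eq_zero hM (hR1.trans hs)]; ring
  have hflux : ∫ s in (0 : ℝ)..R, S s * Lam Q s * s ^ 3 = 0 := by
    have hΛ := continuous_LamQ; simp only [hS, add_mul, mul_assoc]
    rw [intervalIntegral.integral_add (Continuous.intervalIntegrable (by fun_prop) _ _)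
      (Continuous.intervalIntegrable (by fun_prop) _ _), intervalIntegral.integral_const_mul,
      intervalIntegral.integral_const_mul]
    simp only [← mul_assoc]; rw [hFm, hc, ← hF]; field_simp; ring
  have hR1' : 1 ≤ R := by linarith
  set f := Tinv S with hf
  have hfD : FormDomain f := formDomain_Tinv hSc hR1' hS0 hflux
  have hfb : ∀ y, 0 < y → |f y| ≤ k₃ * A * L := fun y hy => by
    rw [hf, hS, Tinv_add hY hφc]
    refine (abs_add_le _ _).trans ?_
    rw [one_mul, abs_mul, abs_neg]
    have h1 := hT Y A b y hY hb hL hb1 hA hYb hY0 hy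
    calc |Tinv Y y| + |c| * |Tinv (phiM χ M) y| ≤ k₁ * A * L + 20 * A * L * k₂ :=
          add_le_add h1 (mul_le_mul hcb (hTφ y hy) (abs_nonneg _) (by positivity))
      _ = _ := by rw [hk₃]; ring
  have hYR : ∀ y, 0 < y → y ≤ R → |y ^ 3 * Y y| ≤ 8 * A * R := fun y hy hyR => by
    have h1 := Q_mul_le y
    have h2 := Q_pos y; rw [abs_pow_mul hy]
    calc y ^ 3 * |Y y| ≤ y ^ 3 * (A * Q y) := by gcongr; exact hYb y hy
      _ = A * (Q y * y ^ 2) * y := by ring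
      _ ≤ A * 8 * R := by gcongr; nlinarith
      _ = _ := by ring
  have iY : Integrable Y ϱ := by
    exact integrable_radial_of_le (R := R) (aesm_radial hY.continuousOn) hYR
      fun y hy => hY0 y (hbs y hy.le)
  have hYi : ∫ y, |Y y| ∂ϱ ≤ 8 * A * R * R :=
    (le_abs_self _).trans (abs_integral_radial_le (by positivity) (fun y hy hyR => by
      rw [abs_mul, abs_abs, ← abs_mul]; exact hYR y hy hyR) fun y hy => by
      rw [hY0 y (hbs y hy.le), abs_zero])
  have iφ := integrable_phiM (χ := χ) hM
  have hSi : Integrable S ϱ := (iY.const_mul 1).add (iφ.const_mul (-c))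
  have hSn : ∫ y, |S y| ∂ϱ ≤ 8 * A * R * R + 20 * A * L * Kφ := by
    calc ∫ y, |S y| ∂ϱ
        ≤ ∫ y, (|Y y| + |c| * |phiM χ M y|) ∂ϱ := by
          refine integral_mono hSi.abs (iY.abs.add (iφ.abs.const_mul _)) fun y => ?_
          refine (abs_add_le _ _).trans ?_
          rw [one_mul, abs_mul, abs_neg]
      _ = (∫ y, |Y y| ∂ϱ) + |c| * Kφ := by
          rw [integral_add iY.abs (iφ.abs.const_mul _), integral_const_mul]
      _ ≤ _ := by gcongr
  have hff : form f f ≤ k₃ * (8 + 20 * Kφ) * A ^ 2 * L * R ^ 2 := by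
    rw [form_Tinv hSc hR1' hS0 hflux hfD (hfD.integrable_mul hSc (by positivity) hS0)]
    refine (le_abs_self _).trans ((abs_ip_le_of_bounded hSi hfb).trans ?_)
    calc k₃ * A * L * ∫ y, |S y| ∂ϱ
        ≤ k₃ * A * L * (8 * A * R * R + 20 * A * L * Kφ) := by gcongr
      _ ≤ k₃ * A * L * (8 * A * R * R + 20 * A * (R * R) * Kφ) := by
          have : L ≤ R * R := hLb.trans (by nlinarith)
          gcongr
      _ = _ := by ring
  have hfψ : |ip f ψ| ≤ k₃ * A * L * Kψ := abs_ip_le_of_bounded hψ.integrable hfb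
  have hPf : formPlus ψ ζ f f ≤ k₅ * (A * √L * R) ^ 2 := by
    have h1 : ip f ψ * ip f ψ ≤ (k₃ * A * L * Kψ) ^ 2 := by rw [← sq, ← sq_abs]; gcongr
    have h2 : L ^ 2 ≤ L * R ^ 2 := by
      rw [sq]; gcongr; exact hLb.trans (by nlinarith)
    calc formPlus ψ ζ f f ≤ k₃ * (8 + 20 * Kφ) * A ^ 2 * L * R ^ 2
          + κ * (k₃ * A * L * Kψ) ^ 2 := add_le_add hff (by gcongr)
      _ = k₃ * (8 + 20 * Kφ) * A ^ 2 * (L * R ^ 2) + κ * (k₃ * Kψ) ^ 2 * A ^ 2 * L ^ 2 := by ring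
      _ ≤ k₃ * (8 + 20 * Kφ) * A ^ 2 * (L * R ^ 2) + κ * (k₃ * Kψ) ^ 2 * A ^ 2 * (L * R ^ 2) := by
          gcongr
      _ = k₅ * (A ^ 2 * L * R ^ 2) := by rw [hk₅]; ring
      _ = _ := by rw [mul_pow, mul_pow, Real.sq_sqrt hL0.le]
  have hP : |formPlus ψ ζ η f| ≤ √k₅ * (A * √L * R) * √(formPlus ψ ζ η η) := by
    refine (Real.abs_le_sqrt (hψ.formPlus_sq_le hη hfD)).trans ?_
    rw [Real.sqrt_mul (hψ.formPlus_self_nonneg hη), mul_comm]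
    refine mul_le_mul_of_nonneg_right ?_ (Real.sqrt_nonneg _)
    refine (Real.sqrt_le_sqrt hPf).trans_eq ?_
    rw [Real.sqrt_mul hk₅0, Real.sqrt_sq (by positivity)]
  have iηS := hη.integrable_mul hSc (by positivity : 0 < R) hS0
  have iηφ := hη.integrable_mul hφc (by positivity : 0 < R) fun s hs =>
    phiM_eq_zero hM (hR1.trans hs)
  have e : ip η Y = formPlus ψ ζ η f - κ * (ip η ψ * ip f ψ) + c * ip η (phiM χ M) := by
    have e1 : ip η Y = ip η S + c * ip η (phiM χ M) := by
      rw [ip_comm, ip_eq_comb (by simpa only [mul_comm] using iηS)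
        (by simpa only [mul_comm] using iηφ) 1 c fun y _ => by simp only [hS]; ring,
        ip_comm S, ip_comm (phiM χ M), one_mul]
    rw [e1, ← form_Tinv hSc hR1' hS0 hflux hη iηS]
    unfold formPlus; ring
  have hs := Real.sqrt_nonneg k₅
  have hsL := Real.sqrt_nonneg L
  have hsη := Real.sqrt_nonneg (formPlus ψ ζ η η)
  have h1 : |κ * (ip η ψ * ip f ψ)| ≤ κ * k₃ * Kψ * A * (L * |ip η ψ|) := by
    rw [abs_mul κ, abs_mul (ip η ψ), abs_of_pos hκ0]
    calc κ * (|ip η ψ| * |ip f ψ|) ≤ κ * (|ip η ψ| * (k₃ * A * L * Kψ)) := by gcongr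
      _ = _ := by ring
  have h2 : |c * ip η (phiM χ M)| ≤ 20 * A * (L * |ip η (phiM χ M)|) := by
    rw [abs_mul c]
    calc |c| * |ip η (phiM χ M)| ≤ 20 * A * L * |ip η (phiM χ M)| := by gcongr
      _ = _ := by ring
  set X := √L / b * √(formPlus ψ ζ η η) with hX
  have hX0 : 0 ≤ X := by positivity
  have h3 : √k₅ * (A * √L * R) * √(formPlus ψ ζ η η) = √k₅ * A * X := by rw [hX, hR]; ring
  rw [e]
  have h4 : 0 ≤ κ * k₃ * Kψ := by positivity
  set p := L * |ip η ψ| with hp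
  set q := L * |ip η (phiM χ M)| with hq
  have hX' : 0 ≤ A * X := by positivity
  have hp' : 0 ≤ A * p := by positivity
  have hq' : 0 ≤ A * q := by positivity
  refine (abs_add_le _ _).trans ((add_le_add ((abs_sub _ _).trans (add_le_add hP h1)) h2).trans ?_)
  rw [h3, mul_add L, ← hp, ← hq]
  set k := κ * k₃ * Kψ
  linear_combination hX' + hp' + hq' + k * hX' + 20 * hX' + √k₅ * hp' + 20 * hp' + √k₅ * hq' + k * hq'

/-! ### Pointwise bounds for radial Sobolev functions -/

theorem abs_sub_le_of_grad (hac : LocallyAC f) (hg : MemLp (deriv f) 2 ϱ)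
    (hr : 0 < r) (hR : r ≤ R) : |f R - f r| ≤ l2 (deriv f) / r := by
  have hR0 : 0 < R := hr.trans_le hR
  have hsub : uIcc r R ⊆ Ioi 0 := by rw [uIcc_of_le hR]; exact fun s hs => hr.trans_le hs.1
  have hc : ContinuousOn (fun s : ℝ => (s ^ 3)⁻¹) (Ioi 0) :=
    ContinuousOn.inv₀ (by fun_prop) fun s hs => by
      have : (0 : ℝ) < s := hs; positivity
  have hi : IntervalIntegrable (fun s : ℝ => s ^ 3 * ((s ^ 3)⁻¹) ^ 2) volume r R :=
    (ContinuousOn.mul (by fun_prop) ((hc.mono hsub).pow 2)).intervalIntegrable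
  have hprim : ∫ s in r..R, s ^ 3 * ((s ^ 3)⁻¹) ^ 2 = (1 / r ^ 2 - 1 / R ^ 2) / 2 := by
    rw [intervalIntegral.integral_eq_sub_of_hasDerivAt (f := fun s => -(1 / 2) * (s ^ 2)⁻¹)
      (fun s hs => ?_) hi]
    · field_simp; ring
    · have hs0 : 0 < s := hsub hs
      refine (((hasDerivAt_pow 2 s).fun_inv (by positivity)).const_mul (-(1 / 2))).congr_deriv ?_
      field_simp; norm_num
  have h := abs_integral_interval_mul_le (a := r) (b := R) (X := 1 / r) hg hr.le hR (by positivity)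
    hc hi (by
      rw [hprim, div_pow, one_pow]
      have : 0 < 1 / R ^ 2 := by positivity
      have : 0 < 1 / r ^ 2 := by positivity
      linarith)
  have e : ∫ s in r..R, s ^ 3 * (deriv f s * (s ^ 3)⁻¹) = f R - f r := by
    rw [← hac.integral_deriv hr hR0]
    refine intervalIntegral.integral_congr fun s hs => ?_
    have hs0 : 0 < s := hsub hs; field_simp
  rw [e, mul_one_div] at h; exact h

/-- The radial Sobolev inequality in `Ḣ¹(ℝ⁴)`. -/
theorem abs_le_of_tendsto (hac : LocallyAC f) (hg : MemLp (deriv f) 2 ϱ)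
    (h0 : Tendsto f atTop (𝓝 0)) (hr : 0 < r) : |f r| ≤ l2 (deriv f) / r := by
  have h1 : Tendsto (fun R => |f R - f r|) atTop (𝓝 |0 - f r|) := (h0.sub_const _).abs
  have h2 := le_of_tendsto h1 (eventually_atTop.2 ⟨r, fun R hR => abs_sub_le_of_grad hac hg hr hR⟩)
  rwa [zero_sub, abs_neg] at h2

theorem abs_le_of_memLp (hac : LocallyAC f) (hg : MemLp (deriv f) 2 ϱ)
    (hf : MemLp f 2 ϱ) (hr : 0 < r) : |f r| ≤ l2 (deriv f) / r := by
  refine le_of_forall_pos_le_add fun ε hε => ?_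
  obtain ⟨y, hy, hy2⟩ := exists_small_near_top hf.integrable_sq (ε := ε ^ 2) (by positivity) (max r 1)
  have hyr : r < y := (le_max_left _ _).trans_lt hy
  have hy1 : 1 < y := (le_max_right _ _).trans_lt hy
  have h1 := abs_sub_le_of_grad hac hg hr hyr.le
  have h2 : |f y| ≤ ε := by
    have h3 : (1 : ℝ) ≤ y ^ 4 := one_le_pow₀ hy1.le
    refine abs_le_of_sq_le_sq ?_ hε.le
    nlinarith [sq_nonneg (f y)]
  have h3 : |f r| ≤ |f y| + |f y - f r| := by
    have := abs_sub (f y) (f y - f r)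
    rwa [sub_sub_cancel] at this
  linarith

/-! ### Differentiation in time of spatial integrals -/

/-- Differentiation under the integral sign within a convex set of times. -/
theorem hasDerivWithinAt_integral {α : Type*} [MeasurableSpace α] {μ : Measure α}
    {F F' : ℝ → α → ℝ} {bound : α → ℝ} {J : Set ℝ} (hJ : Convex ℝ J) (ht : t ∈ J)
    (hF : ∀ τ ∈ J, Integrable (F τ) μ)
    (hd : ∀ᵐ r ∂μ, ∀ τ ∈ J, HasDerivWithinAt (fun τ => F τ r) (F' τ r) J τ ∧ |F' τ r| ≤ bound r)
    (hb : Integrable bound μ) :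
    HasDerivWithinAt (fun τ => ∫ r, F τ r ∂μ) (∫ r, F' t r ∂μ) J t := by
  rw [hasDerivWithinAt_iff_tendsto_slope]
  have h1 : Tendsto (fun τ => ∫ r, slope (fun τ => F τ r) t τ ∂μ) (𝓝[J \ {t}] t)
      (𝓝 (∫ r, F' t r ∂μ)) := by
    refine tendsto_integral_filter_of_dominated_convergence bound ?_ ?_ hb ?_
    · filter_upwards [self_mem_nhdsWithin] with τ hτ
      simp only [slope_def_field]
      exact (((hF τ hτ.1).sub (hF t ht)).div_const _).aestronglyMeasurable
    · filter_upwards [self_mem_nhdsWithin] with τ hτ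
      filter_upwards [hd] with r hr
      have h2 := hJ.norm_image_sub_le_of_norm_hasDerivWithin_le (fun s hs => (hr s hs).1)
        (fun s hs => (hr s hs).2) ht hτ.1
      have h3 : 0 < ‖τ - t‖ := norm_pos_iff.2 (sub_ne_zero.2 hτ.2)
      rw [slope_def_field, norm_div, div_le_iff₀ h3]; exact h2
    · filter_upwards [hd] with r hr
      exact hasDerivWithinAt_iff_tendsto_slope.1 (hr t ht).1
  refine h1.congr' ?_
  filter_upwards [self_mem_nhdsWithin] with τ hτ
  simp only [slope_def_field]; rw [integral_div, integral_sub (hF τ hτ.1) (hF t ht)]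

theorem l2_eq_toReal (hf : MemLp f 2 ϱ) : l2 f = (eLpNorm f 2 ϱ).toReal := by
  unfold l2
  rw [hf.eLpNorm_eq_integral_rpow_norm (by norm_num) (by norm_num), ENNReal.toReal_ofReal (by positivity),
    Real.sqrt_eq_rpow]
  simp

theorem abs_integral_mul_le_eLpNorm (hf : MemLp f 2 ϱ)
    (hg : MemLp g 2 ϱ) : |∫ r, f r * g r ∂ϱ| ≤ (eLpNorm f 2 ϱ).toReal * l2 g :=
  l2_eq_toReal hf ▸ abs_ip_le hf hg

/-- Continuity in `L²` implies local boundedness of the norm. -/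
theorem exists_l2_bound {t₀ : ℝ} {v : ℝ → ℝ → ℝ} (ht : t₀ ∈ Icc 0 T)
    (hv : ∀ t ∈ Icc 0 T, MemLp (v t) 2 ϱ) (hc : ContinuousL2 T v) :
    ∃ C, ∀ᶠ t in 𝓝[Icc 0 T] t₀, l2 (v t) ≤ C := by
  refine ⟨l2 (v t₀) + 1, ?_⟩
  filter_upwards [(hc t₀ ht).eventually (gt_mem_nhds one_pos), self_mem_nhdsWithin] with t h1 h2
  rw [l2_eq_toReal (hv t h2), l2_eq_toReal (hv t₀ ht)]
  have h3 : eLpNorm (v t) 2 ϱ ≤ eLpNorm (v t₀) 2 ϱ + 1 := by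
    have h4 : v t = v t₀ + fun r => v t r - v t₀ r := by funext r; simp
    calc eLpNorm (v t) 2 ϱ
        = eLpNorm (v t₀ + fun r => v t r - v t₀ r) 2 ϱ := by rw [← h4]
      _ ≤ _ := (eLpNorm_add_le (hv t₀ ht).1 ((hv t h2).sub (hv t₀ ht)).1 (by norm_num)).trans
          (add_le_add le_rfl h1.le)
  have h5 := ENNReal.toReal_mono (by simp [(hv t₀ ht).2.ne]) h3
  rwa [ENNReal.toReal_add (hv t₀ ht).2.ne (by simp), ENNReal.toReal_one] at h5

/-- Weights with uniformly compact support that are differentiable in time. -/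
structure IsWeight (J : Set ℝ) (W W' : ℝ → ℝ → ℝ) (R B : ℝ) : Prop where
  deriv : ∀ t ∈ J, ∀ r, 0 < r → HasDerivWithinAt (fun τ => W τ r) (W' t r) J t
  cont : ∀ t ∈ J, ContinuousOn (W t) (Ioi 0)
  bound : ∀ t ∈ J, ∀ r, 0 < r → |W t r| ≤ B ∧ |W' t r| ≤ B
  zero : ∀ t ∈ J, ∀ r, R < r → W t r = 0 ∧ W' t r = 0

theorem IsWeight.mono {J J' : Set ℝ} {W W' : ℝ → ℝ → ℝ} {B : ℝ} (h : IsWeight J W W' R B)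
    (hJ : J' ⊆ J) : IsWeight J' W W' R B where
  deriv t ht r hr := (h.deriv t (hJ ht) r hr).mono hJ
  cont t ht := h.cont t (hJ ht)
  bound t ht := h.bound t (hJ ht)
  zero t ht := h.zero t (hJ ht)

theorem abs_mul_le_mul_indicator {x w B D : ℝ} (hx : |x| ≤ D) (hw : |w| ≤ B) (h0 : R < r → w = 0) :
    |x * w| ≤ D * (Iic R).indicator (fun _ : ℝ => B) r := by
  rcases le_or_gt r R with hrR | hrR
  · rw [indicator_of_mem (mem_Iic.2 hrR), abs_mul]
    exact mul_le_mul hx hw (abs_nonneg _) ((abs_nonneg _).trans hx)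
  · rw [h0 hrR, indicator_of_notMem (by simpa using hrR)]; simp

theorem integrable_div_mul_indicator (C R B : ℝ) :
    Integrable (fun r => C / r * (Iic R).indicator (fun _ : ℝ => B) r) ϱ := by
  refine integrable_radial_of_le (R := R) (A := R ^ 2 * |C * B|)
    ((aesm_radial (continuousOn_const.div continuousOn_id fun r hr => ne_of_gt hr)).mul
      (aestronglyMeasurable_const.indicator measurableSet_Iic)) (fun r hr hrR => ?_) fun r hr => ?_
  · rw [indicator_of_mem (mem_Iic.2 hrR), show r ^ 3 * (C / r * B) = r ^ 2 * (C * B) by field_simp,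
      abs_pow_mul hr]
    gcongr
  · rw [indicator_of_notMem (by simpa using hr), mul_zero]

/-- The derivative of `∫ u W` when `u` and `∂_t u` are dominated by an integrable function. -/
theorem hasDerivWithinAt_integral_weight {J : Set ℝ} (hJ : Convex ℝ J) (ht : t ∈ J)
    {u' W W' : ℝ → ℝ → ℝ} {φ : ℝ → ℝ} {B : ℝ} (hW : IsWeight J W W' R B)
    (hφ : Integrable (fun r => φ r * (Iic R).indicator (fun _ : ℝ => B) r) ϱ)
    (hu : ∀ τ ∈ J, ∀ r, 0 < r → HasDerivWithinAt (fun τ => u τ r) (u' τ r) J τ)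
    (hc : ∀ τ ∈ J, AEStronglyMeasurable (u τ) ϱ)
    (hb : ∀ τ ∈ J, ∀ r, 0 < r → |u τ r| ≤ φ r ∧ |u' τ r| ≤ φ r) :
    HasDerivWithinAt (fun τ => ∫ r, u τ r * W τ r ∂ϱ)
      (∫ r, (u' t r * W t r + u t r * W' t r) ∂ϱ) J t := by
  refine hasDerivWithinAt_integral (F := fun τ r => u τ r * W τ r)
    (F' := fun τ r => u' τ r * W τ r + u τ r * W' τ r) hJ ht (fun τ hτ => ?_)
    (ae_radial_of_forall fun r hr τ hτ => ⟨(hu τ hτ r hr).mul (hW.deriv τ hτ r hr), ?_⟩)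
    (hφ.add hφ)
  · exact hφ.mono' ((hc τ hτ).mul (aesm_radial (hW.cont τ hτ))) (ae_radial_of_forall fun r hr =>
      abs_mul_le_mul_indicator (hb τ hτ r hr).1 (hW.bound τ hτ r hr).1 fun h => (hW.zero τ hτ r h).1)
  · exact (abs_add_le _ _).trans (add_le_add
      (abs_mul_le_mul_indicator (hb τ hτ r hr).2 (hW.bound τ hτ r hr).1 fun h => (hW.zero τ hτ r h).1)
      (abs_mul_le_mul_indicator (hb τ hτ r hr).1 (hW.bound τ hτ r hr).2 fun h => (hW.zero τ hτ r h).2))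

theorem IsWeight.memLp {J : Set ℝ} {W W' : ℝ → ℝ → ℝ} {B : ℝ} (hW : IsWeight J W W' R B)
    (hR : 0 ≤ R) (ht : t ∈ J) :
    MemLp (W t) 2 ϱ ∧ l2 (W t) ≤ √(R ^ 3 * B ^ 2 * R) := by
  have hb : ∀ r, 0 < r → r ≤ R → |r ^ 3 * W t r ^ 2| ≤ R ^ 3 * B ^ 2 := fun r hr hrR => by
    rw [abs_pow_mul hr, abs_pow]
    have := (hW.bound t ht r hr).1
    gcongr
  have h0 : ∀ r, R < r → W t r = 0 := fun r hr => (hW.zero t ht r hr).1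
  refine ⟨memLp_radial_of_le (aesm_radial (hW.cont t ht)) hb h0, Real.sqrt_le_sqrt ?_⟩
  exact (le_abs_self _).trans (abs_integral_radial_le (f := fun r => W t r ^ 2) hR hb fun r hr => by
    rw [h0 r hr]; ring)

/-- The derivative of `∫ q W` when the difference quotients of `q` converge in `L²`. -/
theorem hasDerivWithinAt_integral_weight_l2 {J : Set ℝ} (hJ : Convex ℝ J) (ht : t ∈ J)
    {q W W' : ℝ → ℝ → ℝ} {A : ℝ → ℝ} {B : ℝ} (hR : 0 ≤ R) (hW : IsWeight J W W' R B)
    (hq : ∀ τ ∈ J, MemLp (q τ) 2 ϱ) (hA : MemLp A 2 ϱ)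
    (hlim : Tendsto (fun τ => eLpNorm (fun r => (q τ r - q t r) / (τ - t) - A r) 2 ϱ)
      (𝓝[J \ {t}] t) (𝓝 0)) :
    HasDerivWithinAt (fun τ => ∫ r, q τ r * W τ r ∂ϱ)
      ((∫ r, A r * W t r ∂ϱ) + ∫ r, q t r * W' t r ∂ϱ) J t := by
  have hone : MemLp ((Iic R).indicator fun _ : ℝ => B) 2 ϱ := by
    refine memLp_radial_of_le (R := R) (A := R ^ 3 * B ^ 2)
      (aestronglyMeasurable_const.indicator measurableSet_Iic) (fun r hr hrR => ?_) fun r hr => ?_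
    · rw [indicator_of_mem (mem_Iic.2 hrR), abs_of_nonneg (by positivity)]
      gcongr
    · rw [indicator_of_notMem (by simpa using hr)]
  have hbd : ∀ {f : ℝ → ℝ}, MemLp f 2 ϱ →
      Integrable (fun r => |f r| * (Iic R).indicator (fun _ : ℝ => B) r) ϱ :=
    fun hf => hf.abs.integrable_mul hone
  have hint : ∀ {f : ℝ → ℝ}, MemLp f 2 ϱ → ∀ τ ∈ J,
      Integrable (fun r => f r * W τ r) ϱ := fun hf τ hτ =>
    hf.integrable_mul (hW.memLp hR hτ).1
  have h1 : HasDerivWithinAt (fun τ => ∫ r, q t r * W τ r ∂ϱ) (∫ r, q t r * W' t r ∂ϱ) J t := by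
    simpa using hasDerivWithinAt_integral_weight hJ ht hW (u := fun _ => q t) (u' := fun _ _ => 0)
      (hbd (hq t ht)) (fun τ _ r _ => hasDerivWithinAt_const _ _ _) (fun _ _ => (hq t ht).1)
      fun τ _ r _ => ⟨le_rfl, by simp⟩
  have h2 : Tendsto (fun τ => ∫ r, A r * W τ r ∂ϱ) (𝓝[J \ {t}] t) (𝓝 (∫ r, A r * W t r ∂ϱ)) := by
    refine tendsto_integral_filter_of_dominated_convergence _ ?_ ?_ (hbd hA) ?_
    · filter_upwards [self_mem_nhdsWithin] with τ hτ
      exact (hint hA τ hτ.1).aestronglyMeasurable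
    · filter_upwards [self_mem_nhdsWithin] with τ hτ
      exact ae_radial_of_forall fun r hr => abs_mul_le_mul_indicator le_rfl
        (hW.bound τ hτ.1 r hr).1 fun h => (hW.zero τ hτ.1 r h).1
    · exact ae_radial_of_forall fun r hr => ((hW.deriv t ht r hr).continuousWithinAt.mono
        sdiff_subset).tendsto.const_mul _
  set E : ℝ → ℝ → ℝ := fun τ r => (q τ r - q t r) / (τ - t) - A r with hE
  have hEm : ∀ τ ∈ J, MemLp (E τ) 2 ϱ := fun τ hτ => by
    have h3 := (((hq τ hτ).sub (hq t ht)).const_mul (τ - t)⁻¹).sub hA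
    refine h3.ae_eq (Eventually.of_forall fun r => ?_)
    simp only [Pi.sub_apply, hE]; ring
  have h3 : Tendsto (fun τ => ∫ r, E τ r * W τ r ∂ϱ) (𝓝[J \ {t}] t) (𝓝 0) := by
    have h4 := ((ENNReal.tendsto_toReal (by simp)).comp hlim).mul_const (√(R ^ 3 * B ^ 2 * R))
    rw [ENNReal.toReal_zero, zero_mul] at h4
    refine squeeze_zero_norm' ?_ h4
    filter_upwards [self_mem_nhdsWithin] with τ hτ
    obtain ⟨h5, h6⟩ := hW.memLp hR hτ.1
    exact (abs_integral_mul_le_eLpNorm (hEm τ hτ.1) h5).trans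
      (mul_le_mul_of_nonneg_left h6 ENNReal.toReal_nonneg)
  rw [hasDerivWithinAt_iff_tendsto_slope] at h1 ⊢
  have h4 := (h3.add h2).add h1; rw [zero_add] at h4
  refine h4.congr' ?_
  filter_upwards [self_mem_nhdsWithin] with τ hτ
  have hτt : τ - t ≠ 0 := sub_ne_zero.2 hτ.2; simp only [slope_def_field]
  rw [← integral_add (hint (hEm τ hτ.1) τ hτ.1) (hint hA τ hτ.1), eq_div_iff hτt, add_mul,
    div_mul_cancel₀ _ hτt, ← integral_mul_const]
  have e : ∫ r, (E τ r * W τ r + A r * W τ r) * (τ - t) ∂ϱ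
      = (∫ r, q τ r * W τ r ∂ϱ) - ∫ r, q t r * W τ r ∂ϱ := by
    rw [← integral_sub (hint (hq τ hτ.1) τ hτ.1) (hint (hq t ht) τ hτ.1)]
    congr 1
    funext r
    simp only [hE]; field_simp; ring
  rw [e]; ring

/-- The limit in `L²` of difference quotients is in `L²`. -/
theorem memLp_of_tendsto {J : Set ℝ} (ht : t ∈ J) [(𝓝[J \ {t}] t).NeBot]
    {q : ℝ → ℝ → ℝ} {A : ℝ → ℝ} (hq : ∀ τ ∈ J, MemLp (q τ) 2 ϱ)
    (hA : AEStronglyMeasurable A ϱ)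
    (hlim : Tendsto (fun τ => eLpNorm (fun r => (q τ r - q t r) / (τ - t) - A r) 2 ϱ)
      (𝓝[J \ {t}] t) (𝓝 0)) : MemLp A 2 ϱ := by
  obtain ⟨τ, h1, h2⟩ := ((hlim.eventually (gt_mem_nhds one_pos)).and self_mem_nhdsWithin).exists
  have h3 : MemLp (fun r => (q τ r - q t r) / (τ - t)) 2 ϱ := by
    refine (((hq τ h2.1).sub (hq t ht)).const_mul (τ - t)⁻¹).ae_eq (Eventually.of_forall fun r => ?_)
    simp only [Pi.sub_apply]; ring
  have h4 : MemLp (fun r => (q τ r - q t r) / (τ - t) - A r) 2 ϱ :=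
    ⟨h3.1.sub hA, h1.trans ENNReal.one_lt_top⟩
  refine (h3.sub h4).ae_eq (Eventually.of_forall fun r => ?_)
  simp

/-! ### Renormalized variables -/

/-- `v(t, y) = λ u(t, λ y)`. -/
def vres (lam : ℝ → ℝ) (u : ℝ → ℝ → ℝ) (t y : ℝ) : ℝ := lam t * u t (lam t * y)

/-- `p(t, y) = λ² ∂_t u(t, λ y)`. -/
def pres (T : ℝ) (u : ℝ → ℝ → ℝ) (lam : ℝ → ℝ) (t y : ℝ) : ℝ := lam t ^ 2 * dt T u t (lam t * y)

/-- `η = p - b Λ P_{B₁} - b_s ∂_b P_{B₁}`, that is `λ² ∂_t w` at `r = λ y`. -/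
def etares (χ : ℝ → ℝ) (M T : ℝ) (u : ℝ → ℝ → ℝ) (lam : ℝ → ℝ) (t y : ℝ) : ℝ :=
  pres T u lam t y - bpar T lam t * Lam (PB1 χ M (bpar T lam t)) y
    - bs T lam t * dbPB1 χ M (bpar T lam t) y

/-- The chain rule along a curve in the plane. -/
theorem hasDerivWithinAt_curve {f : ℝ → ℝ → ℝ} {α β : ℝ → ℝ} {α' β' : ℝ} {s : Set ℝ}
    (hf : DifferentiableAt ℝ (Function.uncurry f) (α t, β t)) (hα : HasDerivWithinAt α α' s t)
    (hβ : HasDerivWithinAt β β' s t) :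
    HasDerivWithinAt (fun τ => f (α τ) (β τ))
      (α' * deriv (fun x => f x (β t)) (α t) + β' * deriv (f (α t)) (β t)) s t := by
  have h := hf.hasFDerivAt
  set Df := fderiv ℝ (Function.uncurry f) (α t, β t) with hDf
  have h1 : HasDerivAt (fun x => f x (β t)) (Df (1, 0)) (α t) :=
    HasFDerivAt.comp_hasDerivAt (α t) (f := fun x => (x, β t)) h
      ((hasDerivAt_id (α t)).prodMk (hasDerivAt_const _ _))
  have h2 : HasDerivAt (f (α t)) (Df (0, 1)) (β t) :=
    HasFDerivAt.comp_hasDerivAt (β t) (f := fun x => (α t, x)) h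
      ((hasDerivAt_const _ _).prodMk (hasDerivAt_id (β t)))
  have h3 := HasFDerivAt.comp_hasDerivWithinAt t (f := fun τ => (α τ, β τ)) h (hα.prodMk hβ)
  have e : Df (α', β') = α' * Df (1, 0) + β' * Df (0, 1) := by
    rw [show ((α', β') : ℝ × ℝ) = α' • (1, 0) + β' • (0, 1) by simp, map_add, map_smul, map_smul]
    rfl
  rw [h1.deriv, h2.deriv, ← e]; exact h3

theorem hasDerivWithinAt_lam (hl : ContDiffOn ℝ 2 lam (Icc 0 T)) (ht : t ∈ Icc 0 T) :
    HasDerivWithinAt lam (-bpar T lam t) (Icc 0 T) t := by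
  unfold bpar; rw [neg_neg]; exact (hl.differentiableOn (by norm_num) t ht).hasDerivWithinAt

theorem hasDerivWithinAt_bpar (hT : 0 < T) (hl : ContDiffOn ℝ 2 lam (Icc 0 T))
    (hpos : 0 < lam t) (ht : t ∈ Icc 0 T) :
    HasDerivWithinAt (bpar T lam) (bs T lam t / lam t) (Icc 0 T) t := by
  have h1 : ContDiffOn ℝ 1 (derivWithin lam (Icc 0 T)) (Icc 0 T) :=
    ((contDiffOn_succ_iff_derivWithin (n := 1) (uniqueDiffOn_Icc hT)).1 hl).2.2
  have h2 : DifferentiableWithinAt ℝ (bpar T lam) (Icc 0 T) t :=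
    (h1.differentiableOn (by norm_num) t ht).neg
  have e : bs T lam t / lam t = derivWithin (bpar T lam) (Icc 0 T) t := by
    unfold bs dds; field_simp
  rw [e]; exact h2.hasDerivWithinAt

theorem continuousOn_bs (hT : 0 < T) (hl : ContDiffOn ℝ 2 lam (Icc 0 T)) :
    ContinuousOn (bs T lam) (Icc 0 T) := by
  have h1 : ContDiffOn ℝ 1 (derivWithin lam (Icc 0 T)) (Icc 0 T) :=
    ((contDiffOn_succ_iff_derivWithin (n := 1) (uniqueDiffOn_Icc hT)).1 hl).2.2
  have h2 : ContDiffOn ℝ 1 (bpar T lam) (Icc 0 T) := h1.neg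
  exact hl.continuousOn.mul (h2.continuousOn_derivWithin (uniqueDiffOn_Icc hT) le_rfl)

theorem IsStrongSolution.hasDerivWithinAt_curve (h : IsStrongSolution T u) (hT : 0 < T)
    (ht : t ∈ Icc 0 T) {β : ℝ → ℝ} {β' : ℝ} (hβ : HasDerivWithinAt β β' (Icc 0 T) t)
    (hpos : ∀ τ ∈ Icc 0 T, 0 < β τ) :
    HasDerivWithinAt (fun τ => u τ (β τ)) (dt T u t (β t) + β' * deriv (u t) (β t))
      (Icc 0 T) t := by
  have hβ0 := hpos t ht
  have hd := (h.c1.differentiableOn (by norm_num) (t, β t) ⟨ht, hβ0⟩).hasFDerivWithinAt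
  set Df := fderivWithin ℝ (Function.uncurry u) (Icc 0 T ×ˢ Ioi 0) (t, β t) with hDf
  have h1 : HasDerivWithinAt (fun τ => u τ (β t)) (Df (1, 0)) (Icc 0 T) t :=
    HasFDerivWithinAt.comp_hasDerivWithinAt t (f := fun τ => (τ, β t)) hd
      ((hasDerivWithinAt_id t _).prodMk (hasDerivWithinAt_const _ _ _)) fun τ hτ => ⟨hτ, hβ0⟩
  have h2 : HasDerivAt (u t) (Df (0, 1)) (β t) := by
    have := HasFDerivWithinAt.comp_hasDerivWithinAt (s := Ioi (0 : ℝ)) (β t)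
      (f := fun x => (t, x)) hd
      ((hasDerivWithinAt_const _ _ _).prodMk (hasDerivWithinAt_id (β t) _)) fun x hx => ⟨ht, hx⟩
    exact this.hasDerivAt (Ioi_mem_nhds hβ0)
  have h3 := HasFDerivWithinAt.comp_hasDerivWithinAt t (f := fun τ => (τ, β τ)) hd
    ((hasDerivWithinAt_id t _).prodMk hβ) fun τ hτ => ⟨hτ, hpos τ hτ⟩
  have e1 : dt T u t (β t) = Df (1, 0) := h1.derivWithin (uniqueDiffOn_Icc hT t ht)
  have e : Df (1, β') = Df (1, 0) + β' * Df (0, 1) := by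
    rw [show ((1, β') : ℝ × ℝ) = (1, 0) + β' • (0, 1) by simp, map_add, map_smul]
    rfl
  rw [h2.deriv, e1, ← e]; exact h3

theorem IsStrongSolution.hasDerivWithinAt (h : IsStrongSolution T u) (hT : 0 < T)
    (ht : t ∈ Icc 0 T) (hr : 0 < r) :
    HasDerivWithinAt (fun τ => u τ r) (dt T u t r) (Icc 0 T) t := by
  simpa using h.hasDerivWithinAt_curve hT ht (hasDerivWithinAt_const t _ r) fun _ _ => hr

theorem RadialH2.continuousOn (h : RadialH2 g) : ContinuousOn g (Ioi 0) := fun _ hr =>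
  (h.diff _ hr).continuousAt.continuousWithinAt

theorem RadialH2.locallyAC (h : RadialH2 g) : LocallyAC g :=
  locallyAC_of_hasDerivAt (fun _ hx => (h.diff _ hx).hasDerivAt) h.ac_deriv.continuousOn

theorem RadialH2.abs_le (h : RadialH2 g) (hr : 0 < r) :
    |g r| ≤ l2 (deriv g) / r := abs_le_of_tendsto h.locallyAC h.grad_memL2 h.decay hr

theorem RadialH1.abs_le (h : RadialH1 g) (hr : 0 < r) :
    |g r| ≤ l2 (deriv g) / r := abs_le_of_memLp h.ac h.grad_memL2 h.memL2 hr

theorem deriv_comp_mul_left' (f : ℝ → ℝ) (c x : ℝ) :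
    deriv (fun y => f (c * y)) x = c * deriv f (c * x) := by
  simpa using deriv_comp_mul_left c f x

theorem deriv_vres (y : ℝ) : deriv (vres lam u t) y = lam t ^ 2 * deriv (u t) (lam t * y) := by
  unfold vres; rw [deriv_const_mul_field, deriv_comp_mul_left', sq, mul_assoc]

theorem lap_comp_mul (f : ℝ → ℝ) (a c y : ℝ) :
    lap (fun y => a * f (c * y)) y = a * c ^ 2 * lap f (c * y) := by
  have e : deriv (fun y => a * f (c * y)) = fun y => a * c * deriv f (c * y) := by
    funext y
    rw [deriv_const_mul_field, deriv_comp_mul_left', mul_assoc]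
  unfold lap; rw [e, deriv_const_mul_field, deriv_comp_mul_left']
  rcases eq_or_ne c 0 with rfl | hc
  · simp
  rcases eq_or_ne y 0 with rfl | hy
  · simp; ring
  · field_simp

theorem lap_vres (y : ℝ) : lap (vres lam u t) y = lam t ^ 3 * lap (u t) (lam t * y) :=
  (lap_comp_mul (u t) (lam t) (lam t) y).trans (by ring)

/-- Regularity of the renormalized solution at a fixed time. -/
theorem RadialH2.vres (h : RadialH2 (u t)) (hl : 0 < lam t) : RadialH2 (vres lam u t) where
  diff y hy := by
    have h1 := (h.diff (lam t * y) (by positivity)).hasDerivAt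
    have h2 := h1.comp y ((hasDerivAt_id y).const_mul (lam t))
    exact (h2.const_mul (lam t)).differentiableAt
  ac_deriv := ((h.ac_deriv.comp_mul hl).const_mul (lam t ^ 2)).congr fun y _ => (deriv_vres y).symm
  decay := by
    have := (h.decay.comp (tendsto_id.const_mul_atTop hl)).const_mul (lam t); rw [mul_zero] at this
    exact this
  grad_memL2 := by
    rw [funext deriv_vres]; exact (memLp_radial_comp_mul hl h.grad_memL2).const_mul _
  lap_memL2 := by
    rw [funext lap_vres]; exact (memLp_radial_comp_mul hl h.lap_memL2).const_mul _

theorem memLp_V_mul (hf : ContinuousOn f (Ioi 0))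
    (hb : ∀ y, 0 < y → |f y| ≤ C * (1 + 1 / y)) : MemLp (fun y => V y * f y) 2 ϱ := by
  have hC : 0 ≤ C := by
    have := (abs_nonneg _).trans (hb 1 one_pos); linarith
  refine memLp_radial_of_decay (A := 4 * 192 ^ 2 * C ^ 2)
    (aesm_radial (continuous_V.continuousOn.mul hf)) fun y hy => ?_
  have hq := Q_pos y
  have h1 := Q_mul_le y
  have h2 : y * (1 + 1 / y) = y + 1 := by field_simp
  have h3 : V y * (1 + y ^ 2) ^ 2 ≤ 192 := by
    unfold V
    have : (Q y * (1 + y ^ 2)) ^ 2 ≤ 8 ^ 2 := by gcongr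
    nlinarith
  have hV := V_nonneg y
  have h4 : y * |f y| ≤ C * (1 + y) := by
    calc y * |f y| ≤ y * (C * (1 + 1 / y)) := by gcongr; exact hb y hy
      _ = C * (y * (1 + 1 / y)) := by ring
      _ = _ := by rw [h2]; ring
  have h5 : y ≤ 1 + y ^ 2 := by nlinarith [sq_nonneg (y - 1)]
  have h6 : (1 + y) ^ 2 ≤ 4 * (1 + y ^ 2) := by nlinarith [sq_nonneg (y - 1)]
  have e : |y ^ 3 * (V y * f y) ^ 2| = y * V y ^ 2 * (y * |f y|) ^ 2 := by
    rw [abs_pow_mul hy, abs_pow, abs_mul, abs_of_nonneg hV]; ring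
  rw [e, le_div_iff₀ (by positivity)]
  calc y * V y ^ 2 * (y * |f y|) ^ 2 * (1 + y ^ 2)
      ≤ (1 + y ^ 2) * V y ^ 2 * (C * (1 + y)) ^ 2 * (1 + y ^ 2) := by gcongr
    _ = (1 + y ^ 2) ^ 2 * V y ^ 2 * C ^ 2 * (1 + y) ^ 2 := by ring
    _ ≤ (1 + y ^ 2) ^ 2 * V y ^ 2 * C ^ 2 * (4 * (1 + y ^ 2)) := by gcongr
    _ ≤ (1 + y ^ 2) ^ 2 * V y ^ 2 * C ^ 2 * (4 * (1 + y ^ 2) ^ 2) := by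
        gcongr; nlinarith [sq_nonneg y]
    _ = 4 * C ^ 2 * (V y * (1 + y ^ 2) ^ 2) ^ 2 := by ring
    _ ≤ 4 * C ^ 2 * 192 ^ 2 := by gcongr
    _ = _ := by ring

local notation "bₜ" => bpar T lam t
local notation "vₜ" => vres lam u t
local notation "pₜ" => pres T u lam t
local notation "εₜ" => eps χ M T u lam t
local notation "ηₜ" => etares χ M T u lam t

/-! ### The remainder of a trapped solution at a fixed time -/

theorem eps_eq (y : ℝ) : εₜ y = vₜ y - PB1 χ M bₜ y := rfl

theorem hasDerivAt_vres (h : RadialH2 (u t)) (hl : 0 < lam t) (hy : 0 < y) :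
    HasDerivAt vₜ (deriv vₜ y) y := ((h.vres hl).diff y hy).hasDerivAt

namespace Trapped

theorem exists_PB1_abs_le (ha : Admissible χ M b)
    (hT1 : ∀ y, 0 < y → |T1 χ M b y| ≤ C) : ∃ C', 0 < C' ∧ ∀ y, 0 < y → |PB1 χ M b y| ≤ C' := by
  obtain ⟨Cχ, hCχ, hb⟩ := hχ.1.exists_bound
  have hb0 := ha.pos
  have hC : 0 ≤ C := (abs_nonneg _).trans (hT1 1 one_pos)
  refine ⟨1 + Cχ * (b ^ 2 * C), by positivity, fun y hy => ?_⟩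
  unfold PB1
  refine (abs_add_le _ _).trans (add_le_add ?_ ?_)
  · rw [abs_of_pos (Q_pos y)]; exact Q_le_one y
  · rw [abs_mul, abs_mul (b ^ 2), abs_of_pos (by positivity : 0 < b ^ 2)]
    have h1 : |cut χ (B1 b) y| ≤ Cχ := (hb _).1
    have h2 := hT1 y hy
    gcongr

theorem locallyAC_deriv_PB1 (b : ℝ) : LocallyAC (deriv (PB1 χ M b)) := by
  have hc := Admissible.contDiffOn_deriv_PB1 (χ := χ) (M := M) b
  exact locallyAC_of_hasDerivAt (f' := deriv (deriv (PB1 χ M b))) (fun y hy =>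
    ((hc.differentiableOn (by norm_num)).differentiableAt (Ioi_mem_nhds hy)).hasDerivAt)
    (hc.continuousOn_deriv_of_isOpen isOpen_Ioi le_rfl)

variable (h : Trapped χ ψ ζ M K b₀ T u lam) (ht : t ∈ Icc 0 T)
include h ht

theorem hasDerivAt_eps (hy : 0 < y) : HasDerivAt εₜ (deriv vₜ y - deriv (PB1 χ M bₜ) y) y :=
  (hasDerivAt_vres (h.solution.memH2 t ht) (h.lam_pos t ht) hy).sub
    (Admissible.hasDerivAt_PB1_right _ hy)

theorem Lam_eps (hy : 0 < y) : Lam εₜ y = Lam vₜ y - Lam (PB1 χ M bₜ) y := by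
  unfold Lam; rw [(h.hasDerivAt_eps ht hy).deriv, eps_eq]; ring

theorem dsEps_eq (hT : 0 < T) (ha : Admissible χ M bₜ) (hy : 0 < y) :
    dsEps χ M T u lam t y = ηₜ y - bₜ * Lam εₜ y := by
  have hl := h.lam_pos t ht
  have h1 := hasDerivWithinAt_lam h.lam_c2 ht
  have h2 := hasDerivWithinAt_bpar hT h.lam_c2 hl ht
  have h3 := h.solution.hasDerivWithinAt_curve hT ht (h1.mul_const y)
    fun τ hτ => mul_pos (h.lam_pos τ hτ) hy
  have h4 := (ha.hasDerivAt_PB1 y).comp_hasDerivWithinAt t h2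
  have h5 := ((h1.mul h3).sub h4).derivWithin (uniqueDiffOn_Icc hT t ht); rw [h.Lam_eps ht hy]
  unfold dsEps dds
  refine (congrArg (lam t * ·) h5).trans ?_
  unfold etares pres Lam; rw [deriv_vres]; simp only [vres]; field_simp; ring

theorem wrad_eq (r : ℝ) : wrad χ M T u lam t r = (lam t)⁻¹ * εₜ ((lam t)⁻¹ * r) := by
  have hl := h.lam_pos t ht
  unfold wrad rescale eps; rw [mul_inv_cancel_left₀ hl.ne', div_eq_inv_mul]; field_simp

theorem dt_wrad_eq (hT : 0 < T) (ha : Admissible χ M bₜ) (hr : 0 < r) :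
    dt T (wrad χ M T u lam) t r = ((lam t) ^ 2)⁻¹ * ηₜ ((lam t)⁻¹ * r) := by
  have hl := h.lam_pos t ht
  have h1 := hasDerivWithinAt_lam h.lam_c2 ht
  have h2 := hasDerivWithinAt_bpar hT h.lam_c2 hl ht
  have h3 := h.solution.hasDerivWithinAt hT ht hr
  have hi := h1.fun_inv hl.ne'
  have hrl : 0 < r * (lam t)⁻¹ := by positivity
  have h4 := hasDerivWithinAt_curve (f := PB1 χ M) (β := fun τ => r * (lam τ)⁻¹)
    (ha.differentiableAt_PB1 hrl) h2 (hi.const_mul r)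
  have h5 := (h3.sub (hi.mul h4)).derivWithin (uniqueDiffOn_Icc hT t ht)
  unfold dt
  refine Eq.trans ?_ (h5.trans ?_)
  · congr 1
  · have e : (lam t)⁻¹ * r = r * (lam t)⁻¹ := mul_comm _ _
    have e2 : lam t * (r * (lam t)⁻¹) = r := by field_simp
    unfold etares pres Lam dbPB1; rw [e, e2]; field_simp; ring

theorem deriv_dt_wrad_eq (hT : 0 < T) (ha : Admissible χ M bₜ) (hr : 0 < r) :
    deriv (dt T (wrad χ M T u lam) t) r = ((lam t) ^ 3)⁻¹ * deriv ηₜ ((lam t)⁻¹ * r) := by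
  have e : dt T (wrad χ M T u lam) t =ᶠ[𝓝 r] fun r => ((lam t) ^ 2)⁻¹ * ηₜ ((lam t)⁻¹ * r) := by
    filter_upwards [lt_mem_nhds hr] with s hs using h.dt_wrad_eq ht hT ha hs
  rw [e.deriv_eq, deriv_const_mul_field, deriv_comp_mul_left']; ring

theorem Hlam_wrad_eq (r : ℝ) : Hlam (lam t) (wrad χ M T u lam t) r
      = ((lam t) ^ 3)⁻¹ * Hop εₜ ((lam t)⁻¹ * r) := by
  unfold Hlam Hop Vlam V rescale; rw [funext (h.wrad_eq ht), lap_comp_mul, div_eq_inv_mul]; ring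

/-- The remainder `η` lies in the domain of the form of `H`. -/
theorem formDomain_eta (ha : Admissible χ M bₜ) : FormDomain ηₜ := by
  have hl := h.lam_pos t ht
  have hu := h.solution.memH1 t ht
  have h1 : FormDomain pₜ := by
    have hac := (hu.ac.comp_mul hl).const_mul (lam t ^ 2)
    refine ⟨hac, ?_, ?_⟩
    · have e : deriv pₜ = fun y => lam t ^ 3 * deriv (dt T u t) (lam t * y) := by
        funext y
        unfold pres; rw [deriv_const_mul_field, deriv_comp_mul_left']; ring
      rw [e]; exact (memLp_radial_comp_mul hl hu.grad_memL2).const_mul _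
    · have h2 : MemLp pₜ 2 ϱ := (memLp_radial_comp_mul hl hu.memL2).const_mul _
      refine h2.mono ?_ (ae_radial_of_forall fun y hy => ?_)
      · exact aesm_radial (hac.continuousOn.div (by fun_prop) fun y hy => by
          have : (0 : ℝ) < y := hy; positivity)
      · rw [norm_div]
        refine div_le_self (norm_nonneg _) ?_
        rw [Real.norm_eq_abs, abs_of_pos (by positivity)]
        linarith
  have h2 := (h1.comb ha.formDomain_Lam_PB1 1 (-bₜ)).comb ha.formDomain_dbPB1 1 (-bs T lam t)
  refine h2.congr fun y _ => ?_
  unfold etares; ring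

/-- The energy in renormalized variables. -/
theorem energy_eq (hT : 0 < T) (ha : Admissible χ M bₜ) : energy χ M T u lam t = form ηₜ ηₜ
      + ∫ y, Hop εₜ y ^ 2 ∂ϱ := by
  have hl := h.lam_pos t ht
  have hη := h.formDomain_eta ht ha
  have hl' : 0 < (lam t)⁻¹ := by positivity
  have e1 : ∫ r, deriv (dt T (wrad χ M T u lam) t) r ^ 2 ∂ϱ
      = (lam t ^ 2)⁻¹ * ∫ y, deriv ηₜ y ^ 2 ∂ϱ := by
    rw [integral_radial_congr fun r hr => by
      rw [h.deriv_dt_wrad_eq ht hT ha hr, mul_pow], integral_const_mul,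
      radial_integral_comp_mul hl' fun y => deriv ηₜ y ^ 2]
    field_simp
  have e2 : ∫ r, Vlam (lam t) r * dt T (wrad χ M T u lam) t r ^ 2 ∂ϱ
      = (lam t ^ 2)⁻¹ * ∫ y, V y * ηₜ y ^ 2 ∂ϱ := by
    rw [integral_radial_congr fun r hr => by
      rw [h.dt_wrad_eq ht hT ha hr, show Vlam (lam t) r
        * (((lam t) ^ 2)⁻¹ * ηₜ ((lam t)⁻¹ * r)) ^ 2 = ((lam t) ^ 6)⁻¹
        * (V ((lam t)⁻¹ * r) * ηₜ ((lam t)⁻¹ * r) ^ 2) by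
          unfold Vlam V rescale; rw [div_eq_inv_mul]; field_simp], integral_const_mul,
      radial_integral_comp_mul hl' fun y => V y * ηₜ y ^ 2]
    field_simp
  have e3 : ∫ r, Hlam (lam t) (wrad χ M T u lam t) r ^ 2 ∂ϱ
      = (lam t ^ 2)⁻¹ * ∫ y, Hop εₜ y ^ 2 ∂ϱ := by
    rw [integral_radial_congr fun r hr => by
      rw [h.Hlam_wrad_eq ht, mul_pow], integral_const_mul,
      radial_integral_comp_mul hl' fun y => Hop εₜ y ^ 2]
    field_simp
  have e4 : form ηₜ ηₜ = (∫ y, deriv ηₜ y ^ 2 ∂ϱ) - ∫ y, V y * ηₜ y ^ 2 ∂ϱ := by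
    rw [← integral_sub hη.grad.integrable_sq (by simpa only [sq] using hη.integrable_V hη)]
    unfold form
    congr 1; funext y; ring
  unfold energy; rw [e1, e2, e3, e4]; field_simp

theorem deriv_eps (hy : 0 < y) : deriv εₜ y = deriv vₜ y - deriv (PB1 χ M bₜ) y := (h.hasDerivAt_eps ht hy).deriv

theorem ae_lap_eps : ∀ᵐ y ∂ϱ, lap vₜ y - lap (PB1 χ M bₜ) y = lap εₜ y := by
  have hv := (h.solution.memH2 t ht).vres (h.lam_pos t ht)
  refine ae_radial_of_ae ?_
  filter_upwards [hv.ac_deriv.ae_differentiableAt,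
    (locallyAC_deriv_PB1 (χ := χ) (M := M) bₜ).ae_differentiableAt] with y h1 h2 hy
  have he : deriv εₜ =ᶠ[𝓝 y] (deriv vₜ) - deriv (PB1 χ M bₜ) := by
    filter_upwards [lt_mem_nhds hy] with z hz using h.deriv_eps ht hz
  unfold lap; rw [he.deriv_eq, deriv_sub (h1 hy) (h2 hy), h.deriv_eps ht hy]; ring

/-- The regularity of `ε` that is needed to invert `H`. -/
theorem regular_eps (ha : Admissible χ M bₜ) (hT1 : ∀ y, 0 < y → |T1 χ M bₜ y| ≤ C) :
    LocallyAC (deriv εₜ) ∧ MemLp (deriv εₜ) 2 ϱ ∧ (∃ C₀, ∀ y, 0 < y → y ≤ 1 → |εₜ y| ≤ C₀ / y) ∧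
    MemLp (Hop εₜ) 2 ϱ := by
  have hl := h.lam_pos t ht
  have hv := (h.solution.memH2 t ht).vres hl
  set b := bₜ with hb
  obtain ⟨C', hC', hP⟩ := exists_PB1_abs_le ha hT1
  have hbd : ∀ y, 0 < y → |εₜ y| ≤ (l2 (deriv vₜ) + C') * (1 + 1 / y) := fun y hy => by
      rw [eps_eq]
      have h1 := hv.abs_le hy
      have h2 := hP y hy
      have h3 := l2_nonneg (deriv vₜ)
      have h4 : 0 < 1 / y := by positivity
      have h5 : l2 (deriv vₜ) / y = l2 (deriv vₜ) * (1 / y) := by ring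
      refine (abs_sub _ _).trans ?_
      nlinarith [mul_nonneg h3 h4.le, mul_nonneg hC'.le h4.le]
  have hce : ContinuousOn εₜ (Ioi 0) := fun y hy =>
    (h.hasDerivAt_eps ht hy).continuousAt.continuousWithinAt
  refine ⟨(hv.ac_deriv.sub (locallyAC_deriv_PB1 b)).congr fun y hy => (h.deriv_eps ht hy).symm,
    (hv.grad_memL2.sub ha.formDomain_PB1.grad).ae_eq (ae_radial_of_forall fun y hy =>
      (h.deriv_eps ht hy).symm), ⟨2 * (l2 (deriv vₜ) + C'), fun y hy hy1 => ?_⟩, ?_⟩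
  · refine (hbd y hy).trans ?_
    have h3 := l2_nonneg (deriv vₜ)
    have h4 : 1 + 1 / y ≤ 2 / y := by
      rw [le_div_iff₀ hy, add_mul, one_div_mul_cancel hy.ne']; linarith
    exact (mul_le_mul_of_nonneg_left h4 (by positivity)).trans_eq (by ring)
  · exact ((hv.lap_memL2.sub ha.memLp_lap_PB1).ae_eq (h.ae_lap_eps ht)).neg.sub
      (memLp_V_mul hce hbd)

end Trapped

/-! ### Time derivatives of weak quantities -/

/-- A family `Y_b` of functions supported in `b y ≤ 1`, smooth in `(b, y)`, bounded together with
`y ∂_y Y_b` and `b ∂_b Y_b` for `b ∈ S`. -/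
structure IsFamily (S : Set ℝ) (Y : ℝ → ℝ → ℝ) (A : ℝ) : Prop where
  smooth : ContDiff ℝ 1 (Function.uncurry Y)
  cont : ∀ b, Continuous (yscale Y b) ∧ Continuous (bscale Y b)
  bound : ∀ b ∈ S, ∀ y, 0 < y → |Y b y| ≤ A ∧ |yscale Y b y| ≤ A ∧ |bscale Y b y| ≤ A
  zero : ∀ b ∈ S, ∀ y, 1 ≤ b * y → Y b y = 0 ∧ yscale Y b y = 0 ∧ bscale Y b y = 0

theorem IsTest.exists_isFamily (hY : IsTest χ Y) (S : Set ℝ) : ∃ A, IsFamily S Y A := by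
  obtain ⟨A₁, hA₁, h1⟩ := hY.exists_bound
  obtain ⟨A₂, hA₂, h2⟩ := hY.yscale.exists_bound
  obtain ⟨A₃, hA₃, h3⟩ := hY.bscale.exists_bound
  have key : ∀ A y, 0 ≤ A → A * Q y ≤ A := fun A y hA => mul_le_of_le_one_right hA (Q_le_one y)
  refine ⟨A₁ + A₂ + A₃, hY.contDiff.of_le (by norm_cast),
    fun b => ⟨hY.yscale.continuous b, hY.bscale.continuous b⟩,
    fun b _ y _ => ⟨?_, ?_, ?_⟩,
    fun b _ y hy => ⟨hY.eq_zero hy, hY.yscale.eq_zero hy, hY.bscale.eq_zero hy⟩⟩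
  · linarith [h1 b y, key A₁ y hA₁]
  · linarith [h2 b y, key A₂ y hA₂]
  · linarith [h3 b y, key A₃ y hA₃]

/-- `d/ds` acting on the parameter `b` and on the scale of a family of weights. -/
def sdot (T : ℝ) (lam : ℝ → ℝ) (Y : ℝ → ℝ → ℝ) (t y : ℝ) : ℝ :=
  (bpar T lam t) * yscale Y (bpar T lam t) y
    + bs T lam t / (bpar T lam t) * bscale Y (bpar T lam t) y

namespace Trapped

theorem exists_isWeight (h : Trapped χ ψ ζ M K b₀ T u lam) (hT : 0 < T)
    (hY : IsFamily (bpar T lam '' Icc 0 T) Y A) :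
    ∃ R B, 0 ≤ R ∧ IsWeight (Icc 0 T) (fun t r => Y (bpar T lam t) ((lam t)⁻¹ * r))
      (fun t r => (lam t)⁻¹ * sdot T lam Y t ((lam t)⁻¹ * r)) R B := by
  have hcl := h.lam_c2.continuousOn
  have hcb : ContinuousOn (bpar T lam) (Icc 0 T) := fun t ht =>
    (hasDerivWithinAt_bpar hT h.lam_c2 (h.lam_pos t ht) ht).continuousWithinAt
  have hcs := continuousOn_bs hT h.lam_c2
  have hl0 : ∀ t ∈ Icc 0 T, lam t ≠ 0 := fun t ht => (h.lam_pos t ht).ne'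
  have hb0 : ∀ t ∈ Icc 0 T, (bpar T lam t) ≠ 0 := fun t ht => (h.b_pos t ht).ne'
  obtain ⟨R, hR0, hR⟩ := exists_abs_le (hcl.div hcb hb0)
  obtain ⟨B₁, hB₁0, hB₁⟩ := exists_abs_le ((hcl.inv₀ hl0).mul hcb)
  obtain ⟨B₂, hB₂0, hB₂⟩ := exists_abs_le ((hcl.inv₀ hl0).mul (hcs.div hcb hb0))
  have h0 : (0 : ℝ) ∈ Icc 0 T := ⟨le_rfl, hT.le⟩
  have hA0 : 0 ≤ A := (abs_nonneg _).trans (hY.bound _ (mem_image_of_mem _ h0) 1 one_pos).1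
  refine ⟨R, A + (B₁ * A + B₂ * A), hR0.le, fun t ht r hr => ?_, fun t ht => ?_,
    fun t ht r hr => ?_, fun t ht r hr => ?_⟩
  · have hl := h.lam_pos t ht
    have hb := h.b_pos t ht
    have h1 := hasDerivWithinAt_lam h.lam_c2 ht
    have h2 := hasDerivWithinAt_bpar hT h.lam_c2 hl ht
    have h3 := hasDerivWithinAt_curve (f := Y) (β := fun τ => (lam τ)⁻¹ * r)
      (hY.smooth.differentiable (by norm_num) _) h2 ((h1.fun_inv hl.ne').mul_const r)
    refine h3.congr_deriv ?_
    unfold sdot yscale bscale; field_simp; ring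
  · have : Continuous (Y (bpar T lam t)) := hY.smooth.continuous.comp (Continuous.prodMk_right _)
    fun_prop
  · have hl := h.lam_pos t ht
    obtain ⟨h1, h2, h3⟩ := hY.bound _ (mem_image_of_mem _ ht) ((lam t)⁻¹ * r) (by positivity)
    refine ⟨by linarith [mul_nonneg hB₁0.le hA0, mul_nonneg hB₂0.le hA0], ?_⟩
    unfold sdot; rw [mul_add, ← mul_assoc, ← mul_assoc]
    refine (abs_add_le _ _).trans ?_
    rw [abs_mul _ (yscale Y _ _), abs_mul _ (bscale Y _ _)]
    exact (add_le_add (mul_le_mul (hB₁ t ht.1 ht.2) h2 (abs_nonneg _) hB₁0.le)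
      (mul_le_mul (hB₂ t ht.1 ht.2) h3 (abs_nonneg _) hB₂0.le)).trans (by linarith)
  · have hl := h.lam_pos t ht
    have hb := h.b_pos t ht
    have h1 : lam t / (bpar T lam t) ≤ R := (le_abs_self _).trans (hR t ht.1 ht.2)
    obtain ⟨h1, h2, h3⟩ := hY.zero _ (mem_image_of_mem _ ht) ((lam t)⁻¹ * r) (by
      have h2 : lam t / (bpar T lam t) < r := h1.trans_lt hr; rw [div_lt_iff₀ hb] at h2
      rw [← mul_assoc, mul_comm _ (lam t)⁻¹, mul_assoc, inv_mul_eq_div, le_div_iff₀ hl]; linarith)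
    refine ⟨h1, ?_⟩
    unfold sdot; rw [h2, h3]; ring

/-- Near each time `u` and `∂_t u` are `O(1/r)`, uniformly in time. -/
theorem _root_.CriticalWave.IsStrongSolution.exists_abs_le (h : IsStrongSolution T u) (ht : t ∈ Icc 0 T) :
    ∃ C J, Convex ℝ J ∧ t ∈ J ∧ J ⊆ Icc 0 T ∧ J ∈ 𝓝[Icc 0 T] t ∧
      ∀ τ ∈ J, ∀ r, 0 < r → |u τ r| ≤ C / r ∧ |dt T u τ r| ≤ C / r := by
  obtain ⟨C₁, h1⟩ := exists_l2_bound ht (fun τ hτ => (h.memH2 τ hτ).grad_memL2) h.cont_grad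
  obtain ⟨C₂, h2⟩ := exists_l2_bound ht (fun τ hτ => (h.memH1 τ hτ).grad_memL2) h.cont_grad_dt
  obtain ⟨δ, hδ, h3⟩ := Metric.nhdsWithin_basis_ball.eventually_iff.1 (h1.and h2)
  refine ⟨max C₁ C₂, Metric.ball t δ ∩ Icc 0 T, (convex_ball t δ).inter (convex_Icc 0 T),
    ⟨Metric.mem_ball_self hδ, ht⟩, inter_subset_right, ?_, fun τ hτ r hr => ?_⟩
  · exact inter_mem (mem_nhdsWithin_of_mem_nhds (Metric.ball_mem_nhds t hδ)) self_mem_nhdsWithin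
  · obtain ⟨h4, h5⟩ := h3 hτ
    constructor
    · refine ((h.memH2 τ hτ.2).abs_le hr).trans ?_
      gcongr; exact h4.trans (le_max_left _ _)
    · refine ((h.memH1 τ hτ.2).abs_le hr).trans ?_
      gcongr; exact h5.trans (le_max_right _ _)

theorem ip_comp_mul (hc : 0 < c) (e : ∀ y, f y = A * F (c * y)) (g : ℝ → ℝ) :
    ip f g = A * (c ^ 4)⁻¹ * ∫ r, F r * g (c⁻¹ * r) ∂ϱ := by
  have h := radial_integral_comp_mul hc fun r => F r * g (c⁻¹ * r)
  simp only [inv_mul_cancel_left₀ hc.ne'] at h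
  unfold ip; rw [mul_assoc, ← h, ← integral_const_mul]
  congr 1; funext y; rw [e, mul_assoc]

theorem ip_vres_eq (hl : 0 < lam t) (g : ℝ → ℝ) :
    ip vₜ g = (lam t ^ 3)⁻¹ * ∫ r, u t r * g ((lam t)⁻¹ * r) ∂ϱ :=
  (ip_comp_mul hl (fun _ => rfl) g).trans (by field_simp)

theorem ip_pres_eq (hl : 0 < lam t) (g : ℝ → ℝ) :
    ip pₜ g = (lam t ^ 2)⁻¹ * ∫ r, dt T u t r * g ((lam t)⁻¹ * r) ∂ϱ :=
  (ip_comp_mul hl (fun _ => rfl) g).trans (by field_simp)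

theorem ip_force_eq (hl : 0 < lam t) (g : ℝ → ℝ) : ip (fun y => lap vₜ y + vₜ y ^ 3) g
      = (lam t)⁻¹ * ∫ r, (lap (u t) r + u t r ^ 3) * g ((lam t)⁻¹ * r) ∂ϱ :=
  (ip_comp_mul (A := lam t ^ 3) (F := fun r => lap (u t) r + u t r ^ 3) hl (fun y => by
    rw [lap_vres]; unfold vres; ring) g).trans (by field_simp)

variable (h : Trapped χ ψ ζ M K b₀ T u lam) (ht : t ∈ Icc 0 T)
include h ht

theorem hasDerivWithinAt_ip_vres (hT : 0 < T) (hY : IsFamily (bpar T lam '' Icc 0 T) Y A) :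
    HasDerivWithinAt (fun τ => ip (vres lam u τ) (Y (bpar T lam τ)))
    ((lam t)⁻¹ * (ip pₜ (Y bₜ) + ip vₜ (sdot T lam Y t) + 3 * bₜ * ip vₜ (Y bₜ))) (Icc 0 T) t := by
  have hl := h.lam_pos t ht
  obtain ⟨R, B, hR, hW⟩ := h.exists_isWeight hT hY
  obtain ⟨C, J, hJ, htJ, hJs, hJn, hb⟩ := h.solution.exists_abs_le ht
  have h1 := hasDerivWithinAt_integral_weight hJ htJ (hW.mono hJs) (u := u) (u' := dt T u)
    (integrable_div_mul_indicator C R B)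
    (fun τ hτ r hr => (h.solution.hasDerivWithinAt hT (hJs hτ) hr).mono hJs)
    (fun τ hτ => aesm_radial (h.solution.memH2 τ (hJs hτ)).continuousOn) hb
  have h2 := (hasDerivWithinAt_lam h.lam_c2 ht).fun_inv hl.ne'
  have h3 := (h2.fun_pow 3).mul (h1.mono_of_mem_nhdsWithin hJn)
  have hr' : ∀ {r x : ℝ}, 0 < r → |x| ≤ C / r → |r * x| ≤ C := fun hr hx => by
    rwa [abs_mul, abs_of_pos hr, ← le_div_iff₀' hr]
  have hcY := hY.cont bₜ
  have hcs : Continuous (sdot T lam Y t) := by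
    unfold sdot
    have := hcY.1
    have := hcY.2; fun_prop
  have hYc : Continuous (Y bₜ) := hY.smooth.continuous.comp (Continuous.prodMk_right _)
  have i1 := integrable_mul_of_bounded (g := fun r => Y bₜ ((lam t)⁻¹ * r))
    (h.solution.memH1 t ht).ac.continuousOn (by fun_prop)
    (fun r hr _ => hr' hr (hb t htJ r hr).2) fun r hr => (hW.zero t ht r hr).1
  have i2 := integrable_mul_of_bounded (h.solution.memH2 t ht).continuousOn
    (g := fun r => (lam t)⁻¹ * sdot T lam Y t ((lam t)⁻¹ * r)) (by fun_prop)
    (fun r hr _ => hr' hr (hb t htJ r hr).1) fun r hr => (hW.zero t ht r hr).2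
  rw [integral_add i1 i2] at h3
  refine (h3.congr (fun τ hτ => ?_) ?_).congr_deriv ?_
  · rw [ip_vres_eq (h.lam_pos τ hτ), ← inv_pow]; rfl
  · rw [ip_vres_eq hl, ← inv_pow]; rfl
  · rw [ip_vres_eq hl, ip_vres_eq hl, ip_pres_eq hl]
    simp_rw [mul_left_comm _ (lam t)⁻¹ (sdot _ _ _ _ _)]
    rw [integral_const_mul]; push_cast; field_simp; ring

theorem hasDerivWithinAt_ip_pres (hT : 0 < T) (hY : IsFamily (bpar T lam '' Icc 0 T) Y A) :
    HasDerivWithinAt (fun τ => ip (pres T u lam τ) (Y (bpar T lam τ)))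
    ((lam t)⁻¹ * (ip (fun y => lap vₜ y + vₜ y ^ 3) (Y bₜ) + ip pₜ (sdot T lam Y t)
        + 2 * bₜ * ip pₜ (Y bₜ))) (Icc 0 T) t := by
  have hl := h.lam_pos t ht
  obtain ⟨R, B, hR, hW⟩ := h.exists_isWeight hT hY
  have hu := h.solution.memH2 t ht
  have hA : AEStronglyMeasurable (fun r => lap (u t) r + u t r ^ 3) ϱ :=
    hu.lap_memL2.1.add ((aesm_radial hu.continuousOn).pow 3)
  have : (𝓝[Icc 0 T \ {t}] t).NeBot := accPt_principal_iff_nhdsWithin.1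
    (uniqueDiffWithinAt_iff_accPt.1 (uniqueDiffOn_Icc hT t ht))
  have hq : ∀ τ ∈ Icc 0 T, MemLp (dt T u τ) 2 ϱ := fun τ hτ => (h.solution.memH1 τ hτ).memL2
  have h1 := hasDerivWithinAt_integral_weight_l2 (convex_Icc 0 T) ht hR hW hq
    (memLp_of_tendsto ht hq hA (h.solution.equation t ht)) (h.solution.equation t ht)
  have h2 := (hasDerivWithinAt_lam h.lam_c2 ht).fun_inv hl.ne'
  have h3 := (h2.fun_pow 2).mul h1
  refine (h3.congr (fun τ hτ => ?_) ?_).congr_deriv ?_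
  · rw [ip_pres_eq (h.lam_pos τ hτ), ← inv_pow]; rfl
  · rw [ip_pres_eq hl, ← inv_pow]; rfl
  · rw [ip_pres_eq hl, ip_pres_eq hl, ip_force_eq hl]
    simp_rw [mul_left_comm _ (lam t)⁻¹ (sdot _ _ _ _ _)]
    rw [integral_const_mul]; push_cast; field_simp; ring

end Trapped

/-! ### Pairing with test functions -/

/-- The functions `f` whose product with every test function at scale `1/b` is integrable. -/
def Pairs (χ : ℝ → ℝ) (b : ℝ) (f : ℝ → ℝ) : Prop :=
  ∀ Y, IsTest χ Y → Integrable (fun y => f y * Y b y) ϱ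

section
variable {Y' : ℝ → ℝ → ℝ}

theorem pairs_of_le (hb : 0 < b) (hf : ContinuousOn f (Ioi 0))
    (hA : ∀ y, 0 < y → b * y ≤ 1 → |y ^ 3 * f y| ≤ A) : Pairs χ b f := fun _ hY =>
  hY.integrable_mul hb hf hA

theorem abs_mul_le_of_weight {x : ℝ} (hb : 0 < b) (hy : 0 < y) (hby : b * y ≤ 1)
    (hx : |x| ≤ A * (1 + 1 / y)) : |y * x| ≤ A * (1 / b + 1) := by
  have hA : 0 ≤ A := nonneg_of_mul_nonneg_left ((abs_nonneg _).trans hx) (by positivity)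
  have hyb : y ≤ 1 / b := (le_div_iff₀' hb).2 hby
  rw [abs_mul, abs_of_pos hy]
  calc y * |x| ≤ y * (A * (1 + 1 / y)) := by gcongr
    _ = A * (y + 1) := by field_simp
    _ ≤ _ := by gcongr

theorem pairs_of_bounded (hb : 0 < b) (hf : ContinuousOn f (Ioi 0))
    (hA : ∀ y, 0 < y → b * y ≤ 1 → |f y| ≤ A * (1 + 1 / y)) : Pairs χ b f := by
  refine pairs_of_le hb hf (A := (1 / b) ^ 2 * (A * (1 / b + 1))) fun y hy hby => ?_
  have hyb : y ≤ 1 / b := (le_div_iff₀' hb).2 hby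
  rw [pow_succ, mul_assoc, abs_pow_mul hy]
  exact mul_le_mul (by gcongr) (abs_mul_le_of_weight hb hy hby (hA y hy hby)) (abs_nonneg _)
    (by positivity)

theorem le_weight {x : ℝ} (hA : 0 ≤ A) (hy : 0 < y) (hx : x ≤ A) : x ≤ A * (1 + 1 / y) :=
  hx.trans (le_mul_of_one_le_right hA (le_add_of_nonneg_right (by positivity)))

theorem pairs_of_abs_le (hb : 0 < b) (hf : ContinuousOn f (Ioi 0)) (hA : ∀ y, 0 < y → |f y| ≤ A) :
    Pairs χ b f :=
  pairs_of_bounded hb hf fun y hy _ => le_weight ((abs_nonneg _).trans (hA 1 one_pos)) hy (hA y hy)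

theorem IsTest.memLp (hY : IsTest χ Y) (hb : 0 < b) : MemLp (Y b) 2 ϱ := by
  obtain ⟨A, hA0, hA⟩ := hY.exists_bound
  refine memLp_radial_of_le (R := 1 / b) (A := (1 / b) ^ 3 * (A * 1) ^ 2)
    (aesm_radial (hY.continuous b).continuousOn) (fun y hy hyb => ?_) fun y hy =>
      hY.eq_zero ((div_lt_iff₀' hb).1 hy).le
  have := Q_le_one y; rw [abs_pow_mul hy, abs_pow]
  gcongr; exact (hA b y).trans (by gcongr)

theorem pairs_of_memLp (hb : 0 < b) (hf : MemLp f 2 ϱ) : Pairs χ b f := fun _ hY =>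
  hf.integrable_mul (q := 2) (hY.memLp hb)

theorem FormDomain.pairs (hb : 0 < b) (hf : FormDomain f) : Pairs χ b f :=
  fun Y hY => hf.integrable_mul (hY.continuous b) (R := 1 / b) (by positivity) fun s hs =>
    hY.eq_zero ((div_le_iff₀' hb).1 hs)

theorem Pairs.comb (hf : Pairs χ b f) (hg : Pairs χ b g) (c d : ℝ) :
    Pairs χ b fun y => c * f y + d * g y := fun Y hY =>
  (((hf Y hY).const_mul c).add ((hg Y hY).const_mul d)).congr
    (Eventually.of_forall fun y => by simp only [Pi.add_apply]; ring)

theorem Pairs.ip_comb (hf : Pairs χ b f) (hg : Pairs χ b g) (hY : IsTest χ Y) (c d : ℝ) :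
    ip (fun y => c * f y + d * g y) (Y b) = c * ip f (Y b) + d * ip g (Y b) :=
  ip_eq_comb (hf Y hY) (hg Y hY) c d fun y _ => by ring

theorem Pairs.ip_comb_right (hf : Pairs χ b f) (hY : IsTest χ Y) (hY' : IsTest χ Y') (c d : ℝ) :
    ip f (fun y => c * Y b y + d * Y' b y) = c * ip f (Y b) + d * ip f (Y' b) := by
  simp only [ip_comm f]
  exact ip_eq_comb ((hf Y hY).congr (by simp [mul_comm])) ((hf Y' hY').congr (by simp [mul_comm]))
    c d fun y _ => by ring

/-- The scaling operators are adjoint to each other up to constants: `Λ` against `-(1 + D)`. -/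
theorem ip_Lam_test (hb : 0 < b) {f' : ℝ → ℝ} (hY : IsTest χ Y)
    (hd : ∀ y, 0 < y → HasDerivAt f (f' y) y) (hc : ContinuousOn f' (Ioi 0))
    (hA : ∀ y, 0 < y → b * y ≤ 1 → |f y| ≤ A * (1 + 1 / y) ∧ |y * f' y| ≤ A * (1 + 1 / y)) :
    ip (Lam f) (Y b) = -ip f (Y b) - ip f (Dop (Y b)) := by
  have hp := pairs_of_bounded (χ := χ) hb (fun y hy => (hd y hy).continuousAt.continuousWithinAt)
    fun y hy hby => (hA y hy hby).1
  obtain ⟨-, -, h3⟩ := ip_Lam_left hd hc ((hY.contDiff_right b).of_le (by norm_cast))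
    (R := 1 / b) (by positivity) (fun y hy => hY.eq_zero ((div_le_iff₀' hb).1 hy))
    fun y hy hyb => by
      have hby := (le_div_iff₀' hb).1 hyb
      obtain ⟨h1, h2⟩ := hA y hy hby
      exact ⟨abs_mul_le_of_weight hb hy hby h1, by
        rw [sq, mul_assoc]; exact abs_mul_le_of_weight hb hy hby h2⟩
  have h4 := hp.ip_comb_right hY hY.Dop 1 1; simp only [one_mul] at h4; rw [h3, h4]; ring

/-- A function of size `A (1 + 1/y)` has pairings of size `A / b²`. -/
theorem IsTest.abs_ip_le_of_bounded (hY : IsTest χ Y) {B : ℝ} (hB : 0 ≤ B)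
    (hYB : ∀ b y, |Y b y| ≤ B * Q y) (hb : 0 < b) (hA0 : 0 ≤ A)
    (hA : ∀ y, 0 < y → b * y ≤ 1 → |f y| ≤ A * (1 + 1 / y)) :
    |ip f (Y b)| ≤ 16 * B * (A / b ^ 2) := by
  have h := hY.abs_ip_le hb (f := f) (A := 16 * B * A / b) fun y hy hby => by
    have h1 := hA y hy hby
    have h2 := hYB b y
    have hq := Q_pos y
    have h3 := Q_mul_le y
    have hyb : y ≤ 1 / b := (le_div_iff₀' hb).2 hby
    rw [abs_mul, abs_mul (f y), abs_of_pos (pow_pos hy 3)]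
    calc y ^ 3 * (|f y| * |Y b y|) ≤ y ^ 3 * (A * (1 + 1 / y) * (B * Q y)) := by gcongr
      _ = A * B * y * (Q y * (y ^ 2 + y)) := by field_simp
      _ ≤ A * B * (1 / b) * 16 := by
          gcongr; nlinarith [sq_nonneg (y - 1)]
      _ = _ := by ring
  refine h.trans_eq ?_
  field_simp

end

/-! ### The orthogonality condition in time -/

theorem contDiff_phiM (M : ℝ) : ContDiff ℝ 1 (phiM χ M) := by
  have h1 : ContDiff ℝ 1 fun y : ℝ => χ (y / M) :=
    (hχ.1.smooth.of_le (by norm_cast)).comp (contDiff_id.div_const M)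
  exact h1.mul contDiff_Phi

theorem mul_deriv_phiM_eq_zero (hM : 1 ≤ M) (hy : 2 * M ≤ y) : y * deriv (phiM χ M) y = 0 := by
  rw [deriv_eq_zero_of_eqOn_const (s := Ici (2 * M)) ((contDiff_phiM M).differentiable (by norm_num))
    (uniqueDiffOn_Ici _) (fun z hz => phiM_eq_zero hM hz) hy, mul_zero]

theorem exists_isFamily_phiM (hM : 1 ≤ M) {S : Set ℝ}
    (hS : ∀ b ∈ S, 0 < b ∧ 2 * M * b ≤ 1) : ∃ A, IsFamily S (fun _ => phiM χ M) A := by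
  have hc := contDiff_phiM (χ := χ) M
  have hc' : Continuous fun y => y * deriv (phiM χ M) y :=
    continuous_id.mul (hc.continuous_deriv le_rfl)
  obtain ⟨A₁, hA₁, h1⟩ := exists_abs_le (a := 0) (b := 2 * M) hc.continuous.continuousOn
  obtain ⟨A₂, hA₂, h2⟩ := exists_abs_le (a := 0) (b := 2 * M) hc'.continuousOn
  have hb : bscale (fun _ => phiM χ M) = fun _ _ => 0 := by funext b y; unfold bscale; simp
  have hys : yscale (fun _ => phiM χ M) = fun _ y => y * deriv (phiM χ M) y := rfl
  refine ⟨A₁ + A₂, hc.comp contDiff_snd, fun b => ?_, fun b _ y hy => ?_, fun b hbS y hy => ?_⟩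
  · rw [hb, hys]; exact ⟨hc', continuous_const⟩
  · rw [hb, hys]; simp only [abs_zero]
    refine ⟨?_, ?_, by positivity⟩
    · rcases le_total y (2 * M) with h | h
      · exact (h1 y hy.le h).trans (by linarith)
      · rw [phiM_eq_zero hM h, abs_zero]; positivity
    · rcases le_total y (2 * M) with h | h
      · exact (h2 y hy.le h).trans (by linarith)
      · rw [mul_deriv_phiM_eq_zero hM h, abs_zero]; positivity
  · obtain ⟨hb0, hb1⟩ := hS b hbS
    have h : 2 * M ≤ y := by
      by_contra h3
      nlinarith [not_le.1 h3]
    rw [hb, hys]; exact ⟨phiM_eq_zero hM h, mul_deriv_phiM_eq_zero hM h, rfl⟩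

theorem Admissible.exists_PB1_deriv_bound (ha : Admissible χ M b) (R : ℝ) :
    ∃ C, 0 < C ∧ ∀ y, 0 < y → y ≤ R → |PB1 χ M b y| ≤ C ∧ |y * deriv (PB1 χ M b) y| ≤ C := by
  obtain ⟨C, hC⟩ := ha.exists_PB1_bound_zero
  have hsub : Icc 1 R ⊆ Ioi 0 := fun y hy => zero_lt_one.trans_le hy.1
  obtain ⟨C₁, p1, h1⟩ := exists_abs_le ((contDiffOn_PB1 (χ := χ) (M := M) b).continuousOn.mono hsub)
  obtain ⟨C₂, p2, h2⟩ := exists_abs_le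
    (continuousOn_id.mul ((contDiffOn_deriv_PB1 (χ := χ) (M := M) b).continuousOn.mono hsub))
  refine ⟨|C| + C₁ + C₂, by positivity, fun y hy hyR => ?_⟩
  have p0 := abs_nonneg C
  have q0 := le_abs_self C
  rcases lt_or_ge y 1 with h | h
  · obtain ⟨h3, h4, -⟩ := hC y hy h
    constructor <;> linarith
  · exact ⟨(h1 y h hyR).trans (by linarith), (h2 y h hyR).trans (by linarith)⟩

/-- Pointwise bounds of `ε` by `|H ε|_{L²}`. -/
theorem exists_eps_bound (hM : 1 ≤ M) (hm : 16 ≤ massM χ M) :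
    ∃ C, 1 ≤ C ∧ ∀ {ψ : ℝ → ℝ} {ζ K b₀ T : ℝ} {u : ℝ → ℝ → ℝ} {lam : ℝ → ℝ} {t CT : ℝ},
      Trapped χ ψ ζ M K b₀ T u lam → t ∈ Icc 0 T → Admissible χ M (bpar T lam t) →
      (∀ y, 0 < y → |T1 χ M (bpar T lam t) y| ≤ CT) → ∀ y, 0 < y →
      (|(eps χ M T u lam t) y| ≤ C * l2 (Hop (eps χ M T u lam t)) * (1 / y + 1 + y) ∧
        |y * deriv (eps χ M T u lam t) y| ≤ C * l2 (Hop (eps χ M T u lam t)) * (1 / y + 1 + y)) ∧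
      ((bpar T lam t) * y ≤ 1 → |(eps χ M T u lam t) y|
          ≤ C * (l2 (Hop (eps χ M T u lam t)) * √|log (bpar T lam t)|) * (1 + 1 / y) ∧
        |y * deriv (eps χ M T u lam t) y|
          ≤ C * (l2 (Hop (eps χ M T u lam t)) * √|log (bpar T lam t)|) * (1 + 1 / y)) := by
  obtain ⟨C, hC, hI⟩ := exists_inversion_bound hM hm
  refine ⟨2 * C, by linarith, fun {ψ ζ K b₀ T u lam t CT} h ht ha hT1 y hy => ?_⟩
  obtain ⟨r1, r2, r3, r4⟩ := h.regular_eps ht ha hT1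
  obtain ⟨h1, h2⟩ := hI _ (fun y hy => (h.hasDerivAt_eps ht hy).differentiableAt) r1 r2 r3 r4
    (h.orthogonality t ht) y hy
  set n := l2 (Hop (eps χ M T u lam t)) with hn
  have hn0 : 0 ≤ n := l2_nonneg _
  set b := (bpar T lam t) with hb
  set L := |log b| with hLd
  have hL : 1 ≤ √L := Real.one_le_sqrt.2 ha.log_ge
  have hCn : 0 ≤ C * n := by positivity
  have hy' : 0 < 1 / y := by positivity
  -- Both estimates follow from a bound by `C n (1 / y)` or by `C n (1 + √(log y))`.
  have key : ∀ X, (y ≤ 1 → X ≤ C * n / y) → (1 ≤ y → X ≤ C * n * (1 + √(log y))) →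
      X ≤ 2 * C * n * (1 / y + 1 + y) ∧
      (b * y ≤ 1 → X ≤ 2 * C * (n * √L) * (1 + 1 / y)) := fun X k1 k2 => by
    rcases le_total y 1 with h3 | h3
    · have k3 := k1 h3; rw [div_eq_mul_one_div] at k3
      have h4 : 0 ≤ C * n * (1 / y) := by positivity
      have h5 : 0 ≤ C * n * y := by positivity
      refine ⟨by linarith, fun _ => ?_⟩
      have h6 : C * n * (1 / y) * 1 ≤ C * n * (1 / y) * √L := by gcongr
      have h7 : 0 ≤ C * n * √L := by positivity
      have h8 : 0 ≤ C * n * (1 / y) * √L := by positivity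
      linarith
    · have k3 := k2 h3
      have hs : √(log y) ≤ y := by
        rw [Real.sqrt_le_left hy.le]; nlinarith [Real.log_le_sub_one_of_pos hy]
      have h4 : C * n * √(log y) ≤ C * n * y := by gcongr
      have h5 : 0 ≤ C * n * (1 / y) := by positivity
      have h6 : 0 ≤ C * n * y := by positivity
      refine ⟨by linarith, fun hby => ?_⟩
      have h7 : √(log y) ≤ √L := by
        refine Real.sqrt_le_sqrt ?_
        have h8 : log y ≤ log (1 / b) := by
          refine Real.log_le_log hy ?_
          rw [le_div_iff₀ ha.pos]; linarith
        rw [one_div, Real.log_inv] at h8; rw [hLd, ha.abs_log]; exact h8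
      have h9 : C * n * √(log y) ≤ C * n * √L := by gcongr
      have h10 : C * n * 1 ≤ C * n * √L := by gcongr
      have h11 : 0 ≤ C * n * √L * (1 / y) := by positivity
      linarith
  obtain ⟨a1, a2⟩ := key _ (fun h => (h1 h).1) fun h => (h2 h).1
  obtain ⟨a3, a4⟩ := key _ (fun h => (h1 h).2) fun h => (h2 h).2
  exact ⟨⟨a1, a3⟩, fun hby => ⟨a2 hby, a4 hby⟩⟩

namespace Trapped

variable (h : Trapped χ ψ ζ M K b₀ T u lam) (ht : t ∈ Icc 0 T)
include h ht

theorem continuousOn_deriv_vres : ContinuousOn (deriv vₜ) (Ioi 0) :=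
  ((h.solution.memH2 t ht).vres (h.lam_pos t ht)).ac_deriv.continuousOn

theorem continuousOn_vres : ContinuousOn vₜ (Ioi 0) :=
  ((h.solution.memH2 t ht).vres (h.lam_pos t ht)).continuousOn

theorem exists_vres_bound : ∃ A, 0 ≤ A ∧ ∀ y, 0 < y → |y * vₜ y| ≤ A ∧ |y * pₜ y| ≤ A := by
  have hl := h.lam_pos t ht
  refine ⟨l2 (deriv vₜ) + lam t * l2 (deriv (dt T u t)),
    add_nonneg (l2_nonneg _) (mul_nonneg hl.le (l2_nonneg _)), fun y hy => ?_⟩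
  have h1 := ((h.solution.memH2 t ht).vres hl).abs_le hy
  have h2 := (h.solution.memH1 t ht).abs_le (mul_pos hl hy); rw [le_div_iff₀ hy] at h1
  rw [le_div_iff₀ (by positivity)] at h2
  have h3 := l2_nonneg (deriv vₜ)
  have h4 := mul_nonneg hl.le (l2_nonneg (deriv (dt T u t))); rw [abs_mul, abs_mul, abs_of_pos hy]
  refine ⟨by linarith, ?_⟩
  have e : y * |pₜ y| = lam t * (|dt T u t (lam t * y)| * (lam t * y)) := by
    unfold pres; rw [abs_mul, abs_of_pos (by positivity : 0 < lam t ^ 2)]; ring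
  rw [e]
  have := mul_le_mul_of_nonneg_left h2 hl.le; linarith

theorem continuousOn_pres : ContinuousOn pₜ (Ioi 0) :=
  (((h.solution.memH1 t ht).ac.comp_mul (h.lam_pos t ht)).const_mul _).continuousOn

/-- The orthogonality condition, differentiated in time. -/
theorem ip_eta_phiM (hT : 0 < T) {CT : ℝ}
    (ha : ∀ τ ∈ Icc 0 T, Admissible χ M (bpar T lam τ) ∧ ∀ y, 0 < y →
      |T1 χ M (bpar T lam τ) y| ≤ CT ∧ bpar T lam τ * |dT1 χ M (bpar T lam τ) y| ≤ CT) :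
    ip ηₜ (phiM χ M) = bₜ * ip (Lam εₜ) (phiM χ M) := by
  obtain ⟨ha', hT1⟩ := ha t ht
  have hM := ha'.one_le
  have hM0 : 0 < 2 * M := by linarith
  have hφ := contDiff_phiM (χ := χ) M
  have h0 : ∀ s, 2 * M ≤ s → phiM χ M s = 0 := fun s => phiM_eq_zero hM
  have h0' : ∀ s, 2 * M ≤ s → s * deriv (phiM χ M) s = 0 := fun s => mul_deriv_phiM_eq_zero hM
  have hφ' : Continuous fun y => y * deriv (phiM χ M) y :=
    continuous_id.mul (hφ.continuous_deriv le_rfl)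
  obtain ⟨A, hA⟩ := exists_isFamily_phiM (χ := χ) hM (S := bpar T lam '' Icc 0 T) (by
    rintro b ⟨τ, hτ, rfl⟩
    have := (ha τ hτ).1
    exact ⟨this.pos, by linarith [this.four_mul, mul_pos (by linarith : 0 < M) this.pos]⟩)
  have hd := h.hasDerivWithinAt_ip_vres ht hT hA
  have hconst : ∀ τ ∈ Icc 0 T, ip (vres lam u τ) (phiM χ M) = ip Q (phiM χ M) := fun τ hτ => by
    obtain ⟨ha'', hT1'⟩ := ha τ hτ
    obtain ⟨B, -, hB⟩ := h.exists_vres_bound hτ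
    have i1 := integrable_mul_of_bounded (h.continuousOn_vres hτ) hφ.continuous.continuousOn
      (fun y hy _ => (hB y hy).1) fun s hs => h0 s hs.le
    have i2 := ha''.formDomain_PB1.integrable_mul hφ.continuous hM0 h0
    have e := ip_eq_comb i1 i2 1 (-1) (F := eps χ M T u lam τ) fun y _ => by rw [eps_eq]; ring
    rw [ha''.ip_PB1 fun y hy => (hT1' y hy).1] at e
    have := h.orthogonality τ hτ
    unfold phiM at this e ⊢; linarith
  have hz := ((hasDerivWithinAt_const t (Icc 0 T) (ip Q (phiM χ M))).congr hconst (hconst t ht))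
  have hz2 := (uniqueDiffOn_Icc hT t ht).eq_deriv _ hd hz
  have hl := h.lam_pos t ht
  have hz3 : ip pₜ (phiM χ M) + ip vₜ (sdot T lam (fun _ => phiM χ M) t)
      + 3 * bₜ * ip vₜ (phiM χ M) = 0 := by
    rcases mul_eq_zero.1 hz2 with h1 | h1
    · exact absurd h1 (by positivity)
    · exact h1
  obtain ⟨B, -, hB⟩ := h.exists_vres_bound ht
  have i1 := integrable_mul_of_bounded (h.continuousOn_vres ht) hφ.continuous.continuousOn
    (fun y hy _ => (hB y hy).1) fun s hs => h0 s hs.le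
  have i2 := integrable_mul_of_bounded (h.continuousOn_vres ht) hφ'.continuousOn
    (fun y hy _ => (hB y hy).1) fun s hs => h0' s hs.le
  have i3 := integrable_mul_of_bounded (h.continuousOn_pres ht) hφ.continuous.continuousOn
    (fun y hy _ => (hB y hy).2) fun s hs => h0 s hs.le
  have i4 := ha'.formDomain_Lam_PB1.integrable_mul hφ.continuous hM0 h0
  have i5 := ha'.formDomain_dbPB1.integrable_mul hφ.continuous hM0 h0
  obtain ⟨C₁, hC₁, hC₁b⟩ := ha'.exists_PB1_deriv_bound (2 * M)
  obtain ⟨C₂, hC₂, hC₂b⟩ := exists_eps_bound hM ha'.massM_ge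
  set n := l2 (Hop εₜ)
  have hn0 : 0 ≤ n := l2_nonneg _
  obtain ⟨i6, -, h6⟩ := ip_Lam_left (R := 2 * M) (A := B + (C₂ * n * (1 + 2 * M + (2 * M) ^ 2) + 2 * M * C₁))
    (fun y hy => hasDerivAt_vres (h.solution.memH2 t ht) hl hy) (h.continuousOn_deriv_vres ht)
    hφ hM0 h0 fun y hy hyR => by
      have p1 : 0 ≤ C₂ * n * (1 + 2 * M + (2 * M) ^ 2) + 2 * M * C₁ := by positivity
      have p2 := (abs_nonneg _).trans (hB y hy).1
      refine ⟨(hB y hy).1.trans (by linarith), ?_⟩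
      have e1 := (h.hasDerivAt_eps ht hy).deriv
      have e2 : deriv vₜ y = deriv εₜ y + deriv (PB1 χ M bₜ) y := by linarith
      rw [e2, show y ^ 2 * (deriv εₜ y + deriv (PB1 χ M bₜ) y)
        = y * (y * deriv εₜ y) + y * (y * deriv (PB1 χ M bₜ) y) by ring]
      refine (abs_add_le _ _).trans ?_
      rw [abs_mul y, abs_mul y (y * _), abs_of_pos hy]
      have p3 := (hC₂b h ht ha' (fun y hy => (hT1 y hy).1) y hy).1.2
      have p4 := (hC₁b y hy hyR).2
      have p5 : y * |y * deriv εₜ y| ≤ C₂ * n * (1 + 2 * M + (2 * M) ^ 2) := by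
        calc y * |y * deriv εₜ y| ≤ y * (C₂ * n * (1 / y + 1 + y)) := by gcongr
          _ = C₂ * n * (1 + y + y ^ 2) := by field_simp
          _ ≤ _ := by gcongr
      have p6 : y * |y * deriv (PB1 χ M bₜ) y| ≤ 2 * M * C₁ := by gcongr
      linarith
  have j1 : Integrable (fun y => phiM χ M y * vₜ y) ϱ := by simpa only [mul_comm] using i1
  have j2 : Integrable (fun y => y * deriv (phiM χ M) y * vₜ y) ϱ := by
    simpa only [mul_comm] using i2
  have e1 : ip vₜ (sdot T lam (fun _ => phiM χ M) t) + 3 * bₜ * ip vₜ (phiM χ M)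
      = -(bₜ * ip (Lam vₜ) (phiM χ M)) := by
    rw [h6, ip_comm vₜ, ip_comm vₜ, ip_comm vₜ,
      ip_eq_comb (F := fun y => phiM χ M y + Dop (phiM χ M) y) j2 j1 1 3
        fun y _ => by unfold Dop; ring,
      ip_eq_comb (F := sdot T lam (fun _ => phiM χ M) t) j2 j1 bₜ 0 fun y _ => by
        unfold sdot yscale bscale; simp only [deriv_const]; ring]
    ring
  have e2 : ip ηₜ (phiM χ M) = ip pₜ (phiM χ M) - bₜ * ip (Lam (PB1 χ M bₜ)) (phiM χ M)
      - bs T lam t * ip (dbPB1 χ M bₜ) (phiM χ M) := by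
    have e := ip_eq_comb (F := fun y => pₜ y - bₜ * Lam (PB1 χ M bₜ) y) i3 i4 1 (-bₜ)
      fun y _ => by ring
    rw [ip_eq_comb ((i3.sub (i4.const_mul bₜ)).congr (Eventually.of_forall fun y => ?_)) i5 1
      (-bs T lam t) fun y _ => ?_, e]
    · ring
    · simp only [Pi.sub_apply]; ring
    · unfold etares; ring
  have e3 : ip (Lam εₜ) (phiM χ M) = ip (Lam vₜ) (phiM χ M) - ip (Lam (PB1 χ M bₜ)) (phiM χ M) := by
    rw [ip_eq_comb i6 i4 1 (-1) fun y hy => by rw [h.Lam_eps ht hy]; ring]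
    ring
  rw [e2, e3, ha'.ip_dbPB1 hT1]
  linear_combination hz3 - e1

end Trapped

/-! ### Size of the remainder -/

theorem abs_ip_le_of_weight (hg : Integrable (fun y => (1 / y + 1 + y) * |g y|) ϱ)
    (hf : ∀ y, 0 < y → |f y| ≤ A * (1 / y + 1 + y)) :
    |ip f g| ≤ A * ∫ y, (1 / y + 1 + y) * |g y| ∂ϱ := by
  unfold ip; rw [← integral_const_mul, ← Real.norm_eq_abs]
  refine norm_integral_le_of_norm_le (hg.const_mul A) (ae_radial_of_forall fun y hy => ?_)
  rw [Real.norm_eq_abs, abs_mul, ← mul_assoc]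
  exact mul_le_mul_of_nonneg_right (hf y hy) (abs_nonneg _)

theorem continuousOn_weight : ContinuousOn (fun y : ℝ => 1 / y + 1 + y) (Ioi 0) :=
  ((continuousOn_const.div continuousOn_id fun _ hy => ne_of_gt hy).add continuousOn_const).add
    continuousOn_id

theorem IsBoundState.integrable_weight (h : IsBoundState ψ ζ) :
    Integrable (fun y => (1 / y + 1 + y) * |ψ y|) ϱ := by
  refine (h.integrable_weight_mul continuousOn_weight (A := 1) fun y hy => ?_).abs.congr
    (ae_radial_of_forall fun y hy => ?_)
  · rw [abs_of_pos (by positivity)]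
    have h1 : 0 ≤ 1 + 6 * y + 14 * y ^ 2 + 19 * y ^ 3 + 14 * y ^ 4 + 6 * y ^ 5 + y ^ 6 := by
      positivity
    have h2 : y ^ 3 * (1 / y + 1 + y) = y ^ 2 + y ^ 3 + y ^ 4 := by field_simp
    linear_combination h1 + h2
  · beta_reduce; rw [abs_mul, abs_of_pos (by positivity : 0 < 1 / y + 1 + y)]

theorem integrable_weight_phiM (hM : 1 ≤ M) :
    Integrable (fun y => (1 / y + 1 + y) * |phiM χ M y|) ϱ := by
  have hc := continuous_phiM (χ := χ) M
  refine (integrable_mul_of_bounded (f := fun y => 1 / y) (A := 1) (R := 2 * M)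
    (g := fun y => (1 + y + y ^ 2) * |phiM χ M y|)
    (continuousOn_const.div continuousOn_id fun _ hy => ne_of_gt hy) (by fun_prop)
    (fun y hy _ => by rw [mul_one_div_cancel hy.ne', abs_one]) fun y hy => by
      rw [phiM_eq_zero hM hy.le, abs_zero, mul_zero]).congr (ae_radial_of_forall fun y hy => ?_)
  field_simp

set_option maxHeartbeats 1000000 in
/-- The bootstrap bounds control `H ε`, `∂_s ε` and the pairings of `η`, the unstable direction
being controlled by `κ±`. -/
theorem exists_remainder_bound (hψ : IsBoundState ψ ζ)
    (hM : 1 ≤ M) (hm : 16 ≤ massM χ M) : ∃ C b₁ : ℝ, 1 ≤ C ∧ 0 < b₁ ∧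
      ∀ {K b₀ T : ℝ} {u : ℝ → ℝ → ℝ} {lam : ℝ → ℝ} {t b D : ℝ}, Trapped χ ψ ζ M K b₀ T u lam →
      1 ≤ K → 0 < T → t ∈ Icc 0 T → (∀ τ ∈ Icc 0 T, bpar T lam τ < b₁) → b = bpar T lam t →
      D = √K * (b ^ 2 / |log b|) →
      l2 (Hop (eps χ M T u lam t)) ≤ C * D ∧ |bs T lam t| ≤ D ∧
      (∀ y, 0 < y → b * y ≤ 1 → |eps χ M T u lam t y| ≤ C * (D * √|log b|) * (1 + 1 / y) ∧
        |y * deriv (eps χ M T u lam t) y| ≤ C * (D * √|log b|) * (1 + 1 / y)) ∧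
      ∀ Y A, IsTest χ Y → 0 ≤ A → (∀ b y, |Y b y| ≤ A * Q y) →
        |ip (etares χ M T u lam t) (Y b)| ≤ C * A * (D * √|log b| / b) := by
  obtain ⟨C₁, b₂, hC₁, hb₂, hT1⟩ := exists_T1_bound hM hm
  obtain ⟨C₂, hC₂, hE⟩ := exists_eps_bound hM hm
  obtain ⟨C₃, hC₃, hDu⟩ := exists_duality_bound hψ hM hm
  obtain ⟨Cχ, hCχ, hχb⟩ := hχ.1.exists_bound
  have hζ := hψ.pos
  set κ := ζ / ip ψ ψ with hκ
  have hκ0 : 0 < κ := div_pos hζ hψ.ip_self_pos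
  set Kψ := ∫ y, |ψ y| ∂ϱ with hKψ
  have hKψ0 : 0 ≤ Kψ := integral_nonneg fun _ => abs_nonneg _
  have hpos : ∀ g : ℝ → ℝ, 0 ≤ ∫ y, (1 / y + 1 + y) * |g y| ∂ϱ := fun g =>
    integral_nonneg_of_ae (ae_radial_of_forall fun y hy => by positivity)
  set Wψ := ∫ y, (1 / y + 1 + y) * |ψ y| ∂ϱ with hWψ
  set Wφ := ∫ y, (1 / y + 1 + y) * |phiM χ M y| ∂ϱ with hWφ
  have hWψ0 : 0 ≤ Wψ := hpos ψ
  have hWφ0 : 0 ≤ Wφ := hpos _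
  set k₁ := 3 * √ζ + 7 * Cχ * C₁ * Kψ with hk₁
  set k₂ := 2 * C₂ * Wψ with hk₂
  set k₃ := 1 + 2 * κ * k₁ ^ 2 with hk₃
  set k₄ := 1 + 2 * k₃ with hk₄
  have hk₁0 : 0 ≤ k₁ := by positivity
  have hk₂0 : 0 ≤ k₂ := by positivity
  have hk₃0 : 1 ≤ k₃ := le_add_of_nonneg_right (by positivity)
  have hk₄0 : 1 ≤ k₄ := by linarith
  set k₅ := k₄ + (k₁ + k₂ * k₄) + 2 * C₂ * k₄ * Wφ with hk₅
  have p1 : 0 ≤ C₂ * k₄ := by positivity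
  have p2 : 0 ≤ C₃ * k₅ := by positivity
  refine ⟨k₄ + C₂ * k₄ + C₃ * k₅, min b₂ (1 / (4 * κ * k₂ ^ 2 + 1)), by linarith, by positivity,
    fun {K b₀ T u lam t b D} h hK hT ht hsm hbt hDd => ?_⟩
  have hall : ∀ τ ∈ Icc 0 T, Admissible χ M (bpar T lam τ) ∧ ∀ y, 0 < y →
      |T1 χ M (bpar T lam τ) y| ≤ C₁ ∧ bpar T lam τ * |dT1 χ M (bpar T lam τ) y| ≤ C₁ :=
    fun τ hτ => by
      obtain ⟨h1, h2, -⟩ := hT1 _ (h.b_pos τ hτ) ((hsm τ hτ).trans_le (min_le_left _ _))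
      exact ⟨h1, h2⟩
  obtain ⟨ha, hTt⟩ := hall t ht
  have hE' := hE h ht ha fun y hy => (hTt y hy).1
  have hηφ := h.ip_eta_phiM ht hT hall
  have hη := h.formDomain_eta ht ha
  have hen := h.energy_eq ht hT ha
  have hds := fun y (hy : 0 < y) => h.dsEps_eq ht hT ha hy
  have hbs2 := h.bs_bound t ht
  have hH2 := h.H2_bound t ht
  have hun := h.unstable t ht
  have hst := h.stable t ht
  have hdP := fun y (hy : 0 < y) => ha.abs_dbPB1_le hχb hTt hy
  have hsmall := (hsm t ht).le.trans (min_le_right _ _)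
  have hdPD := ha.formDomain_dbPB1
  have hcΛ : ContinuousOn (Lam (eps χ M T u lam t)) (Ioi 0) := by
    obtain ⟨r1, -⟩ := h.regular_eps ht ha fun y hy => (hTt y hy).1
    have hce : ContinuousOn (eps χ M T u lam t) (Ioi 0) := fun y hy =>
      (h.hasDerivAt_eps ht hy).continuousAt.continuousWithinAt
    exact hce.add (continuousOn_id.mul r1.continuousOn)
  simp only [kappa] at hun hst; rw [← hbt] at *
  set ε := eps χ M T u lam t with hε
  set η := etares χ M T u lam t with hηd
  set L := |log b| with hL
  set n := l2 (Hop ε) with hn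
  have hb0 := ha.pos
  have hL1 := ha.log_ge
  have hn0 : 0 ≤ n := l2_nonneg _
  have hbL : 0 ≤ b ^ 2 / L := by positivity
  have hsK : 1 ≤ √K := Real.one_le_sqrt.2 hK
  have hD0 : 0 ≤ D := by rw [hDd]; positivity
  have hD2 : K * (b ^ 4 / L ^ 2) = D ^ 2 := by
    rw [hDd, mul_pow, Real.sq_sqrt (by linarith), div_pow]; ring
  have hbD : b ^ 2 / L ≤ D := by rw [hDd]; exact le_mul_of_one_le_left hbL hsK
  rw [hD2] at hbs2 hH2
  have hbs : |bs T lam t| ≤ D := by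
    rw [← abs_of_nonneg hD0]; exact sq_le_sq.1 (by rwa [sq_abs] at hbs2)
  have hK8 : K ^ (1 / 8 : ℝ) ≤ √K := by
    rw [Real.sqrt_eq_rpow]; exact Real.rpow_le_rpow_of_exponent_le hK (by norm_num)
  replace hst := hst.trans ((mul_le_mul_of_nonneg_right hK8 hbL).trans_eq hDd.symm)
  have hΛ : ∀ y, 0 < y → |Lam ε y| ≤ 2 * C₂ * n * (1 / y + 1 + y) := fun y hy => by
    obtain ⟨⟨h1, h2⟩, -⟩ := hE' y hy; exact (abs_add_le _ _).trans (by linarith only [h1, h2])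
  have hΛψ : |ip (Lam ε) ψ| ≤ k₂ * n :=
    (abs_ip_le_of_weight hψ.integrable_weight hΛ).trans_eq (by rw [hk₂]; ring)
  have hΛφ : |ip (Lam ε) (phiM χ M)| ≤ 2 * C₂ * n * Wφ :=
    abs_ip_le_of_weight (integrable_weight_phiM hM) hΛ
  have hdPψ : |ip (dbPB1 χ M b) ψ| ≤ 7 * Cχ * C₁ * Kψ :=
    (abs_ip_le_of_bounded hψ.integrable hdP).trans
      (mul_le_mul_of_nonneg_right (mul_le_of_le_one_right (by positivity) ha.lt_one.le) hKψ0)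
  set q := ip η ψ with hq
  have hqe : ip (dsEps χ M T u lam t) ψ = q - b * ip (Lam ε) ψ := by
    have i2 : Integrable (fun y => Lam ε y * ψ y) ϱ := by
      refine (hψ.integrable_weight.const_mul (2 * C₂ * n)).mono'
        (aesm_radial (hcΛ.mul hψ.continuousOn)) (ae_radial_of_forall fun y hy => ?_)
      rw [Real.norm_eq_abs, abs_mul, ← mul_assoc]
      exact mul_le_mul_of_nonneg_right (hΛ y hy) (abs_nonneg _)
    rw [ip_eq_comb (hψ.integrable_mul hη.wt) i2 1 (-b) fun y hy => by rw [hds y hy]; ring, hq]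
    ring
  have hsζ : 0 < √ζ := Real.sqrt_pos.2 hζ
  have hq1 : |q| ≤ k₁ * D + k₂ * (b * n) := by
    set X := (ip ε ψ + 1 * (ip (dsEps χ M T u lam t) ψ / √ζ)) / 2
      + 1 * (bs T lam t / (2 * √ζ) * ip (dbPB1 χ M b) ψ) with hX
    set X' := (ip ε ψ + -1 * (ip (dsEps χ M T u lam t) ψ / √ζ)) / 2
      + -1 * (bs T lam t / (2 * √ζ) * ip (dbPB1 χ M b) ψ) with hX'
    have e : q = √ζ * (X - X') - bs T lam t * ip (dbPB1 χ M b) ψ + b * ip (Lam ε) ψ := by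
      have e1 : √ζ * (X - X') = ip (dsEps χ M T u lam t) ψ + bs T lam t * ip (dbPB1 χ M b) ψ := by
        rw [hX, hX']; field_simp; ring
      rw [e1, hqe]; ring
    have e2 : |√ζ * (X - X')| ≤ √ζ * (3 * D) := by
      rw [abs_mul, abs_of_pos hsζ]
      have := abs_sub X X'
      gcongr; linarith
    have e3 : |bs T lam t * ip (dbPB1 χ M b) ψ| ≤ D * (7 * Cχ * C₁ * Kψ) := by
      rw [abs_mul (bs T lam t)]; exact mul_le_mul hbs hdPψ (abs_nonneg _) hD0
    have e4 : |b * ip (Lam ε) ψ| ≤ b * (k₂ * n) := by rw [abs_mul b, abs_of_pos hb0]; gcongr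
    rw [e]
    refine (abs_add_le _ _).trans ((add_le_add ((abs_sub _ _).trans (add_le_add e2 e3)) e4).trans ?_)
    rw [hk₁]; exact le_of_eq (by ring)
  have hP : formPlus ψ ζ η η = form η η + κ * q ^ 2 := by unfold formPlus; rw [sq]
  have hP0 := hψ.formPlus_self_nonneg hη
  have hn2 : ∫ y, Hop ε y ^ 2 ∂ϱ = n ^ 2 :=
    (Real.sq_sqrt (integral_nonneg fun _ => sq_nonneg _)).symm
  rw [hen, hn2] at hH2
  -- The factor `b` in front of `n` lets the energy absorb the contribution of `ε` to `(η, ψ)`.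
  have hq2 : κ * q ^ 2 ≤ 2 * κ * k₁ ^ 2 * D ^ 2 + n ^ 2 / 2 := by
    have h1 : q ^ 2 ≤ (k₁ * D + k₂ * (b * n)) ^ 2 := by rw [← sq_abs]; gcongr
    have h2 : (k₁ * D + k₂ * (b * n)) ^ 2 ≤ 2 * ((k₁ * D) ^ 2 + (k₂ * (b * n)) ^ 2) := add_sq_le
    have h3 : b * (4 * κ * k₂ ^ 2 + 1) ≤ 1 := (le_div_iff₀ (by positivity)).1 hsmall
    have h4 : 4 * κ * k₂ ^ 2 * b * b ≤ 1 := by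
      have h5 : 0 ≤ 4 * κ * k₂ ^ 2 * b := by positivity
      refine mul_le_one₀ ?_ hb0.le ha.lt_one.le
      rw [mul_add, mul_one, mul_comm] at h3; linarith only [h3, hb0]
    calc κ * q ^ 2 ≤ κ * (2 * ((k₁ * D) ^ 2 + (k₂ * (b * n)) ^ 2)) :=
          mul_le_mul_of_nonneg_left (h1.trans h2) hκ0.le
      _ = 2 * κ * k₁ ^ 2 * D ^ 2 + 4 * κ * k₂ ^ 2 * b * b * n ^ 2 / 2 := by ring
      _ ≤ 2 * κ * k₁ ^ 2 * D ^ 2 + 1 * n ^ 2 / 2 := by gcongr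
      _ = _ := by ring
  have hfin : n ^ 2 / 2 + formPlus ψ ζ η η ≤ k₃ * D ^ 2 := by
    have := le_abs_self (form η η + n ^ 2); rw [hP, hk₃]; linarith only [this, hH2, hq2]
  have hk4D : 2 * k₃ * D ^ 2 ≤ (k₄ * D) ^ 2 := by
    rw [mul_pow]
    have : 2 * k₃ ≤ k₄ ^ 2 := by nlinarith only [hk₃0, hk₄]
    gcongr
  have hnD : n ≤ k₄ * D := by
    refine (sq_le_sq₀ hn0 (by positivity)).1 ?_
    linarith only [hfin, hk4D, hP0]
  have hPD : √(formPlus ψ ζ η η) ≤ k₄ * D := by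
    refine (Real.sqrt_le_left (by positivity)).2 ?_
    have h1 : 0 ≤ k₃ * D ^ 2 := by positivity
    linarith only [hfin, hk4D, sq_nonneg n, h1]
  have hqD : |q| ≤ (k₁ + k₂ * k₄) * D := by
    have h1 : b * n ≤ 1 * (k₄ * D) := mul_le_mul ha.lt_one.le hnD hn0 zero_le_one
    have h2 := mul_le_mul_of_nonneg_left h1 hk₂0; linarith only [h2, hq1]
  have hφD : |ip η (phiM χ M)| ≤ 2 * C₂ * k₄ * Wφ * D := by
    rw [hηφ, abs_mul b, abs_of_pos hb0]
    calc b * |ip (Lam ε) (phiM χ M)| ≤ 1 * (2 * C₂ * (k₄ * D) * Wφ) :=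
          mul_le_mul ha.lt_one.le (hΛφ.trans (by gcongr)) (abs_nonneg _) zero_le_one
      _ = _ := by ring
  have hDL : 0 ≤ D * √L := by positivity
  have hk₅0 : 0 ≤ k₄ + C₂ * k₄ := by linarith only [p1, hk₄0]
  have q1 : k₄ ≤ k₄ + C₂ * k₄ + C₃ * k₅ := by linarith only [p1, p2]
  have q2 : C₂ * k₄ ≤ k₄ + C₂ * k₄ + C₃ * k₅ := by linarith only [hk₄0, p2]
  have q3 : C₃ * k₅ ≤ k₄ + C₂ * k₄ + C₃ * k₅ := by linarith only [hk₅0]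
  refine ⟨hnD.trans (mul_le_mul_of_nonneg_right q1 hD0), hbs, fun y hy hby => ?_,
    fun Y A hY hA hYA => ?_⟩
  · obtain ⟨-, h2⟩ := hE' y hy
    obtain ⟨h3, h4⟩ := h2 hby
    have h5 : C₂ * (n * √L) * (1 + 1 / y) ≤ (k₄ + C₂ * k₄ + C₃ * k₅) * (D * √L) * (1 + 1 / y) := by
      refine mul_le_mul_of_nonneg_right ?_ (by positivity)
      calc C₂ * (n * √L) ≤ C₂ * (k₄ * D * √L) := by gcongr
        _ = C₂ * k₄ * (D * √L) := by ring
        _ ≤ _ := mul_le_mul_of_nonneg_right q2 hDL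
    exact ⟨h3.trans h5, h4.trans h5⟩
  · have h0 : 2 * M * b ≤ 1 := by
      have := mul_le_mul_of_nonneg_right hM hb0.le; linarith only [ha.four_mul, this, hb0]
    have h1 := hDu b A (Y b) η hb0 hL1 ha.lt_one h0 hA (hY.continuous b)
      (fun s _ => hYA b s) (fun s hs => hY.eq_zero hs) hη
    refine h1.trans ?_
    have hLb : L ≤ √L / b := by
      have h3 : √L ≤ L := (Real.sqrt_le_left (by linarith only [hL1])).2 (by nlinarith only [hL1])
      have h2 : L ≤ 1 / b := by
        rw [hL, ha.abs_log, ← Real.log_inv, one_div]; exact Real.log_le_self (inv_nonneg.2 hb0.le)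
      calc L = √L * √L := (Real.mul_self_sqrt (by linarith only [hL1])).symm
        _ ≤ √L * (1 / b) := mul_le_mul_of_nonneg_left (h3.trans h2) (Real.sqrt_nonneg _)
        _ = _ := mul_one_div _ _
    have hLb0 : 0 ≤ √L / b := by positivity
    have r1 := mul_le_mul_of_nonneg_left hPD hLb0
    have r2 := mul_le_mul hLb (add_le_add hqD hφD) (by positivity) hLb0
    calc C₃ * A * (√L / b * √(formPlus ψ ζ η η) + L * (|q| + |ip η (phiM χ M)|))
        ≤ C₃ * A * (√L / b * (k₄ * D) + √L / b * ((k₁ + k₂ * k₄) * D + 2 * C₂ * k₄ * Wφ * D)) :=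
          mul_le_mul_of_nonneg_left (add_le_add r1 r2) (by positivity)
      _ = C₃ * k₅ * (A * (D * √L / b)) := by rw [hk₅]; ring
      _ ≤ (k₄ + C₂ * k₄ + C₃ * k₅) * (A * (D * √L / b)) :=
          mul_le_mul_of_nonneg_right q3 (by positivity)
      _ = _ := by ring

/-! ### The derivative of `G + 𝓘` -/

/-- The coefficient of `b_s` in the derivative of `G + 𝓘`. -/
def bsCoeff (χ : ℝ → ℝ) (M T : ℝ) (u : ℝ → ℝ → ℝ) (lam : ℝ → ℝ) (t b : ℝ) : ℝ :=
  ip (Ztest χ b) (Ztest χ b) + 2 * ip (bscale (Ztest χ) b) (Ztest χ b)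
    + ip (bscale (Ptilde χ) b) (Ztest χ b)
    + ip (PB1 χ M b) (Ztest χ b) + ip (PB1 χ M b) (Dop (Ztest χ b))
    + b * (ip (dbPB1 χ M b) (Ztest χ b) + 2 * ip (dbPB1 χ M b) (Dop (Ztest χ b)))
    + b⁻¹ * ip (etares χ M T u lam t) (bscale (Ztest χ) b)
    + b⁻¹ * bs T lam t * ip (dbPB1 χ M b) (bscale (Ztest χ) b)
    - ip (eps χ M T u lam t) (Dop (Ztest χ b))
    - ip (eps χ M T u lam t) (Dop (bscale (Ztest χ) b))

namespace Trapped
variable {CT : ℝ}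

/-- The pairing of the profile with a test function, differentiated in `b`. -/
theorem _root_.CriticalWave.hasDerivAt_ip_PB1 {b₁ : ℝ} (hb : 0 < b) (hb₁ : b < b₁)
    (hT : ∀ β, 0 < β → β < b₁ → Admissible χ M β ∧
      ∀ y, 0 < y → |T1 χ M β y| ≤ CT ∧ β * |dT1 χ M β y| ≤ CT) (hY : IsTest χ Y) :
    HasDerivAt (fun β => ip (PB1 χ M β) (Y β))
      (ip (dbPB1 χ M b) (Y b) + b⁻¹ * ip (PB1 χ M b) (bscale Y b)) b := by
  obtain ⟨Cχ, hCχ, hχb⟩ := hχ.1.exists_bound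
  have hCT : 0 ≤ CT := (abs_nonneg _).trans ((hT b hb hb₁).2 1 one_pos).1
  refine hasDerivAt_ip_test hY hb (Ioo_mem_nhds hb hb₁) (A := 1 + 7 * Cχ * CT)
    (fun β hβ => (Admissible.contDiffOn_PB1 β).continuousOn)
    ((hT b hb hb₁).1.contDiffOn_dbPB1).continuousOn
    (fun β hβ y _ => (hT β hβ.1 hβ.2).1.hasDerivAt_PB1 y) fun β hβ y hy => ?_
  obtain ⟨ha, h1⟩ := hT β hβ.1 hβ.2
  have h0 := ha.pos
  have h2 := ha.lt_one.le
  have h3 : 0 ≤ Cχ * CT := by positivity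
  constructor
  · unfold PB1
    refine (abs_add_le _ _).trans (add_le_add ?_ ?_)
    · rw [abs_of_pos (Q_pos y)]; exact Q_le_one y
    · rw [abs_mul, abs_mul (β ^ 2), abs_of_pos (by positivity : 0 < β ^ 2)]
      calc |cut χ (B1 β) y| * (β ^ 2 * |T1 χ M β y|) ≤ Cχ * (1 * CT) := by
            gcongr
            · exact (hχb _).1
            · exact pow_le_one₀ h0.le h2
            · exact (h1 y hy).1
        _ ≤ 7 * Cχ * CT := by linarith
  · refine (ha.abs_dbPB1_le hχb h1 hy).trans ?_
    refine (mul_le_of_le_one_right (by positivity) h2).trans (by linarith)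

variable (h : Trapped χ ψ ζ M K b₀ T u lam) (ht : t ∈ Icc 0 T)
include h ht

theorem pairs_vres : Pairs χ bₜ vₜ ∧ Pairs χ bₜ pₜ := by
  obtain ⟨A, hA0, hA⟩ := h.exists_vres_bound ht
  have hY0 : ∀ {Y : ℝ → ℝ → ℝ}, IsTest χ Y → ∀ y, 1 / bₜ < y → Y bₜ y = 0 := fun hY y hy =>
    hY.eq_zero ((div_lt_iff₀' (h.b_pos t ht)).1 hy).le
  exact ⟨fun Y hY => integrable_mul_of_bounded (h.continuousOn_vres ht)
    (hY.continuous _).continuousOn (fun y hy _ => (hA y hy).1) (hY0 hY),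
    fun Y hY => integrable_mul_of_bounded (h.continuousOn_pres ht)
    (hY.continuous _).continuousOn (fun y hy _ => (hA y hy).2) (hY0 hY)⟩

theorem ip_eps_test (ha : Admissible χ M bₜ) (hY : IsTest χ Y) :
    ip εₜ (Y bₜ) = ip vₜ (Y bₜ) - ip (PB1 χ M bₜ) (Y bₜ) := by
  have e := (h.pairs_vres ht).1.ip_comb (ha.formDomain_PB1.pairs ha.pos) hY 1 (-1)
  rw [ip_congr (fun y _ => (by rw [eps_eq]; ring : εₜ y
    = 1 * vₜ y + -1 * PB1 χ M bₜ y)) fun _ _ => rfl, e]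
  ring

theorem ip_pres_test (ha : Admissible χ M bₜ) (hY : IsTest χ Y) :
    ip pₜ (Y bₜ) = ip ηₜ (Y bₜ) - bₜ * (ip (PB1 χ M bₜ) (Y bₜ) + ip (PB1 χ M bₜ) (Dop (Y bₜ)))
      + bs T lam t * ip (dbPB1 χ M bₜ) (Y bₜ) := by
  have p1 := (h.formDomain_eta ht ha).pairs (χ := χ) ha.pos
  have p2 := ha.formDomain_Lam_PB1.pairs (χ := χ) ha.pos
  have p3 := ha.formDomain_dbPB1.pairs (χ := χ) ha.pos
  obtain ⟨C, hC, hP⟩ := ha.exists_PB1_deriv_bound (1 / bₜ)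
  have e1 := ip_Lam_test ha.pos hY (f := PB1 χ M bₜ)
    (fun y hy => Admissible.hasDerivAt_PB1_right _ hy)
    (Admissible.contDiffOn_deriv_PB1 _).continuousOn (A := C) fun y hy hby => by
      obtain ⟨h1, h2⟩ := hP y hy (by rw [le_div_iff₀ ha.pos]; linarith)
      exact ⟨le_weight hC.le hy h1, le_weight hC.le hy h2⟩
  rw [ip_congr (fun y _ => (by unfold etares; ring : pₜ y
    = 1 * (1 * ηₜ y + bₜ * Lam (PB1 χ M bₜ) y) + bs T lam t * dbPB1 χ M bₜ y)) fun _ _ => rfl,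
    (p1.comb p2 1 _).ip_comb p3 hY, p1.ip_comb p2 hY, e1]
  ring

theorem exists_eps_test_bound (ha : Admissible χ M bₜ) (hT1 : ∀ y, 0 < y → |T1 χ M bₜ y| ≤ CT) :
    ∃ A, ∀ y, 0 < y → bₜ * y ≤ 1 → |εₜ y| ≤ A * (1 + 1 / y) ∧
      |y * deriv εₜ y| ≤ A * (1 + 1 / y) := by
  obtain ⟨C, -, hC⟩ := exists_eps_bound ha.one_le ha.massM_ge
  exact ⟨_, fun y hy hby => (hC h ht ha hT1 y hy).2 hby⟩

theorem Ifun_eq_eta (hT : 0 < T) (ha : Admissible χ M bₜ)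
    (hT1 : ∀ y, 0 < y → |T1 χ M bₜ y| ≤ CT) : Ifun χ M T u lam t = ip ηₜ (Ztest χ bₜ)
      - bₜ * ip εₜ (Dop (Ztest χ bₜ)) + bs T lam t * ip (dbPB1 χ M bₜ) (Ztest χ bₜ) := by
  set b := bₜ with hb
  have hb0 := ha.pos
  have hZ := isTest_Ztest (χ := χ)
  obtain ⟨A, hA⟩ := h.exists_eps_test_bound ht ha hT1
  obtain ⟨r1, -⟩ := h.regular_eps ht ha hT1
  have hd : ∀ y, 0 < y → HasDerivAt εₜ (deriv εₜ y) y :=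
    fun y hy => (h.hasDerivAt_eps ht hy).differentiableAt.hasDerivAt
  have hce : ContinuousOn εₜ (Ioi 0) := fun y hy => (hd y hy).continuousAt.continuousWithinAt
  have p1 := (h.formDomain_eta ht ha).pairs (χ := χ) hb0
  have p2 := pairs_of_bounded (χ := χ) hb0 hce fun y hy hby => (hA y hy hby).1
  have p3 : Pairs χ b (Lam εₜ) := pairs_of_bounded hb0
    (hce.add (continuousOn_id.mul r1.continuousOn)) (A := 2 * A) fun y hy hby => by
      obtain ⟨h1, h2⟩ := hA y hy hby
      exact (abs_add_le _ _).trans (by linarith)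
  have p4 := ha.formDomain_dbPB1.pairs (χ := χ) hb0
  have p5 : Pairs χ b (dbPtilde χ b) := by
    have hP := (isTest_Ptilde χ).bscale
    obtain ⟨B, hB0, hB⟩ := hP.exists_bound
    have e : dbPtilde χ b = fun y => b⁻¹ * bscale (Ptilde χ) b y := by
      funext y; unfold bscale dbPtilde; rw [inv_mul_cancel_left₀ hb0.ne']
    rw [e]
    refine pairs_of_abs_le hb0 (continuous_const.mul (hP.continuous b)).continuousOn
      (A := b⁻¹ * B) fun y hy => ?_
    rw [abs_mul, abs_of_pos (inv_pos.2 hb0)]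
    gcongr; exact (hB b y).trans (mul_le_of_le_one_right hB0 (Q_le_one y))
  have e1 := ip_Lam_test hb0 hZ hd r1.continuousOn hA
  unfold Ifun; rw [← hb]
  change ip _ (Ztest χ b) + b * ip _ (Ztest χ b) + bs T lam t * ip _ (Ztest χ b)
    + bs T lam t * ip _ (Ztest χ b) = _
  rw [ip_congr (fun y hy => ((h.dsEps_eq ht hT ha hy).trans (by ring) : dsEps χ M T u lam t y
      = 1 * ηₜ y + -b * Lam εₜ y)) fun _ _ => rfl,
    p1.ip_comb p3 hZ,
    ip_congr (fun y _ => (by ring : εₜ y + 2 * Lam εₜ y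
      = 1 * εₜ y + 2 * Lam εₜ y)) fun _ _ => rfl,
    p2.ip_comb p3 hZ,
    ip_congr (fun y _ => (by ring : dbPB1 χ M b y - dbPtilde χ b y
      = 1 * dbPB1 χ M b y + -1 * dbPtilde χ b y)) fun _ _ => rfl,
    p4.ip_comb p5 hZ, e1]
  ring

/-- Only the first derivatives of `u` enter `𝓘`, through pairings that are differentiable. -/
theorem Ifun_eq (hT : 0 < T) (ha : Admissible χ M bₜ) (hT1 : ∀ y, 0 < y → |T1 χ M bₜ y| ≤ CT) :
    Ifun χ M T u lam t = ip pₜ (Ztest χ bₜ) - bₜ * ip vₜ (Dop (Ztest χ bₜ))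
      + bₜ * (ip (PB1 χ M bₜ) (Ztest χ bₜ) + 2 * ip (PB1 χ M bₜ) (Dop (Ztest χ bₜ))) := by
  have hZ := isTest_Ztest (χ := χ)
  rw [h.Ifun_eq_eta ht hT ha hT1, h.ip_pres_test ht ha hZ, h.ip_eps_test ht ha hZ.Dop]; ring

/-- The derivative of `G + 𝓘` in the rescaled time. The terms containing `∂_s ε` cancel up to those
with a factor `b_s`. -/
theorem hasDerivWithinAt_G_add_Ifun (hT : 0 < T) {b₁ : ℝ} (hb₁ : ∀ τ ∈ Icc 0 T, bpar T lam τ < b₁)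
    (ha : ∀ β, 0 < β → β < b₁ → Admissible χ M β ∧
      ∀ y, 0 < y → |T1 χ M β y| ≤ CT ∧ β * |dT1 χ M β y| ≤ CT) (hb : b = bₜ) :
    HasDerivWithinAt (fun τ => G χ (bpar T lam τ) + Ifun χ M T u lam τ)
    ((lam t)⁻¹ * (ip (fun y => lap vₜ y + vₜ y ^ 3) (Ztest χ b)
        - b ^ 2 * (ip vₜ (Dop (Ztest χ b)) + ip vₜ (Dop (Dop (Ztest χ b))))
        + bs T lam t * bsCoeff χ M T u lam t b)) (Icc 0 T) t := by
  have hb0 : 0 < b := hb ▸ h.b_pos t ht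
  have hbb : b < b₁ := hb ▸ hb₁ t ht
  have hl := h.lam_pos t ht
  have hZ := isTest_Ztest (χ := χ)
  have hDZ := hZ.Dop
  have hsZ := hZ.bscale
  have hBD : bscale (fun b => Dop (Ztest χ b)) b = Dop (bscale (Ztest χ) b) := hZ.bscale_Dop b
  have hdb := hasDerivWithinAt_bpar hT h.lam_c2 hl ht
  have hadm := (ha b hb0 hbb).1
  obtain ⟨A₁, hF₁⟩ := hZ.exists_isFamily (bpar T lam '' Icc 0 T)
  obtain ⟨A₂, hF₂⟩ := hDZ.exists_isFamily (bpar T lam '' Icc 0 T)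
  have d1 := h.hasDerivWithinAt_ip_pres ht hT hF₁
  have d2 := h.hasDerivWithinAt_ip_vres ht hT hF₂
  have i1 := hasDerivAt_ip_PB1 hb0 hbb ha hZ
  have i2 := hasDerivAt_ip_PB1 hb0 hbb ha hDZ
  have i3 := hasDerivAt_G (χ := χ) hb0
  have q1 := fun {Y : ℝ → ℝ → ℝ} (hY : IsTest χ Y) => h.ip_eps_test ht (hb ▸ hadm) hY
  have q2 := h.ip_pres_test ht (hb ▸ hadm) hsZ
  obtain ⟨pv, pp⟩ := h.pairs_vres ht
  -- The scaling derivative of a test function in time, in terms of `D` and `b ∂_b`.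
  have key : ∀ {f : ℝ → ℝ} {Y : ℝ → ℝ → ℝ}, Pairs χ b f → IsTest χ Y → ip f (sdot T lam Y t)
      = b * (ip f (Dop (Y b)) - 2 * ip f (Y b)) + bs T lam t / b * ip f (bscale Y b) :=
    fun {f Y} hf hY => by
      have e : sdot T lam Y t = fun y => 1 * (b * Dop (Y b) y + -2 * b * Y b y)
          + bs T lam t / b * bscale Y b y := by
        funext y; unfold sdot Dop yscale; rw [← hb]; ring
      rw [e, hf.ip_comb_right (Y := fun b' y => b * Dop (Y b') y + -2 * b * Y b' y)
        ((hY.Dop.smul b).add (hY.smul (-2 * b))) hY.bscale,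
        hf.ip_comb_right hY.Dop hY]
      ring
  rw [← hb] at d1 d2 q1 q2 pv pp; rw [key pp hZ] at d1; rw [key pv hDZ, hBD] at d2; rw [hBD] at i2
  have hdb' : HasDerivWithinAt (bpar T lam) (bs T lam t / lam t) (Icc 0 T) t := hdb
  rw [hb] at i1 i2 i3
  have j1 := i1.comp_hasDerivWithinAt t hdb
  have j2 := i2.comp_hasDerivWithinAt t hdb
  have j3 := i3.comp_hasDerivWithinAt t hdb; rw [← hb] at j1 j2 j3
  have hd := j3.add ((d1.sub (hdb.mul d2)).add (hdb.mul (j1.add (j2.const_mul 2))))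
  refine (hd.congr_deriv ?_).congr (fun τ hτ => ?_) ?_
  · simp only [Function.comp_def, Pi.add_apply]; rw [← hb]
    have e1 := q1 hDZ
    have e2 := q1 hsZ.Dop
    unfold bsCoeff
    beta_reduce at e1 e2 q2 ⊢
    rw [e1, e2]
    have e3 : ip ηₜ (bscale (Ztest χ) b)
        = ip pₜ (bscale (Ztest χ) b) + b * (ip (PB1 χ M b) (bscale (Ztest χ) b)
          + ip (PB1 χ M b) (Dop (bscale (Ztest χ) b)))
          - bs T lam t * ip (dbPB1 χ M b) (bscale (Ztest χ) b) := by rw [q2]; ring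
    rw [e3]; field_simp; ring
  · have hτa := ha _ (h.b_pos τ hτ) (hb₁ τ hτ)
    rw [h.Ifun_eq hτ hT hτa.1 fun y hy => (hτa.2 y hy).1]
    rfl
  · have hτa := ha _ (h.b_pos t ht) (hb₁ t ht)
    rw [h.Ifun_eq ht hT hτa.1 fun y hy => (hτa.2 y hy).1]
    rfl

end Trapped

/-! ### The leading term of the flux -/

theorem ip_LamQ_test (hb : 0 < b) (hY : IsTest χ Y) :
    ip (Lam Q) (Y b) = -ip Q (Y b) - ip Q (Dop (Y b)) := by
  refine ip_Lam_test hb hY (fun y _ => hasDerivAt_Q y)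
    ((by have := continuous_Q; fun_prop : Continuous fun y => -(y / 4) * Q y ^ 2).continuousOn)
    (A := 2) fun y hy _ => ?_
  have h1 := Q_pos y
  have h2 := Q_le_one y
  have h3 : 0 < 1 / y := by positivity
  have h4 := mul_deriv_Q y; rw [(hasDerivAt_Q y).deriv] at h4; rw [h4, abs_le, abs_le]
  refine ⟨⟨by linarith, by linarith⟩, by nlinarith, by nlinarith⟩

/-- The contributions of `Φ` and of the dilated ground state cancel. -/
theorem ip_Phi_test (hb : 0 < b) (hY : IsTest χ Y) :
    ip Phi (Y b) = ip Q (Dop (Y b)) + ip Q (Dop (Dop (Y b))) := by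
  have hb1 : ∀ y, 0 < y → |Lam Q y| ≤ 6 * (1 + 1 / y) ∧ |y * dLamQ y| ≤ 6 * (1 + 1 / y) :=
    fun y hy => ⟨le_weight (by norm_num) hy ((abs_LamQ_le_one y).trans (by norm_num)),
      le_weight (by norm_num) hy ((abs_mul_dLamQ_le y).trans (by linarith [Q_le_one y]))⟩
  have p1 : Pairs χ b (Lam Q) := formDomain_LamQ.pairs hb
  have p2 : Pairs χ b (Lam (Lam Q)) := by
    have e : Lam (Lam Q) = fun y => Lam Q y + y * dLamQ y := by
      funext y; unfold Lam; rw [← (hasDerivAt_LamQ y).deriv]; rfl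
    rw [e]
    exact pairs_of_bounded hb ((formDomain_LamQ.ac.continuousOn).add
      (continuousOn_id.mul continuous_dLamQ.continuousOn)) (A := 12) fun y hy _ =>
        (abs_add_le _ _).trans (by linarith [hb1 y hy])
  have e1 := ip_Lam_test hb hY (fun y _ => hasDerivAt_LamQ y) continuous_dLamQ.continuousOn
    fun y hy _ => hb1 y hy
  have e2 := ip_LamQ_test hb hY.Dop
  rw [ip_congr (fun y _ => (by unfold Phi Dop Lam; ring : Phi y = 1 * Lam Q y + 1 * Lam (Lam Q) y))
    fun _ _ => rfl, p1.ip_comb p2 hY, e1]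
  linarith

theorem Admissible.pairs_T1 (ha : Admissible χ M b)
    (hT : ∀ y, 0 < y → |T1 χ M b y| ≤ C) : Pairs χ b (T1 χ M b) :=
  pairs_of_abs_le ha.pos (contDiffOn_Tperp (continuous_source b)).continuousOn hT

theorem Admissible.ip_PB1_test (ha : Admissible χ M b)
    (hT : ∀ y, 0 < y → |T1 χ M b y| ≤ C) (hY : IsTest χ Y) :
    ip (PB1 χ M b) (Y b) = ip Q (Y b) + b ^ 2 * ip (T1 χ M b) (Y b) := by
  have e := (formDomain_Q.pairs ha.pos).ip_comb (ha.pairs_T1 hT) hY 1 (b ^ 2); rw [one_mul] at e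
  rw [← e]
  refine integral_radial_congr fun y hy => ?_
  rcases le_total (b * y) 1 with h | h
  · rw [ha.PB1_eq (h.trans ha.log_ge)]; ring
  · rw [hY.eq_zero h, mul_zero, mul_zero]

/-- The decay of `T₁` makes its pairings smaller than `1/b²`. -/
theorem abs_ip_T1_le (hb : 0 < b) (hL : 0 < |log b|) (hY : IsTest χ Y)
    (hA : 0 ≤ A) (hYA : ∀ b y, |Y b y| ≤ A * Q y) (hC : 0 ≤ C)
    (hT : ∀ y, 0 < y → b * y ≤ 1 →
      |T1 χ M b y| ≤ C * (1 / |log b| + 1 / (b * |log b| * y) + 1 / (1 + y))) :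
    |ip (T1 χ M b) (Y b)| ≤ 8 * A * C * (2 / (b * |log b|) + 1) / b := by
  refine hY.abs_ip_le hb fun y hy hby => ?_
  have hq := Q_pos y
  have h3 := Q_mul_le y
  have hyb : y ≤ 1 / b := (le_div_iff₀' hb).2 hby
  have h4 : Q y * y ^ 2 ≤ 8 := by linarith
  have h5 := hT y hy hby
  have h6 := hYA b y; rw [abs_mul, abs_mul (T1 χ M b y), abs_of_pos (pow_pos hy 3)]
  calc y ^ 3 * (|T1 χ M b y| * |Y b y|)
      ≤ y ^ 3 * (C * (1 / |log b| + 1 / (b * |log b| * y) + 1 / (1 + y)) * (A * Q y)) := by gcongr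
    _ = A * C * (Q y * y ^ 2) * (y * (1 / |log b|) + 1 / (b * |log b|) + y / (1 + y)) := by
        field_simp
    _ ≤ A * C * 8 * (1 / b * (1 / |log b|) + 1 / (b * |log b|) + 1) := by
        gcongr; rw [div_le_one (by positivity)]; linarith
    _ = _ := by field_simp; ring

/-- The nonlinear terms of `(Q + X)³`. -/
theorem abs_ip_nonlinear_le (hb : 0 < b) (hb1 : b < 1) {X : ℝ → ℝ}
    (hY : IsTest χ Y) (hA : 0 ≤ A) (hYA : ∀ b y, |Y b y| ≤ A * Q y) (hC : 1 ≤ C)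
    (hX : ∀ y, 0 < y → b * y ≤ 1 → |X y| ≤ C * b ^ 2 * (1 + 1 / y)) :
    |ip (fun y => X y ^ 2 * (3 * Q y + X y)) (Y b)| ≤ 300 * A * C ^ 3 * b ^ 3 := by
  have h := hY.abs_ip_le hb (f := fun y => X y ^ 2 * (3 * Q y + X y))
    (A := 300 * A * C ^ 3 * b ^ 4) fun y hy hby => by
    have hq := Q_pos y
    have hq1 := Q_le_one y
    have h3 := Q_mul_le y
    have h4 : |y * X y| ≤ C * b ^ 2 * (1 + y) := by
      rw [abs_mul, abs_of_pos hy]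
      calc y * |X y| ≤ y * (C * b ^ 2 * (1 + 1 / y)) := by have := hX y hy hby; gcongr
        _ = _ := by field_simp; ring
    have h5 : Q y * (1 + y) ^ 2 ≤ 18 := by nlinarith [mul_nonneg hq.le (sq_nonneg (1 - y))]
    have h6 : |3 * (y * Q y) + y * X y| ≤ 16 * C := by
      have h7 : y * Q y ≤ 4 := by nlinarith [mul_nonneg hq.le (sq_nonneg (1 - y))]
      have h8 : 0 ≤ y * Q y := by positivity
      have h9 : C * b ^ 2 * (1 + y) ≤ C * 2 := by
        rw [mul_assoc]
        refine mul_le_mul_of_nonneg_left ?_ (by linarith)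
        nlinarith [mul_le_mul_of_nonneg_left hby hb.le]
      refine (abs_add_le _ _).trans ?_
      rw [abs_of_nonneg (by positivity)]
      linarith
    rw [show y ^ 3 * (X y ^ 2 * (3 * Q y + X y) * Y b y)
      = (y * X y) ^ 2 * (3 * (y * Q y) + y * X y) * Y b y by ring, abs_mul, abs_mul, abs_pow]
    calc |y * X y| ^ 2 * |3 * (y * Q y) + y * X y| * |Y b y|
        ≤ (C * b ^ 2 * (1 + y)) ^ 2 * (16 * C) * (A * Q y) := by
          have := hYA b y
          gcongr
      _ = 16 * A * C ^ 3 * b ^ 4 * (Q y * (1 + y) ^ 2) := by ring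
      _ ≤ 16 * A * C ^ 3 * b ^ 4 * 18 := by gcongr
      _ ≤ _ := by
        have : 0 ≤ A * C ^ 3 * b ^ 4 := by positivity
        linarith
  exact h.trans_eq (by field_simp)

namespace Trapped
variable {CT : ℝ}

variable (h : Trapped χ ψ ζ M K b₀ T u lam) (ht : t ∈ Icc 0 T)
include h ht

/-- The equation for `u` near the profile: `Δv + v³ = -Hε - b² F + 3QX² + X³`, `X = v - Q`. -/
theorem ip_force_test (hb : b = bₜ) (ha : Admissible χ M b) (hT1 : ∀ y, 0 < y → |T1 χ M b y| ≤ CT)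
    (hY : IsTest χ Y)
    (hX : ∀ y, 0 < y → b * y ≤ 1 → |vₜ y - Q y| ≤ C * b ^ 2 * (1 + 1 / y)) :
    ip (fun y => lap vₜ y + vₜ y ^ 3) (Y b)
      = -ip (Hop εₜ) (Y b) + b ^ 2 * (ip Phi (Y b) - cb χ b * ip (cutLam χ b) (Y b))
        + ip (fun y => (vₜ y - Q y) ^ 2 * (3 * Q y + (vₜ y - Q y))) (Y b) := by
  have hb0 := ha.pos
  set N := fun y => (vₜ y - Q y) ^ 2 * (3 * Q y + (vₜ y - Q y)) with hN
  have hv := h.continuousOn_vres ht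
  have hq := continuous_Q.continuousOn (s := Ioi (0 : ℝ))
  have p1 : Pairs χ b (Hop εₜ) := pairs_of_memLp hb0 (h.regular_eps ht (hb ▸ ha) (hb ▸ hT1)).2.2.2
  have p2 : Pairs χ b Phi := pairs_of_abs_le hb0 continuous_Phi.continuousOn fun y _ =>
    (abs_Phi_le y).trans (mul_le_of_le_one_right (by norm_num) (pow_le_one₀ (Q_pos y).le (Q_le_one y)))
  obtain ⟨Cχ, hCχ, hχb⟩ := hχ.1.exists_bound
  have p3 : Pairs χ b (cutLam χ b) := pairs_of_abs_le hb0 (continuous_cutLam' b).continuousOn fun y _ => by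
    unfold cutLam; rw [abs_mul]
    exact (mul_le_mul (hχb _).1 (abs_LamQ_le_one y) (abs_nonneg _) (by linarith)).trans_eq (mul_one _)
  have p4 : Pairs χ b N := by
    refine pairs_of_le hb0 (by fun_prop)
      (A := (C * b ^ 2 * (1 / b + 1)) ^ 2 * (3 * (1 / b) + C * b ^ 2 * (1 / b + 1))) fun y hy hby => ?_
    have hyb : y ≤ 1 / b := (le_div_iff₀' hb0).2 hby
    have h1 := abs_mul_le_of_weight hb0 hy hby (hX y hy hby)
    have h2 : |3 * (y * Q y)| ≤ 3 * (1 / b) := by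
      rw [abs_of_nonneg (by have := Q_pos y; positivity)]
      have := mul_le_mul hyb (Q_le_one y) (Q_pos y).le (by positivity)
      linarith
    rw [show y ^ 3 * N y = (y * (vₜ y - Q y)) ^ 2
      * (3 * (y * Q y) + y * (vₜ y - Q y)) by rw [hN]; ring, abs_mul, abs_pow]
    gcongr; exact (abs_add_le _ _).trans (add_le_add h2 h1)
  have e := ((p1.comb (p2.comb p3 1 (-cb χ b)) (-1) (b ^ 2)).ip_comb p4 hY 1 1)
  rw [p1.ip_comb (p2.comb p3 1 (-cb χ b)) hY, p2.ip_comb p3 hY] at e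
  rw [show -ip (Hop εₜ) (Y b) + b ^ 2 * (ip Phi (Y b) - cb χ b * ip (cutLam χ b) (Y b))
        + ip N (Y b) = 1 * (-1 * ip (Hop εₜ) (Y b)
        + b ^ 2 * (1 * ip Phi (Y b) + -cb χ b * ip (cutLam χ b) (Y b))) + 1 * ip N (Y b) by ring, ← e]
  refine integral_congr_ae ?_
  filter_upwards [h.ae_lap_eps (M := M) ht, ae_radial_of_forall fun y hy => hy] with y h1 hy
  rcases lt_or_ge (b * y) 1 with hby | hby
  · have hL := ha.log_ge
    have e1 := ha.lap_PB1 hy (hby.trans_le hL)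
    have e2 := ha.PB1_eq (hby.le.trans hL)
    have e3 : εₜ y = vₜ y - PB1 χ M b y := by rw [hb]; rfl
    rw [← hb] at h1
    have e4 : source χ b y = (-1) * Phi y + cb χ b * cutLam χ b y := by rw [source_eq]
    have e5 : lap vₜ y = lap εₜ y + lap (PB1 χ M b) y := by linarith
    congr 1
    unfold Hop; rw [e5, e1, e3, e2, e4, hN]
    unfold V; ring
  · rw [hY.eq_zero hby, mul_zero, mul_zero]

end Trapped

/-! ### The flux estimate -/

theorem abs_sum_le {x₁ x₂ x₃ x₄ x₅ x₆ : ℝ} : |x₁ - x₂ + x₃ - x₄ - x₅ + x₆|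
    ≤ |x₁| + |x₂| + |x₃| + |x₄| + |x₅| + |x₆| := by
  have h1 := abs_add_le (x₁ - x₂ + x₃ - x₄ - x₅) x₆
  have h2 := abs_sub (x₁ - x₂ + x₃ - x₄) x₅
  have h3 := abs_sub (x₁ - x₂ + x₃) x₄
  have h4 := abs_add_le (x₁ - x₂) x₃
  have h5 := abs_sub x₁ x₂; linarith

/-- The test functions that occur have a common bound. -/
theorem exists_test_bound : ∃ A, 0 ≤ A ∧ ∀ b y,
    |Ztest χ b y| ≤ A * Q y ∧ |Dop (Ztest χ b) y| ≤ A * Q y ∧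
    |Dop (Dop (Ztest χ b)) y| ≤ A * Q y ∧ |bscale (Ztest χ) b y| ≤ A * Q y ∧
    |Dop (bscale (Ztest χ) b) y| ≤ A * Q y := by
  have hZ := isTest_Ztest (χ := χ)
  obtain ⟨A₁, p1, h1⟩ := hZ.exists_bound
  obtain ⟨A₂, p2, h2⟩ := hZ.Dop.exists_bound
  obtain ⟨A₃, p3, h3⟩ := (hZ.Dop.Dop).exists_bound
  obtain ⟨A₄, p4, h4⟩ := hZ.bscale.exists_bound
  obtain ⟨A₅, p5, h5⟩ := (hZ.bscale.Dop).exists_bound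
  have key : ∀ {x A y : ℝ}, |x| ≤ A * Q y → A ≤ A₁ + A₂ + A₃ + A₄ + A₅ →
      |x| ≤ (A₁ + A₂ + A₃ + A₄ + A₅) * Q y := fun h hA =>
    h.trans (mul_le_mul_of_nonneg_right hA (Q_pos _).le)
  exact ⟨A₁ + A₂ + A₃ + A₄ + A₅, by linarith, fun b y => ⟨key (h1 b y) (by linarith),
    key (h2 b y) (by linarith), key (h3 b y) (by linarith), key (h4 b y) (by linarith),
    key (h5 b y) (by linarith)⟩⟩

theorem abs_bsCoeff_le (ha : Admissible χ M b) {C₀ B E : ℝ} (hA : 0 ≤ A) (hC : 0 ≤ C)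
    (hAb : ∀ b y, |Ztest χ b y| ≤ A * Q y ∧ |Dop (Ztest χ b) y| ≤ A * Q y ∧
      |Dop (Dop (Ztest χ b)) y| ≤ A * Q y ∧ |bscale (Ztest χ) b y| ≤ A * Q y ∧
      |Dop (bscale (Ztest χ) b) y| ≤ A * Q y)
    (hG : |ip (Ztest χ b) (Ztest χ b) - ip (Lam Q) (Ztest χ b)| ≤ C₀ ∧
      |ip (bscale (Ptilde χ) b) (Ztest χ b)| ≤ C₀ ∧ |ip (bscale (Ztest χ) b) (Ztest χ b)| ≤ C₀)
    (hT : ∀ y, 0 < y → |T1 χ M b y| ≤ C)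
    (hdP : ∀ Y, IsTest χ Y → (∀ b y, |Y b y| ≤ A * Q y) → b * |ip (dbPB1 χ M b) (Y b)| ≤ B)
    (hε : ∀ Y, IsTest χ Y → (∀ b y, |Y b y| ≤ A * Q y) → |ip (eps χ M T u lam t) (Y b)| ≤ E)
    (hη : ∀ Y, IsTest χ Y → (∀ b y, |Y b y| ≤ A * Q y) →
      b⁻¹ * |ip (etares χ M T u lam t) (Y b)| ≤ E)
    (hbs : |bs T lam t| ≤ b ^ 2) :
    |bsCoeff χ M T u lam t b| ≤ 4 * C₀ + 32 * A * C + 4 * B + 3 * E := by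
  have hb := ha.pos
  have hZ := isTest_Ztest (χ := χ)
  have hDZ := hZ.Dop
  have hsZ := hZ.bscale
  have hDsZ := hsZ.Dop
  have b1 := fun b y => (hAb b y).1
  have b2 := fun b y => (hAb b y).2.1
  have b4 := fun b y => (hAb b y).2.2.2.1
  have b5 := fun b y => (hAb b y).2.2.2.2
  have hT' : ∀ Y, IsTest χ Y → (∀ b y, |Y b y| ≤ A * Q y) →
      |b ^ 2 * ip (T1 χ M b) (Y b)| ≤ 16 * A * C := fun Y hY hYA => by
    have h1 := hY.abs_ip_le_of_bounded hA hYA hb hC (f := T1 χ M b) fun y hy _ =>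
      le_weight hC hy (hT y hy)
    rw [abs_mul, abs_of_pos (by positivity : 0 < b ^ 2)]
    calc b ^ 2 * |ip (T1 χ M b) (Y b)| ≤ b ^ 2 * (16 * A * (C / b ^ 2)) := by gcongr
      _ = _ := by field_simp
  have e1 := ha.ip_PB1_test hT hZ
  have e2 := ha.ip_PB1_test hT hDZ
  have e3 := ip_LamQ_test hb hZ
  have t1 := hT' _ hZ b1
  have t2 := hT' _ hDZ b2
  have d1 := hdP _ hZ b1
  have d2 := hdP _ hDZ b2
  have d3 := hdP _ hsZ b4; rw [← abs_of_pos hb, ← abs_mul, abs_of_pos hb] at d1 d2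
  have d4 : |b⁻¹ * bs T lam t * ip (dbPB1 χ M b) (bscale (Ztest χ) b)| ≤ B := by
    rw [abs_mul (b⁻¹ * _), abs_mul b⁻¹, abs_of_pos (inv_pos.2 hb)]
    calc b⁻¹ * |bs T lam t| * |ip (dbPB1 χ M b) (bscale (Ztest χ) b)|
        ≤ b⁻¹ * b ^ 2 * |ip (dbPB1 χ M b) (bscale (Ztest χ) b)| := by gcongr
      _ = b * |ip (dbPB1 χ M b) (bscale (Ztest χ) b)| := by field_simp
      _ ≤ B := d3
  have f1 := hε _ hDZ b2
  have f2 := hε _ hDsZ b5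
  have f3 := hη _ hsZ b4; rw [← abs_of_pos (inv_pos.2 hb), ← abs_mul] at f3
  obtain ⟨g1, g2, g3⟩ := hG
  unfold bsCoeff
  beta_reduce at e2 t2 d2 f1 f2
  rw [e1, e2]; rw [abs_le] at *
  constructor <;> linarith

/-- The derivative of `G + 𝓘` is `-32 b²` up to an error, the loss in `K` being a square root. -/
theorem exists_flux_bound (hψ : IsBoundState ψ ζ)
    (hM : 1 ≤ M) (hm : 16 ≤ massM χ M) : ∃ C b₁ : ℝ, 1 ≤ C ∧ 0 < b₁ ∧
      ∀ {K b₀ T : ℝ} {u : ℝ → ℝ → ℝ} {lam : ℝ → ℝ} {t b : ℝ}, Trapped χ ψ ζ M K b₀ T u lam →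
      1 ≤ K → 0 < T → t ∈ Icc 0 T → (∀ τ ∈ Icc 0 T, bpar T lam τ < b₁) → b = bpar T lam t →
      K ≤ |log b| → |Ifun χ M T u lam t| ≤ C * (√K * b) ∧
      ∃ d, HasDerivWithinAt (fun τ => G χ (bpar T lam τ) + Ifun χ M T u lam τ) ((lam t)⁻¹ * d)
          (Icc 0 T) t ∧ |d + 32 * b ^ 2| ≤ C * (√K * (b ^ 2 / √|log b|)) := by
  obtain ⟨C₁, b₂, hC₁, hb₂, hT1⟩ := exists_T1_bound hM hm
  obtain ⟨C₂, b₃, hC₂, hb₃, hR⟩ := exists_remainder_bound hψ hM hm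
  obtain ⟨C₃, hC₃, hZZ⟩ := exists_ip_Ztest_bound (χ := χ)
  obtain ⟨C₄, hC₄, hbsc⟩ := exists_ip_bscale_bound (χ := χ)
  obtain ⟨C₅, b₅, hC₅, hb₅, -, hcb⟩ := exists_cb_bound (χ := χ)
  obtain ⟨Cχ, hCχ, hχb⟩ := hχ.1.exists_bound
  obtain ⟨A, hA, hAb⟩ := exists_test_bound (χ := χ)
  set B := 112 * A * Cχ * C₁ with hB
  set E := 16 * A * C₂ with hE
  set S := 4 * (C₃ + C₄) + 32 * A * C₁ + 4 * B + 3 * E with hS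
  set W := 32 * C₃ + C₂ * √(64 + C₃) + 300 * A * (C₁ + C₂) ^ 3 + 48 * A * C₁ + 2 * E + S with hW
  have hB0 : 0 ≤ B := by positivity
  have hE0 : 0 ≤ E := by positivity
  have hS0 : 0 ≤ S := by positivity
  have hW0 : 0 ≤ W := by positivity
  refine ⟨1 + W + 2 * E + B, min (min b₂ b₃) b₅, by linarith, by positivity,
    fun {K b₀ T u lam t b} h hK hT ht hsm hb hKL => ?_⟩
  have hsm1 := hsm t ht; rw [← hb] at hsm1
  have hb0 : 0 < b := hb ▸ h.b_pos t ht
  obtain ⟨ha, hTb, hTr⟩ := hT1 b hb0 (hsm1.trans_le ((min_le_left _ _).trans (min_le_left _ _)))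
  obtain ⟨-, -, -, -, hcb'⟩ := hcb b hb0 (hsm1.trans_le (min_le_right _ _))
  have hT1b := fun y hy => (hTb y hy).1
  have hadm : ∀ β, 0 < β → β < b₂ → Admissible χ M β ∧
      ∀ y, 0 < y → |T1 χ M β y| ≤ C₁ ∧ β * |dT1 χ M β y| ≤ C₁ := fun β h1 h2 =>
    ⟨(hT1 β h1 h2).1, (hT1 β h1 h2).2.1⟩
  have hd := h.hasDerivWithinAt_G_add_Ifun ht hT (fun τ hτ => (hsm τ hτ).trans_le
    ((min_le_left _ _).trans (min_le_left _ _))) hadm hb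
  have hI := h.Ifun_eq_eta ht hT (hb ▸ ha) (hb ▸ hT1b)
  have hb1 := ha.lt_one
  have hL1 := ha.log_ge
  have hLb : |log b| ≤ 1 / b := by
    rw [ha.abs_log, ← Real.log_inv, one_div]; exact Real.log_le_self (inv_nonneg.2 hb0.le)
  obtain ⟨hg, hbs, hε, hη⟩ := hR h hK hT ht (fun τ hτ => (hsm τ hτ).trans_le
    ((min_le_left _ _).trans (min_le_right _ _))) hb rfl
  have hreg := (h.regular_eps ht (hb ▸ ha) (hb ▸ hT1b)).2.2.2
  have hmass := ha.mass_ge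
  have hdPb := fun y hy => ha.abs_dbPB1_le hχb hTb (y := y) hy
  obtain ⟨z1, z2, z3⟩ := hZZ b hb0 hb1
  obtain ⟨z4, z5⟩ := hbsc b hb0; rw [← hb] at hI
  set L := |log b| with hL
  have hL0 : 0 < L := by linarith only [hL1]
  have hsL1 : 1 ≤ √L := Real.one_le_sqrt.2 hL1
  have hsL0 : 0 < √L := by linarith only [hsL1]
  have hsLL : √L ≤ L := (Real.sqrt_le_left hL0.le).2 (by nlinarith only [hL1])
  have hsq : √L * √L = L := Real.mul_self_sqrt hL0.le
  have hsK1 : 1 ≤ √K := Real.one_le_sqrt.2 hK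
  have hsK0 : 0 < √K := by linarith only [hsK1]
  have hsKL : √K ≤ √L := Real.sqrt_le_sqrt hKL
  -- All the errors are measured in terms of `r`.
  set r := √K * (b ^ 2 / √L) with hr
  have hr0 : 0 < r := by positivity
  have hDr : √K * (b ^ 2 / L) * √L = r := by
    have e : b ^ 2 / L * √L = b ^ 2 / √L := by
      rw [div_mul_eq_mul_div, div_eq_div_iff hL0.ne' hsL0.ne', mul_assoc, hsq]
    rw [hr, mul_assoc, e]
  have hDb : √K * (b ^ 2 / L) ≤ b ^ 2 := by
    rw [mul_div_assoc', div_le_iff₀ hL0, mul_comm]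
    exact mul_le_mul_of_nonneg_left (hsKL.trans hsLL) (by positivity)
  have hrb : r ≤ b ^ 2 := by
    rw [hr, mul_div_assoc', div_le_iff₀ hsL0, mul_comm]
    exact mul_le_mul_of_nonneg_left hsKL (by positivity)
  have hbr : b ^ 2 / √L ≤ r := le_mul_of_one_le_left (by positivity) hsK1
  have hb2L : b ^ 2 / L ≤ r := (div_le_div_of_nonneg_left (by positivity) hsL0 hsLL).trans hbr
  have hb3 : b ^ 3 ≤ r := by
    refine le_trans ?_ hbr
    rw [le_div_iff₀ hsL0]
    calc b ^ 3 * √L ≤ b ^ 3 * (1 / b) := by gcongr; exact hsLL.trans hLb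
      _ = b ^ 2 := by field_simp
  rw [hDr] at hη; simp only [hDr] at hε
  have hε' : ∀ Y, IsTest χ Y → (∀ b y, |Y b y| ≤ A * Q y) →
      b ^ 2 * |ip (eps χ M T u lam t) (Y b)| ≤ E * r := fun Y hY hYA => by
    have h1 := hY.abs_ip_le_of_bounded hA hYA hb0 (by positivity : 0 ≤ C₂ * r)
      fun y hy hby => (hε y hy hby).1
    calc b ^ 2 * |ip (eps χ M T u lam t) (Y b)| ≤ b ^ 2 * (16 * A * (C₂ * r / b ^ 2)) := by gcongr
      _ = _ := by rw [hE]; field_simp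
  have hη' : ∀ Y, IsTest χ Y → (∀ b y, |Y b y| ≤ A * Q y) →
      b * |ip (etares χ M T u lam t) (Y b)| ≤ E * r := fun Y hY hYA => by
    calc b * |ip (etares χ M T u lam t) (Y b)| ≤ b * (C₂ * A * (r / b)) :=
          mul_le_mul_of_nonneg_left (hη Y A hY hA hYA) hb0.le
      _ = A * C₂ * r := by field_simp
      _ ≤ E * r := by
        rw [hE]
        have : 0 ≤ A * C₂ * r := by positivity
        linarith only [this]
  have hdP' : ∀ Y, IsTest χ Y → (∀ b y, |Y b y| ≤ A * Q y) →
      b * |ip (dbPB1 χ M b) (Y b)| ≤ B := fun Y hY hYA => by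
    have h0 : 0 ≤ 7 * Cχ * C₁ * b := by positivity
    have h1 := hY.abs_ip_le_of_bounded hA hYA hb0 h0 (f := dbPB1 χ M b) fun y hy _ =>
      le_weight h0 hy (hdPb y hy)
    calc b * |ip (dbPB1 χ M b) (Y b)| ≤ b * (16 * A * (7 * Cχ * C₁ * b / b ^ 2)) := by gcongr
      _ = B := by rw [hB]; field_simp; ring
  have hZ := isTest_Ztest (χ := χ)
  have hDZ := hZ.Dop
  have hDDZ := hDZ.Dop
  have a1 := fun b y => (hAb b y).1
  have a2 := fun b y => (hAb b y).2.1
  have a3 := fun b y => (hAb b y).2.2.1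
  constructor
  · have h1 : b * |Ifun χ M T u lam t| ≤ (2 * E + B) * r := by
      have k1 := hη' _ hZ a1
      have k2 := hε' _ hDZ a2
      have k3 : b * |bs T lam t * ip (dbPB1 χ M b) (Ztest χ b)| ≤ r * B := by
        rw [abs_mul, mul_left_comm]
        have h2 : |bs T lam t| ≤ r := by
          refine hbs.trans ?_
          rw [← hDr]; exact le_mul_of_one_le_right (by positivity) hsL1
        exact mul_le_mul h2 (hdP' _ hZ a1) (by positivity) hr0.le
      rw [hI]
      have k4 := abs_add_le (ip (etares χ M T u lam t) (Ztest χ b)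
        - b * ip (eps χ M T u lam t) (Dop (Ztest χ b))) (bs T lam t * ip (dbPB1 χ M b) (Ztest χ b))
      have k5 := abs_sub (ip (etares χ M T u lam t) (Ztest χ b))
        (b * ip (eps χ M T u lam t) (Dop (Ztest χ b)))
      rw [abs_mul b, abs_of_pos hb0] at k5
      have k6 := mul_le_mul_of_nonneg_left (k4.trans (add_le_add_left k5 _)) hb0.le
      beta_reduce at k2
      linarith only [k1, k2, k3, k6]
    have h2 : r ≤ √K * b ^ 2 := by
      rw [hr]; gcongr; exact div_le_self (by positivity) hsL1
    have h3 : b * |Ifun χ M T u lam t| ≤ b * ((1 + W + 2 * E + B) * (√K * b)) := by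
      calc b * |Ifun χ M T u lam t| ≤ (2 * E + B) * (√K * b ^ 2) :=
            h1.trans (mul_le_mul_of_nonneg_left h2 (by positivity))
        _ ≤ (1 + W + 2 * E + B) * (√K * b ^ 2) := by gcongr; linarith only [hW0]
        _ = _ := by ring
    exact le_of_mul_le_mul_left h3 hb0
  · refine ⟨_, hd, ?_⟩
    have hX : ∀ y, 0 < y → b * y ≤ 1 →
        |vres lam u t y - Q y| ≤ (C₁ + C₂) * b ^ 2 * (1 + 1 / y) := fun y hy hby => by
      have e : vres lam u t y - Q y = b ^ 2 * T1 χ M b y + eps χ M T u lam t y := by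
        rw [eps_eq, ← hb, ha.PB1_eq (hby.trans hL1)]; ring
      have h1 := (hε y hy hby).1
      have h2 : 0 < 1 / y := by positivity
      rw [e]
      refine (abs_add_le _ _).trans ?_
      rw [abs_mul, abs_of_pos (by positivity : 0 < b ^ 2)]
      calc b ^ 2 * |T1 χ M b y| + |eps χ M T u lam t y|
          ≤ b ^ 2 * (C₁ * (1 + 1 / y)) + C₂ * b ^ 2 * (1 + 1 / y) := by
            gcongr
            · exact le_weight (by linarith only [hC₁]) hy (hT1b y hy)
            · exact h1.trans (by gcongr)
        _ = _ := by ring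
    have s1 := h.ip_force_test ht hb ha hT1b hZ hX
    have s2 := ip_Phi_test hb0 hZ
    have s3 := h.ip_eps_test ht (hb ▸ ha) hDZ
    have s4 := h.ip_eps_test ht (hb ▸ ha) hDDZ; rw [← hb, ha.ip_PB1_test hT1b hDZ] at s3
    rw [← hb, ha.ip_PB1_test hT1b hDDZ] at s4
    have n1 := abs_ip_nonlinear_le hb0 hb1 hZ hA a1 (by linarith only [hC₁, hC₂]) hX
    have n2 : ∀ Y, IsTest χ Y → (∀ b y, |Y b y| ≤ A * Q y) →
        |b ^ 4 * ip (T1 χ M b) (Y b)| ≤ 24 * A * C₁ * r := fun Y hY hYA => by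
      rw [abs_mul, abs_of_pos (by positivity : 0 < b ^ 4)]
      calc b ^ 4 * |ip (T1 χ M b) (Y b)| ≤ b ^ 4 * (8 * A * C₁ * (2 / (b * L) + 1) / b) := by
            gcongr; exact abs_ip_T1_le hb0 hL0 hY hA hYA (by linarith only [hC₁]) hTr
        _ = 8 * A * C₁ * (2 * (b ^ 2 / L) + b ^ 3) := by field_simp
        _ ≤ 8 * A * C₁ * (2 * r + r) := by gcongr
        _ = _ := by ring
    have n3 : |ip (Hop (eps χ M T u lam t)) (Ztest χ b)| ≤ C₂ * √(64 + C₃) * r := by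
      have m2 : √(∫ y, Ztest χ b y ^ 2 ∂ϱ) ≤ √(64 + C₃) * √L := by
        rw [← Real.sqrt_mul (by positivity)]
        refine Real.sqrt_le_sqrt ?_
        have e : ∫ y, Ztest χ b y ^ 2 ∂ϱ = ip (Ztest χ b) (Ztest χ b) := by
          unfold ip; congr 1; funext y; ring
        have := (abs_le.1 z1).2
        have h2 : C₃ ≤ C₃ * L := le_mul_of_one_le_right hC₃ hL1; rw [e]; linarith only [this, h2]
      calc |ip (Hop (eps χ M T u lam t)) (Ztest χ b)|
          ≤ C₂ * (√K * (b ^ 2 / L)) * (√(64 + C₃) * √L) :=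
            (abs_ip_le hreg (hZ.memLp hb0)).trans (mul_le_mul hg m2 (Real.sqrt_nonneg _) (by positivity))
        _ = C₂ * √(64 + C₃) * r := by rw [← hDr]; ring
    -- Since `c_b = 32 / (χ_{B₀/4} ΛQ, ΛQ)`, replacing `Z` by `ΛQ` costs `O(b² / |log b|)`.
    have n4 : |32 * b ^ 2 - b ^ 2 * (cb χ b * ip (cutLam χ b) (Ztest χ b))| ≤ 32 * C₃ * r := by
      have hm0 : 0 < massN χ b := hL0.trans_le hmass
      have e : 32 * b ^ 2 - b ^ 2 * (cb χ b * ip (cutLam χ b) (Ztest χ b))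
          = -(32 * (b ^ 2 / massN χ b) * (ip (cutLam χ b) (Ztest χ b) - massN χ b)) := by
        rw [hcb']; field_simp; ring
      rw [e, abs_neg, abs_mul, abs_of_pos (by positivity)]
      calc 32 * (b ^ 2 / massN χ b) * |ip (cutLam χ b) (Ztest χ b) - massN χ b|
          ≤ 32 * r * C₃ := by
            gcongr; exact (div_le_div_of_nonneg_left (by positivity) hL0 hmass).trans hb2L
        _ = _ := by ring
    have n5 : |bs T lam t * bsCoeff χ M T u lam t b| ≤ S * r := by
      have k := abs_bsCoeff_le (t := t) (C₀ := C₃ + C₄) (C := C₁) (B := B) (E := E) ha hA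
        (by linarith only [hC₁]) hAb
        ⟨z2.trans (by linarith only [hC₄]), z4.trans (by linarith only [hC₃]),
          z5.trans (by linarith only [hC₃])⟩ hT1b hdP' (fun Y hY hYA => by
          have h1 := (hε' Y hY hYA).trans (mul_le_mul_of_nonneg_left hrb hE0); rw [mul_comm E] at h1
          exact le_of_mul_le_mul_left h1 (by positivity)) (fun Y hY hYA => by
          have h1 := (hη' Y hY hYA).trans (mul_le_mul_of_nonneg_left hrb hE0)
          rw [inv_mul_eq_div, div_le_iff₀ hb0]
          refine le_of_mul_le_mul_left (h1.trans_eq ?_) hb0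
          ring) (hbs.trans hDb)
      rw [abs_mul, mul_comm S]
      refine mul_le_mul (hbs.trans ?_) k (abs_nonneg _) hr0.le
      rw [← hDr]; exact le_mul_of_one_le_right (by positivity) hsL1
    have n6 := hε' _ hDZ a2
    have n7 := hε' _ hDDZ a3
    have n8 := n2 _ hDZ a2
    have n9 := n2 _ hDDZ a3; rw [← abs_of_pos (by positivity : 0 < b ^ 2), ← abs_mul] at n6 n7
    have n10 : |ip (fun y => (vres lam u t y - Q y) ^ 2 * (3 * Q y + (vres lam u t y - Q y)))
        (Ztest χ b)| ≤ 300 * A * (C₁ + C₂) ^ 3 * r :=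
      n1.trans (mul_le_mul_of_nonneg_left hb3 (by positivity))
    set d₁ := ip (eps χ M T u lam t) (Dop (Ztest χ b)) with hd₁
    set d₂ := ip (eps χ M T u lam t) (Dop (Dop (Ztest χ b))) with hd₂
    set d₃ := ip (T1 χ M b) (Dop (Ztest χ b)) with hd₃
    set d₄ := ip (T1 χ M b) (Dop (Dop (Ztest χ b))) with hd₄
    rw [s1, s2]
    have e : ∀ x y z w v₁ v₂ q₁ q₂ : ℝ, d₁ = v₁ - (q₁ + b ^ 2 * d₃) → d₂ = v₂ - (q₂ + b ^ 2 * d₄) →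
        -x + b ^ 2 * (q₁ + q₂ - y) + z - b ^ 2 * (v₁ + v₂) + w + 32 * b ^ 2
        = (32 * b ^ 2 - b ^ 2 * y) - x + z - (b ^ 4 * d₃ + b ^ 4 * d₄) - (b ^ 2 * d₁ + b ^ 2 * d₂) + w :=
      fun x y z w v₁ v₂ q₁ q₂ h1 h2 => by rw [h1, h2]; ring
    rw [e _ _ _ _ _ _ _ _ s3 s4]
    refine abs_sum_le.trans ?_
    have m1 := abs_add_le (b ^ 4 * d₃) (b ^ 4 * d₄)
    have m2 := abs_add_le (b ^ 2 * d₁) (b ^ 2 * d₂)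
    have m3 : 0 ≤ (1 + 2 * E + B) * r := by positivity
    have m4 : (1 + W + 2 * E + B) * r = 32 * C₃ * r + C₂ * √(64 + C₃) * r
      + 300 * A * (C₁ + C₂) ^ 3 * r + 48 * A * C₁ * r + 2 * E * r + S * r + (1 + 2 * E + B) * r := by
      rw [hW]; ring
    linarith only [m1, m2, m3, m4, n3, n4, n5, n6, n7, n8, n9, n10]

end

end CriticalWave

theorem lemma5 (χ ψ : ℝ → ℝ) (ζ : ℝ) (hχ : CriticalWave.IsCutoff χ)
    (hψ : CriticalWave.IsBoundState ψ ζ) :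
    ∃ C : ℝ, 0 < C ∧
      (∃ b₁ : ℝ, 0 < b₁ ∧ ∀ b : ℝ, 0 < b → b < b₁ →
        |CriticalWave.G χ b - 64 * b * (|Real.log b|)| ≤ C * b) ∧
      ∃ M₀ : ℝ, 1 ≤ M₀ ∧ ∀ M : ℝ, M₀ ≤ M →
        ∃ K₀ : ℝ, 1 ≤ K₀ ∧ ∀ K : ℝ, K₀ ≤ K →
          ∃ bstar : ℝ, 0 < bstar ∧ ∀ b₀ : ℝ, 0 < b₀ → b₀ < bstar →
            ∀ (T : ℝ) (u : ℝ → ℝ → ℝ) (lam : ℝ → ℝ), 0 < T →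
              CriticalWave.Trapped χ ψ ζ M K b₀ T u lam →
              ∀ t ∈ Set.Icc 0 T,
                |CriticalWave.Ifun χ M T u lam t| ≤ C * (K * CriticalWave.bpar T lam t) ∧
                DifferentiableWithinAt ℝ
                  (fun τ => CriticalWave.G χ (CriticalWave.bpar T lam τ)
                    + CriticalWave.Ifun χ M T u lam τ) (Set.Icc 0 T) t ∧
                |CriticalWave.dds T lam
                    (fun τ => CriticalWave.G χ (CriticalWave.bpar T lam τ)
                      + CriticalWave.Ifun χ M T u lam τ) t
                    + 32 * CriticalWave.bpar T lam t ^ 2|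
                  ≤ C * (K * (CriticalWave.bpar T lam t ^ 2
                      / √|Real.log (CriticalWave.bpar T lam t)|)) := by
  have : Fact (CriticalWave.IsCutoff χ) := ⟨hχ⟩
  obtain ⟨C₀, hC₀, hG⟩ := CriticalWave.exists_G_bound (χ := χ)
  obtain ⟨M₀, hM₀, hmass⟩ := CriticalWave.exists_massM_bound (χ := χ)
  refine ⟨1 + C₀, by linarith, ⟨1, one_pos, fun b hb hb1 => (hG b hb hb1).trans
    (mul_le_mul_of_nonneg_right (by linarith) hb.le)⟩, M₀, hM₀, fun M hM => ?_⟩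
  obtain ⟨C, b₁, hC, hb₁, hflux⟩ :=
    CriticalWave.exists_flux_bound hψ (hM₀.trans hM) (hmass M hM)
  -- The errors are `O(√K)` with a constant depending on `M`, which `√K ≥ C` absorbs.
  refine ⟨C ^ 2, one_le_pow₀ hC, fun K hK => ⟨min b₁ (exp (-K)) / 5, by positivity,
    fun b₀ _ hb₀ T u lam hT h t ht => ?_⟩⟩
  have hK1 : 1 ≤ K := (one_le_pow₀ hC).trans hK
  have hsmall : ∀ τ ∈ Icc 0 T, CriticalWave.bpar T lam τ < min b₁ (exp (-K)) := fun τ hτ => by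
    linarith [h.b_small τ hτ]
  have hb0 := h.b_pos t ht
  have hKL : K ≤ |Real.log (CriticalWave.bpar T lam t)| := by
    have h1 := (Real.log_le_log hb0 ((hsmall t ht).le.trans (min_le_right _ _)))
    rw [Real.log_exp] at h1
    exact le_trans (by linarith) (neg_le_abs _)
  obtain ⟨h1, d, h2, h3⟩ := hflux h hK1 hT ht
    (fun τ hτ => (hsmall τ hτ).trans_le (min_le_left _ _)) rfl hKL
  have hCK : C * √K ≤ (1 + C₀) * K := by
    have h4 : C ≤ √K := Real.le_sqrt_of_sq_le hK
    calc C * √K ≤ √K * √K := mul_le_mul_of_nonneg_right h4 (Real.sqrt_nonneg _)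
      _ = K := Real.mul_self_sqrt (by linarith)
      _ ≤ _ := le_mul_of_one_le_left (by linarith) (by linarith)
  have hl := h.lam_pos t ht
  refine ⟨?_, h2.differentiableWithinAt, ?_⟩
  · rw [← mul_assoc] at h1 ⊢
    exact h1.trans (mul_le_mul_of_nonneg_right hCK hb0.le)
  · unfold CriticalWave.dds
    rw [h2.derivWithin (uniqueDiffOn_Icc hT t ht), mul_inv_cancel_left₀ hl.ne']
    rw [← mul_assoc] at h3 ⊢
    exact h3.trans (mul_le_mul_of_nonneg_right hCK (by positivity))
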